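/- Let $k$ be an algebraically closed field of characteristic $2$, let $r\ge 1$, and let $G$ be an elementary abelian $2$-group of rank $r$ with generators $g_1,\dots,g_r$, acting freely on a finite simplicial set $X$. Differentials have degree $-1$ (so $H^n$ sits in degree $-n$), $(-)^*$ is the graded $k$-dual, and $C=C_\bullet(X;k)$ is the complex of normalized chains. Notation. $S=k[x_1,\dots,x_r]$ is the polynomial algebra with $x_i$ in degree $-1$, and $S_{\mathbf c}$ is its graded dual coalgebra, with basis $x^{(a)}$ ($a\in\mathbb N^r$) in degree $|a|$ and $\Delta x^{(a)}=\sum_{b+c=a}x^{(b)}\otimes x^{(c)}$. $\Omega S_{\mathbf c}$ is its cobar construction and $\iota:S_{\mathbf c}\to\Omega S_{\mathbf c}$ the universal twisting morphism. $\Lambda$ is the exterior algebra on $t_1,\dots,t_r$ in degree $0$, and $\kappa:S_{\mathbf c}\to\Lambda$ is the twisting morphism sending $x^{(e_i)}$ to $t_i$ and the other basis elements to $0$. (Operads concentrated in arity one are dg algebras, and their algebras are dg modules.) For a twisting morphism $\varphi:S_{\mathbf c}\to A$ into a dg algebra and a dg $A$-module $M$, the bar construction $\mathrm B_\varphi M$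 is $S_{\mathbf c}\otimes M$ with differential $c\otimes m\mapsto c\otimes dm+\sum c'\otimes\varphi(c'')m$; it is a conilpotent $S_{\mathbf c}$-coalgebra, and its graded dual is a dg $S$-module. $C$ is a dg $\Lambda$-module with $t_i$ acting as $1+g_i$, and $jC$ is $C$ regarded as a dg $\Omega S_{\mathbf c}$-module along the map $\Omega S_{\mathbf c}\to\Lambda$ induced by $\kappa$. Then: 1. $H^\bullet(BG;k)\cong S$ as graded $k$-algebras (with the cup product). 2. $H(C)$, with zero differential, has a dg $\Omega S_{\mathbf c}$-module structure for which there is an $\infty$-quasi-isomorphism $H(C)\rightsquigarrow jC$ whose linear part $i:H(C)\to C$ sends every class to a cycle representing it; with this structure there is a zigzag of quasi-isomorphisms of dg $\Omega S_{\mathbf c}$-modules between $H(C)$ and $jC$. 3. There is a zigzag of quasi-isomorphisms of conilpotent dg $S_{\mathbf c}$-coalgebras between $\mathrm B_\iota H(C)$ and $\mathrm B_\iota(jC)$; moreover $\mathrm B_\iota(jC)=\mathrm B_\kappa C$, and $\mathrm B_\kappa C$ is chain homotopy equivalent over $k$ to $C_\bullet(EG\times_GX;k)$. 4. There is an $S$-linear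 differential $\delta$ of degree $-1$ on $S\otimes_kH^\bullet(X;k)\cong H^\bullet(BG;k)\otimes_k H^\bullet(X;k)$ such that the pairing $\langle p\otimes[\alpha],\,c\otimes[z]\rangle=\langle p,c\rangle\,\alpha(z)$ gives an isomorphism of dg $S$-modules $(S\otimes H^\bullet(X;k),\delta)\cong(\mathrm B_\iota H(C))^*$. It is minimal, i.e. $\delta\equiv 0$ modulo $(x_1,\dots,x_r)$. The dg $S$-module $(S\otimes H^\bullet(X;k),\delta)$ is connected to $(\mathrm B_\kappa C)^*$ by a zigzag of quasi-isomorphisms of dg $S$-modules, and to $C_\bullet(EG\times_GX;k)^*$ by a zigzag of quasi-isomorphisms of dg $k$-modules. So it is a minimal Hirsch–Brown model of $X$. -/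

import Mathlib

open scoped TensorProduct DirectSum Simplicial
open CategoryTheory MonoidalCategory

universe u

namespace HirschBrown

section Graded

variable {k V W : Type u} [Field k] [AddCommGroup V] [Module k V] [AddCommGroup W] [Module k W]

theorem isInternal_of_proj (𝒱 : ℤ → Submodule k V) (π : ℤ → V →ₗ[k] V)
    (h1 : ∀ n, ∀ x ∈ 𝒱 n, π n x = x) (h2 : ∀ m n, m ≠ n → ∀ x ∈ 𝒱 n, π m x = 0)
    (h3 : ∀ x, x ∈ ⨆ n, 𝒱 n) : DirectSum.IsInternal 𝒱 := by
  rw [DirectSum.isInternal_submodule_iff_iSupIndep_and_iSup_eq_top]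
  refine ⟨fun n => ?_, Submodule.eq_top_iff'.2 h3⟩
  rw [Submodule.disjoint_def]
  intro x hx hx'
  have hle : (⨆ m, ⨆ (_ : m ≠ n), 𝒱 m) ≤ LinearMap.ker (π n) :=
    iSup_le fun m => iSup_le fun hm y hy => h2 n m (Ne.symm hm) y hy
  rw [← h1 n x hx]
  exact hle hx'

/-- The identification of `V` with the direct sum of its homogeneous components. -/
noncomputable def gequiv {𝒱 : ℤ → Submodule k V} (h : DirectSum.IsInternal 𝒱) :
    (⨁ n, 𝒱 n) ≃ₗ[k] V :=
  LinearEquiv.ofBijective (DirectSum.coeLinearMap 𝒱) h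

theorem gequiv_apply {𝒱 : ℤ → Submodule k V} (h : DirectSum.IsInternal 𝒱) (x : ⨁ n, 𝒱 n) :
    gequiv h x = DirectSum.coeLinearMap 𝒱 x := rfl

/-- The projection onto the component of degree `n`. -/
noncomputable def gproj {𝒱 : ℤ → Submodule k V} (h : DirectSum.IsInternal 𝒱) (n : ℤ) :
    V →ₗ[k] V :=
  (𝒱 n).subtype ∘ₗ DirectSum.component k ℤ (fun i => 𝒱 i) n ∘ₗ
    (gequiv h).symm.toLinearMap

theorem symm_of_mem {𝒱 : ℤ → Submodule k V} (h : DirectSum.IsInternal 𝒱) {n : ℤ} {x : V}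
    (hx : x ∈ 𝒱 n) : (gequiv h).symm x =
      DirectSum.lof k ℤ (fun i => 𝒱 i) n ⟨x, hx⟩ := by
  rw [LinearEquiv.symm_apply_eq, gequiv_apply, DirectSum.coeLinearMap_lof]

theorem gproj_mem {𝒱 : ℤ → Submodule k V} (h : DirectSum.IsInternal 𝒱) (n : ℤ) (x : V) :
    gproj h n x ∈ 𝒱 n := by
  simp [gproj]

theorem gproj_self {𝒱 : ℤ → Submodule k V} (h : DirectSum.IsInternal 𝒱) {n : ℤ} {x : V}
    (hx : x ∈ 𝒱 n) : gproj h n x = x := by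
  simp [gproj, symm_of_mem h hx, DirectSum.component.lof_self]

theorem gproj_ne {𝒱 : ℤ → Submodule k V} (h : DirectSum.IsInternal 𝒱) {m n : ℤ} (hmn : m ≠ n)
    {x : V} (hx : x ∈ 𝒱 n) : gproj h m x = 0 := by
  simp [gproj, symm_of_mem h hx, DirectSum.component.of, hmn.symm]

theorem mem_iSup_of_isInternal {𝒱 : ℤ → Submodule k V} (h : DirectSum.IsInternal 𝒱) (x : V) :
    x ∈ ⨆ n, 𝒱 n := by
  rw [h.submodule_iSup_eq_top]; trivial

/-- Induction on homogeneous elements. -/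
theorem homog_induction {𝒱 : ℤ → Submodule k V} (h : DirectSum.IsInternal 𝒱) {P : V → Prop}
    (x : V) (hom : ∀ n, ∀ y ∈ 𝒱 n, P y) (add : ∀ y z, P y → P z → P (y + z)) : P x :=
  Submodule.iSup_induction 𝒱 (motive := P) (mem_iSup_of_isInternal h x) hom
    (hom 0 0 (Submodule.zero_mem _)) add

/-- The total grading of a tensor product. -/
def tensorDeg (𝒱 : ℤ → Submodule k V) (𝒲 : ℤ → Submodule k W) (n : ℤ) :
    Submodule k (V ⊗[k] W) :=
  Submodule.span k {t | ∃ i j : ℤ, i + j = n ∧ ∃ x ∈ 𝒱 i, ∃ y ∈ 𝒲 j, t = x ⊗ₜ[k] y}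

theorem tmul_mem_tensorDeg {𝒱 : ℤ → Submodule k V} {𝒲 : ℤ → Submodule k W} {i j n : ℤ} {x : V}
    {y : W} (hx : x ∈ 𝒱 i) (hy : y ∈ 𝒲 j) (h : i + j = n) :
    x ⊗ₜ[k] y ∈ tensorDeg 𝒱 𝒲 n :=
  Submodule.subset_span ⟨i, j, h, x, hx, y, hy, rfl⟩

theorem tensorDeg_isInternal {𝒱 : ℤ → Submodule k V} {𝒲 : ℤ → Submodule k W}
    (hV : DirectSum.IsInternal 𝒱) (hW : DirectSum.IsInternal 𝒲) :
    DirectSum.IsInternal (tensorDeg 𝒱 𝒲) := by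
  let π : ℤ → V ⊗[k] W →ₗ[k] V ⊗[k] W := fun n => TensorProduct.lift
    ((DirectSum.toModule k ℤ (W →ₗ[k] V ⊗[k] W) (fun i =>
      ((TensorProduct.mk k V W).compl₂ (gproj hW (n - i))) ∘ₗ (𝒱 i).subtype)) ∘ₗ
      (gequiv hV).symm.toLinearMap)
  have hπ : ∀ n i x y, x ∈ 𝒱 i → π n (x ⊗ₜ y) = x ⊗ₜ gproj hW (n - i) y := by
    intro n i x y hx
    simp only [π, TensorProduct.lift.tmul, LinearMap.comp_apply, LinearEquiv.coe_coe,
      symm_of_mem hV hx, DirectSum.toModule_lof]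
    simp
  refine isInternal_of_proj _ π ?_ ?_ ?_
  · intro n x hx
    refine Submodule.span_induction (p := fun x _ => π n x = x) ?_ (by simp) ?_ ?_ hx
    · rintro _ ⟨i, j, rfl, x, hx, y, hy, rfl⟩
      rw [hπ _ i x y hx, gproj_self hW]
      simpa using hy
    · intro x y _ _ hx hy; rw [map_add, hx, hy]
    · intro c x _ hx; rw [map_smul, hx]
  · intro m n hmn x hx
    refine Submodule.span_induction (p := fun x _ => π m x = 0) ?_ (by simp) ?_ ?_ hx
    · rintro _ ⟨i, j, rfl, x, hx, y, hy, rfl⟩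
      rw [hπ _ i x y hx, gproj_ne hW (n := j) (by omega) hy, TensorProduct.tmul_zero]
    · intro x y _ _ hx hy; rw [map_add, hx, hy, add_zero]
    · intro c x _ hx; rw [map_smul, hx, smul_zero]
  · intro t
    induction t with
    | zero => exact Submodule.zero_mem _
    | add x y hx hy => exact Submodule.add_mem _ hx hy
    | tmul x y =>
      refine homog_induction hV x (P := fun x => x ⊗ₜ[k] y ∈ _) ?_ ?_
      · intro i x hx
        refine homog_induction hW y (P := fun y => x ⊗ₜ[k] y ∈ _) ?_ ?_
        · intro j y hy
          exact Submodule.mem_iSup_of_mem (i + j) (tmul_mem_tensorDeg hx hy rfl)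
        · intro y z hy hz; rw [TensorProduct.tmul_add]; exact Submodule.add_mem _ hy hz
      · intro y z hy hz; rw [TensorProduct.add_tmul]; exact Submodule.add_mem _ hy hz

/-- A vector space placed in degree `0`. -/
def concentratedDeg (k V : Type u) [Field k] [AddCommGroup V] [Module k V] (n : ℤ) :
    Submodule k V := if n = 0 then ⊤ else ⊥

theorem concentratedDeg_isInternal :
    DirectSum.IsInternal (concentratedDeg k V) := by
  refine isInternal_of_proj _ (fun n => if n = 0 then LinearMap.id else 0) ?_ ?_ ?_
  · intro n x hx
    by_cases h : n = 0 <;> simp_all [concentratedDeg]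
  · intro m n hmn x hx
    by_cases h : n = 0
    · subst h; simp [hmn]
    · simp_all [concentratedDeg]
  · intro x
    exact Submodule.mem_iSup_of_mem 0 (by simp [concentratedDeg])

theorem eq_zero_of_mem_concentratedDeg {n : ℤ} (hn : n ≠ 0) {x : V}
    (hx : x ∈ concentratedDeg k V n) : x = 0 := by
  rwa [concentratedDeg, if_neg hn, Submodule.mem_bot] at hx

end Graded

/-- A differential graded `k`-module (homological grading, differential of degree `-1`). -/
structure DGMod (k : Type u) [Field k] where
  carrier : Type u
  [grp : AddCommGroup carrier]
  [mod : Module k carrier]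
  deg : ℤ → Submodule k carrier
  internal : DirectSum.IsInternal deg
  d : carrier →ₗ[k] carrier
  d_deg : ∀ n, ∀ x ∈ deg n, d x ∈ deg (n - 1)
  d_sq : ∀ x, d (d x) = 0

attribute [instance] DGMod.grp DGMod.mod

namespace DGMod

variable {k : Type u} [Field k]

instance : CoeSort (DGMod k) (Type u) := ⟨DGMod.carrier⟩

theorem d_gproj (V : DGMod k) (n : ℤ) (x : V) :
    V.d (gproj V.internal n x) = gproj V.internal (n - 1) (V.d x) := by
  refine homog_induction V.internal
    (P := fun x => V.d (gproj V.internal n x) = gproj V.internal (n - 1) (V.d x)) x ?_ ?_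
  · intro m y hy
    by_cases h : n = m
    · subst h
      rw [gproj_self _ hy, gproj_self _ (V.d_deg _ _ hy)]
    · rw [gproj_ne _ h hy, gproj_ne _ (n := m - 1) (by omega) (V.d_deg _ _ hy), map_zero]
  · intro y z hy hz; simp only [map_add, hy, hz]

/-- The cycles of `V`. -/
abbrev cycles (V : DGMod k) : Submodule k V := LinearMap.ker V.d

/-- The boundaries of `V`, as a subspace of the cycles. -/
abbrev boundaries (V : DGMod k) : Submodule k V.cycles :=
  (LinearMap.range V.d).comap V.cycles.subtype

/-- The homology class of a cycle. -/
abbrev cls (V : DGMod k) : V.cycles →ₗ[k] V.cycles ⧸ V.boundaries := V.boundaries.mkQ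

/-- The homology `H(V)`, a dg `k`-module with zero differential. -/
noncomputable def homology (V : DGMod k) : DGMod k where
  carrier := V.cycles ⧸ V.boundaries
  deg n := ((V.deg n).comap V.cycles.subtype).map V.cls
  internal := by
    have hc : ∀ n, ∀ x ∈ V.cycles, gproj V.internal n x ∈ V.cycles := by
      intro n x hx
      rw [LinearMap.mem_ker, d_gproj, LinearMap.mem_ker.1 hx, map_zero]
    let σ : ℤ → V.cycles →ₗ[k] V.cycles := fun n => (gproj V.internal n).restrict (hc n)
    have hb : ∀ n, V.boundaries ≤ V.boundaries.comap (σ n) := by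
      rintro n ⟨x, hx⟩ ⟨y, hy⟩
      refine ⟨gproj V.internal (n + 1) y, ?_⟩
      rw [d_gproj, hy]
      simp [σ]
    refine isInternal_of_proj _ (fun n => V.boundaries.mapQ V.boundaries (σ n) (hb n)) ?_ ?_ ?_
    · rintro n _ ⟨x, hx, rfl⟩
      have : σ n x = x := Subtype.ext (gproj_self V.internal hx)
      simp [this]
    · rintro m n hmn _ ⟨x, hx, rfl⟩
      have : σ m x = 0 := Subtype.ext (gproj_ne V.internal hmn hx)
      simp [this]
    · intro x
      obtain ⟨⟨x, hx⟩, rfl⟩ := V.boundaries.mkQ_surjective x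
      have key : ∀ x : V, ∃ s : Finset ℤ, x = ∑ n ∈ s, gproj V.internal n x := by
        intro x
        classical
        let y := (gequiv V.internal).symm x
        refine ⟨y.support, ?_⟩
        have := (gequiv V.internal).apply_symm_apply x
        conv_lhs => rw [← this]
        rw [gequiv_apply, DirectSum.coeLinearMap_eq_dfinsuppSum,
          DFinsupp.sum]
        rfl
      obtain ⟨s, hs⟩ := key x
      have : (⟨x, hx⟩ : V.cycles) = ∑ n ∈ s, ⟨gproj V.internal n x, hc n x hx⟩ := by
        apply Subtype.ext
        rw [AddSubmonoidClass.coe_finsetSum]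
        exact hs
      rw [this, map_sum]
      refine Submodule.sum_mem _ fun n _ => Submodule.mem_iSup_of_mem n ?_
      exact ⟨_, gproj_mem V.internal n x, rfl⟩
  d := 0
  d_deg _ _ _ := Submodule.zero_mem _
  d_sq _ := rfl

/-- Morphisms of dg `k`-modules: chain maps of degree `0`. -/
structure Hom (V W : DGMod k) where
  toLin : V →ₗ[k] W
  map_deg : ∀ n, ∀ x ∈ V.deg n, toLin x ∈ W.deg n
  comm : ∀ x, toLin (V.d x) = W.d (toLin x)

namespace Hom

variable {V W : DGMod k} (f : Hom V W)

theorem map_cycles : ∀ x ∈ V.cycles, f.toLin x ∈ W.cycles := by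
  intro x hx
  rw [LinearMap.mem_ker, ← f.comm, LinearMap.mem_ker.1 hx, map_zero]

/-- The map induced in homology. -/
noncomputable def mapHomology : V.homology →ₗ[k] W.homology :=
  V.boundaries.mapQ W.boundaries (f.toLin.restrict f.map_cycles) (by
    rintro ⟨x, hx⟩ ⟨y, rfl⟩
    exact ⟨f.toLin y, (f.comm y).symm⟩)

/-- `f` induces an isomorphism in homology. -/
def IsQuasiIso : Prop := Function.Bijective f.mapHomology

end Hom

/-- Existence of a zigzag of quasi-isomorphisms of dg `k`-modules. -/
def Zigzag : DGMod k → DGMod k → Prop :=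
  Relation.EqvGen fun V W => ∃ f : Hom V W, f.IsQuasiIso

/-- Chain homotopy equivalence of dg `k`-modules. -/
def HomotopyEquivalent (V W : DGMod k) : Prop :=
  ∃ (f : Hom V W) (g : Hom W V) (s : V →ₗ[k] V) (t : W →ₗ[k] W),
    (∀ n, ∀ x ∈ V.deg n, s x ∈ V.deg (n + 1)) ∧ (∀ n, ∀ y ∈ W.deg n, t y ∈ W.deg (n + 1)) ∧
    (∀ x, x - g.toLin (f.toLin x) = V.d (s x) + s (V.d x)) ∧
    (∀ y, y - f.toLin (g.toLin y) = W.d (t y) + t (W.d y))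

/-- The functionals on `V` which vanish in all but finitely many degrees. -/
def gradedDual (V : DGMod k) : Submodule k (Module.Dual k V) where
  carrier := {φ | ∃ s : Finset ℤ, ∀ n, n ∉ s → ∀ x ∈ V.deg n, φ x = 0}
  zero_mem' := ⟨∅, by simp⟩
  add_mem' := by
    rintro φ ψ ⟨s, hs⟩ ⟨t, ht⟩
    refine ⟨s ∪ t, fun n hn x hx => ?_⟩
    rw [Finset.mem_union, not_or] at hn
    rw [LinearMap.add_apply, hs n hn.1 x hx, ht n hn.2 x hx, add_zero]
  smul_mem' := by
    rintro c φ ⟨s, hs⟩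
    refine ⟨s, fun n hn x hx => ?_⟩
    rw [LinearMap.smul_apply, hs n hn x hx, smul_zero]

/-- The graded dual `V^*`: a functional on `V_n` has degree `-n`, and the differential is the
transpose of that of `V` (no sign is needed in characteristic two). -/
noncomputable def dual (V : DGMod k) : DGMod k where
  carrier := V.gradedDual
  deg n :=
    { carrier := {φ | ∀ m, m ≠ -n → ∀ x ∈ V.deg m, φ.1 x = 0}
      zero_mem' := by simp
      add_mem' := by
        intro φ ψ hφ hψ m hm x hx
        simp [hφ m hm x hx, hψ m hm x hx]
      smul_mem' := by
        intro c φ hφ m hm x hx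
        simp [hφ m hm x hx] }
  internal := by
    have hfin : ∀ n (φ : Module.Dual k V), φ ∘ₗ gproj V.internal (-n) ∈ V.gradedDual := by
      intro n φ
      refine ⟨{-n}, fun m hm x hx => ?_⟩
      rw [Finset.mem_singleton] at hm
      simp [gproj_ne V.internal (Ne.symm hm) hx]
    let π : ℤ → V.gradedDual →ₗ[k] V.gradedDual := fun n =>
      { toFun := fun φ => ⟨φ.1 ∘ₗ gproj V.internal (-n), hfin n φ.1⟩
        map_add' := fun φ ψ => rfl
        map_smul' := fun c φ => rfl }
    refine isInternal_of_proj (k := k) (V := V.gradedDual) _ π ?_ ?_ ?_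
    · intro n φ hφ
      apply Subtype.ext
      apply LinearMap.ext
      intro x
      refine homog_induction V.internal (P := fun x => (π n φ).1 x = φ.1 x) x ?_ ?_
      · intro m y hy
        by_cases hm : m = -n
        · subst hm; simp [π, gproj_self V.internal hy]
        · simp [π, gproj_ne V.internal (Ne.symm hm) hy, hφ m hm y hy]
      · intro y z hy hz; rw [map_add, map_add, hy, hz]
    · intro m n hmn φ hφ
      apply Subtype.ext
      apply LinearMap.ext
      intro x
      exact hφ (-m) (by omega) _ (gproj_mem V.internal _ x)
    · intro φ
      obtain ⟨s, hs⟩ := φ.2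
      have : φ = ∑ n ∈ s, ⟨φ.1 ∘ₗ gproj V.internal n, by
          simpa using hfin (-n) φ.1⟩ := by
        apply Subtype.ext
        apply LinearMap.ext
        intro x
        rw [AddSubmonoidClass.coe_finsetSum, LinearMap.sum_apply]
        refine homog_induction V.internal
          (P := fun x => φ.1 x = ∑ n ∈ s, φ.1 (gproj V.internal n x)) x ?_ ?_
        · intro m y hy
          by_cases hm : m ∈ s
          · rw [Finset.sum_eq_single_of_mem m hm]
            · simp [gproj_self V.internal hy]
            · intro n _ hn
              simp [gproj_ne V.internal hn hy]
          · rw [Finset.sum_eq_zero]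
            · exact hs m hm y hy
            · intro n hn
              have : n ≠ m := fun h => hm (h ▸ hn)
              simp [gproj_ne V.internal this hy]
        · intro y z hy hz
          rw [map_add, hy, hz, ← Finset.sum_add_distrib]
          simp
      rw [this]
      refine Submodule.sum_mem _ fun n _ => Submodule.mem_iSup_of_mem (-n) ?_
      intro m hm x hx
      simp [gproj_ne V.internal (m := n) (n := m) (by omega) hx]
  d :=
    { toFun := fun φ => ⟨φ.1 ∘ₗ V.d, by
        obtain ⟨s, hs⟩ := φ.2
        refine ⟨s.image (· + 1), fun n hn x hx => hs (n - 1) (fun h => hn ?_) _ (V.d_deg n x hx)⟩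
        exact Finset.mem_image.2 ⟨n - 1, h, by simp⟩⟩
      map_add' := fun φ ψ => rfl
      map_smul' := fun c φ => rfl }
  d_deg := by
    intro n φ hφ m hm x hx
    exact hφ (m - 1) (by omega) _ (V.d_deg m x hx)
  d_sq := by
    intro φ
    apply Subtype.ext
    apply LinearMap.ext
    intro x
    simp [V.d_sq]

end DGMod

/-- A differential graded `k`-algebra, `k` of characteristic two (so that no sign appears in the
Leibniz rule). A dg operad concentrated in arity one is the same thing as a dg algebra. -/
structure DGAlg (k : Type u) [Field k] where
  carrier : Type u
  [ring : Ring carrier]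
  [alg : Algebra k carrier]
  deg : ℤ → Submodule k carrier
  internal : DirectSum.IsInternal deg
  one_mem : (1 : carrier) ∈ deg 0
  mul_mem : ∀ m n, ∀ a ∈ deg m, ∀ b ∈ deg n, a * b ∈ deg (m + n)
  d : carrier →ₗ[k] carrier
  d_deg : ∀ n, ∀ a ∈ deg n, d a ∈ deg (n - 1)
  d_sq : ∀ a, d (d a) = 0
  d_mul : ∀ a b, d (a * b) = d a * b + a * d b

attribute [instance] DGAlg.ring DGAlg.alg

instance {k : Type u} [Field k] : CoeSort (DGAlg k) (Type u) := ⟨DGAlg.carrier⟩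

section Modules

variable {k : Type u} [Field k]

/-- Morphisms of dg algebras. -/
structure DGAlg.Hom (A B : DGAlg k) where
  toAlgHom : A →ₐ[k] B
  map_deg : ∀ n, ∀ a ∈ A.deg n, toAlgHom a ∈ B.deg n
  comm : ∀ a, toAlgHom (A.d a) = B.d (toAlgHom a)

/-- The structure of a dg `A`-module on the dg `k`-module `V`: a morphism of dg algebras from `A`
to `End(V)`. When `A` is seen as a unary operad, this is the structure of an `A`-algebra. -/
structure DGAction (A : DGAlg k) (V : DGMod k) where
  act : A →ₐ[k] Module.End k V
  act_deg : ∀ m n, ∀ a ∈ A.deg m, ∀ x ∈ V.deg n, act a x ∈ V.deg (m + n)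
  act_d : ∀ a x, V.d (act a x) = act (A.d a) x + act a (V.d x)

/-- A dg `A`-module, that is, an algebra over the unary operad `A`. -/
structure DGAlgMod (A : DGAlg k) where
  toDGMod : DGMod k
  action : DGAction A toDGMod

namespace DGAlgMod

variable {A B : DGAlg k}

/-- The action of an element of `A`. -/
abbrev act (M : DGAlgMod A) : A →ₐ[k] Module.End k M.toDGMod := M.action.act

/-- Morphisms of dg `A`-modules. -/
structure Hom (M N : DGAlgMod A) extends DGMod.Hom M.toDGMod N.toDGMod where
  map_act : ∀ a x, toLin (M.act a x) = N.act a (toLin x)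

/-- Quasi-isomorphisms of dg `A`-modules. -/
def Hom.IsQuasiIso {M N : DGAlgMod A} (f : Hom M N) : Prop := f.toHom.IsQuasiIso

/-- Existence of a zigzag of quasi-isomorphisms of dg `A`-modules. -/
def Zigzag : DGAlgMod A → DGAlgMod A → Prop :=
  Relation.EqvGen fun M N => ∃ f : Hom M N, f.IsQuasiIso

/-- Restriction of the action along a morphism of dg algebras. -/
def restrict (f : DGAlg.Hom A B) (M : DGAlgMod B) : DGAlgMod A where
  toDGMod := M.toDGMod
  action :=
    { act := M.act.comp f.toAlgHom
      act_deg := fun m n a ha x hx => M.action.act_deg m n _ (f.map_deg m a ha) x hx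
      act_d := fun a x => by
        have := M.action.act_d (f.toAlgHom a) x
        rw [← f.comm] at this
        exact this }

end DGAlgMod

end Modules

/-! ### The polynomial algebra and the polynomial coalgebra -/

section Poly

variable (k : Type u) [Field k] (r : ℕ)

/-- The grading of `k[x₁, …, x_r]` with the variables in degree `-1`. -/
def polyDeg (n : ℤ) : Submodule k (MvPolynomial (Fin r) k) where
  carrier := {p | ∀ a, MvPolynomial.coeff a p ≠ 0 → (a.degree : ℤ) = -n}
  zero_mem' := by simp
  add_mem' := by
    intro p q hp hq a ha
    by_cases h : MvPolynomial.coeff a p = 0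
    · exact hq a (by simpa [h] using ha)
    · exact hp a h
  smul_mem' := by
    intro c p hp a ha
    exact hp a (fun h => ha (by simp [h]))

theorem monomial_mem_polyDeg (a : Fin r →₀ ℕ) (c : k) :
    MvPolynomial.monomial a c ∈ polyDeg k r (-(a.degree : ℤ)) := by
  intro b hb
  rw [MvPolynomial.coeff_monomial] at hb
  have : a = b := by by_contra h; simp [h] at hb
  rw [this, neg_neg]

theorem polyDeg_isInternal : DirectSum.IsInternal (polyDeg k r) := by
  refine isInternal_of_proj _
    (fun n => if n ≤ 0 then MvPolynomial.homogeneousComponent (-n).toNat else 0) ?_ ?_ ?_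
  · intro n p hp
    ext a
    have := hp a
    by_cases hn : n ≤ 0
    · simp only [hn, if_true, MvPolynomial.coeff_homogeneousComponent]
      split_ifs with h
      · rfl
      · by_contra h'
        have := hp a (fun h'' => h' h''.symm)
        omega
    · simp only [hn, if_false, LinearMap.zero_apply, MvPolynomial.coeff_zero]
      by_contra h'
      have := hp a (fun h'' => h' h''.symm)
      omega
  · intro m n hmn p hp
    ext a
    have := hp a
    by_cases hn : m ≤ 0
    · simp only [hn, if_true, MvPolynomial.coeff_homogeneousComponent, MvPolynomial.coeff_zero]
      split_ifs with h
      · by_contra h'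
        have := hp a h'
        omega
      · rfl
    · simp [hn]
  · intro p
    rw [← MvPolynomial.support_sum_monomial_coeff p]
    exact Submodule.sum_mem _ fun a _ =>
      Submodule.mem_iSup_of_mem _ (monomial_mem_polyDeg k r a _)

/-- The polynomial algebra `S = k[x₁, …, x_r]` with zero differential, the variables in
degree `-1`. -/
noncomputable def polyAlg : DGAlg k where
  carrier := MvPolynomial (Fin r) k
  deg := polyDeg k r
  internal := polyDeg_isInternal k r
  one_mem := by
    intro a ha
    rw [MvPolynomial.coeff_one] at ha
    have : 0 = a := by by_contra h; simp [h] at ha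
    simp [← this]
  mul_mem := by
    classical
    intro m n p hp q hq a ha
    rw [MvPolynomial.coeff_mul] at ha
    obtain ⟨⟨b, c⟩, hbc, h⟩ := Finset.exists_ne_zero_of_sum_ne_zero ha
    rw [Finset.HasAntidiagonal.mem_antidiagonal] at hbc
    have h1 := hp b (left_ne_zero_of_mul h)
    have h2 := hq c (right_ne_zero_of_mul h)
    simp only at hbc
    rw [← hbc, map_add]
    push_cast
    omega
  d := 0
  d_deg _ _ _ := Submodule.zero_mem _
  d_sq _ := rfl
  d_mul _ _ := by simp

/-- The polynomial coalgebra `S_c`, the graded dual of `k[x₁, …, x_r]`; it has the basis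
`mono a` dual to the monomials `x^a`. -/
def PolyCoalg : Type u := (Fin r →₀ ℕ) →₀ k

noncomputable instance : AddCommGroup (PolyCoalg k r) :=
  inferInstanceAs (AddCommGroup ((Fin r →₀ ℕ) →₀ k))

noncomputable instance : Module k (PolyCoalg k r) :=
  inferInstanceAs (Module k ((Fin r →₀ ℕ) →₀ k))

namespace PolyCoalg

variable {r}

/-- The basis element of `S_c` dual to the monomial `x^a`. -/
noncomputable def mono (a : Fin r →₀ ℕ) : PolyCoalg k r := Finsupp.single a (1 : k)

/-- The basis `mono` of `S_c`. -/
noncomputable def basis : Module.Basis (Fin r →₀ ℕ) k (PolyCoalg k r) :=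
  Module.Basis.ofRepr (LinearEquiv.refl k ((Fin r →₀ ℕ) →₀ k))

@[simp] theorem basis_apply (a : Fin r →₀ ℕ) : basis k a = mono k a := rfl

/-- The linear map with prescribed values on the basis. -/
noncomputable def lin {M : Type u} [AddCommGroup M] [Module k M] (f : (Fin r →₀ ℕ) → M) :
    PolyCoalg k r →ₗ[k] M := (basis k).constr k f

@[simp] theorem lin_mono {M : Type u} [AddCommGroup M] [Module k M] (f : (Fin r →₀ ℕ) → M)
    (a : Fin r →₀ ℕ) : lin k f (mono k a) = f a :=
  (basis k).constr_basis k f a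

variable {k}

theorem hom_ext {M : Type u} [AddCommGroup M] [Module k M] {f g : PolyCoalg k r →ₗ[k] M}
    (h : ∀ a, f (mono k a) = g (mono k a)) : f = g := (basis k).ext h

variable (k r)

/-- The grading of `S_c`: `mono a` has degree `|a|`. -/
noncomputable def cdeg (n : ℤ) : Submodule k (PolyCoalg k r) :=
  Submodule.span k {c | ∃ a : Fin r →₀ ℕ, (a.degree : ℤ) = n ∧ c = mono k a}

variable {r}

theorem mono_mem (a : Fin r →₀ ℕ) : mono k a ∈ cdeg k r a.degree :=
  Submodule.subset_span ⟨a, rfl, rfl⟩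

theorem mono_mem' {a : Fin r →₀ ℕ} {n : ℤ} (h : (a.degree : ℤ) = n) : mono k a ∈ cdeg k r n :=
  Submodule.subset_span ⟨a, h, rfl⟩

variable (r)

theorem cdeg_isInternal : DirectSum.IsInternal (cdeg k r) := by
  refine isInternal_of_proj _ (fun n => lin k fun a => if (a.degree : ℤ) = n then mono k a else 0)
    ?_ ?_ ?_
  · intro n x hx
    refine (LinearMap.eqOn_span (f := lin k fun a => if (a.degree : ℤ) = n then mono k a else 0)
      (g := LinearMap.id) ?_) hx
    rintro _ ⟨a, rfl, rfl⟩
    simp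
  · intro m n hmn x hx
    refine (LinearMap.eqOn_span (f := lin k fun a => if (a.degree : ℤ) = m then mono k a else 0)
      (g := 0) ?_) hx
    rintro _ ⟨a, rfl, rfl⟩
    simp [hmn.symm]
  · intro x
    induction (basis k).mem_span x using Submodule.span_induction with
    | mem x hx =>
      obtain ⟨a, rfl⟩ := hx
      exact Submodule.mem_iSup_of_mem _ (mono_mem k a)
    | zero => exact Submodule.zero_mem _
    | add x y _ _ hx hy => exact Submodule.add_mem _ hx hy
    | smul c x _ hx => exact Submodule.smul_mem _ _ hx

/-- The comultiplication `mono a ↦ ∑_{b + c = a} mono b ⊗ mono c`. -/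
noncomputable def comul : PolyCoalg k r →ₗ[k] PolyCoalg k r ⊗[k] PolyCoalg k r :=
  lin k fun a => ∑ p ∈ Finset.HasAntidiagonal.antidiagonal a, mono k p.1 ⊗ₜ[k] mono k p.2

/-- The counit `mono 0 ↦ 1`, `mono a ↦ 0` for `a ≠ 0`. -/
noncomputable def counit : PolyCoalg k r →ₗ[k] k :=
  lin k fun a => if a = 0 then 1 else 0

theorem sum_antidiagonal_assoc {M : Type*} [AddCommMonoid M] (a : Fin r →₀ ℕ)
    (f : (Fin r →₀ ℕ) → (Fin r →₀ ℕ) → (Fin r →₀ ℕ) → M) :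
    ∑ p ∈ Finset.HasAntidiagonal.antidiagonal a, ∑ q ∈ Finset.HasAntidiagonal.antidiagonal p.1, f q.1 q.2 p.2 =
      ∑ p ∈ Finset.HasAntidiagonal.antidiagonal a, ∑ q ∈ Finset.HasAntidiagonal.antidiagonal p.2, f p.1 q.1 q.2 := by
  rw [Finset.sum_sigma', Finset.sum_sigma']
  refine Finset.sum_bij' (fun x _ => ⟨(x.2.1, x.2.2 + x.1.2), (x.2.2, x.1.2)⟩)
    (fun x _ => ⟨(x.1.1 + x.2.1, x.2.2), (x.1.1, x.2.1)⟩) ?_ ?_ ?_ ?_ ?_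
  · rintro ⟨⟨a, b⟩, ⟨c, d⟩⟩ h
    simp only [Finset.mem_sigma, Finset.HasAntidiagonal.mem_antidiagonal] at h ⊢
    rw [← add_assoc, h.2]; exact ⟨h.1, trivial⟩
  · rintro ⟨⟨a, b⟩, ⟨c, d⟩⟩ h
    simp only [Finset.mem_sigma, Finset.HasAntidiagonal.mem_antidiagonal] at h ⊢
    rw [add_assoc, h.2]; exact ⟨h.1, trivial⟩
  · rintro ⟨⟨a, b⟩, ⟨c, d⟩⟩ h
    simp only [Finset.mem_sigma, Finset.HasAntidiagonal.mem_antidiagonal] at h ⊢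
    rw [h.2]
  · rintro ⟨⟨a, b⟩, ⟨c, d⟩⟩ h
    simp only [Finset.mem_sigma, Finset.HasAntidiagonal.mem_antidiagonal] at h ⊢
    rw [h.2]
  · intros; rfl

noncomputable instance : Coalgebra k (PolyCoalg k r) where
  comul := comul k r
  counit := counit k r
  coassoc := by
    apply hom_ext
    intro a
    simp only [comul, LinearMap.comp_apply, lin_mono, map_sum, LinearMap.rTensor_tmul,
      LinearMap.lTensor_tmul, LinearEquiv.coe_coe, TensorProduct.sum_tmul,
      TensorProduct.tmul_sum, TensorProduct.assoc_tmul]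
    exact sum_antidiagonal_assoc r a fun x y z => mono k x ⊗ₜ[k] (mono k y ⊗ₜ[k] mono k z)
  rTensor_counit_comp_comul := by
    apply hom_ext
    intro a
    simp only [comul, counit, LinearMap.comp_apply, lin_mono, map_sum, LinearMap.rTensor_tmul,
      TensorProduct.mk_apply]
    rw [Finset.sum_eq_single_of_mem (0, a) (by simp)]
    · simp
    · rintro ⟨b, c⟩ h hne
      rw [Finset.HasAntidiagonal.mem_antidiagonal] at h
      have : b ≠ 0 := by
        rintro rfl
        exact hne (by simpa using h)
      simp [this]
  lTensor_counit_comp_comul := by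
    apply hom_ext
    intro a
    simp only [comul, counit, LinearMap.comp_apply, lin_mono, map_sum, LinearMap.lTensor_tmul,
      LinearMap.flip_apply, TensorProduct.mk_apply]
    rw [Finset.sum_eq_single_of_mem (a, 0) (by simp)]
    · simp
    · rintro ⟨b, c⟩ h hne
      rw [Finset.HasAntidiagonal.mem_antidiagonal] at h
      have : c ≠ 0 := by
        rintro rfl
        exact hne (by simpa using h)
      simp [this]

theorem comul_mono (a : Fin r →₀ ℕ) : Coalgebra.comul (R := k) (mono k a) =
    ∑ p ∈ Finset.HasAntidiagonal.antidiagonal a, mono k p.1 ⊗ₜ[k] mono k p.2 := lin_mono k _ a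

/-- The pairing between `S` and `S_c`, for which `x^a` and `mono a` are dual bases. -/
noncomputable def pairing (p : MvPolynomial (Fin r) k) : PolyCoalg k r →ₗ[k] k :=
  lin k fun a => MvPolynomial.coeff a p

/-- The operator on `S_c` given by the monomial `x^e`: it sends `mono a` to `mono (a - e)` if
`e ≤ a`, and to zero otherwise. -/
noncomputable def lower (e : Fin r →₀ ℕ) : PolyCoalg k r →ₗ[k] PolyCoalg k r :=
  lin k fun a => if e ≤ a then mono k (a - e) else 0

/-- The action of `S` on its graded dual `S_c`. -/
noncomputable def contract : MvPolynomial (Fin r) k →ₐ[k] Module.End k (PolyCoalg k r) :=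
  AddMonoidAlgebra.lift k (Module.End k (PolyCoalg k r)) (Fin r →₀ ℕ)
    { toFun := fun e => lower k r e.toAdd
      map_one' := by
        apply hom_ext
        intro a
        simp [lower]
      map_mul' := by
        intro e f
        apply hom_ext
        intro a
        simp only [lower, toAdd_mul, lin_mono, Module.End.mul_apply]
        by_cases hf : f.toAdd ≤ a
        · rw [if_pos hf, lin_mono]
          by_cases he : e.toAdd ≤ a - f.toAdd
          · rw [if_pos he, if_pos ((le_tsub_iff_right hf).1 he), tsub_tsub, add_comm f.toAdd]
          · rw [if_neg he, if_neg (fun h => he ((le_tsub_iff_right hf).2 h))]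
        · rw [if_neg hf, map_zero, if_neg (fun h => hf (le_trans le_add_self h))] }

theorem contract_monomial (e a : Fin r →₀ ℕ) (c : k) :
    contract k r (MvPolynomial.monomial e c) (mono k a) =
      c • (if e ≤ a then mono k (a - e) else 0) := by
  have : contract k r (MvPolynomial.monomial e c) = c • lower k r e := by
    simp only [contract]
    exact (AddMonoidAlgebra.lift_single _ _ _)
  rw [this, LinearMap.smul_apply, lower, lin_mono]

end PolyCoalg

end Poly

/-! ### The cobar construction of `S_c` and the exterior algebra -/

section Cobar

variable (k : Type u) [Field k] (r : ℕ)

/-- The exponents of the monomial basis of the coaugmentation coideal of `S_c`. -/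
abbrev Gen : Type := {a : Fin r →₀ ℕ // a ≠ 0}

variable {r} in
open Classical in
/-- The generator `s⁻¹ (mono a)` of the cobar construction; it is zero for `a = 0`. -/
noncomputable def gen (a : Fin r →₀ ℕ) : FreeAlgebra k (Gen r) :=
  if h : a ≠ 0 then FreeAlgebra.ι k ⟨a, h⟩ else 0

/-- The algebra map `w ↦ w + ε ∂w` whose second component is the cobar differential. -/
noncomputable def cobarHom :
    FreeAlgebra k (Gen r) →ₐ[k] TrivSqZeroExt (FreeAlgebra k (Gen r)) (FreeAlgebra k (Gen r)) :=
  FreeAlgebra.lift k fun a => TrivSqZeroExt.inl (FreeAlgebra.ι k a) +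
    TrivSqZeroExt.inr (∑ p ∈ Finset.HasAntidiagonal.antidiagonal a.1, gen k p.1 * gen k p.2)

/-- The cobar differential: the derivation with
`∂ (s⁻¹ (mono a)) = ∑ s⁻¹ (mono b) * s⁻¹ (mono c)`, the sum over `b + c = a`, `b ≠ 0`, `c ≠ 0`. -/
noncomputable def cobarD : FreeAlgebra k (Gen r) →ₗ[k] FreeAlgebra k (Gen r) where
  toFun w := (cobarHom k r w).snd
  map_add' x y := by rw [map_add, TrivSqZeroExt.snd_add]
  map_smul' c x := by rw [map_smul, TrivSqZeroExt.snd_smul]; rfl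

theorem cobarHom_fst (w : FreeAlgebra k (Gen r)) : (cobarHom k r w).fst = w := by
  induction w using FreeAlgebra.induction with
  | grade0 c => rw [AlgHom.commutes]; rfl
  | grade1 x => simp [cobarHom]
  | mul a b ha hb => rw [map_mul, TrivSqZeroExt.fst_mul, ha, hb]
  | add a b ha hb => rw [map_add, TrivSqZeroExt.fst_add, ha, hb]

theorem cobarD_mul (v w : FreeAlgebra k (Gen r)) :
    cobarD k r (v * w) = cobarD k r v * w + v * cobarD k r w := by
  change (cobarHom k r (v * w)).snd = _
  rw [map_mul, TrivSqZeroExt.snd_mul, cobarHom_fst, cobarHom_fst, add_comm]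
  rfl

theorem cobarD_algebraMap (c : k) : cobarD k r (algebraMap k _ c) = 0 := by
  change (cobarHom k r _).snd = _
  rw [AlgHom.commutes]
  rfl

theorem cobarD_one : cobarD k r 1 = 0 := by
  simpa using cobarD_algebraMap k r 1

theorem cobarD_gen (a : Fin r →₀ ℕ) : cobarD k r (gen k a) =
    ∑ p ∈ Finset.HasAntidiagonal.antidiagonal a, gen k p.1 * gen k p.2 := by
  by_cases h : a ≠ 0
  · conv_lhs => rw [gen, dif_pos h]
    change (cobarHom k r _).snd = _
    simp [cobarHom]
  · push Not at h
    subst h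
    simp [gen]

theorem cobarD_sq [CharP k 2] (w : FreeAlgebra k (Gen r)) : cobarD k r (cobarD k r w) = 0 := by
  have h2 : ∀ x : FreeAlgebra k (Gen r), x + x = 0 := by
    intro x
    rw [← two_smul k x, CharTwo.two_eq_zero, zero_smul]
  induction w using FreeAlgebra.induction with
  | grade0 c => rw [cobarD_algebraMap, map_zero]
  | grade1 x =>
    have : FreeAlgebra.ι k x = gen k x.1 := by rw [gen, dif_pos x.2]
    rw [this, cobarD_gen, map_sum]
    simp only [cobarD_mul, cobarD_gen, Finset.sum_add_distrib, Finset.sum_mul, Finset.mul_sum]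
    rw [PolyCoalg.sum_antidiagonal_assoc r x.1 fun a b c => gen k a * gen k b * gen k c]
    simp only [mul_assoc]
    exact h2 _
  | mul a b ha hb =>
    rw [cobarD_mul, map_add, cobarD_mul, cobarD_mul, ha, hb, zero_mul, mul_zero, zero_add, add_zero]
    exact h2 _
  | add a b ha hb => rw [map_add, map_add, ha, hb, add_zero]

/-- The degree of a word in the generators, `s⁻¹ (mono a)` having degree `|a| - 1`. -/
noncomputable def wordDeg (l : List (Gen r)) : ℤ := (l.map fun a => (a.1.degree : ℤ) - 1).sum

/-- The product of a word in the generators. -/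
noncomputable def word (l : List (Gen r)) : FreeAlgebra k (Gen r) :=
  (l.map (FreeAlgebra.ι k)).prod

/-- The grading of the cobar construction. -/
noncomputable def cobarDeg (n : ℤ) : Submodule k (FreeAlgebra k (Gen r)) :=
  Submodule.span k {w | ∃ l : List (Gen r), wordDeg r l = n ∧ w = word k r l}

theorem word_mem (l : List (Gen r)) : word k r l ∈ cobarDeg k r (wordDeg r l) :=
  Submodule.subset_span ⟨l, rfl, rfl⟩

instance : SetLike.GradedMonoid (cobarDeg k r) where
  one_mem := Submodule.subset_span ⟨[], rfl, rfl⟩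
  mul_mem := by
    intro m n a b ha hb
    have := Submodule.mul_mem_mul ha hb
    rw [cobarDeg, cobarDeg, Submodule.span_mul_span] at this
    refine Submodule.span_mono ?_ this
    rintro _ ⟨_, ⟨l, rfl, rfl⟩, _, ⟨l', rfl, rfl⟩, rfl⟩
    exact ⟨l ++ l', by simp [wordDeg], by simp [word]⟩

theorem gen_mem (a : Fin r →₀ ℕ) : gen k a ∈ cobarDeg k r ((a.degree : ℤ) - 1) := by
  by_cases h : a ≠ 0
  · rw [gen, dif_pos h]
    exact Submodule.subset_span ⟨[⟨a, h⟩], by simp [wordDeg], by simp [word]⟩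
  · rw [gen, dif_neg h]
    exact Submodule.zero_mem _

theorem cobarDeg_isInternal : DirectSum.IsInternal (cobarDeg k r) := by
  have hm : ∀ x : Gen r, FreeAlgebra.ι k x ∈ cobarDeg k r ((x.1.degree : ℤ) - 1) := fun x =>
    Submodule.subset_span ⟨[x], by simp [wordDeg], by simp [word]⟩
  let f : FreeAlgebra k (Gen r) →ₐ[k] ⨁ n, cobarDeg k r n :=
    FreeAlgebra.lift k fun x => DirectSum.of (fun n => cobarDeg k r n) _ ⟨FreeAlgebra.ι k x, hm x⟩
  have hf : ∀ l : List (Gen r), f (word k r l) =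
      DirectSum.of (fun n => cobarDeg k r n) _ ⟨word k r l, word_mem k r l⟩ := by
    intro l
    induction l with
    | nil => exact map_one f
    | cons x l ih =>
      have h1 : word k r (x :: l) = FreeAlgebra.ι k x * word k r l := by simp [word]
      have h2 : f (FreeAlgebra.ι k x) =
          DirectSum.of (fun n => cobarDeg k r n) _ ⟨FreeAlgebra.ι k x, hm x⟩ := by simp [f]
      refine (congrArg f h1).trans ?_
      rw [map_mul, ih, h2, DirectSum.of_mul_of]
      refine DirectSum.of_eq_of_gradedMonoid_eq (Sigma.subtype_ext ?_ ?_)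
      · change (x.1.degree : ℤ) - 1 + wordDeg r l = wordDeg r (x :: l)
        simp [wordDeg]
      · simp [GradedMonoid.mk, GradedMonoid.GMul.mul, h1]
  let _ : GradedAlgebra (cobarDeg k r) := GradedAlgebra.ofAlgHom _ f
    (by
      apply FreeAlgebra.hom_ext
      funext x
      simp [f])
    (by
      rintro i ⟨x, hx⟩
      have key : ∀ x (hx : x ∈ cobarDeg k r i),
          f x = DirectSum.lof k ℤ (fun n => cobarDeg k r n) i ⟨x, hx⟩ := by
        intro x hx
        induction hx using Submodule.span_induction with
        | mem x h =>
          obtain ⟨l, rfl, rfl⟩ := h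
          exact hf l
        | zero => rw [map_zero]; exact (map_zero _).symm
        | add x y hx hy h1 h2 => rw [map_add, h1, h2, ← map_add]; rfl
        | smul c x hx h1 => rw [map_smul, h1, ← map_smul]; rfl
      exact key x hx)
  exact DirectSum.Decomposition.isInternal _

theorem cobarD_mem (n : ℤ) : ∀ w ∈ cobarDeg k r n, cobarD k r w ∈ cobarDeg k r (n - 1) := by
  intro w hw
  induction hw using Submodule.span_induction with
  | mem x h =>
    obtain ⟨l, rfl, rfl⟩ := h
    induction l with
    | nil =>
      have : word k r ([] : List (Gen r)) = 1 := rfl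
      rw [this, cobarD_one]
      exact Submodule.zero_mem _
    | cons x l ih =>
      have h1 : word k r (x :: l) = gen k x.1 * word k r l := by
        rw [gen, dif_pos x.2]; simp [word]
      have h2 : wordDeg r (x :: l) = (x.1.degree : ℤ) - 1 + wordDeg r l := by simp [wordDeg]
      rw [h1, h2, cobarD_mul, cobarD_gen]
      refine Submodule.add_mem _ ?_ ?_
      · rw [show (x.1.degree : ℤ) - 1 + wordDeg r l - 1 =
          ((x.1.degree : ℤ) - 1 - 1) + wordDeg r l by ring]
        refine SetLike.GradedMul.mul_mem (Submodule.sum_mem _ fun p hp => ?_) (word_mem k r l)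
        rw [Finset.HasAntidiagonal.mem_antidiagonal] at hp
        have := SetLike.GradedMul.mul_mem (gen_mem k r p.1) (gen_mem k r p.2)
        convert this using 2
        rw [← hp, map_add]
        push_cast
        ring
      · rw [add_sub_assoc]
        exact SetLike.GradedMul.mul_mem (gen_mem k r x.1) ih
  | zero => rw [map_zero]; exact Submodule.zero_mem _
  | add x y _ _ hx hy => rw [map_add]; exact Submodule.add_mem _ hx hy
  | smul c x _ hx => rw [map_smul]; exact Submodule.smul_mem _ _ hx

/-- The cobar construction `Ω S_c`, the tensor algebra on the desuspension of the coaugmentation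
coideal of `S_c` with its cobar differential. -/
noncomputable def cobar [CharP k 2] : DGAlg k where
  carrier := FreeAlgebra k (Gen r)
  deg := cobarDeg k r
  internal := cobarDeg_isInternal k r
  one_mem := SetLike.GradedOne.one_mem
  mul_mem _ _ _ ha _ hb := SetLike.GradedMul.mul_mem ha hb
  d := cobarD k r
  d_deg := cobarD_mem k r
  d_sq := cobarD_sq k r
  d_mul := cobarD_mul k r

/-- The exterior algebra `Λ = Λ(t₁, …, t_r)` in degree `0`, with zero differential. -/
noncomputable def extAlg : DGAlg k where
  carrier := ExteriorAlgebra k (Fin r → k)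
  deg := concentratedDeg k (ExteriorAlgebra k (Fin r → k))
  internal := concentratedDeg_isInternal
  one_mem := by simp [concentratedDeg]
  mul_mem := by
    intro m n a ha b hb
    by_cases hm : m = 0
    · by_cases hn : n = 0
      · simp [concentratedDeg, hm, hn]
      · have : b = 0 := by simpa [concentratedDeg, hn] using hb
        rw [this, mul_zero]; exact Submodule.zero_mem _
    · have : a = 0 := by simpa [concentratedDeg, hm] using ha
      rw [this, zero_mul]; exact Submodule.zero_mem _
  d := 0
  d_deg _ _ _ := Submodule.zero_mem _
  d_sq _ := rfl
  d_mul _ _ := by simp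

/-- The generator `t_i` of the exterior algebra. -/
noncomputable def tgen (i : Fin r) : ExteriorAlgebra k (Fin r → k) :=
  ExteriorAlgebra.ι k (Pi.single i 1)

/-- A twisting morphism from `S_c` (which has zero differential) to the dg algebra `A`: a linear
map of degree `-1`, zero on the coaugmentation, with `∂φ + φ ⋆ φ = 0`. -/
structure Twisting (A : DGAlg k) where
  toLin : PolyCoalg k r →ₗ[k] A
  map_deg : ∀ n, ∀ c ∈ PolyCoalg.cdeg k r n, toLin c ∈ A.deg (n - 1)
  map_unit : toLin (PolyCoalg.mono k 0) = 0
  maurerCartan : ∀ c, A.d (toLin c) +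
    LinearMap.mul' k A (TensorProduct.map toLin toLin (Coalgebra.comul (R := k) c)) = 0

variable {r} in
/-- The twisting morphism with prescribed values on the basis of `S_c`. -/
noncomputable def Twisting.ofFun {A : DGAlg k} (φ : (Fin r →₀ ℕ) → A)
    (hdeg : ∀ a : Fin r →₀ ℕ, φ a ∈ A.deg ((a.degree : ℤ) - 1)) (h0 : φ 0 = 0)
    (hmc : ∀ a, A.d (φ a) +
      ∑ p ∈ Finset.HasAntidiagonal.antidiagonal a, φ p.1 * φ p.2 = 0) : Twisting k r A where
  toLin := PolyCoalg.lin k φ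
  map_deg := by
    intro n c hc
    induction hc using Submodule.span_induction with
    | mem x h =>
      obtain ⟨a, rfl, rfl⟩ := h
      rw [PolyCoalg.lin_mono]
      exact hdeg a
    | zero => rw [map_zero]; exact Submodule.zero_mem _
    | add x y _ _ hx hy => rw [map_add]; exact Submodule.add_mem _ hx hy
    | smul c x _ hx => rw [map_smul]; exact Submodule.smul_mem _ _ hx
  map_unit := by rw [PolyCoalg.lin_mono, h0]
  maurerCartan := by
    intro c
    let F : PolyCoalg k r →ₗ[k] A := A.d ∘ₗ PolyCoalg.lin k φ +
      LinearMap.mul' k A ∘ₗ TensorProduct.map (PolyCoalg.lin k φ) (PolyCoalg.lin k φ) ∘ₗ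
        Coalgebra.comul (R := k)
    have : F = 0 := by
      apply PolyCoalg.hom_ext
      intro a
      simp only [F, LinearMap.add_apply, LinearMap.comp_apply, PolyCoalg.comul_mono, map_sum,
        TensorProduct.map_tmul, LinearMap.mul'_apply, PolyCoalg.lin_mono, LinearMap.zero_apply]
      exact hmc a
    exact LinearMap.congr_fun this c

/-- The universal twisting morphism `ι : S_c → Ω S_c`. -/
noncomputable def iotaTw [CharP k 2] : Twisting k r (cobar k r) :=
  Twisting.ofFun k (A := cobar k r) (gen k) (gen_mem k r) (dif_neg (by simp)) (by
    intro a
    change cobarD k r (gen k a) + _ = 0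
    rw [cobarD_gen]
    change (∑ p ∈ Finset.HasAntidiagonal.antidiagonal a, gen k p.1 * gen k p.2) +
      (∑ p ∈ Finset.HasAntidiagonal.antidiagonal a, gen k p.1 * gen k p.2) = 0
    rw [← two_smul k (∑ p ∈ Finset.HasAntidiagonal.antidiagonal a, gen k p.1 * gen k p.2),
      CharTwo.two_eq_zero, zero_smul])

/-- The values of the canonical twisting morphism on the basis: `κ (mono e_i) = t_i`, and zero on
the other basis elements. -/
noncomputable def kappaFun (a : Fin r →₀ ℕ) : ExteriorAlgebra k (Fin r → k) :=
  ∑ i : Fin r, if a = Finsupp.single i 1 then tgen k r i else 0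

theorem kappaFun_sum (a : Fin r →₀ ℕ) :
    ∑ p ∈ Finset.HasAntidiagonal.antidiagonal a, kappaFun k r p.1 * kappaFun k r p.2 = 0 := by
  have h1 : ∀ p : (Fin r →₀ ℕ) × (Fin r →₀ ℕ), kappaFun k r p.1 * kappaFun k r p.2 =
      ∑ ij : Fin r × Fin r, if p = (Finsupp.single ij.1 1, Finsupp.single ij.2 1) then
        tgen k r ij.1 * tgen k r ij.2 else 0 := by
    rintro ⟨b, c⟩
    rw [Fintype.sum_prod_type, kappaFun, kappaFun, Finset.sum_mul_sum]
    refine Finset.sum_congr rfl fun i _ => Finset.sum_congr rfl fun j _ => ?_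
    by_cases hb : b = Finsupp.single i 1 <;> by_cases hc : c = Finsupp.single j 1 <;>
      simp [hb, hc]
  simp only [h1]
  rw [Finset.sum_comm]
  refine Finset.sum_involution (fun ij _ => ij.swap) ?_ ?_ (fun _ _ => Finset.mem_univ _)
    (fun _ _ => rfl)
  · rintro ⟨i, j⟩ _
    have hij : tgen k r i * tgen k r j + tgen k r j * tgen k r i = 0 :=
      ExteriorAlgebra.ι_add_mul_swap _ _
    simp only [Prod.swap_prod_mk, Finset.sum_ite_eq', Finset.HasAntidiagonal.mem_antidiagonal]
    rw [add_comm (Finsupp.single j 1) (Finsupp.single i 1)]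
    split_ifs
    · exact hij
    · exact add_zero 0
  · rintro ⟨i, j⟩ _ hne heq
    simp only [Prod.swap_prod_mk, Prod.mk.injEq] at heq
    rw [heq.1] at hne
    exact hne (by simp [tgen])

/-- The canonical twisting morphism `κ : S_c → Λ`. -/
noncomputable def kappaTw : Twisting k r (extAlg k r) :=
  Twisting.ofFun k (A := extAlg k r) (kappaFun k r)
    (by
      intro a
      refine Submodule.sum_mem _ fun i _ => ?_
      split_ifs with h
      · subst h
        have : concentratedDeg k (ExteriorAlgebra k (Fin r → k))
            (((Finsupp.single i 1 : Fin r →₀ ℕ).degree : ℤ) - 1) = ⊤ := by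
          simp [concentratedDeg]
        change _ ∈ concentratedDeg k (ExteriorAlgebra k (Fin r → k)) _
        rw [this]
        trivial
      · exact Submodule.zero_mem _)
    (Finset.sum_eq_zero fun i _ => if_neg fun h => by
      simpa using DFunLike.congr_fun h i)
    (by
      intro a
      exact (zero_add _).trans (kappaFun_sum k r a))

variable {k r}

/-- The morphism of dg algebras `Ω S_c → A` induced by a twisting morphism `S_c → A`. -/
noncomputable def Twisting.lift [CharP k 2] {A : DGAlg k} (φ : Twisting k r A) :
    DGAlg.Hom (cobar k r) A :=
  let f : FreeAlgebra k (Gen r) →ₐ[k] A := FreeAlgebra.lift k fun a => φ.toLin (PolyCoalg.mono k a.1)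
  have hgen : ∀ a, f (gen k a) = φ.toLin (PolyCoalg.mono k a) := by
    intro a
    by_cases h : a ≠ 0
    · rw [gen, dif_pos h, FreeAlgebra.lift_ι_apply]
    · push Not at h
      subst h
      rw [φ.map_unit, gen, dif_neg (by simp), map_zero]
  have hι : ∀ x : Gen r, FreeAlgebra.ι k x = gen k x.1 := fun x => by rw [gen, dif_pos x.2]
  { toAlgHom := f
    map_deg := by
      intro n w hw
      induction hw using Submodule.span_induction with
      | mem x h =>
        obtain ⟨l, rfl, rfl⟩ := h
        induction l with
        | nil =>
          have : word k r ([] : List (Gen r)) = 1 := rfl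
          rw [this]
          change f 1 ∈ _
          rw [map_one]
          exact A.one_mem
        | cons x l ih =>
          have h1 : word k r (x :: l) = gen k x.1 * word k r l := by rw [← hι]; simp [word]
          have h2 : wordDeg r (x :: l) = (x.1.degree : ℤ) - 1 + wordDeg r l := by simp [wordDeg]
          rw [h1, h2]
          change f (_ * _) ∈ _
          rw [map_mul, hgen]
          exact A.mul_mem _ _ _ (φ.map_deg _ _ (PolyCoalg.mono_mem k x.1)) _ ih
      | zero => exact (map_zero f).symm ▸ Submodule.zero_mem _
      | add x y _ _ hx hy => exact (map_add f x y).symm ▸ Submodule.add_mem _ hx hy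
      | smul c x _ hx => exact (map_smul f c x).symm ▸ Submodule.smul_mem _ _ hx
    comm := by
      intro w
      change f (cobarD k r w) = A.d (f w)
      induction w using FreeAlgebra.induction with
      | grade0 c =>
        have h1 : A.d 1 = 0 := by
          have := A.d_mul 1 1
          rw [mul_one, mul_one, one_mul] at this
          exact left_eq_add.1 this
        rw [cobarD_algebraMap, map_zero, AlgHom.commutes, Algebra.algebraMap_eq_smul_one,
          map_smul, h1, smul_zero]
      | grade1 x =>
        have hmc := φ.maurerCartan (PolyCoalg.mono k x.1)
        rw [PolyCoalg.comul_mono, map_sum, map_sum] at hmc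
        simp only [TensorProduct.map_tmul, LinearMap.mul'_apply] at hmc
        rw [hι, cobarD_gen, map_sum, hgen]
        simp only [map_mul, hgen]
        rw [eq_neg_of_add_eq_zero_left hmc, eq_neg_iff_add_eq_zero,
          ← two_smul k, CharTwo.two_eq_zero, zero_smul]
      | mul a b ha hb => rw [cobarD_mul, map_add, map_mul, map_mul, map_mul, A.d_mul, ha, hb]
      | add a b ha hb => rw [map_add, map_add, map_add, map_add, ha, hb] }

end Cobar

/-! ### The bar construction -/

section Bar

variable {k : Type u} [Field k] {r : ℕ} {A : DGAlg k}

/-- The twisting term `c ⊗ m ↦ ∑ c' ⊗ φ(c'') m` of the differential of the bar construction. -/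
noncomputable def Twisting.term (φ : Twisting k r A) (M : DGAlgMod A) :
    PolyCoalg k r ⊗[k] M.toDGMod →ₗ[k] PolyCoalg k r ⊗[k] M.toDGMod :=
  LinearMap.lTensor (PolyCoalg k r) (TensorProduct.lift (M.act.toLinearMap ∘ₗ φ.toLin)) ∘ₗ
    (TensorProduct.assoc k (PolyCoalg k r) (PolyCoalg k r) M.toDGMod).toLinearMap ∘ₗ
    LinearMap.rTensor M.toDGMod (Coalgebra.comul (R := k))

theorem Twisting.term_mono (φ : Twisting k r A) (M : DGAlgMod A) (a : Fin r →₀ ℕ)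
    (m : M.toDGMod) : φ.term M (PolyCoalg.mono k a ⊗ₜ m) =
      ∑ p ∈ Finset.HasAntidiagonal.antidiagonal a,
        PolyCoalg.mono k p.1 ⊗ₜ M.act (φ.toLin (PolyCoalg.mono k p.2)) m := by
  simp only [Twisting.term, LinearMap.comp_apply, LinearMap.rTensor_tmul, PolyCoalg.comul_mono,
    TensorProduct.sum_tmul, map_sum, LinearEquiv.coe_coe, TensorProduct.assoc_tmul,
    LinearMap.lTensor_tmul, TensorProduct.lift.tmul]
  rfl

/-- The differential `c ⊗ m ↦ c ⊗ dm + ∑ c' ⊗ φ(c'') m` of the bar construction. -/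
noncomputable def Twisting.barD (φ : Twisting k r A) (M : DGAlgMod A) :
    PolyCoalg k r ⊗[k] M.toDGMod →ₗ[k] PolyCoalg k r ⊗[k] M.toDGMod :=
  LinearMap.lTensor (PolyCoalg k r) M.toDGMod.d + φ.term M

theorem Twisting.barD_mono (φ : Twisting k r A) (M : DGAlgMod A) (a : Fin r →₀ ℕ)
    (m : M.toDGMod) : φ.barD M (PolyCoalg.mono k a ⊗ₜ m) =
      PolyCoalg.mono k a ⊗ₜ M.toDGMod.d m + ∑ p ∈ Finset.HasAntidiagonal.antidiagonal a,
        PolyCoalg.mono k p.1 ⊗ₜ M.act (φ.toLin (PolyCoalg.mono k p.2)) m := by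
  rw [Twisting.barD, LinearMap.add_apply, LinearMap.lTensor_tmul, Twisting.term_mono]

theorem tensor_hom_ext {M N : Type u} [AddCommGroup M] [Module k M] [AddCommGroup N] [Module k N]
    {f g : PolyCoalg k r ⊗[k] M →ₗ[k] N}
    (h : ∀ a m, f (PolyCoalg.mono k a ⊗ₜ m) = g (PolyCoalg.mono k a ⊗ₜ m)) : f = g := by
  refine TensorProduct.ext (PolyCoalg.hom_ext fun a => LinearMap.ext fun m => ?_)
  exact h a m

theorem Twisting.barD_sq [CharP k 2] (φ : Twisting k r A) (M : DGAlgMod A)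
    (x : PolyCoalg k r ⊗[k] M.toDGMod) : φ.barD M (φ.barD M x) = 0 := by
  have : φ.barD M ∘ₗ φ.barD M = 0 := by
    refine tensor_hom_ext fun a m => ?_
    have hmc : ∀ b : Fin r →₀ ℕ, ∑ p ∈ Finset.HasAntidiagonal.antidiagonal b,
        M.act (φ.toLin (PolyCoalg.mono k p.1)) (M.act (φ.toLin (PolyCoalg.mono k p.2)) m) =
        M.act (A.d (φ.toLin (PolyCoalg.mono k b))) m := by
      intro b
      have hmc := φ.maurerCartan (PolyCoalg.mono k b)
      rw [PolyCoalg.comul_mono, map_sum, map_sum] at hmc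
      simp only [TensorProduct.map_tmul, LinearMap.mul'_apply] at hmc
      have h2 : ∀ x : A, -x = x := by
        intro x
        rw [neg_eq_iff_add_eq_zero, ← two_smul k, CharTwo.two_eq_zero, zero_smul]
      rw [eq_neg_of_add_eq_zero_left hmc, h2, map_sum, LinearMap.sum_apply]
      exact Finset.sum_congr rfl fun p _ => by rw [map_mul]; rfl
    rw [LinearMap.comp_apply, Twisting.barD_mono, map_add, Twisting.barD_mono, map_sum]
    simp only [Twisting.barD_mono, M.toDGMod.d_sq, TensorProduct.tmul_zero, zero_add,
      Finset.sum_add_distrib, M.action.act_d, TensorProduct.tmul_add, LinearMap.zero_apply]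
    rw [PolyCoalg.sum_antidiagonal_assoc r a fun b c e => PolyCoalg.mono k b ⊗ₜ[k]
      M.act (φ.toLin (PolyCoalg.mono k c)) (M.act (φ.toLin (PolyCoalg.mono k e)) m)]
    simp only [← TensorProduct.tmul_sum, hmc]
    have h2 : ∀ x y : PolyCoalg k r ⊗[k] M.toDGMod, x + (y + x + y) = 0 := by
      intro x y
      have : x + (y + x + y) = (2 : k) • (x + y) := by rw [two_smul]; abel
      rw [this, CharTwo.two_eq_zero, zero_smul]
    exact h2 _ _
  exact LinearMap.congr_fun this x

theorem sum_antidiagonal_lower {M : Type*} [AddCommMonoid M] (e a : Fin r →₀ ℕ)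
    (F : (Fin r →₀ ℕ) → (Fin r →₀ ℕ) → M) :
    (∑ p ∈ Finset.HasAntidiagonal.antidiagonal a, if e ≤ p.1 then F (p.1 - e) p.2 else 0) =
      if e ≤ a then ∑ p ∈ Finset.HasAntidiagonal.antidiagonal (a - e), F p.1 p.2 else 0 := by
  split_ifs with h
  · rw [← Finset.sum_filter]
    refine Finset.sum_bij' (fun p _ => (p.1 - e, p.2)) (fun p _ => (p.1 + e, p.2)) ?_ ?_ ?_ ?_ ?_
    · rintro ⟨b, c⟩ hp
      simp only [Finset.mem_filter, Finset.HasAntidiagonal.mem_antidiagonal] at hp ⊢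
      rw [← hp.1, tsub_add_eq_add_tsub hp.2]
    · rintro ⟨b, c⟩ hp
      simp only [Finset.mem_filter, Finset.HasAntidiagonal.mem_antidiagonal] at hp ⊢
      refine ⟨?_, le_add_self⟩
      rw [add_right_comm, hp, tsub_add_cancel_of_le h]
    · rintro ⟨b, c⟩ hp
      simp only [Finset.mem_filter, Finset.HasAntidiagonal.mem_antidiagonal] at hp ⊢
      rw [tsub_add_cancel_of_le hp.2]
    · rintro ⟨b, c⟩ hp
      simp
    · rintro ⟨b, c⟩ hp
      rfl
  · refine Finset.sum_eq_zero fun p hp => if_neg fun h' => h ?_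
    rw [Finset.HasAntidiagonal.mem_antidiagonal] at hp
    rw [← hp]
    exact le_trans h' le_self_add

theorem contract_barD (φ : Twisting k r A) (M : DGAlgMod A) (p : MvPolynomial (Fin r) k)
    (x : PolyCoalg k r ⊗[k] M.toDGMod) :
    φ.barD M (LinearMap.rTensor M.toDGMod (PolyCoalg.contract k r p) x) =
      LinearMap.rTensor M.toDGMod (PolyCoalg.contract k r p) (φ.barD M x) := by
  induction p using MvPolynomial.induction_on' with
  | monomial e c =>
    refine LinearMap.congr_fun (f := φ.barD M ∘ₗ LinearMap.rTensor M.toDGMod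
      (PolyCoalg.contract k r (MvPolynomial.monomial e c)))
      (g := LinearMap.rTensor M.toDGMod (PolyCoalg.contract k r (MvPolynomial.monomial e c)) ∘ₗ
        φ.barD M) (tensor_hom_ext fun a m => ?_) x
    simp only [LinearMap.comp_apply, LinearMap.rTensor_tmul, PolyCoalg.contract_monomial,
      Twisting.barD_mono, map_add, map_sum]
    have h1 : ∀ (P : Prop) [Decidable P] (y : PolyCoalg k r) (z : M.toDGMod),
        (c • if P then y else 0) ⊗ₜ[k] z = if P then c • (y ⊗ₜ[k] z) else 0 := by
      intro P _ y z
      split_ifs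
      · exact TensorProduct.smul_tmul' c y z
      · simp
    simp only [h1]
    rw [sum_antidiagonal_lower e a fun b b' => c • (PolyCoalg.mono k b ⊗ₜ[k]
      M.act (φ.toLin (PolyCoalg.mono k b')) m)]
    split_ifs
    · rw [map_smul, Twisting.barD_mono, smul_add, Finset.smul_sum]
    · simp
  | add p q hp hq =>
    rw [map_add, LinearMap.rTensor_add, LinearMap.add_apply, LinearMap.add_apply, map_add, hp, hq]

/-- Induction on the homogeneous elements of `S_c ⊗ M`. -/
theorem tensorDeg_induction {M : DGMod k} {n : ℤ} {x : PolyCoalg k r ⊗[k] M}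
    (hx : x ∈ tensorDeg (PolyCoalg.cdeg k r) M.deg n) {P : PolyCoalg k r ⊗[k] M → Prop}
    (mono : ∀ (a : Fin r →₀ ℕ) (m : M), m ∈ M.deg (n - a.degree) → P (PolyCoalg.mono k a ⊗ₜ m))
    (zero : P 0) (add : ∀ y z, P y → P z → P (y + z)) (smul : ∀ (c : k) y, P y → P (c • y)) :
    P x := by
  induction hx using Submodule.span_induction with
  | mem x h =>
    obtain ⟨i, j, rfl, x, hx, y, hy, rfl⟩ := h
    induction hx using Submodule.span_induction with
    | mem x h =>
      obtain ⟨a, rfl, rfl⟩ := h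
      refine mono a y ?_
      rwa [add_sub_cancel_left]
    | zero => rw [TensorProduct.zero_tmul]; exact zero
    | add x z _ _ h1 h2 => rw [TensorProduct.add_tmul]; exact add _ _ h1 h2
    | smul c x _ h1 => rw [← TensorProduct.smul_tmul']; exact smul _ _ h1
  | zero => exact zero
  | add x y _ _ hx hy => exact add _ _ hx hy
  | smul c x _ hx => exact smul _ _ hx

variable (r) in
theorem contract_mem {m : ℤ} {p : MvPolynomial (Fin r) k} (hp : p ∈ polyDeg k r m)
    (a : Fin r →₀ ℕ) : PolyCoalg.contract k r p (PolyCoalg.mono k a) ∈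
      PolyCoalg.cdeg k r (m + a.degree) := by
  rw [← MvPolynomial.support_sum_monomial_coeff p, map_sum, LinearMap.sum_apply]
  refine Submodule.sum_mem _ fun e he => ?_
  have := hp e (MvPolynomial.mem_support_iff.1 he)
  rw [PolyCoalg.contract_monomial]
  refine Submodule.smul_mem _ _ ?_
  split_ifs with h
  · refine PolyCoalg.mono_mem' k ?_
    have h2 : (a - e).degree + e.degree = a.degree := by
      rw [← map_add, tsub_add_cancel_of_le h]
    omega
  · exact Submodule.zero_mem _

theorem rTensor_contract_mem {M : DGMod k} {m n : ℤ} {p : MvPolynomial (Fin r) k}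
    (hp : p ∈ polyDeg k r m) {x : PolyCoalg k r ⊗[k] M}
    (hx : x ∈ tensorDeg (PolyCoalg.cdeg k r) M.deg n) :
    LinearMap.rTensor M (PolyCoalg.contract k r p) x ∈
      tensorDeg (PolyCoalg.cdeg k r) M.deg (m + n) := by
  refine tensorDeg_induction hx (P := fun x => LinearMap.rTensor M (PolyCoalg.contract k r p) x ∈
    tensorDeg (PolyCoalg.cdeg k r) M.deg (m + n)) ?_ ?_ ?_ ?_
  · intro a y hy
    rw [LinearMap.rTensor_tmul]
    exact tmul_mem_tensorDeg (contract_mem r hp a) hy (by ring)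
  · rw [map_zero]; exact Submodule.zero_mem _
  · intro y z hy hz; rw [map_add]; exact Submodule.add_mem _ hy hz
  · intro c y hy; rw [map_smul]; exact Submodule.smul_mem _ _ hy

theorem barD_mem (φ : Twisting k r A) (M : DGAlgMod A) {n : ℤ}
    {x : PolyCoalg k r ⊗[k] M.toDGMod}
    (hx : x ∈ tensorDeg (PolyCoalg.cdeg k r) M.toDGMod.deg n) :
    φ.barD M x ∈ tensorDeg (PolyCoalg.cdeg k r) M.toDGMod.deg (n - 1) := by
  refine tensorDeg_induction hx
    (P := fun x => φ.barD M x ∈ tensorDeg (PolyCoalg.cdeg k r) M.toDGMod.deg (n - 1)) ?_ ?_ ?_ ?_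
  · intro a m hm
    rw [Twisting.barD_mono]
    refine Submodule.add_mem _ ?_ (Submodule.sum_mem _ fun p hp => ?_)
    · exact tmul_mem_tensorDeg (PolyCoalg.mono_mem k a) (M.toDGMod.d_deg _ m hm) (by ring)
    · rw [Finset.HasAntidiagonal.mem_antidiagonal] at hp
      refine tmul_mem_tensorDeg (PolyCoalg.mono_mem k p.1) (M.action.act_deg _ _ _
        (φ.map_deg _ _ (PolyCoalg.mono_mem k p.2)) m hm) ?_
      rw [← hp, map_add]
      push_cast
      ring
  · rw [map_zero]; exact Submodule.zero_mem _
  · intro y z hy hz; rw [map_add]; exact Submodule.add_mem _ hy hz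
  · intro c y hy; rw [map_smul]; exact Submodule.smul_mem _ _ hy

/-- The dg `k`-module underlying the bar construction. -/
noncomputable def barDG [CharP k 2] (φ : Twisting k r A) (M : DGAlgMod A) : DGMod k where
  carrier := PolyCoalg k r ⊗[k] M.toDGMod
  deg := tensorDeg (PolyCoalg.cdeg k r) M.toDGMod.deg
  internal := tensorDeg_isInternal (PolyCoalg.cdeg_isInternal k r) M.toDGMod.internal
  d := φ.barD M
  d_deg _ _ hx := barD_mem φ M hx
  d_sq := φ.barD_sq M

/-- The action of `S` on `S_c ⊗ M` through the left-hand factor. -/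
noncomputable def barAct (r : ℕ) (M : DGMod k) :
    MvPolynomial (Fin r) k →ₐ[k] Module.End k (PolyCoalg k r ⊗[k] M) :=
  (AlgHom.ofLinearMap
    (LinearMap.rTensorHom M : Module.End k (PolyCoalg k r) →ₗ[k]
      Module.End k (PolyCoalg k r ⊗[k] M))
    (LinearMap.rTensor_id _ _) (fun f g => LinearMap.rTensor_comp _ f g)).comp
      (PolyCoalg.contract k r)

/-- The bar construction `B_φ M = S_c ⊗_φ M`, an `S_c`-coalgebra: the dual algebra `S` of `S_c`
acts through the left-hand factor. -/
noncomputable def bar [CharP k 2] (φ : Twisting k r A) (M : DGAlgMod A) :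
    DGAlgMod (polyAlg k r) where
  toDGMod := barDG φ M
  action :=
    { act := barAct r M.toDGMod
      act_deg := fun _ _ _ hp _ hx => rTensor_contract_mem hp hx
      act_d := by
        intro p x
        have h : (barAct r M.toDGMod) 0 x = 0 := by rw [map_zero]; rfl
        exact (contract_barD φ M p x).trans ((zero_add _).symm.trans
          (congrArg (· + barAct r M.toDGMod p (φ.barD M x)) h.symm)) }

end Bar

/-! ### `∞`-morphisms, conilpotent coalgebras, duals and twisted tensor products -/

section Misc

variable {k : Type u} [Field k] {r : ℕ}

/-- An `∞`-morphism `f : V ⇝ W` of `Ω S_c`-algebras: a family of maps `f_c : V → W`, of degree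
`|c|` and linear in `c ∈ S_c`, such that
`d (f_c v) + f_c (d v) = ∑ f_{c'} (ι(c'') v) + ∑ ι(c') (f_{c''} v)`. -/
structure InfMorphism [CharP k 2] (V W : DGAlgMod (cobar k r)) where
  toLin : PolyCoalg k r →ₗ[k] V.toDGMod →ₗ[k] W.toDGMod
  map_deg : ∀ m n, ∀ c ∈ PolyCoalg.cdeg k r m, ∀ v ∈ V.toDGMod.deg n,
    toLin c v ∈ W.toDGMod.deg (m + n)
  eqn : ∀ (a : Fin r →₀ ℕ) (v : V.toDGMod),
    W.toDGMod.d (toLin (PolyCoalg.mono k a) v) + toLin (PolyCoalg.mono k a) (V.toDGMod.d v) =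
      (∑ p ∈ Finset.HasAntidiagonal.antidiagonal a, toLin (PolyCoalg.mono k p.1)
        (V.act ((iotaTw k r).toLin (PolyCoalg.mono k p.2)) v)) +
      ∑ p ∈ Finset.HasAntidiagonal.antidiagonal a,
        W.act ((iotaTw k r).toLin (PolyCoalg.mono k p.1)) (toLin (PolyCoalg.mono k p.2) v)

/-- The component `f_1 : V → W` of an `∞`-morphism, a chain map. -/
noncomputable def InfMorphism.linear [CharP k 2] {V W : DGAlgMod (cobar k r)}
    (f : InfMorphism V W) : DGMod.Hom V.toDGMod W.toDGMod where
  toLin := f.toLin (PolyCoalg.mono k 0)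
  map_deg := by
    intro n v hv
    simpa using f.map_deg 0 n _ (PolyCoalg.mono_mem' k (a := 0) (by simp)) v hv
  comm := by
    intro v
    have h := f.eqn 0 v
    simp only [Finset.HasAntidiagonal.antidiagonal_zero, Finset.sum_singleton, (iotaTw k r).map_unit, map_zero,
      LinearMap.zero_apply, add_zero] at h
    rw [eq_comm, ← sub_eq_zero, ← h, sub_eq_add_neg, add_right_inj, neg_eq_iff_add_eq_zero,
      ← two_smul k, CharTwo.two_eq_zero, zero_smul]

/-- An `S_c`-coalgebra, given by the action of the dual algebra `S`, is conilpotent if every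
element is annihilated by all monomials of sufficiently large degree. -/
def IsConilpotent (M : DGAlgMod (polyAlg k r)) : Prop :=
  ∀ x : M.toDGMod, ∃ N : ℕ, ∀ a : Fin r →₀ ℕ, N ≤ a.degree →
    M.act (MvPolynomial.monomial a (1 : k) : MvPolynomial (Fin r) k) x = 0

/-- Existence of a zigzag of quasi-isomorphisms of conilpotent dg `S_c`-coalgebras. -/
def CoalgZigzag (M N : DGAlgMod (polyAlg k r)) : Prop :=
  IsConilpotent M ∧ IsConilpotent N ∧
    Relation.EqvGen (fun M N : DGAlgMod (polyAlg k r) =>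
      IsConilpotent M ∧ IsConilpotent N ∧ ∃ f : DGAlgMod.Hom M N, f.IsQuasiIso) M N

/-- The transposed action on the graded dual. -/
noncomputable def dualAct (M : DGAlgMod (polyAlg k r)) :
    MvPolynomial (Fin r) k →ₐ[k] Module.End k M.toDGMod.gradedDual :=
  have hmem : ∀ (p : MvPolynomial (Fin r) k) (φ : M.toDGMod.gradedDual),
      φ.1 ∘ₗ M.act p ∈ M.toDGMod.gradedDual := by
    intro p φ
    obtain ⟨s, hs⟩ := φ.2
    refine ⟨(s ×ˢ p.support).image fun q => q.1 + (q.2.degree : ℤ), fun n hn x hx => ?_⟩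
    have hp : M.act p x = ∑ a ∈ p.support,
        M.act (MvPolynomial.monomial a (MvPolynomial.coeff a p) : MvPolynomial (Fin r) k) x := by
      conv_lhs => rw [← MvPolynomial.support_sum_monomial_coeff p]
      exact (congrArg (fun f : Module.End k M.toDGMod => f x) (map_sum M.act _ _)).trans
        (LinearMap.sum_apply _ _ _)
    rw [LinearMap.comp_apply, hp, map_sum]
    refine Finset.sum_eq_zero fun a ha => hs (-(a.degree : ℤ) + n) (fun h => hn ?_) _
      (M.action.act_deg _ _ _ (monomial_mem_polyDeg k r a _) x hx)
    exact Finset.mem_image.2 ⟨(-(a.degree : ℤ) + n, a), Finset.mem_product.2 ⟨h, ha⟩, by simp⟩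
  AlgHom.ofLinearMap
    { toFun := fun p =>
        { toFun := fun φ => ⟨φ.1 ∘ₗ M.act p, hmem p φ⟩
          map_add' := fun φ ψ => rfl
          map_smul' := fun c φ => rfl }
      map_add' := by
        intro p q
        apply LinearMap.ext
        intro φ
        apply Subtype.ext
        apply LinearMap.ext
        intro x
        have : M.act (p + q) = M.act p + M.act q := map_add M.act p q
        change φ.1 (M.act (p + q) x) = φ.1 (M.act p x) + φ.1 (M.act q x)
        rw [this, LinearMap.add_apply, map_add]
      map_smul' := by
        intro c p
        apply LinearMap.ext
        intro φ
        apply Subtype.ext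
        apply LinearMap.ext
        intro x
        have : M.act (c • p) = c • M.act p := map_smul M.act c p
        change φ.1 (M.act (c • p) x) = c • φ.1 (M.act p x)
        rw [this, LinearMap.smul_apply, map_smul] }
    (by
      apply LinearMap.ext
      intro φ
      apply Subtype.ext
      apply LinearMap.ext
      intro x
      have : M.act (1 : MvPolynomial (Fin r) k) = 1 := map_one M.act
      change φ.1 (M.act (1 : MvPolynomial (Fin r) k) x) = φ.1 x
      rw [this]
      rfl)
    (by
      intro p q
      apply LinearMap.ext
      intro φ
      apply Subtype.ext
      apply LinearMap.ext
      intro x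
      have : M.act (q * p) = M.act q * M.act p := map_mul M.act q p
      change φ.1 (M.act (p * q) x) = φ.1 (M.act q (M.act p x))
      rw [mul_comm p q, this]
      rfl)

/-- The graded dual of a dg `S`-module, with the transposed action. -/
noncomputable def dualMod (M : DGAlgMod (polyAlg k r)) : DGAlgMod (polyAlg k r) where
  toDGMod := M.toDGMod.dual
  action :=
    { act := dualAct M
      act_deg := by
        intro m n p hp φ hφ i hi x hx
        exact hφ (m + i) (by omega) _ (M.action.act_deg m i p hp x hx)
      act_d := by
        intro p φ
        apply Subtype.ext
        apply LinearMap.ext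
        intro x
        have h1 : M.toDGMod.d (M.act p x) = M.act p (M.toDGMod.d x) := by
          have := M.action.act_d p x
          rwa [show (polyAlg k r).d p = 0 from rfl, map_zero, LinearMap.zero_apply,
            zero_add] at this
        have h2 : dualAct M 0 φ = 0 := by rw [map_zero]; rfl
        have h3 : (dualAct M p (M.toDGMod.dual.d φ)).1 x = φ.1 (M.toDGMod.d (M.act p x)) := rfl
        have h4 : (M.toDGMod.dual.d (dualAct M p φ)).1 x = φ.1 (M.act p (M.toDGMod.d x)) := rfl
        change (M.toDGMod.dual.d (dualAct M p φ)).1 x =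
          (dualAct M 0 φ + dualAct M p (M.toDGMod.dual.d φ)).1 x
        rw [h2, zero_add, h3, h4, h1] }

/-- A twisted differential on `S ⊗ H`, for a graded vector space `H`: an `S`-linear differential
of degree `-1` for the total (homological) grading. -/
structure TwistedDiff (r : ℕ) (H : DGMod k) where
  δ : MvPolynomial (Fin r) k ⊗[k] H →ₗ[MvPolynomial (Fin r) k] MvPolynomial (Fin r) k ⊗[k] H
  δ_deg : ∀ n, ∀ x ∈ tensorDeg (polyDeg k r) H.deg n, δ x ∈ tensorDeg (polyDeg k r) H.deg (n - 1)
  δ_sq : ∀ x, δ (δ x) = 0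

theorem smul_mem_tensorDeg {H : DGMod k} {m n : ℤ} {p : MvPolynomial (Fin r) k}
    (hp : p ∈ polyDeg k r m) {x : MvPolynomial (Fin r) k ⊗[k] H}
    (hx : x ∈ tensorDeg (polyDeg k r) H.deg n) : p • x ∈ tensorDeg (polyDeg k r) H.deg (m + n) := by
  induction hx using Submodule.span_induction with
  | mem x h =>
    obtain ⟨i, j, rfl, q, hq, y, hy, rfl⟩ := h
    rw [TensorProduct.smul_tmul', smul_eq_mul]
    exact tmul_mem_tensorDeg ((polyAlg k r).mul_mem m i p hp q hq) hy (by ring)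
  | zero => rw [smul_zero]; exact Submodule.zero_mem _
  | add x y _ _ hx hy => rw [smul_add]; exact Submodule.add_mem _ hx hy
  | smul c x _ hx => rw [smul_comm]; exact Submodule.smul_mem _ _ hx

/-- The dg `k`-module `S ⊗ H` with a twisted differential. -/
noncomputable def TwistedDiff.toDG {H : DGMod k} (D : TwistedDiff r H) : DGMod k where
  carrier := MvPolynomial (Fin r) k ⊗[k] H
  deg := tensorDeg (polyDeg k r) H.deg
  internal := tensorDeg_isInternal (polyDeg_isInternal k r) H.internal
  d := D.δ.restrictScalars k
  d_deg := D.δ_deg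
  d_sq := D.δ_sq

/-- The action of `S` on `S ⊗ H` by multiplication on the left-hand factor. -/
noncomputable def freeAct (r : ℕ) (H : DGMod k) :
    MvPolynomial (Fin r) k →ₐ[k] Module.End k (MvPolynomial (Fin r) k ⊗[k] H) :=
  Algebra.lsmul k k (MvPolynomial (Fin r) k ⊗[k] H)

/-- The dg `S`-module `S ⊗ H` with a twisted differential. -/
noncomputable def TwistedDiff.toMod {H : DGMod k} (D : TwistedDiff r H) :
    DGAlgMod (polyAlg k r) where
  toDGMod := D.toDG
  action :=
    { act := freeAct r H
      act_deg := fun _ _ _ hp _ hx => smul_mem_tensorDeg hp hx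
      act_d := by
        intro p x
        have h : freeAct r H 0 x = 0 := by rw [map_zero]; rfl
        exact (D.δ.map_smul p x).trans ((zero_add _).symm.trans
          (congrArg (· + freeAct r H p (D.δ x)) h.symm)) }

/-- The twisted differential is minimal: it is zero modulo the ideal `(x₁, …, x_r)`. -/
def TwistedDiff.IsMinimal {H : DGMod k} (D : TwistedDiff r H) : Prop :=
  ∀ x, D.δ x ∈ (Ideal.span (Set.range (MvPolynomial.X : Fin r → MvPolynomial (Fin r) k))) •
    (⊤ : Submodule (MvPolynomial (Fin r) k) (MvPolynomial (Fin r) k ⊗[k] H))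

end Misc

/-! ### Simplicial sets with an action, chains, and the Borel construction -/

section Simplicial

variable (k : Type u) [Field k]

variable {k} in
/-- The total differential of a chain complex. -/
noncomputable def complexD (K : ChainComplex (ModuleCat.{u} k) ℕ) :
    (⨁ n, K.X n) →ₗ[k] ⨁ n, K.X n :=
  DirectSum.toModule k ℕ _ fun n => match n with
    | 0 => 0
    | n + 1 => DirectSum.lof k ℕ (fun n => K.X n) n ∘ₗ (K.d (n + 1) n).hom

variable {k} in
theorem complexD_apply (K : ChainComplex (ModuleCat.{u} k) ℕ) (x : ⨁ n, K.X n) (n : ℕ) :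
    complexD K x n = (K.d (n + 1) n).hom (x (n + 1)) := by
  induction x using DirectSum.induction_on with
  | zero => simp
  | of m y =>
    rw [← DirectSum.lof_eq_of k, complexD, DirectSum.toModule_lof]
    match m with
    | 0 =>
      have : DirectSum.lof k ℕ (fun n => K.X n) 0 y (n + 1) = 0 :=
        DirectSum.of_eq_of_ne _ _ _ (by simp)
      rw [this, map_zero]
      rfl
    | m + 1 =>
      by_cases h : n = m
      · subst h
        rw [LinearMap.comp_apply, DirectSum.lof_apply, DirectSum.lof_apply]
      · have h1 : DirectSum.lof k ℕ (fun n => K.X n) (m + 1) y (n + 1) = 0 :=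
          DirectSum.of_eq_of_ne _ _ _ (by simpa using h)
        rw [h1, map_zero]
        exact DirectSum.of_eq_of_ne _ _ _ h
  | add x y hx hy =>
    rw [map_add, DirectSum.add_apply, DirectSum.add_apply, map_add, hx, hy]

/-- The dg `k`-module `⨁ n, K_n` of a chain complex `K`. -/
noncomputable def ofComplex (K : ChainComplex (ModuleCat.{u} k) ℕ) : DGMod k where
  carrier := ⨁ n, K.X n
  deg m :=
    { carrier := {x | ∀ n : ℕ, (n : ℤ) ≠ m → x n = 0}
      zero_mem' := fun _ _ => rfl
      add_mem' := by
        intro x y hx hy n hn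
        rw [DirectSum.add_apply, hx n hn, hy n hn, add_zero]
      smul_mem' := by
        intro c x hx n hn
        rw [DirectSum.smul_apply, hx n hn, smul_zero] }
  internal := by
    refine isInternal_of_proj _ (fun m => if 0 ≤ m then
      DirectSum.lof k ℕ (fun n => K.X n) m.toNat ∘ₗ
        DirectSum.component k ℕ (fun n => K.X n) m.toNat else 0) ?_ ?_ ?_
    · intro m x hx
      refine DFinsupp.ext fun n => ?_
      by_cases hm : 0 ≤ m
      · rw [if_pos hm, LinearMap.comp_apply]
        by_cases hn : n = m.toNat
        · subst hn
          exact DirectSum.lof_apply k _ _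
        · exact (DirectSum.of_eq_of_ne _ _ _ hn).trans (hx n (by omega)).symm
      · rw [if_neg hm]
        exact (hx n (by omega)).symm
    · intro m n hmn x hx
      by_cases hm : 0 ≤ m
      · have h0 : DirectSum.component k ℕ (fun n => K.X n) m.toNat x = 0 := hx _ (by omega)
        rw [if_pos hm, LinearMap.comp_apply, h0, map_zero]
      · rw [if_neg hm, LinearMap.zero_apply]
    · intro x
      induction x using DirectSum.induction_on with
      | zero => exact Submodule.zero_mem _
      | of n y =>
        refine Submodule.mem_iSup_of_mem (n : ℤ) fun i hi => ?_
        exact DirectSum.of_eq_of_ne _ _ _ (by simpa using hi)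
      | add x y hx hy => exact Submodule.add_mem _ hx hy
  d := complexD K
  d_deg := by
    intro m x hx n hn
    rw [complexD_apply, hx (n + 1) (by push_cast; omega), map_zero]
  d_sq := by
    intro x
    refine DFinsupp.ext fun n => ?_
    rw [complexD_apply, complexD_apply]
    have := congrArg (fun f => f.hom (x (n + 1 + 1))) (K.d_comp_d (n + 1 + 1) (n + 1) n)
    exact this

variable {k} in
/-- The total map of a morphism of chain complexes. -/
noncomputable def complexMap {K L : ChainComplex (ModuleCat.{u} k) ℕ} (f : K ⟶ L) :
    (⨁ n, K.X n) →ₗ[k] ⨁ n, L.X n := DirectSum.lmap fun n => (f.f n).hom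

variable {k} in
theorem complexMap_apply {K L : ChainComplex (ModuleCat.{u} k) ℕ} (f : K ⟶ L) (x : ⨁ n, K.X n)
    (n : ℕ) : complexMap f x n = (f.f n).hom (x n) := rfl

variable {k} in
theorem complexD_complexMap {K L : ChainComplex (ModuleCat.{u} k) ℕ} (f : K ⟶ L)
    (x : ⨁ n, K.X n) : complexD L (complexMap f x) = complexMap f (complexD K x) := by
  refine DFinsupp.ext fun n => ?_
  rw [complexD_apply, complexMap_apply, complexMap_apply, complexD_apply]
  exact congrArg (fun g => g.hom (x (n + 1))) (f.comm (n + 1) n)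

variable {k} in
theorem complexMap_id (K : ChainComplex (ModuleCat.{u} k) ℕ) :
    complexMap (𝟙 K) = LinearMap.id :=
  LinearMap.ext fun x => DFinsupp.ext fun n => by rw [complexMap_apply]; rfl

variable {k} in
theorem complexMap_comp {K L M : ChainComplex (ModuleCat.{u} k) ℕ} (f : K ⟶ L) (g : L ⟶ M) :
    complexMap (f ≫ g) = complexMap g ∘ₗ complexMap f :=
  LinearMap.ext fun x => DFinsupp.ext fun n => by
    rw [LinearMap.comp_apply, complexMap_apply, complexMap_apply, complexMap_apply]; rfl

/-- The normalized chains `C_•(X; k)`. -/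
noncomputable def chains (X : SSet.{u}) : DGMod k :=
  ofComplex k (X.normalizedChainComplex (ModuleCat.of k k))

/-- The class in `C_n(X; k)` of an `n`-simplex of `X`; it is zero if the simplex is degenerate. -/
noncomputable def simplexChain {X : SSet.{u}} {n : ℕ} (σ : X _⦋n⦌) : chains k X :=
  DirectSum.lof k ℕ (fun n => (X.normalizedChainComplex (ModuleCat.of k k)).X n) n
    ((X.ιNormalizedChainComplex (R := ModuleCat.of k k) σ).hom (1 : k))

/-- The linear map induced on chains by a map of simplicial sets. -/
noncomputable def chainsMap {X Y : SSet.{u}} (f : X ⟶ Y) : chains k X →ₗ[k] chains k Y :=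
  complexMap (SSet.normalizedChainComplexMap f (ModuleCat.of k k))

variable {k} in
theorem chainsMap_mem {X Y : SSet.{u}} (f : X ⟶ Y) {m : ℤ} {x : chains k X}
    (hx : x ∈ (chains k X).deg m) : chainsMap k f x ∈ (chains k Y).deg m := fun n hn =>
  (congrArg ((SSet.normalizedChainComplexMap f (ModuleCat.of k k)).f n).hom (hx n hn)).trans
    (map_zero _)

variable {k} in
theorem chainsMap_d {X Y : SSet.{u}} (f : X ⟶ Y) (x : chains k X) :
    (chains k Y).d (chainsMap k f x) = chainsMap k f ((chains k X).d x) :=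
  complexD_complexMap _ x

theorem chainsMap_id (X : SSet.{u}) : chainsMap k (𝟙 X) = LinearMap.id :=
  (congrArg complexMap
    ((SSet.normalizedChainComplexFunctorObj (ModuleCat.of k k)).map_id X)).trans (complexMap_id _)

theorem chainsMap_comp {X Y Z : SSet.{u}} (f : X ⟶ Y) (g : Y ⟶ Z) :
    chainsMap k (f ≫ g) = chainsMap k g ∘ₗ chainsMap k f :=
  (congrArg complexMap
    ((SSet.normalizedChainComplexFunctorObj (ModuleCat.of k k)).map_comp f g)).trans
    (complexMap_comp _ _)

variable {k} in
/-- The cochain `γ` is the cup product `α ∪ β`: on an `n`-simplex `σ` it takes the value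
`∑_{i + j = n} α(front i-face of σ) * β(back j-face of σ)`. -/
def IsCup {X : SSet.{u}} (α β γ : (chains k X).gradedDual) : Prop :=
  ∀ (n : ℕ) (σ : X _⦋n⦌), γ.1 (simplexChain k σ) = ∑ i : Fin (n + 1),
    α.1 (simplexChain k (X.map (SimplexCategory.subinterval 0 i.1 (by omega)).op σ)) *
    β.1 (simplexChain k (X.map (SimplexCategory.subinterval i.1 (n - i.1) (by omega)).op σ))

variable {G : Type u} [Group G]

/-- The action of `G` is free. -/
def IsFreeAction (X : Action SSet.{u} G) : Prop :=
  ∀ (n : SimplexCategoryᵒᵖ) (x : X.V.obj n) (g : G), (X.ρ g).app n x = x → g = 1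

/-- The quotient simplicial set `X / G`. -/
def orbits (X : Action SSet.{u} G) : SSet.{u} where
  obj n := Quot fun x y : X.V.obj n => ∃ g : G, y = (X.ρ g).app n x
  map f := TypeCat.ofHom (Quot.map (X.V.map f) (by
    rintro x _ ⟨g, rfl⟩
    exact ⟨g, (NatTrans.naturality_apply (X.ρ g) f x).symm⟩))
  map_id n := by
    ext x
    induction x using Quot.ind with
    | mk x => exact congrArg (Quot.mk _) (X.V.map_id_apply _ x)
  map_comp f g := by
    ext x
    induction x using Quot.ind with
    | mk x => exact congrArg (Quot.mk _) (X.V.map_comp_apply f g x)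

variable (G) in
/-- The universal `G`-space `EG`, the simplicial set with `n`-simplices `G^{n+1}` on which `G`
acts diagonally. -/
noncomputable def universalSpace : Action SSet.{u} G where
  V := classifyingSpaceUniversalCover G ⋙ Action.forget (Type u) G
  ρ :=
    { toFun := fun g =>
        { app := fun n => ((classifyingSpaceUniversalCover G).obj n).ρ g
          naturality := fun _ _ f => ((classifyingSpaceUniversalCover G).map f).comm g |>.symm }
      map_one' := NatTrans.ext (funext fun n =>
        ((classifyingSpaceUniversalCover G).obj n).ρ.map_one)
      map_mul' := fun g h => NatTrans.ext (funext fun n =>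
        ((classifyingSpaceUniversalCover G).obj n).ρ.map_mul g h) }

variable (G) in
/-- The classifying space `BG = EG / G`. -/
noncomputable def classifyingSpace : SSet.{u} := orbits (universalSpace G)

/-- The Borel construction `EG ×_G X = (EG × X) / G`. -/
noncomputable def borelConstruction (X : Action SSet.{u} G) : SSet.{u} := orbits (universalSpace G ⊗ X)

/-- The representation of `G` on the chains of a simplicial set with `G`-action. -/
noncomputable def chainsRep (X : Action SSet.{u} G) : G →* Module.End k (chains k X.V) where
  toFun g := chainsMap k (X.ρ g : X.V ⟶ X.V)
  map_one' := by
    rw [map_one]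
    exact chainsMap_id k X.V
  map_mul' g h := by
    rw [map_mul]
    exact chainsMap_comp k (X.ρ h : X.V ⟶ X.V) (X.ρ g : X.V ⟶ X.V)

/-- The operator `1 + g_i` on the chains of `X`. -/
noncomputable def tOp (X : Action SSet.{u} G) (g : G) : Module.End k (chains k X.V) :=
  1 + chainsRep k X g

theorem tOp_sq [CharP k 2] (hG : ∀ x : G, x * x = 1) (X : Action SSet.{u} G) {r : ℕ}
    (g : Fin r → G) (v : Fin r → k) :
    (∑ i, v i • tOp k X (g i)) * (∑ i, v i • tOp k X (g i)) = 0 := by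
  have h2 : ∀ f : Module.End k (chains k X.V), f + f = 0 := by
    intro f
    rw [← two_smul k f, CharTwo.two_eq_zero, zero_smul]
  have hcomm : ∀ x y : G, x * y = y * x := by
    intro x y
    have hinv : ∀ z : G, z⁻¹ = z := fun z => inv_eq_of_mul_eq_one_left (hG z)
    rw [← hinv (x * y), mul_inv_rev, hinv, hinv]
  have hc : ∀ x y : G, tOp k X x * tOp k X y = tOp k X y * tOp k X x := by
    intro x y
    simp only [tOp, add_mul, mul_add, one_mul, mul_one, ← map_mul, hcomm x y]
    abel
  have hs : ∀ x : G, tOp k X x * tOp k X x = 0 := by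
    intro x
    simp only [tOp, add_mul, mul_add, one_mul, mul_one, ← map_mul, hG x, map_one]
    rw [add_comm (chainsRep k X x) 1]
    exact h2 _
  rw [Finset.sum_mul_sum, ← Finset.sum_product']
  refine Finset.sum_involution (fun ij _ => ij.swap) ?_ ?_ (fun _ _ => by simp) (fun _ _ => rfl)
  · rintro ⟨i, j⟩ _
    simp only [Prod.swap_prod_mk, smul_mul_smul_comm]
    rw [hc (g j) (g i), mul_comm (v j)]
    exact h2 _
  · rintro ⟨i, j⟩ _ hne heq
    simp only [Prod.swap_prod_mk, Prod.mk.injEq] at heq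
    rw [heq.1] at hne
    exact hne (by simp [hs])

/-- The action of the exterior algebra on the chains of `X`, where `t_i` acts as `1 + g_i`. -/
noncomputable def chainsAct [CharP k 2] (hG : ∀ x : G, x * x = 1) (X : Action SSet.{u} G) {r : ℕ}
    (g : Fin r → G) : ExteriorAlgebra k (Fin r → k) →ₐ[k] Module.End k (chains k X.V) :=
  ExteriorAlgebra.lift k ⟨Fintype.linearCombination k fun i => tOp k X (g i), fun v => by
    rw [Fintype.linearCombination_apply]
    exact tOp_sq k hG X g v⟩

theorem chainsAct_spec [CharP k 2] (hG : ∀ x : G, x * x = 1) (X : Action SSet.{u} G) {r : ℕ}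
    (g : Fin r → G) (a : ExteriorAlgebra k (Fin r → k)) :
    (∀ n, ∀ x ∈ (chains k X.V).deg n, chainsAct k hG X g a x ∈ (chains k X.V).deg n) ∧
    ∀ x, (chains k X.V).d (chainsAct k hG X g a x) =
      chainsAct k hG X g a ((chains k X.V).d x) := by
  induction a using ExteriorAlgebra.induction with
  | algebraMap c =>
    rw [AlgHom.commutes]
    refine ⟨fun n x hx => ?_, fun x => ?_⟩
    · rw [Module.algebraMap_end_apply]
      exact Submodule.smul_mem _ _ hx
    · rw [Module.algebraMap_end_apply, Module.algebraMap_end_apply, map_smul]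
  | ι v =>
    have h : chainsAct k hG X g (ExteriorAlgebra.ι k v) = ∑ i, v i • tOp k X (g i) := by
      rw [chainsAct, ExteriorAlgebra.lift_ι_apply, Fintype.linearCombination_apply]
    rw [h]
    refine ⟨fun n x hx => ?_, fun x => ?_⟩
    · rw [LinearMap.sum_apply]
      exact Submodule.sum_mem _ fun i _ => Submodule.smul_mem _ _
        (Submodule.add_mem _ hx (chainsMap_mem _ hx))
    · rw [LinearMap.sum_apply, LinearMap.sum_apply, map_sum]
      refine Finset.sum_congr rfl fun i _ => ?_
      rw [LinearMap.smul_apply, LinearMap.smul_apply, map_smul]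
      refine congrArg (v i • ·) ?_
      refine (map_add (chains k X.V).d _ _).trans ?_
      exact congrArg ((chains k X.V).d x + ·) (chainsMap_d _ x)
  | mul a b ha hb =>
    rw [map_mul]
    exact ⟨fun n x hx => ha.1 n _ (hb.1 n x hx), fun x => (ha.2 _).trans
      (congrArg (chainsAct k hG X g a) (hb.2 x))⟩
  | add a b ha hb =>
    rw [map_add]
    refine ⟨fun n x hx => Submodule.add_mem _ (ha.1 n x hx) (hb.1 n x hx), fun x => ?_⟩
    rw [LinearMap.add_apply, LinearMap.add_apply, map_add, ha.2, hb.2]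

/-- `C_•(X; k)` as a dg `Λ`-module. -/
noncomputable def chainsMod [CharP k 2] (hG : ∀ x : G, x * x = 1) (X : Action SSet.{u} G) {r : ℕ}
    (g : Fin r → G) : DGAlgMod (extAlg k r) where
  toDGMod := chains k X.V
  action :=
    { act := chainsAct k hG X g
      act_deg := by
        intro m n a ha x hx
        by_cases hm : m = 0
        · subst hm
          rw [zero_add]
          exact (chainsAct_spec k hG X g a).1 n x hx
        · have h : a ∈ concentratedDeg k (ExteriorAlgebra k (Fin r → k)) m := ha
          have h := eq_zero_of_mem_concentratedDeg
            (V := ExteriorAlgebra k (Fin r → k)) hm h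
          subst h
          have h0 : chainsAct k hG X g 0 x = 0 := by rw [map_zero]; rfl
          exact h0.symm ▸ Submodule.zero_mem _
      act_d := by
        intro a x
        have h0 : chainsAct k hG X g 0 x = 0 := by rw [map_zero]; rfl
        exact ((chainsAct_spec k hG X g a).2 x).trans ((zero_add _).symm.trans
          (congrArg (· + chainsAct k hG X g a ((chains k X.V).d x)) h0.symm)) }

theorem chainsMod_tgen [CharP k 2] (hG : ∀ x : G, x * x = 1) (X : Action SSet.{u} G) {r : ℕ}
    (g : Fin r → G) (i : Fin r) (x : chains k X.V) :
    (chainsMod k hG X g).act (tgen k r i) x = x + chainsRep k X (g i) x := by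
  have h : chainsAct k hG X g (tgen k r i) = tOp k X (g i) := by
    rw [chainsAct, tgen, ExteriorAlgebra.lift_ι_apply, Fintype.linearCombination_apply_single,
      one_smul]
  exact congrArg (fun f => f x) h

end Simplicial

end HirschBrown

open HirschBrown

/-! The theorem combines homotopy transfer over a field with one Koszul computation. Characteristic
two removes all signs.

Homotopy transfer. Over a field a complex M retracts onto its homology: there are maps incl and proj
and a homotopy hom between incl ∘ proj and the identity (`DGMod.Contraction`). Write φ_a for the
action of φ(x^(a)) on M and ⋆ for convolution over b + c = a. The equations f = incl + hom(φ ⋆ f)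
and μ = proj(φ ⋆ f) can be solved by recursion on |a|, because φ_0 = 0. Induction on |a| gives d(φ ⋆
f) = (φ ⋆ f) ⋆ μ and d f = φ ⋆ f + f ⋆ μ (`d_transferObs`, `d_transferMap`). Applying proj to the
former yields μ ⋆ μ = 0, so μ is an Ω S_c-structure on H(M); the latter says that f is an
∞-morphism. Its linear part is incl.

From ∞-morphisms to strict maps. An ∞-morphism is a comodule map between bar constructions.
Filtering S_c ⊗ M by the degree in S_c shows that such a map is a quasi-isomorphism as soon as its
linear part is (`bar_isQuasiIso`). An ∞-morphism V ⇝ W is also a strict map to W from the resolution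
Ω S_c ⊗ S_c ⊗ V of V, which gives the zigzag of modules (`InfMorphism.zigzag`). That this is a
resolution follows from Fox calculus in the free algebra Ω S_c (`exists_rectD_eq`).

The Borel construction. Let Y be a simplicial G-set with equivariant maps Y_n → G, not necessarily
simplicial. Coordinates on G dual to the g_i give operators s_i on C(Y) with t_i s_i + s_i t_i = 1.
The homotopies x^(a) ⊗ σ ↦ x^(a + e_i) ⊗ s_i σ then contract the kernel of B_κ C(Y) → C(Y/G), up to
terms of lower degree in C(Y), so this map is a quasi-isomorphism (`barOrbit_isQuasiIso`). For Y =
EG × X there is the span B_κ C(X) ← B_κ C(EG × X) → C(EG ×_G X). Over a field such a span gives a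
chain homotopy equivalence.

The cohomology of BG. For Y = EG, the augmentation C(EG) → k gives quasi-isomorphisms S = (B_κ k)^*
→ (B_κ C(EG))^* ← C(BG)^*. Cochains of BG multiply the middle term from the right by the cup
product, and S acts on it. If α and β represent p and q, the pullback of α ∪ β is homologous to p
times the pullback of β, hence to the image of pq (`exists_cup_represents`).

The model. As X is finite, the pairing identifies S ⊗ H^•(X) with the graded dual of S_c ⊗ H(C), and
δ is the transpose of the bar differential. It is minimal because the bar differential vanishes on
x^(0) ⊗ z: the differential of H(C) is zero and ι(x^(0)) = 0. -/

namespace HirschBrown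

/-! ### Signs in characteristic two -/

section CharTwo

variable (k : Type u) [Field k] [CharP k 2] {V : Type*} [AddCommGroup V] [Module k V]

include k in
theorem add_self_eq_zero_of_charTwo (x : V) : x + x = 0 := by
  rw [← two_smul k, CharTwo.two_eq_zero, zero_smul]

include k in
theorem neg_eq_of_charTwo (x : V) : -x = x :=
  neg_eq_of_add_eq_zero_left (add_self_eq_zero_of_charTwo k x)

include k in
theorem sub_eq_add_of_charTwo (x y : V) : x - y = x + y := by
  rw [sub_eq_add_neg, neg_eq_of_charTwo k]

include k in
theorem eq_of_add_eq_zero_of_charTwo {x y : V} (h : x + y = 0) : x = y := by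
  rw [eq_neg_of_add_eq_zero_left h, neg_eq_of_charTwo k]

end CharTwo

/-! ### Homogeneous components of linear maps -/

section Homogeneous

variable {k V W : Type u} [Field k] [AddCommGroup V] [Module k V] [AddCommGroup W] [Module k W]

theorem hom_ext_of_isInternal {V' : Type*} [AddCommGroup V'] [Module k V']
    {𝒱 : ℤ → Submodule k V} (hV : DirectSum.IsInternal 𝒱)
    {f g : V →ₗ[k] V'} (h : ∀ n, ∀ x ∈ 𝒱 n, f x = g x) : f = g :=
  LinearMap.ext fun x => homog_induction hV (P := fun x => f x = g x) x h
    fun y z hy hz => by rw [map_add, map_add, hy, hz]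

/-- The component of degree `e` of a linear map between graded vector spaces. -/
noncomputable def homogComp {𝒱 : ℤ → Submodule k V} {𝒲 : ℤ → Submodule k W}
    (hV : DirectSum.IsInternal 𝒱) (hW : DirectSum.IsInternal 𝒲) (e : ℤ) (φ : V →ₗ[k] W) :
    V →ₗ[k] W :=
  DirectSum.toModule k ℤ W (fun n => gproj hW (n + e) ∘ₗ φ ∘ₗ (𝒱 n).subtype) ∘ₗ
    (gequiv hV).symm.toLinearMap

theorem homogComp_apply {𝒱 : ℤ → Submodule k V} {𝒲 : ℤ → Submodule k W}
    (hV : DirectSum.IsInternal 𝒱) (hW : DirectSum.IsInternal 𝒲) (e : ℤ) (φ : V →ₗ[k] W)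
    {n : ℤ} {x : V} (hx : x ∈ 𝒱 n) : homogComp hV hW e φ x = gproj hW (n + e) (φ x) := by
  simp [homogComp, symm_of_mem hV hx, DirectSum.toModule_lof]

theorem gproj_comm {𝒱 : ℤ → Submodule k V} {𝒲 : ℤ → Submodule k W}
    (hV : DirectSum.IsInternal 𝒱) (hW : DirectSum.IsInternal 𝒲) {e : ℤ} {f : V →ₗ[k] W}
    (hf : ∀ n, ∀ x ∈ 𝒱 n, f x ∈ 𝒲 (n + e)) (n : ℤ) (x : V) :
    gproj hW (n + e) (f x) = f (gproj hV n x) := by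
  refine homog_induction hV (P := fun x => gproj hW (n + e) (f x) = f (gproj hV n x)) x ?_ ?_
  · intro m y hy
    by_cases h : n = m
    · subst h
      rw [gproj_self hV hy, gproj_self hW (hf _ _ hy)]
    · rw [gproj_ne hV h hy, gproj_ne hW (n := m + e) (by omega) (hf _ _ hy), map_zero]
  · intro y z hy hz; simp only [map_add, hy, hz]

theorem mem_of_gproj_eq {𝒱 : ℤ → Submodule k V} (hV : DirectSum.IsInternal 𝒱) {n : ℤ} {x : V}
    (h : gproj hV n x = x) : x ∈ 𝒱 n := h ▸ gproj_mem hV n x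

/-- An injective map of degree zero reflects degrees. -/
theorem mem_of_map_mem {𝒱 : ℤ → Submodule k V} {𝒲 : ℤ → Submodule k W}
    (hV : DirectSum.IsInternal 𝒱) (hW : DirectSum.IsInternal 𝒲) {f : V →ₗ[k] W}
    (hf : ∀ n, ∀ x ∈ 𝒱 n, f x ∈ 𝒲 n) (hinj : Function.Injective f) {n : ℤ} {x : V}
    (hx : f x ∈ 𝒲 n) : x ∈ 𝒱 n := by
  refine mem_of_gproj_eq hV (hinj ?_)
  have := gproj_comm hV hW (e := 0) (f := f) (by simpa using hf) n x
  rw [add_zero] at this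
  rw [← this, gproj_self hW hx]

end Homogeneous

/-! ### Contractions onto homology, quasi-isomorphisms and duality over a field -/

namespace DGMod

variable {k : Type u} [Field k]

/-- A graded generalized inverse of the differential. -/
structure Contraction (V : DGMod k) where
  h : V →ₗ[k] V
  h_deg : ∀ n, ∀ x ∈ V.deg n, h x ∈ V.deg (n + 1)
  dhd : ∀ x, V.d (h (V.d x)) = V.d x

/-- Over a field the image of d splits off: a section of d composed with a projection onto the image
satisfies dhd = d. These choices need not respect the grading. The component of degree one does, and
it still satisfies dhd = d because d is homogeneous. -/
theorem exists_contraction (V : DGMod k) : Nonempty V.Contraction := by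
  obtain ⟨g, hg⟩ := V.d.rangeRestrict.exists_rightInverse_of_surjective V.d.range_rangeRestrict
  obtain ⟨π, hπ⟩ := (LinearMap.range V.d).subtype.exists_leftInverse_of_injective
    (Submodule.ker_subtype _)
  let h0 : V →ₗ[k] V := g ∘ₗ π
  have h0d : ∀ x, V.d (h0 (V.d x)) = V.d x := by
    intro x
    have h1 : π (V.d x) = V.d.rangeRestrict x := LinearMap.congr_fun hπ (V.d.rangeRestrict x)
    have h2 := congrArg Subtype.val (LinearMap.congr_fun hg (V.d.rangeRestrict x))
    simpa [h0, h1] using h2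
  refine ⟨⟨homogComp V.internal V.internal 1 h0, ?_, ?_⟩⟩
  · intro n x hx
    rw [homogComp_apply _ _ _ _ hx]
    exact gproj_mem _ _ _
  · intro x
    refine LinearMap.congr_fun (f := V.d ∘ₗ homogComp V.internal V.internal 1 h0 ∘ₗ V.d)
      (hom_ext_of_isInternal V.internal ?_) x
    intro n x hx
    have hdx := V.d_deg n x hx
    rw [LinearMap.comp_apply, LinearMap.comp_apply, homogComp_apply _ _ _ _ hdx, d_gproj, h0d,
      sub_add_cancel, gproj_self _ hdx]

/-- The cycle given by an element with zero differential. -/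
def cyc (V : DGMod k) (x : V) (hx : V.d x = 0) : V.cycles := ⟨x, LinearMap.mem_ker.2 hx⟩

theorem d_cycle {V : DGMod k} (z : V.cycles) : V.d z.1 = 0 := LinearMap.mem_ker.1 z.2

/-- The homology class of a cycle, as an element of the dg module `H(V)`. -/
noncomputable def hcls (V : DGMod k) : V.cycles →ₗ[k] V.homology := V.cls

theorem exists_hcls {V : DGMod k} (x : V.homology) : ∃ z : V.cycles, V.hcls z = x :=
  V.boundaries.mkQ_surjective x

theorem hcls_eq_zero_iff {V : DGMod k} (x : V.cycles) : V.hcls x = 0 ↔ ∃ w, x.1 = V.d w := by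
  refine (Submodule.Quotient.mk_eq_zero _).trans ⟨?_, ?_⟩
  · rintro ⟨w, hw⟩; exact ⟨w, hw.symm⟩
  · rintro ⟨w, hw⟩; exact ⟨w, hw.symm⟩

theorem hcls_eq_iff {V : DGMod k} (x y : V.cycles) :
    V.hcls x = V.hcls y ↔ ∃ w, x.1 - y.1 = V.d w := by
  rw [← sub_eq_zero, ← map_sub, hcls_eq_zero_iff]; rfl

namespace Contraction

variable {V : DGMod k} (c : V.Contraction)

/-- The projector `1 - dh - hd`, up to homotopy the identity, with values in the cycles. -/
noncomputable def e : V →ₗ[k] V := LinearMap.id - V.d ∘ₗ c.h - c.h ∘ₗ V.d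

theorem e_apply (x : V) : c.e x = x - V.d (c.h x) - c.h (V.d x) := rfl

theorem d_e (x : V) : V.d (c.e x) = 0 := by
  rw [e_apply, map_sub, map_sub, V.d_sq, c.dhd]; simp

theorem e_d (x : V) : c.e (V.d x) = 0 := by
  rw [e_apply, V.d_sq, c.dhd]; simp

theorem e_deg {n : ℤ} {x : V} (hx : x ∈ V.deg n) : c.e x ∈ V.deg n := by
  refine Submodule.sub_mem _ (Submodule.sub_mem _ hx ?_) ?_
  · simpa using V.d_deg _ _ (c.h_deg _ _ hx)
  · simpa using c.h_deg _ _ (V.d_deg _ _ hx)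

/-- The projection onto the homology. -/
noncomputable def proj : V →ₗ[k] V.homology :=
  V.hcls ∘ₗ c.e.codRestrict V.cycles c.d_e

theorem proj_apply (x : V) : c.proj x = V.hcls (V.cyc (c.e x) (c.d_e x)) := rfl

theorem proj_d (x : V) : c.proj (V.d x) = 0 := by
  rw [proj_apply, hcls_eq_zero_iff]
  exact ⟨0, (c.e_d x).trans (map_zero _).symm⟩

/-- On a cycle z, e differs from the identity only by the boundary d h z. -/
theorem proj_cycle (z : V.cycles) : c.proj z.1 = V.hcls z := by
  rw [proj_apply, hcls_eq_iff]
  refine ⟨-c.h z.1, ?_⟩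
  simp [cyc, e_apply]

theorem proj_deg {n : ℤ} {x : V} (hx : x ∈ V.deg n) : c.proj x ∈ V.homology.deg n :=
  ⟨⟨c.e x, c.d_e x⟩, c.e_deg hx, rfl⟩

/-- The inclusion of the homology, choosing a cycle in each class. -/
noncomputable def incl : V.homology →ₗ[k] V :=
  V.boundaries.liftQ (c.e ∘ₗ V.cycles.subtype) (by
    rintro ⟨x, hx⟩ ⟨y, rfl⟩
    exact c.e_d y)

theorem incl_hcls (z : V.cycles) : c.incl (V.hcls z) = c.e z.1 := rfl

theorem d_incl (x : V.homology) : V.d (c.incl x) = 0 := by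
  obtain ⟨z, rfl⟩ := exists_hcls x
  exact c.d_e _

theorem incl_deg {n : ℤ} {x : V.homology} (hx : x ∈ V.homology.deg n) :
    c.incl x ∈ V.deg n := by
  obtain ⟨z, hz, rfl⟩ := hx
  exact c.e_deg hz

theorem proj_incl (x : V.homology) : c.proj (c.incl x) = x := by
  obtain ⟨z, rfl⟩ := exists_hcls x
  rw [incl_hcls, e_apply, map_sub, map_sub, c.proj_d, c.proj_cycle, d_cycle, map_zero, map_zero,
    sub_zero, sub_zero]

theorem hcls_incl (x : V.homology) : V.hcls (V.cyc (c.incl x) (c.d_incl x)) = x := by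
  rw [← c.proj_cycle]; exact c.proj_incl x

/-- The homotopy between `incl ∘ proj` and the identity. -/
noncomputable def hom : V →ₗ[k] V := c.h + c.h ∘ₗ c.e

theorem hom_deg (n : ℤ) (x : V) (hx : x ∈ V.deg n) : c.hom x ∈ V.deg (n + 1) :=
  Submodule.add_mem _ (c.h_deg _ _ hx) (c.h_deg _ _ (c.e_deg hx))

theorem sub_incl_proj (x : V) :
    x - c.incl (c.proj x) = V.d (c.hom x) + c.hom (V.d x) := by
  -- The condition h² = 0 is not imposed, so e need not be idempotent and incl ∘ proj is e². The
  -- summand h e of `hom` accounts for e - e² = d h e.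
  have h1 : c.incl (c.proj x) = c.e (c.e x) := rfl
  have h2 : c.e (c.e x) = c.e x - V.d (c.h (c.e x)) - c.h (V.d (c.e x)) := rfl
  rw [h1, h2, c.d_e, hom, LinearMap.add_apply, LinearMap.add_apply, LinearMap.comp_apply,
    LinearMap.comp_apply, c.e_d, c.e_apply x, map_add]
  simp only [map_zero]
  abel

/-- A functional that vanishes on cycles is a coboundary. -/
theorem comp_hom_d {M : Type*} [AddCommGroup M] [Module k M] (φ : V →ₗ[k] M)
    (h : ∀ x, V.d x = 0 → φ x = 0) (x : V) :
    φ (c.hom (V.d x)) = φ x := by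
  have h1 := congrArg φ (c.sub_incl_proj x)
  rw [map_sub, map_add, h _ (c.d_incl _), h _ (V.d_sq _)] at h1
  simpa using h1.symm

end Contraction

variable {V W : DGMod k}

theorem Hom.mapHomology_hcls (f : Hom V W) (z : V.cycles) :
    f.mapHomology (V.hcls z) = W.hcls ⟨f.toLin z.1, f.map_cycles z.1 z.2⟩ := rfl

/-- Bijectivity in homology, unfolded to representatives so that it can be checked without
quotients. -/
theorem Hom.isQuasiIso_iff (f : Hom V W) : f.IsQuasiIso ↔
    (∀ x, V.d x = 0 → ∀ w, f.toLin x = W.d w → ∃ y, x = V.d y) ∧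
      ∀ w, W.d w = 0 → ∃ x, V.d x = 0 ∧ ∃ u, w = f.toLin x + W.d u := by
  constructor
  · rintro ⟨hi, hs⟩
    refine ⟨fun x hx w hw => ?_, fun w hw => ?_⟩
    · refine (hcls_eq_zero_iff (V.cyc x hx)).1 ?_
      apply hi
      rw [map_zero, f.mapHomology_hcls, hcls_eq_zero_iff]
      exact ⟨w, hw⟩
    · obtain ⟨q, hq⟩ := hs (W.hcls (W.cyc w hw))
      obtain ⟨z, rfl⟩ := exists_hcls q
      rw [f.mapHomology_hcls, eq_comm, hcls_eq_iff] at hq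
      obtain ⟨u, hu⟩ := hq
      exact ⟨z.1, d_cycle z, u, by rw [← hu]; simp [cyc]⟩
  · rintro ⟨h1, h2⟩
    constructor
    · rw [injective_iff_map_eq_zero]
      intro q hq
      obtain ⟨z, rfl⟩ := exists_hcls q
      rw [f.mapHomology_hcls, hcls_eq_zero_iff] at hq
      obtain ⟨w, hw⟩ := hq
      exact (hcls_eq_zero_iff z).2 (h1 z.1 (d_cycle z) w hw)
    · intro q
      obtain ⟨z, rfl⟩ := exists_hcls q
      obtain ⟨x, hx, u, hu⟩ := h2 z.1 (d_cycle z)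
      refine ⟨V.hcls (V.cyc x hx), ?_⟩
      rw [f.mapHomology_hcls, eq_comm, hcls_eq_iff]
      exact ⟨u, by simp [hu, cyc]⟩

/-- A surjective chain map with acyclic kernel is a quasi-isomorphism. -/
theorem Hom.isQuasiIso_of_ker (f : Hom V W) (hs : Function.Surjective f.toLin)
    (hk : ∀ x, f.toLin x = 0 → V.d x = 0 → ∃ y, f.toLin y = 0 ∧ x = V.d y) : f.IsQuasiIso := by
  rw [f.isQuasiIso_iff]
  refine ⟨fun x hx w hw => ?_, fun w hw => ?_⟩
  · obtain ⟨x', rfl⟩ := hs w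
    -- If f x = d w and w = f x', then x - d x' is a cycle in the kernel of f.
    obtain ⟨y, -, hy⟩ := hk (x - V.d x') (by rw [map_sub, hw, f.comm, sub_self])
      (by rw [map_sub, hx, V.d_sq, sub_self])
    exact ⟨y + x', by rw [map_add, ← hy]; simp⟩
  · obtain ⟨x, rfl⟩ := hs w
    obtain ⟨y, hy, hxy⟩ := hk (V.d x) (by rw [f.comm, hw]) (V.d_sq x)
    exact ⟨x - y, by rw [map_sub, hxy, sub_self], 0, by simp [hy]⟩

theorem Hom.mapHomology_deg (f : Hom V W) {n : ℤ} {x : V.homology} (hx : x ∈ V.homology.deg n) :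
    f.mapHomology x ∈ W.homology.deg n := by
  obtain ⟨z, hz, rfl⟩ := hx
  exact ⟨_, f.map_deg n _ hz, rfl⟩

/-- The composition of morphisms. -/
def Hom.comp {U : DGMod k} (g : Hom V W) (f : Hom U V) : Hom U W where
  toLin := g.toLin ∘ₗ f.toLin
  map_deg n x hx := g.map_deg n _ (f.map_deg n x hx)
  comm x := by rw [LinearMap.comp_apply, LinearMap.comp_apply, f.comm, g.comm]

theorem Hom.mapHomology_comp {U : DGMod k} (g : Hom V W) (f : Hom U V) (x : U.homology) :
    (g.comp f).mapHomology x = g.mapHomology (f.mapHomology x) := by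
  obtain ⟨z, rfl⟩ := exists_hcls x
  rfl

theorem Hom.IsQuasiIso.comp {U : DGMod k} {g : Hom V W} {f : Hom U V} (hg : g.IsQuasiIso)
    (hf : f.IsQuasiIso) : (g.comp f).IsQuasiIso := by
  have : ⇑(g.comp f).mapHomology = g.mapHomology ∘ f.mapHomology :=
    funext fun x => Hom.mapHomology_comp g f x
  rw [Hom.IsQuasiIso, this]
  exact Function.Bijective.comp hg hf

theorem Hom.IsQuasiIso.of_comp_right {U : DGMod k} {g : Hom V W} {f : Hom U V}
    (hf : f.IsQuasiIso) (hgf : (g.comp f).IsQuasiIso) : g.IsQuasiIso := by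
  have : ⇑(g.comp f).mapHomology = g.mapHomology ∘ f.mapHomology :=
    funext fun x => Hom.mapHomology_comp g f x
  rw [Hom.IsQuasiIso, this] at hgf
  exact (Function.Bijective.of_comp_iff _ hf).1 hgf

theorem Hom.IsQuasiIso.of_comp_left {U : DGMod k} {g : Hom V W} {f : Hom U V}
    (hg : g.IsQuasiIso) (hgf : (g.comp f).IsQuasiIso) : f.IsQuasiIso := by
  have : ⇑(g.comp f).mapHomology = g.mapHomology ∘ f.mapHomology :=
    funext fun x => Hom.mapHomology_comp g f x
  rw [Hom.IsQuasiIso, this] at hgf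
  exact (Function.Bijective.of_comp_iff' hg _).1 hgf

theorem Hom.isQuasiIso_of_bijective (f : Hom V W) (h : Function.Bijective f.toLin) :
    f.IsQuasiIso :=
  f.isQuasiIso_of_ker h.2 fun x hx _ => ⟨0, map_zero _, by
    rw [map_zero]; exact h.1 (hx.trans (map_zero _).symm)⟩

/-- Graded vector spaces with isomorphic homology are homotopy equivalent. -/
theorem homotopyEquivalent_of_homology (e : V.homology ≃ₗ[k] W.homology)
    (he : ∀ n, ∀ x ∈ V.homology.deg n, e x ∈ W.homology.deg n) : HomotopyEquivalent V W := by
  obtain ⟨c⟩ := V.exists_contraction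
  obtain ⟨c'⟩ := W.exists_contraction
  have he' : ∀ n, ∀ x ∈ W.homology.deg n, e.symm x ∈ V.homology.deg n := fun n x hx =>
    mem_of_map_mem V.homology.internal W.homology.internal (f := e.toLinearMap) he e.injective
      (by simpa using hx)
  -- Both maps factor through homology. Their composites reduce to incl ∘ proj on either side, so
  -- the homotopies of the two contractions serve.
  refine ⟨⟨c'.incl ∘ₗ e.toLinearMap ∘ₗ c.proj, ?_, ?_⟩,
    ⟨c.incl ∘ₗ e.symm.toLinearMap ∘ₗ c'.proj, ?_, ?_⟩, c.hom, c'.hom, c.hom_deg, c'.hom_deg, ?_, ?_⟩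
  · exact fun n x hx => c'.incl_deg (he _ _ (c.proj_deg hx))
  · intro x
    simp [c.proj_d, c'.d_incl]
  · exact fun n x hx => c.incl_deg (he' _ _ (c'.proj_deg hx))
  · intro x
    simp [c'.proj_d, c.d_incl]
  · intro x
    simp [c'.proj_incl, c.sub_incl_proj]
  · intro x
    simp [c.proj_incl, c'.sub_incl_proj]

/-- Quasi-isomorphisms in both directions from a third dg module give a homotopy equivalence. -/
theorem homotopyEquivalent_of_span {U : DGMod k} {f : Hom U V} {g : Hom U W}
    (hf : f.IsQuasiIso) (hg : g.IsQuasiIso) : HomotopyEquivalent V W := by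
  let ef := LinearEquiv.ofBijective f.mapHomology hf
  let eg := LinearEquiv.ofBijective g.mapHomology hg
  refine homotopyEquivalent_of_homology (ef.symm.trans eg) fun n x hx => ?_
  refine g.mapHomology_deg ?_
  refine mem_of_map_mem U.homology.internal V.homology.internal (f := f.mapHomology)
    (fun n x hx => f.mapHomology_deg hx) hf.1 ?_
  have : f.mapHomology (ef.symm x) = x := ef.apply_symm_apply x
  exact this.symm ▸ hx

/-- Precomposition with a homogeneous map preserves the graded dual. -/
theorem comp_mem_gradedDual {φ : Module.Dual k W} (hφ : φ ∈ W.gradedDual) {f : V →ₗ[k] W} (e : ℤ)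
    (hf : ∀ n, ∀ x ∈ V.deg n, f x ∈ W.deg (n + e)) : φ ∘ₗ f ∈ V.gradedDual := by
  obtain ⟨s, hs⟩ := hφ
  refine ⟨s.image (· - e), fun n hn x hx => hs (n + e) (fun h => hn ?_) _ (hf n x hx)⟩
  exact Finset.mem_image.2 ⟨n + e, h, by simp⟩

theorem dual_d_apply (φ : V.dual) (x : V) : (V.dual.d φ).1 x = φ.1 (V.d x) := rfl

theorem dual_ext {φ ψ : V.dual} (h : ∀ x, φ.1 x = ψ.1 x) : φ = ψ :=
  Subtype.ext (LinearMap.ext h)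

theorem dual_d_eq_zero_iff (φ : V.dual) : V.dual.d φ = 0 ↔ ∀ x, φ.1 (V.d x) = 0 :=
  ⟨fun h x => LinearMap.congr_fun (congrArg Subtype.val h) x, fun h => dual_ext h⟩

/-- A cochain that vanishes on all cycles is a coboundary. -/
theorem exists_dual_d_eq (φ : V.dual) (h : ∀ x, V.d x = 0 → φ.1 x = 0) :
    ∃ ψ : V.dual, φ = V.dual.d ψ := by
  obtain ⟨c⟩ := V.exists_contraction
  exact ⟨⟨φ.1 ∘ₗ c.hom, comp_mem_gradedDual φ.2 1 c.hom_deg⟩, dual_ext fun x =>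
    (c.comp_hom_d φ.1 h x).symm⟩

/-- The transpose of a morphism. -/
def Hom.dual (f : Hom V W) : Hom W.dual V.dual where
  toLin :=
    { toFun := fun φ => ⟨φ.1 ∘ₗ f.toLin,
        comp_mem_gradedDual φ.2 0 (by simpa using f.map_deg)⟩
      map_add' := fun _ _ => rfl
      map_smul' := fun _ _ => rfl }
  map_deg n φ hφ m hm x hx := hφ m hm _ (f.map_deg m x hx)
  comm φ := dual_ext fun x => congrArg φ.1 (f.comm x).symm

theorem Hom.dual_apply (f : Hom V W) (φ : W.dual) (x : V) :
    (f.dual.toLin φ).1 x = φ.1 (f.toLin x) := rfl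

/-- Over a field, duality is exact. A cochain is a coboundary once it vanishes on cycles. A cocycle
φ of V extends over W through W → H(W) ≅ H(V) → V. All maps involved are homogeneous, as membership
in the graded dual requires. -/
theorem Hom.IsQuasiIso.dual {f : Hom V W} (hf : f.IsQuasiIso) : f.dual.IsQuasiIso := by
  have hf' := (f.isQuasiIso_iff).1 hf
  rw [f.dual.isQuasiIso_iff]
  refine ⟨fun ψ hψ φ hφ => exists_dual_d_eq ψ fun w hw => ?_, fun φ hφ => ?_⟩
  · obtain ⟨x, hx, u, rfl⟩ := hf'.2 w hw
    rw [dual_d_eq_zero_iff] at hψ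
    rw [map_add, hψ, add_zero, ← f.dual_apply, hφ, dual_d_apply, hx, map_zero]
  · obtain ⟨c⟩ := V.exists_contraction
    obtain ⟨c'⟩ := W.exists_contraction
    let ef := LinearEquiv.ofBijective f.mapHomology hf
    rw [dual_d_eq_zero_iff] at hφ
    let g : W →ₗ[k] V := c.incl ∘ₗ ef.symm.toLinearMap ∘ₗ c'.proj
    have hg : ∀ n, ∀ x ∈ W.deg n, g x ∈ V.deg (n + 0) := by
      intro n x hx
      rw [add_zero]
      refine c.incl_deg (mem_of_map_mem V.homology.internal W.homology.internal
        (f := f.mapHomology) (fun n x hx => f.mapHomology_deg hx) hf.1 ?_)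
      have : f.mapHomology (ef.symm (c'.proj x)) = c'.proj x := ef.apply_symm_apply _
      exact this.symm ▸ c'.proj_deg hx
    have hgd : ∀ x, g (W.d x) = 0 := by intro x; simp [g, c'.proj_d]
    let ψ : W.dual := ⟨φ.1 ∘ₗ g, comp_mem_gradedDual φ.2 0 hg⟩
    refine ⟨ψ, (dual_d_eq_zero_iff ψ).2 fun x => ?_, ?_⟩
    · change φ.1 (g (W.d x)) = 0
      rw [hgd, map_zero]
    -- On cycles φ agrees with the pullback of ψ: incl ∘ proj is homotopic to the identity and φ
    -- kills boundaries.
    · obtain ⟨χ, hχ⟩ := exists_dual_d_eq (φ - f.dual.toLin ψ) (fun x hx => by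
        change φ.1 x - φ.1 (g (f.toLin x)) = 0
        have h1 : g (f.toLin x) = c.incl (V.hcls (V.cyc x hx)) := by
          have h2 : c'.proj (f.toLin x) = ef (V.hcls (V.cyc x hx)) :=
            c'.proj_cycle ⟨f.toLin x, f.map_cycles x (LinearMap.mem_ker.2 hx)⟩
          simp only [g, LinearMap.comp_apply, h2, LinearEquiv.coe_coe]
          exact congrArg c.incl (ef.symm_apply_apply _)
        have h3 : V.hcls (V.cyc x hx) = c.proj x := (c.proj_cycle (V.cyc x hx)).symm
        rw [h1, h3, ← map_sub, c.sub_incl_proj, map_add, hφ, hx, map_zero, map_zero, add_zero])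
      exact ⟨χ, by rw [← hχ]; simp⟩

end DGMod

/-! ### Exactness by filtration -/

section Filtration

variable {k V : Type u} [Field k] [AddCommGroup V] [Module k V]

/-- An exact differential on a vector space has a contracting homotopy. -/
theorem exists_contracting_homotopy (d : V →ₗ[k] V) (hd : ∀ x, d (d x) = 0)
    (hex : ∀ x, d x = 0 → ∃ y, x = d y) : ∃ s : V →ₗ[k] V, ∀ x, d (s x) + s (d x) = x := by
  obtain ⟨g, hg⟩ := d.rangeRestrict.exists_rightInverse_of_surjective d.range_rangeRestrict
  have hg' : ∀ y (hy : y ∈ LinearMap.range d), d (g ⟨y, hy⟩) = y := fun y hy =>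
    congrArg Subtype.val (LinearMap.congr_fun hg ⟨y, hy⟩)
  -- The element x - g (d x) is a cycle, hence a boundary; the homotopy applies the section g of d
  -- to it.
  let p : V →ₗ[k] LinearMap.range d := (LinearMap.id - g ∘ₗ d.rangeRestrict).codRestrict _ (by
    intro x
    obtain ⟨y, hy⟩ := hex (x - g (d.rangeRestrict x)) (by
      rw [map_sub, sub_eq_zero]; exact (hg' _ _).symm)
    exact ⟨y, hy.symm⟩)
  refine ⟨g ∘ₗ p, fun x => ?_⟩
  have h1 : d (g (p x)) = x - g (d.rangeRestrict x) := hg' _ (p x).2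
  have h2 : p (d x) = d.rangeRestrict x := by
    apply Subtype.ext
    have : d.rangeRestrict (d x) = 0 := Subtype.ext (hd x)
    simp [p, this]
  rw [LinearMap.comp_apply, LinearMap.comp_apply, h1, h2, sub_add_cancel]

/-- Exactness of a filtered complex, from exactness up to lower filtration. -/
theorem exact_of_filtration (D : V →ₗ[k] V) (hD : ∀ x, D (D x) = 0) (F : ℕ → Submodule k V)
    (h0 : F 0 = ⊥) (hF : ∀ x, ∃ n, x ∈ F n) (K : Submodule k V) (hK : ∀ x ∈ K, D x ∈ K)
    (h : ∀ n, ∀ x ∈ F (n + 1), x ∈ K → D x = 0 → ∃ y ∈ K, x - D y ∈ F n) (x : V) (hx : x ∈ K)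
    (hDx : D x = 0) : ∃ y ∈ K, x = D y := by
  obtain ⟨n, hn⟩ := hF x
  induction n generalizing x with
  | zero =>
    rw [h0, Submodule.mem_bot] at hn
    exact ⟨0, Submodule.zero_mem _, by rw [hn, map_zero]⟩
  | succ n ih =>
    -- Passing from x to x - D y lowers the filtration by one, and the successive corrections add up
    -- to a preimage of x.
    obtain ⟨y, hy, hxy⟩ := h n x hn hx hDx
    obtain ⟨z, hz, hz'⟩ := ih (x - D y) (Submodule.sub_mem _ hx (hK y hy))
      (by rw [map_sub, hDx, hD, sub_zero]) hxy
    exact ⟨z + y, Submodule.add_mem _ hz hy, by rw [map_add, ← hz', sub_add_cancel]⟩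

end Filtration

/-! ### Filtered maps on `S_c ⊗ M` and their symbols -/

section BarFiltration

variable {k : Type u} [Field k] {r : ℕ}

/-- The filtration of `S_c ⊗ M` by the degree in `S_c`. -/
noncomputable def barFil (k : Type u) [Field k] (r : ℕ) (M : Type u) [AddCommGroup M] [Module k M]
    (n : ℕ) : Submodule k (PolyCoalg k r ⊗[k] M) :=
  Submodule.span k {x | ∃ (a : Fin r →₀ ℕ) (m : M), a.degree < n ∧ x = PolyCoalg.mono k a ⊗ₜ m}

variable {M N : Type u} [AddCommGroup M] [Module k M] [AddCommGroup N] [Module k N]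

theorem mono_tmul_mem_barFil {n : ℕ} {a : Fin r →₀ ℕ} (h : a.degree < n) (m : M) :
    PolyCoalg.mono k a ⊗ₜ[k] m ∈ barFil k r M n := Submodule.subset_span ⟨a, m, h, rfl⟩

theorem barFil_zero : barFil k r M 0 = ⊥ := by
  simp [barFil]

theorem barFil_mono {m n : ℕ} (h : m ≤ n) : barFil k r M m ≤ barFil k r M n := by
  refine Submodule.span_mono ?_
  rintro _ ⟨a, m, ha, rfl⟩
  exact ⟨a, m, ha.trans_le h, rfl⟩

theorem barFil_le_iff {n : ℕ} {P : Submodule k (PolyCoalg k r ⊗[k] M)} :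
    barFil k r M n ≤ P ↔ ∀ (a : Fin r →₀ ℕ) (m : M), a.degree < n →
      PolyCoalg.mono k a ⊗ₜ[k] m ∈ P := by
  refine Submodule.span_le.trans ⟨fun h a m ha => h ⟨a, m, ha, rfl⟩, ?_⟩
  rintro h _ ⟨a, m, ha, rfl⟩
  exact h a m ha

@[elab_as_elim]
theorem bar_induction {P : PolyCoalg k r ⊗[k] M → Prop}
    (mono : ∀ (a : Fin r →₀ ℕ) (m : M), P (PolyCoalg.mono k a ⊗ₜ m))
    (add : ∀ x y, P x → P y → P (x + y)) (x : PolyCoalg k r ⊗[k] M) : P x := by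
  induction x with
  | zero => simpa using mono 0 0
  | add x y hx hy => exact add x y hx hy
  | tmul c m =>
    induction (PolyCoalg.basis k).mem_span c using Submodule.span_induction generalizing m with
    | mem x hx => obtain ⟨a, rfl⟩ := hx; exact mono a m
    | zero => simpa using mono 0 0
    | add x y _ _ hx hy => rw [TensorProduct.add_tmul]; exact add _ _ (hx m) (hy m)
    | smul c x _ hx => rw [TensorProduct.smul_tmul]; exact hx (c • m)

theorem exists_mem_barFil (x : PolyCoalg k r ⊗[k] M) : ∃ n, x ∈ barFil k r M n := by
  induction x using bar_induction with
  | mono a m => exact ⟨a.degree + 1, mono_tmul_mem_barFil (by omega) m⟩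
  | add x y hx hy =>
    obtain ⟨m, hm⟩ := hx
    obtain ⟨n, hn⟩ := hy
    exact ⟨max m n, Submodule.add_mem _ (barFil_mono (le_max_left _ _) hm)
      (barFil_mono (le_max_right _ _) hn)⟩

/-- A linear map is filtered with the given associated graded map. -/
def HasSymbol (Ψ : PolyCoalg k r ⊗[k] M →ₗ[k] PolyCoalg k r ⊗[k] N) (f : M →ₗ[k] N) : Prop :=
  ∀ a m, Ψ (PolyCoalg.mono k a ⊗ₜ m) - PolyCoalg.mono k a ⊗ₜ f m ∈ barFil k r N a.degree

theorem HasSymbol.sub_mem {Ψ : PolyCoalg k r ⊗[k] M →ₗ[k] PolyCoalg k r ⊗[k] N} {f : M →ₗ[k] N}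
    (h : HasSymbol Ψ f) {n : ℕ} {x : PolyCoalg k r ⊗[k] M} (hx : x ∈ barFil k r M (n + 1)) :
    Ψ x - LinearMap.lTensor _ f x ∈ barFil k r N n := by
  have : barFil k r M (n + 1) ≤ (barFil k r N n).comap (Ψ - LinearMap.lTensor _ f) := by
    rw [barFil_le_iff]
    intro a m ha
    exact barFil_mono (Nat.lt_succ_iff.1 ha) (h a m)
  exact this hx

theorem lTensor_mem_barFil (f : M →ₗ[k] N) {n : ℕ} {x : PolyCoalg k r ⊗[k] M}
    (hx : x ∈ barFil k r M n) : LinearMap.lTensor _ f x ∈ barFil k r N n := by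
  have : barFil k r M n ≤ (barFil k r N n).comap (LinearMap.lTensor _ f) := by
    rw [barFil_le_iff]
    intro a m ha
    exact mono_tmul_mem_barFil ha _
  exact this hx

/-- A filtered differential with exact symbol is exact. -/
theorem HasSymbol.exact {D : PolyCoalg k r ⊗[k] M →ₗ[k] PolyCoalg k r ⊗[k] M} {d : M →ₗ[k] M}
    (h : HasSymbol D d) (hD : ∀ x, D (D x) = 0) (hd : ∀ x, d (d x) = 0)
    (hex : ∀ x, d x = 0 → ∃ y, x = d y) (x : PolyCoalg k r ⊗[k] M) (hx : D x = 0) :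
    ∃ y, x = D y := by
  obtain ⟨s, hs⟩ := exists_contracting_homotopy d hd hex
  have key : ∀ n, ∀ x ∈ barFil k r M (n + 1), x ∈ (⊤ : Submodule k (PolyCoalg k r ⊗[k] M)) →
      D x = 0 → ∃ y ∈ (⊤ : Submodule k (PolyCoalg k r ⊗[k] M)), x - D y ∈ barFil k r M n := by
    intro n x hx _ hDx
    -- A contracting homotopy of the symbol, applied to the second factor, contracts D modulo lower
    -- filtration. As D x = 0, subtracting D (1 ⊗ s) x lowers the filtration of x.
    refine ⟨LinearMap.lTensor _ s x, trivial, ?_⟩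
    have h1 := h.sub_mem (lTensor_mem_barFil s hx)
    have h2 := lTensor_mem_barFil s (h.sub_mem hx)
    rw [hDx, zero_sub, map_neg] at h2
    have h3 : LinearMap.lTensor (PolyCoalg k r) d (LinearMap.lTensor _ s x) +
        LinearMap.lTensor _ s (LinearMap.lTensor _ d x) = x := by
      rw [← LinearMap.comp_apply, ← LinearMap.comp_apply, ← LinearMap.lTensor_comp,
        ← LinearMap.lTensor_comp, ← LinearMap.add_apply, ← LinearMap.lTensor_add]
      have : d ∘ₗ s + s ∘ₗ d = LinearMap.id := LinearMap.ext hs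
      rw [this, LinearMap.lTensor_id, LinearMap.id_apply]
    have h4 := Submodule.neg_mem _ (Submodule.add_mem _ h1 h2)
    convert h4 using 1
    nth_rewrite 1 [← h3]
    abel
  obtain ⟨y, -, hy⟩ := exact_of_filtration D hD (barFil k r M) barFil_zero exists_mem_barFil ⊤
    (fun _ _ => trivial) key x trivial hx
  exact ⟨y, hy⟩

end BarFiltration

/-! ### Functoriality of the bar construction -/

section BarMap

variable {k : Type u} [Field k] {r : ℕ} {A B : DGAlg k}

/-- The term with `p.2 = 0` vanishes because φ kills x^(0), so the twisting part strictly lowers the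
degree in S_c. -/
theorem Twisting.hasSymbol_barD (φ : Twisting k r A) (M : DGAlgMod A) :
    HasSymbol (φ.barD M) M.toDGMod.d := by
  intro a m
  rw [Twisting.barD_mono, add_sub_cancel_left]
  refine Submodule.sum_mem _ fun p hp => ?_
  rw [Finset.HasAntidiagonal.mem_antidiagonal] at hp
  by_cases h : p.2 = 0
  · rw [h, φ.map_unit, map_zero, LinearMap.zero_apply, TensorProduct.tmul_zero]
    exact Submodule.zero_mem _
  · refine mono_tmul_mem_barFil ?_ _
    have h1 : p.2.degree ≠ 0 := fun h' => h ((Finsupp.degree_eq_zero_iff _).1 h')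
    rw [← hp, map_add]
    omega

/-- A filtered map of bar constructions with quasi-isomorphic symbol is a quasi-isomorphism. -/
theorem bar_isQuasiIso [CharP k 2] {φ : Twisting k r A} {ψ : Twisting k r B} {M : DGAlgMod A}
    {N : DGAlgMod B} (Ψ : DGMod.Hom (bar φ M).toDGMod (bar ψ N).toDGMod)
    (f : DGMod.Hom M.toDGMod N.toDGMod) (hf : f.IsQuasiIso)
    (h : HasSymbol (M := M.toDGMod) (N := N.toDGMod) Ψ.toLin f.toLin) : Ψ.IsQuasiIso := by
  let P : PolyCoalg k r ⊗[k] M.toDGMod →ₗ[k] PolyCoalg k r ⊗[k] N.toDGMod := Ψ.toLin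
  have hP : ∀ x, P (φ.barD M x) = ψ.barD N (P x) := Ψ.comm
  -- The differential of the mapping cone of f, exact because f is a quasi-isomorphism.
  let dc : (M.toDGMod × N.toDGMod) →ₗ[k] (M.toDGMod × N.toDGMod) :=
    LinearMap.prod (M.toDGMod.d ∘ₗ LinearMap.fst k _ _)
      (N.toDGMod.d ∘ₗ LinearMap.snd k _ _ + f.toLin ∘ₗ LinearMap.fst k _ _)
  have hdc : ∀ x, dc (dc x) = 0 := by
    rintro ⟨m, n⟩
    refine Prod.ext (M.toDGMod.d_sq m) ?_
    change N.toDGMod.d (N.toDGMod.d n + f.toLin m) + f.toLin (M.toDGMod.d m) = 0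
    rw [map_add, N.toDGMod.d_sq, f.comm, zero_add, add_self_eq_zero_of_charTwo k]
  have hex : ∀ x, dc x = 0 → ∃ y, x = dc y := by
    rintro ⟨m, n⟩ hmn
    have h1 : M.toDGMod.d m = 0 := congrArg Prod.fst hmn
    have h2 : N.toDGMod.d n + f.toLin m = 0 := congrArg Prod.snd hmn
    have h2' := (eq_of_add_eq_zero_of_charTwo k h2).symm
    obtain ⟨hf1, hf2⟩ := f.isQuasiIso_iff.1 hf
    obtain ⟨y, rfl⟩ := hf1 m h1 n h2'
    obtain ⟨x, hx, w, hw⟩ := hf2 (f.toLin y + n) (by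
      rw [map_add, ← f.comm, h2', add_self_eq_zero_of_charTwo k])
    refine ⟨(y + x, w), Prod.ext ?_ ?_⟩
    · change _ = M.toDGMod.d (y + x)
      rw [map_add, hx, add_zero]
    · change n = N.toDGMod.d w + f.toLin (y + x)
      rw [map_add, add_comm (f.toLin y), ← add_assoc, add_comm _ (f.toLin x), ← hw,
        add_comm (f.toLin y), add_assoc, add_self_eq_zero_of_charTwo k, add_zero]
  let E := TensorProduct.prodRight k k (PolyCoalg k r) M.toDGMod N.toDGMod
  -- The differential of the mapping cone of Ψ. Transported to S_c ⊗ (M × N), it has the cone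
  -- differential of f as its symbol.
  let D0 : (PolyCoalg k r ⊗[k] M.toDGMod) × (PolyCoalg k r ⊗[k] N.toDGMod) →ₗ[k]
      (PolyCoalg k r ⊗[k] M.toDGMod) × (PolyCoalg k r ⊗[k] N.toDGMod) :=
    LinearMap.prod (φ.barD M ∘ₗ LinearMap.fst k _ _)
      (ψ.barD N ∘ₗ LinearMap.snd k _ _ + P ∘ₗ LinearMap.fst k _ _)
  have hD0 : ∀ x, D0 (D0 x) = 0 := by
    rintro ⟨m, n⟩
    refine Prod.ext (φ.barD_sq M m) ?_
    change ψ.barD N (ψ.barD N n + P m) + P (φ.barD M m) = 0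
    rw [map_add, ψ.barD_sq, hP, zero_add, add_self_eq_zero_of_charTwo k]
  let D : PolyCoalg k r ⊗[k] (M.toDGMod × N.toDGMod) →ₗ[k]
      PolyCoalg k r ⊗[k] (M.toDGMod × N.toDGMod) := E.symm.toLinearMap ∘ₗ D0 ∘ₗ E.toLinearMap
  have hD : ∀ x, D (D x) = 0 := by
    intro x
    simp [D, hD0]
  have hinl : ∀ {n : ℕ} {x : PolyCoalg k r ⊗[k] M.toDGMod}, x ∈ barFil k r M.toDGMod n →
      E.symm (x, 0) ∈ barFil k r (M.toDGMod × N.toDGMod) n := by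
    intro n x hx
    have : barFil k r M.toDGMod n ≤ (barFil k r (M.toDGMod × N.toDGMod) n).comap
        (E.symm.toLinearMap ∘ₗ LinearMap.inl k _ _) := by
      rw [barFil_le_iff]
      intro a m ha
      have : E.symm (PolyCoalg.mono k a ⊗ₜ m, 0) = PolyCoalg.mono k a ⊗ₜ (m, 0) := by
        rw [LinearEquiv.symm_apply_eq]; simp [E]
      rw [Submodule.mem_comap]
      change E.symm _ ∈ _
      exact Set.mem_of_eq_of_mem this (mono_tmul_mem_barFil ha _)
    exact this hx
  have hinr : ∀ {n : ℕ} {x : PolyCoalg k r ⊗[k] N.toDGMod}, x ∈ barFil k r N.toDGMod n →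
      E.symm (0, x) ∈ barFil k r (M.toDGMod × N.toDGMod) n := by
    intro n x hx
    have : barFil k r N.toDGMod n ≤ (barFil k r (M.toDGMod × N.toDGMod) n).comap
        (E.symm.toLinearMap ∘ₗ LinearMap.inr k _ _) := by
      rw [barFil_le_iff]
      intro a m ha
      have : E.symm (0, PolyCoalg.mono k a ⊗ₜ m) = PolyCoalg.mono k a ⊗ₜ (0, m) := by
        rw [LinearEquiv.symm_apply_eq]; simp [E]
      rw [Submodule.mem_comap]
      change E.symm _ ∈ _
      exact Set.mem_of_eq_of_mem this (mono_tmul_mem_barFil ha _)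
    exact this hx
  have hsym : HasSymbol D dc := by
    rintro a ⟨m, n⟩
    have key : D (PolyCoalg.mono k a ⊗ₜ (m, n)) - PolyCoalg.mono k a ⊗ₜ dc (m, n) =
        E.symm (φ.barD M (PolyCoalg.mono k a ⊗ₜ m) - PolyCoalg.mono k a ⊗ₜ M.toDGMod.d m, 0) +
        E.symm (0, (ψ.barD N (PolyCoalg.mono k a ⊗ₜ n) -
          PolyCoalg.mono k a ⊗ₜ N.toDGMod.d n) + (P (PolyCoalg.mono k a ⊗ₜ m) -
          PolyCoalg.mono k a ⊗ₜ f.toLin m)) := by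
      rw [← map_add, LinearEquiv.eq_symm_apply, map_sub]
      simp only [D, LinearMap.comp_apply, LinearEquiv.coe_coe, LinearEquiv.apply_symm_apply]
      refine Prod.ext ?_ ?_
      · simp [E, D0, dc]
      · simp [E, D0, dc, TensorProduct.tmul_add]
        abel
    rw [key]
    exact Submodule.add_mem _ (hinl (φ.hasSymbol_barD M a m))
      (hinr (Submodule.add_mem _ (ψ.hasSymbol_barD N a n) (h a m)))
  have hexact := hsym.exact hD hdc hex
  have hexact0 : ∀ x, D0 x = 0 → ∃ y, x = D0 y := by
    intro x hx
    obtain ⟨y, hy⟩ := hexact (E.symm x) (by simp [D, hx])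
    exact ⟨E y, by simpa [D] using hy⟩
  -- Exactness of the cone of Ψ is read back: at (x, w) it gives injectivity in homology, at (0, w)
  -- surjectivity.
  rw [Ψ.isQuasiIso_iff]
  constructor
  · intro x hx w hw
    obtain ⟨⟨y, z⟩, hyz⟩ := hexact0 (x, w) (Prod.ext hx (by
      have : ψ.barD N w + P x = 0 := by
        rw [show P x = ψ.barD N w from hw]
        exact add_self_eq_zero_of_charTwo k _
      exact this))
    exact ⟨y, congrArg Prod.fst hyz⟩
  · intro w hw
    obtain ⟨⟨y, z⟩, hyz⟩ := hexact0 (0, w) (Prod.ext (map_zero (φ.barD M)) (by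
      change ψ.barD N w + P 0 = 0
      rw [map_zero, add_zero]; exact hw))
    exact ⟨y, (congrArg Prod.fst hyz).symm, z, (congrArg Prod.snd hyz).trans (add_comm _ _)⟩

theorem barAct_tmul (M : DGMod k) (p : MvPolynomial (Fin r) k) (c : PolyCoalg k r) (m : M) :
    barAct r M p (c ⊗ₜ m) = PolyCoalg.contract k r p c ⊗ₜ m := rfl

/-- To commute with the action of `S` it is enough to commute with monomials on the basis. -/
theorem barAct_comm {M : DGMod k} {W : Type u} [AddCommGroup W] [Module k W]
    (T : MvPolynomial (Fin r) k →ₐ[k] Module.End k W)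
    (Ψ : PolyCoalg k r ⊗[k] M →ₗ[k] W)
    (h : ∀ (e a : Fin r →₀ ℕ) (m : M),
      Ψ ((if e ≤ a then PolyCoalg.mono k (a - e) else 0) ⊗ₜ m) =
        T (MvPolynomial.monomial e 1) (Ψ (PolyCoalg.mono k a ⊗ₜ m)))
    (p : MvPolynomial (Fin r) k) (x : PolyCoalg k r ⊗[k] M) :
    Ψ (barAct r M p x) = T p (Ψ x) := by
  induction p using MvPolynomial.induction_on' with
  | monomial e c =>
    have h1 : (MvPolynomial.monomial e c : MvPolynomial (Fin r) k) =
      c • MvPolynomial.monomial e 1 := by rw [MvPolynomial.smul_monomial, smul_eq_mul, mul_one]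
    rw [h1, map_smul, map_smul, LinearMap.smul_apply, LinearMap.smul_apply, map_smul]
    refine congrArg (c • ·) ?_
    induction x using bar_induction with
    | mono a m =>
      rw [barAct_tmul, PolyCoalg.contract_monomial, one_smul]
      exact h e a m
    | add x y hx hy => simp only [map_add, hx, hy]
  | add p q hp hq =>
    rw [map_add, map_add, LinearMap.add_apply, LinearMap.add_apply, map_add, hp, hq]

/-- The monomial x^e kills x^(a) ⊗ m unless e ≤ a, hence as soon as |e| > |a|. -/
theorem bar_isConilpotent [CharP k 2] (φ : Twisting k r A) (M : DGAlgMod A) : IsConilpotent (bar φ M) := by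
  have key : ∀ x : PolyCoalg k r ⊗[k] M.toDGMod, ∃ N : ℕ, ∀ a : Fin r →₀ ℕ, N ≤ a.degree →
      barAct r M.toDGMod (MvPolynomial.monomial a (1 : k)) x = 0 := by
    intro x
    induction x using bar_induction with
    | mono a m =>
      refine ⟨a.degree + 1, fun e he => ?_⟩
      rw [barAct_tmul, PolyCoalg.contract_monomial, if_neg, smul_zero, TensorProduct.zero_tmul]
      intro hle
      have := Finsupp.degree_mono hle
      omega
    | add x y hx hy =>
      obtain ⟨m, hm⟩ := hx
      obtain ⟨n, hn⟩ := hy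
      refine ⟨max m n, fun e he => ?_⟩
      rw [map_add, hm e (le_trans (le_max_left _ _) he), hn e (le_trans (le_max_right _ _) he),
        add_zero]
  exact key

/-- The comodule map `c ⊗ v ↦ ∑ c' ⊗ f_{c''} v` with corestriction `f`. -/
noncomputable def comoduleMap {M N : Type u} [AddCommGroup M] [Module k M] [AddCommGroup N]
    [Module k N] (f : PolyCoalg k r →ₗ[k] M →ₗ[k] N) :
    PolyCoalg k r ⊗[k] M →ₗ[k] PolyCoalg k r ⊗[k] N :=
  LinearMap.lTensor (PolyCoalg k r) (TensorProduct.lift f) ∘ₗ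
    (TensorProduct.assoc k (PolyCoalg k r) (PolyCoalg k r) M).toLinearMap ∘ₗ
    LinearMap.rTensor M (Coalgebra.comul (R := k))

theorem comoduleMap_mono {M N : Type u} [AddCommGroup M] [Module k M] [AddCommGroup N]
    [Module k N] (f : PolyCoalg k r →ₗ[k] M →ₗ[k] N) (a : Fin r →₀ ℕ) (m : M) :
    comoduleMap f (PolyCoalg.mono k a ⊗ₜ m) = ∑ p ∈ Finset.HasAntidiagonal.antidiagonal a,
      PolyCoalg.mono k p.1 ⊗ₜ f (PolyCoalg.mono k p.2) m := by
  simp only [comoduleMap, LinearMap.comp_apply, LinearMap.rTensor_tmul, PolyCoalg.comul_mono,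
    TensorProduct.sum_tmul, map_sum, LinearEquiv.coe_coe, TensorProduct.assoc_tmul,
    LinearMap.lTensor_tmul, TensorProduct.lift.tmul]

/-- Contraction by x^e affects only the left factor of the comultiplication, whereas f uses the
right one. This is colinearity, phrased through the action of S. -/
theorem comoduleMap_lower {M N : Type u} [AddCommGroup M] [Module k M] [AddCommGroup N]
    [Module k N] (f : PolyCoalg k r →ₗ[k] M →ₗ[k] N) (e a : Fin r →₀ ℕ) (m : M) :
    comoduleMap f ((if e ≤ a then PolyCoalg.mono k (a - e) else 0) ⊗ₜ m) =
      LinearMap.rTensor N (PolyCoalg.contract k r (MvPolynomial.monomial e 1))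
        (comoduleMap f (PolyCoalg.mono k a ⊗ₜ m)) := by
  rw [comoduleMap_mono, map_sum]
  simp only [LinearMap.rTensor_tmul, PolyCoalg.contract_monomial, one_smul]
  have h1 : ∀ (P : Prop) [Decidable P] (y : PolyCoalg k r) (z : N),
      (if P then y else 0) ⊗ₜ[k] z = if P then (y ⊗ₜ[k] z) else 0 := by
    intro P _ y z
    split_ifs <;> simp
  simp only [h1]
  rw [sum_antidiagonal_lower e a fun b c => PolyCoalg.mono k b ⊗ₜ[k] f (PolyCoalg.mono k c) m]
  split_ifs
  · rw [comoduleMap_mono]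
  · simp

/-- The splitting (a, 0) gives the symbol; every other splitting has a first part of smaller degree.
-/
theorem hasSymbol_comoduleMap {M N : Type u} [AddCommGroup M] [Module k M] [AddCommGroup N]
    [Module k N] (f : PolyCoalg k r →ₗ[k] M →ₗ[k] N) :
    HasSymbol (comoduleMap f) (f (PolyCoalg.mono k 0)) := by
  intro a m
  rw [comoduleMap_mono, ← Finset.add_sum_erase _ _
    (show (a, 0) ∈ Finset.HasAntidiagonal.antidiagonal a by simp), add_sub_cancel_left]
  refine Submodule.sum_mem _ fun p hp => ?_
  rw [Finset.mem_erase, Finset.HasAntidiagonal.mem_antidiagonal] at hp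
  refine mono_tmul_mem_barFil ?_ _
  have h1 : p.2.degree ≠ 0 := by
    intro h'
    have h0 := (Finsupp.degree_eq_zero_iff _).1 h'
    refine hp.1 (Prod.ext ?_ h0)
    rw [← hp.2, h0, add_zero]
  rw [← hp.2, map_add]
  omega

/-- A linear map of degree zero on `S_c ⊗ M`, checked on the basis of `S_c`. -/
theorem map_tensorDeg {M N : DGMod k} (Ψ : PolyCoalg k r ⊗[k] M →ₗ[k] N)
    (h : ∀ (a : Fin r →₀ ℕ) n, ∀ m ∈ M.deg n, Ψ (PolyCoalg.mono k a ⊗ₜ m) ∈ N.deg (a.degree + n))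
    (n : ℤ) (x : PolyCoalg k r ⊗[k] M) (hx : x ∈ tensorDeg (PolyCoalg.cdeg k r) M.deg n) :
    Ψ x ∈ N.deg n := by
  refine tensorDeg_induction hx (P := fun x => Ψ x ∈ N.deg n) ?_ ?_ ?_ ?_
  · intro a m hm
    simpa using h a _ m hm
  · rw [map_zero]; exact Submodule.zero_mem _
  · intro y z hy hz; rw [map_add]; exact Submodule.add_mem _ hy hz
  · intro c y hy; rw [map_smul]; exact Submodule.smul_mem _ _ hy

/-- The map of bar constructions induced by a morphism of dg modules. -/
noncomputable def barMap [CharP k 2] (φ : Twisting k r A) {M N : DGAlgMod A} (f : DGAlgMod.Hom M N) :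
    DGAlgMod.Hom (bar φ M) (bar φ N) where
  toLin := LinearMap.lTensor (PolyCoalg k r) f.toLin
  map_deg := map_tensorDeg (M := M.toDGMod) (N := (bar φ N).toDGMod)
    (LinearMap.lTensor (PolyCoalg k r) f.toLin) fun a n m hm =>
      tmul_mem_tensorDeg (PolyCoalg.mono_mem k a) (f.map_deg n m hm) rfl
  comm := by
    intro x
    change LinearMap.lTensor (PolyCoalg k r) f.toLin (φ.barD M x) =
      φ.barD N (LinearMap.lTensor (PolyCoalg k r) f.toLin x)
    refine LinearMap.congr_fun (f := LinearMap.lTensor (PolyCoalg k r) f.toLin ∘ₗ φ.barD M)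
      (g := φ.barD N ∘ₗ LinearMap.lTensor (PolyCoalg k r) f.toLin)
      (tensor_hom_ext fun a m => ?_) x
    rw [LinearMap.comp_apply, LinearMap.comp_apply, LinearMap.lTensor_tmul, Twisting.barD_mono, Twisting.barD_mono, map_add, map_sum,
      LinearMap.lTensor_tmul, f.comm]
    refine congrArg _ (Finset.sum_congr rfl fun p _ => ?_)
    rw [LinearMap.lTensor_tmul, f.map_act]
  map_act := by
    intro p x
    refine barAct_comm (barAct r N.toDGMod) (LinearMap.lTensor (PolyCoalg k r) f.toLin)
      (fun e a m => ?_) p x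
    rw [LinearMap.lTensor_tmul, LinearMap.lTensor_tmul, barAct_tmul, PolyCoalg.contract_monomial, one_smul]

theorem barMap_isQuasiIso [CharP k 2] (φ : Twisting k r A) {M N : DGAlgMod A} {f : DGAlgMod.Hom M N}
    (hf : f.IsQuasiIso) : (barMap φ f).IsQuasiIso := by
  refine bar_isQuasiIso (φ := φ) (ψ := φ) (barMap φ f).toHom f.toHom hf ?_
  intro a m
  change LinearMap.lTensor (PolyCoalg k r) f.toLin _ - _ ∈ _
  rw [LinearMap.lTensor_tmul, sub_self]
  exact Submodule.zero_mem _

/-- The map of bar constructions induced by an `∞`-morphism. -/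
noncomputable def InfMorphism.barMap [CharP k 2] {V W : DGAlgMod (cobar k r)} (f : InfMorphism V W) :
    DGAlgMod.Hom (bar (iotaTw k r) V) (bar (iotaTw k r) W) where
  toLin := comoduleMap f.toLin
  map_deg := map_tensorDeg (M := V.toDGMod) (N := (bar (iotaTw k r) W).toDGMod)
    (comoduleMap f.toLin) fun a n m hm => by
      change comoduleMap f.toLin (PolyCoalg.mono k a ⊗ₜ m) ∈
        tensorDeg (PolyCoalg.cdeg k r) W.toDGMod.deg _
      rw [comoduleMap_mono]
      refine Submodule.sum_mem _ fun p hp => ?_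
      rw [Finset.HasAntidiagonal.mem_antidiagonal] at hp
      refine tmul_mem_tensorDeg (PolyCoalg.mono_mem k p.1)
        (f.map_deg _ _ _ (PolyCoalg.mono_mem k p.2) m hm) ?_
      rw [← hp, map_add]
      push_cast
      ring
  comm := by
    intro x
    change comoduleMap f.toLin ((iotaTw k r).barD V x) =
      (iotaTw k r).barD W (comoduleMap f.toLin x)
    refine LinearMap.congr_fun (f := comoduleMap f.toLin ∘ₗ (iotaTw k r).barD V)
      (g := (iotaTw k r).barD W ∘ₗ comoduleMap f.toLin) (tensor_hom_ext fun a m => ?_) x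
    rw [LinearMap.comp_apply, LinearMap.comp_apply, comoduleMap_mono, Twisting.barD_mono, map_add, map_sum, map_sum]
    simp only [comoduleMap_mono, Twisting.barD_mono, Finset.sum_add_distrib]
    rw [PolyCoalg.sum_antidiagonal_assoc r a fun b c e => PolyCoalg.mono k b ⊗ₜ[k]
        f.toLin (PolyCoalg.mono k c) (V.act ((iotaTw k r).toLin (PolyCoalg.mono k e)) m),
      PolyCoalg.sum_antidiagonal_assoc r a fun b c e => PolyCoalg.mono k b ⊗ₜ[k]
        W.act ((iotaTw k r).toLin (PolyCoalg.mono k c)) (f.toLin (PolyCoalg.mono k e) m),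
      ← Finset.sum_add_distrib, ← Finset.sum_add_distrib]
    refine Finset.sum_congr rfl fun p _ => ?_
    rw [← TensorProduct.tmul_sum, ← TensorProduct.tmul_sum, ← TensorProduct.tmul_add,
      ← TensorProduct.tmul_add]
    refine congrArg _ ?_
    -- By coassociativity, the coefficient of each x^(b) is the equation of an ∞-morphism at the
    -- complementary exponent.
    have h := f.eqn p.2 m
    rw [← sub_eq_zero] at h ⊢
    rw [sub_eq_add_of_charTwo k] at h ⊢
    rw [← h]
    abel
  map_act := by
    intro p x
    exact barAct_comm (barAct r W.toDGMod) (comoduleMap f.toLin)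
      (fun e a m => comoduleMap_lower f.toLin e a m) p x

theorem InfMorphism.barMap_isQuasiIso [CharP k 2] {V W : DGAlgMod (cobar k r)} (f : InfMorphism V W)
    (hf : f.linear.IsQuasiIso) : f.barMap.IsQuasiIso :=
  bar_isQuasiIso (φ := iotaTw k r) (ψ := iotaTw k r) f.barMap.toHom f.linear hf
    (hasSymbol_comoduleMap f.toLin)

theorem InfMorphism.coalgZigzag [CharP k 2] {V W : DGAlgMod (cobar k r)} (f : InfMorphism V W)
    (hf : f.linear.IsQuasiIso) : CoalgZigzag (bar (iotaTw k r) V) (bar (iotaTw k r) W) :=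
  ⟨bar_isConilpotent _ _, bar_isConilpotent _ _, Relation.EqvGen.rel _ _
    ⟨bar_isConilpotent _ _, bar_isConilpotent _ _, f.barMap, f.barMap_isQuasiIso hf⟩⟩

/-- The lift of a twisting morphism on the generators. -/
theorem Twisting.lift_gen [CharP k 2] (φ : Twisting k r A) (a : Fin r →₀ ℕ) :
    φ.lift.toAlgHom ((iotaTw k r).toLin (PolyCoalg.mono k a)) = φ.toLin (PolyCoalg.mono k a) := by
  have h : (iotaTw k r).toLin (PolyCoalg.mono k a) = gen k a := PolyCoalg.lin_mono k _ a
  rw [h]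
  by_cases h : a ≠ 0
  · rw [gen, dif_pos h]
    exact FreeAlgebra.lift_ι_apply _ _
  · push Not at h
    subst h
    rw [φ.map_unit, gen, dif_neg (by simp)]
    exact map_zero φ.lift.toAlgHom

/-- The two structures share carrier, grading and action, and their differentials agree because the
lift of φ sends ι(x^(a)) to φ(x^(a)). The auxiliary `mk` leaves the differential as the only datum,
the remaining fields being proofs, so the structures are equal and not merely isomorphic. -/
theorem bar_iota_restrict [CharP k 2] (φ : Twisting k r A) (M : DGAlgMod A) :
    bar (iotaTw k r) (M.restrict φ.lift) = bar φ M := by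
  let V := M.toDGMod
  have h : (iotaTw k r).barD (M.restrict φ.lift) = φ.barD M := by
    refine tensor_hom_ext (M := V) fun a m => ?_
    refine ((iotaTw k r).barD_mono (M.restrict φ.lift) a m).trans
      (Eq.trans ?_ (φ.barD_mono M a m).symm)
    refine congrArg (PolyCoalg.mono k a ⊗ₜ[k] V.d m + ·) (Finset.sum_congr rfl fun p _ => ?_)
    rw [← φ.lift_gen]
    rfl
  let mk (D : PolyCoalg k r ⊗[k] V →ₗ[k] PolyCoalg k r ⊗[k] V)
      (h1 : ∀ n, ∀ x ∈ tensorDeg (PolyCoalg.cdeg k r) V.deg n,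
        D x ∈ tensorDeg (PolyCoalg.cdeg k r) V.deg (n - 1))
      (h2 : ∀ x, D (D x) = 0)
      (h3 : ∀ p x, D (barAct r V p x) = barAct r V 0 x + barAct r V p (D x)) :
      DGAlgMod (polyAlg k r) :=
    { toDGMod :=
        { carrier := PolyCoalg k r ⊗[k] V
          deg := tensorDeg (PolyCoalg.cdeg k r) V.deg
          internal := tensorDeg_isInternal (PolyCoalg.cdeg_isInternal k r) V.internal
          d := D
          d_deg := h1
          d_sq := h2 }
      action :=
        { act := barAct r V
          act_deg := fun _ _ _ hp _ hx => rTensor_contract_mem hp hx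
          act_d := h3 } }
  have key : ∀ D D' h1 h2 h3 h1' h2' h3', D = D' → mk D h1 h2 h3 = mk D' h1' h2' h3' := by
    rintro D D' h1 h2 h3 h1' h2' h3' rfl
    rfl
  exact key _ _ (bar (iotaTw k r) (M.restrict φ.lift)).toDGMod.d_deg
    (bar (iotaTw k r) (M.restrict φ.lift)).toDGMod.d_sq
    (bar (iotaTw k r) (M.restrict φ.lift)).action.act_d
    (bar φ M).toDGMod.d_deg (bar φ M).toDGMod.d_sq (bar φ M).action.act_d h

end BarMap

/-! ### Modules over the cobar construction from families of operators -/

section FamilyAction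

variable {k : Type u} [Field k] [CharP k 2] {r : ℕ}

theorem iotaTw_mono (a : Fin r →₀ ℕ) :
    (iotaTw k r).toLin (PolyCoalg.mono k a) = gen k a := PolyCoalg.lin_mono k _ a

/-- The algebra map on the cobar construction with prescribed values on the generators. -/
noncomputable def familyAct {H : Type u} [AddCommGroup H] [Module k H]
    (μ : (Fin r →₀ ℕ) → Module.End k H) : FreeAlgebra k (Gen r) →ₐ[k] Module.End k H :=
  FreeAlgebra.lift k fun a => μ a.1

omit [CharP k 2] in
theorem familyAct_gen {H : Type u} [AddCommGroup H] [Module k H]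
    {μ : (Fin r →₀ ℕ) → Module.End k H} (h0 : μ 0 = 0) (a : Fin r →₀ ℕ) :
    familyAct μ (gen k a) = μ a := by
  by_cases h : a ≠ 0
  · rw [gen, dif_pos h, familyAct, FreeAlgebra.lift_ι_apply]
  · push Not at h
    subst h
    rw [gen, dif_neg (by simp), map_zero, h0]

omit [CharP k 2] in
-- When H has zero differential, compatibility with the differentials means that boundaries act by
-- zero. As the cobar differential is a derivation, it suffices to look at generators, where the
-- condition is μ ⋆ μ = 0.
theorem familyAct_cobarD {H : Type u} [AddCommGroup H] [Module k H]
    {μ : (Fin r →₀ ℕ) → Module.End k H} (h0 : μ 0 = 0)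
    (hμ : ∀ a, ∑ p ∈ Finset.HasAntidiagonal.antidiagonal a, μ p.1 * μ p.2 = 0)
    (w : FreeAlgebra k (Gen r)) : familyAct μ (cobarD k r w) = 0 := by
  induction w using FreeAlgebra.induction with
  | grade0 c => rw [cobarD_algebraMap, map_zero]
  | grade1 x =>
    have : FreeAlgebra.ι k x = gen k x.1 := by rw [gen, dif_pos x.2]
    rw [this, cobarD_gen, map_sum]
    simp only [map_mul, familyAct_gen h0]
    exact hμ _
  | mul a b ha hb => rw [cobarD_mul, map_add, map_mul, map_mul, ha, hb, zero_mul, mul_zero, add_zero]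
  | add a b ha hb => rw [map_add, map_add, ha, hb, add_zero]

omit [CharP k 2] in
theorem familyAct_deg {H : DGMod k} {μ : (Fin r →₀ ℕ) → Module.End k H}
    (hdeg : ∀ (a : Fin r →₀ ℕ) n, ∀ x ∈ H.deg n, μ a x ∈ H.deg ((a.degree : ℤ) - 1 + n))
    (m n : ℤ) (w : FreeAlgebra k (Gen r)) (hw : w ∈ cobarDeg k r m) (x : H) (hx : x ∈ H.deg n) :
    familyAct μ w x ∈ H.deg (m + n) := by
  induction hw using Submodule.span_induction with
  | mem w h =>
    obtain ⟨l, rfl, rfl⟩ := h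
    induction l with
    | nil =>
      have : word k r ([] : List (Gen r)) = 1 := rfl
      rw [this, map_one]
      simpa [wordDeg] using hx
    | cons a l ih =>
      have h1 : word k r (a :: l) = FreeAlgebra.ι k a * word k r l := by simp [word]
      have h2 : wordDeg r (a :: l) = (a.1.degree : ℤ) - 1 + wordDeg r l := by simp [wordDeg]
      rw [h1, h2, map_mul, familyAct, FreeAlgebra.lift_ι_apply, add_assoc]
      exact hdeg _ _ _ ih
  | zero => rw [map_zero]; exact Submodule.zero_mem _
  | add v w _ _ hv hw => rw [map_add]; exact Submodule.add_mem _ hv hw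
  | smul c w _ hw => rw [map_smul]; exact Submodule.smul_mem _ _ hw

/-- The dg module over the cobar construction, with zero differential, given by a family of
operators. -/
noncomputable def familyAction {H : DGMod k} (hd : H.d = 0) (μ : (Fin r →₀ ℕ) → Module.End k H)
    (h0 : μ 0 = 0)
    (hdeg : ∀ (a : Fin r →₀ ℕ) n, ∀ x ∈ H.deg n, μ a x ∈ H.deg ((a.degree : ℤ) - 1 + n))
    (hμ : ∀ a, ∑ p ∈ Finset.HasAntidiagonal.antidiagonal a, μ p.1 * μ p.2 = 0) :
    DGAction (cobar k r) H where
  act := familyAct μ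
  act_deg := familyAct_deg hdeg
  act_d a x := by
    have h : familyAct μ ((cobar k r).d a) = 0 := familyAct_cobarD h0 hμ a
    exact (LinearMap.congr_fun hd _).trans ((zero_add _).symm.trans
      (congrArg₂ (· + ·) (LinearMap.congr_fun h x).symm
        ((map_zero (familyAct μ a)).symm.trans
          (congrArg (familyAct μ a) (LinearMap.congr_fun hd x).symm))))

/-- The `∞`-morphism with prescribed components. -/
noncomputable def InfMorphism.ofFamily {V W : DGAlgMod (cobar k r)}
    (f : (Fin r →₀ ℕ) → V.toDGMod →ₗ[k] W.toDGMod)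
    (hdeg : ∀ (a : Fin r →₀ ℕ) n, ∀ v ∈ V.toDGMod.deg n, f a v ∈ W.toDGMod.deg (a.degree + n))
    (heqn : ∀ a v, W.toDGMod.d (f a v) + f a (V.toDGMod.d v) =
      (∑ p ∈ Finset.HasAntidiagonal.antidiagonal a,
        f p.1 (V.act ((iotaTw k r).toLin (PolyCoalg.mono k p.2)) v)) +
      ∑ p ∈ Finset.HasAntidiagonal.antidiagonal a,
        W.act ((iotaTw k r).toLin (PolyCoalg.mono k p.1)) (f p.2 v)) :
    InfMorphism V W where
  toLin := PolyCoalg.lin k f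
  map_deg := by
    intro m n x hx v hv
    induction hx using Submodule.span_induction with
    | mem x h =>
      obtain ⟨a, rfl, rfl⟩ := h
      rw [PolyCoalg.lin_mono]
      exact hdeg a n v hv
    | zero => rw [map_zero]; exact Submodule.zero_mem _
    | add x y _ _ hx hy => rw [map_add]; exact Submodule.add_mem _ hx hy
    | smul c x _ hx => rw [map_smul]; exact Submodule.smul_mem _ _ hx
  eqn := by
    intro a v
    simp only [PolyCoalg.lin_mono]
    exact heqn a v

theorem InfMorphism.ofFamily_linear {V W : DGAlgMod (cobar k r)}
    (f : (Fin r →₀ ℕ) → V.toDGMod →ₗ[k] W.toDGMod) (hdeg heqn) :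
    (InfMorphism.ofFamily (V := V) (W := W) f hdeg heqn).linear.toLin = f 0 :=
  PolyCoalg.lin_mono k f 0

end FamilyAction

/-! ### Homotopy transfer to the homology -/

section Transfer

variable {k : Type u} [Field k] {r : ℕ} {A : DGAlg k} (φ : Twisting k r A) (M : DGAlgMod A)
  (c : M.toDGMod.Contraction)

/-- The operator on `M` given by `φ (mono a)`. -/
noncomputable def Twisting.op (a : Fin r →₀ ℕ) : Module.End k M.toDGMod :=
  M.act (φ.toLin (PolyCoalg.mono k a))

theorem Twisting.op_zero : φ.op M 0 = 0 := by
  rw [Twisting.op, φ.map_unit, map_zero]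

/-- The Leibniz rule combined with the Maurer–Cartan equation d φ = φ ⋆ φ. -/
theorem Twisting.d_op [CharP k 2] (a : Fin r →₀ ℕ) (x : M.toDGMod) :
    M.toDGMod.d (φ.op M a x) = φ.op M a (M.toDGMod.d x) +
      ∑ p ∈ Finset.HasAntidiagonal.antidiagonal a, φ.op M p.1 (φ.op M p.2 x) := by
  have hmc := φ.maurerCartan (PolyCoalg.mono k a)
  rw [PolyCoalg.comul_mono, map_sum, map_sum] at hmc
  simp only [TensorProduct.map_tmul, LinearMap.mul'_apply] at hmc
  rw [Twisting.op, M.action.act_d, eq_of_add_eq_zero_of_charTwo k hmc, map_sum,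
    LinearMap.sum_apply, add_comm]
  refine congrArg _ (Finset.sum_congr rfl fun p _ => ?_)
  rw [map_mul]
  rfl

/-- The iterative construction of the transferred `∞`-morphism. -/
noncomputable def transferAux (n : ℕ) :
    (Fin r →₀ ℕ) → M.toDGMod.homology →ₗ[k] M.toDGMod :=
  match n with
  | 0 => fun _ => 0
  | n + 1 => fun a => (if a = 0 then c.incl else 0) + c.hom ∘ₗ
      ∑ p ∈ Finset.HasAntidiagonal.antidiagonal a, φ.op M p.1 ∘ₗ transferAux n p.2

/-- Since φ kills x^(0), the recursion at a only calls exponents of smaller degree. It is therefore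
stable from |a| + 1 steps on. -/
theorem transferAux_eq (m n : ℕ) (a : Fin r →₀ ℕ) (hm : a.degree < m) (hn : a.degree < n) :
    transferAux φ M c m a = transferAux φ M c n a := by
  induction m generalizing n a with
  | zero => omega
  | succ m ih =>
    obtain _ | n := n
    · omega
    · rw [transferAux, transferAux]
      refine congrArg (fun f => _ + c.hom ∘ₗ f) (Finset.sum_congr rfl fun p hp => ?_)
      by_cases h : p.1 = 0
      · rw [h, φ.op_zero, LinearMap.zero_comp, LinearMap.zero_comp]
      · rw [Finset.HasAntidiagonal.mem_antidiagonal] at hp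
        have h1 : p.1.degree ≠ 0 := fun h' => h ((Finsupp.degree_eq_zero_iff _).1 h')
        have h2 : p.1.degree + p.2.degree = a.degree := by rw [← hp, map_add]
        rw [ih n p.2 (by omega) (by omega)]

/-- The components `f_a` of the transferred `∞`-morphism. -/
noncomputable def transferMap (a : Fin r →₀ ℕ) : M.toDGMod.homology →ₗ[k] M.toDGMod :=
  transferAux φ M c (a.degree + 1) a

/-- The sum `∑ φ(b) f_{a - b}`. -/
noncomputable def transferObs (a : Fin r →₀ ℕ) : M.toDGMod.homology →ₗ[k] M.toDGMod :=
  ∑ p ∈ Finset.HasAntidiagonal.antidiagonal a, φ.op M p.1 ∘ₗ transferMap φ M c p.2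

theorem transferObs_apply (a : Fin r →₀ ℕ) (x : M.toDGMod.homology) : transferObs φ M c a x =
    ∑ p ∈ Finset.HasAntidiagonal.antidiagonal a, φ.op M p.1 (transferMap φ M c p.2 x) := by
  rw [transferObs, LinearMap.sum_apply]; rfl

/-- The transferred operations. -/
noncomputable def transferOp (a : Fin r →₀ ℕ) : Module.End k M.toDGMod.homology :=
  c.proj ∘ₗ transferObs φ M c a

/-- The fixed-point form f = incl + hom(φ ⋆ f) of the recursion. -/
theorem transferMap_eq (a : Fin r →₀ ℕ) : transferMap φ M c a =
    (if a = 0 then c.incl else 0) + c.hom ∘ₗ transferObs φ M c a := by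
  rw [transferMap, transferAux, transferObs]
  refine congrArg (fun f => _ + c.hom ∘ₗ f) (Finset.sum_congr rfl fun p hp => ?_)
  by_cases h : p.1 = 0
  · rw [h, φ.op_zero, LinearMap.zero_comp, LinearMap.zero_comp]
  · rw [Finset.HasAntidiagonal.mem_antidiagonal] at hp
    have h1 : p.1.degree ≠ 0 := fun h' => h ((Finsupp.degree_eq_zero_iff _).1 h')
    have h2 : p.1.degree + p.2.degree = a.degree := by rw [← hp, map_add]
    rw [transferMap, transferAux_eq φ M c _ (p.2.degree + 1) p.2 (by omega) (by omega)]

theorem transferObs_zero : transferObs φ M c 0 = 0 := by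
  rw [transferObs, Finset.HasAntidiagonal.antidiagonal_zero, Finset.sum_singleton, φ.op_zero, LinearMap.zero_comp]

theorem transferOp_zero : transferOp φ M c 0 = 0 := by
  rw [transferOp, transferObs_zero, LinearMap.comp_zero]

theorem transferMap_zero : transferMap φ M c 0 = c.incl := by
  rw [transferMap_eq, transferObs_zero, if_pos rfl, LinearMap.comp_zero, add_zero]

/-- Expand d hom = 1 - incl proj - hom d on φ ⋆ f. The last two terms are f ⋆ μ, by the fixed-point
equation and the hypothesis d(φ ⋆ f) = (φ ⋆ f) ⋆ μ at a. The latter is kept as a hypothesis because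
its own proof by induction uses this lemma at smaller exponents. -/
theorem d_transferMap_of [CharP k 2] (a : Fin r →₀ ℕ) (x : M.toDGMod.homology)
    (h : M.toDGMod.d (transferObs φ M c a x) =
      ∑ p ∈ Finset.HasAntidiagonal.antidiagonal a,
        transferObs φ M c p.1 (transferOp φ M c p.2 x)) :
    M.toDGMod.d (transferMap φ M c a x) = transferObs φ M c a x +
      ∑ p ∈ Finset.HasAntidiagonal.antidiagonal a,
        transferMap φ M c p.1 (transferOp φ M c p.2 x) := by
  have h1 : ∀ (b : Fin r →₀ ℕ) y, M.toDGMod.d ((if b = 0 then c.incl else 0 :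
      M.toDGMod.homology →ₗ[k] M.toDGMod) y) = 0 := by
    intro b y
    split_ifs
    · exact c.d_incl y
    · exact map_zero _
  have h2 := c.sub_incl_proj (transferObs φ M c a x)
  have h3 : ∑ p ∈ Finset.HasAntidiagonal.antidiagonal a,
      transferMap φ M c p.1 (transferOp φ M c p.2 x) =
      c.incl (transferOp φ M c a x) + c.hom (M.toDGMod.d (transferObs φ M c a x)) := by
    simp only [transferMap_eq φ M c, LinearMap.add_apply, Finset.sum_add_distrib,
      LinearMap.comp_apply]
    rw [h, map_sum]
    refine congrArg (· + _) ?_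
    rw [Finset.sum_eq_single_of_mem (0, a) (by simp)]
    · rw [if_pos rfl]
    · rintro ⟨b, c⟩ hp hne
      rw [Finset.HasAntidiagonal.mem_antidiagonal] at hp
      rw [if_neg]
      · rfl
      · rintro rfl
        exact hne (by simpa using hp)
  rw [h3, transferMap_eq, LinearMap.add_apply, map_add, h1, zero_add, LinearMap.comp_apply,
    eq_sub_of_add_eq h2.symm, sub_eq_add_of_charTwo k, sub_eq_add_of_charTwo k, add_assoc]
  rfl

/-- Strong induction on |a|. In d(φ_b f_c) the term b = 0 is zero, so the formula for d f_c is
available from the induction hypothesis. By coassociativity φ ⋆ φ ⋆ f occurs twice, once from d φ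
and once from d f, and cancels. What remains is φ ⋆ f ⋆ μ. -/
theorem d_transferObs [CharP k 2] (a : Fin r →₀ ℕ) (x : M.toDGMod.homology) :
    M.toDGMod.d (transferObs φ M c a x) = ∑ p ∈ Finset.HasAntidiagonal.antidiagonal a,
      transferObs φ M c p.1 (transferOp φ M c p.2 x) := by
  induction hn : a.degree using Nat.strong_induction_on generalizing a x with
  | _ n ih =>
    have h1 : ∀ p ∈ Finset.HasAntidiagonal.antidiagonal a,
        M.toDGMod.d (φ.op M p.1 (transferMap φ M c p.2 x)) =
        (φ.op M p.1 (transferObs φ M c p.2 x) +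
          ∑ q ∈ Finset.HasAntidiagonal.antidiagonal p.2,
            φ.op M p.1 (transferMap φ M c q.1 (transferOp φ M c q.2 x))) +
        ∑ q ∈ Finset.HasAntidiagonal.antidiagonal p.1,
          φ.op M q.1 (φ.op M q.2 (transferMap φ M c p.2 x)) := by
      intro p hp
      rw [φ.d_op]
      refine congrArg (· + _) ?_
      by_cases h : p.1 = 0
      · simp [h, φ.op_zero]
      · rw [Finset.HasAntidiagonal.mem_antidiagonal] at hp
        have h1 : p.1.degree ≠ 0 := fun h' => h ((Finsupp.degree_eq_zero_iff _).1 h')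
        have h2 : p.1.degree + p.2.degree = a.degree := by rw [← hp, map_add]
        rw [d_transferMap_of φ M c p.2 x (ih p.2.degree (by omega) p.2 x rfl), map_add, map_sum]
    rw [transferObs_apply, map_sum, Finset.sum_congr rfl h1, Finset.sum_add_distrib,
      Finset.sum_add_distrib]
    simp only [transferObs_apply, map_sum]
    rw [PolyCoalg.sum_antidiagonal_assoc r a fun b c' e =>
        φ.op M b (φ.op M c' (transferMap φ M c e x)),
      PolyCoalg.sum_antidiagonal_assoc r a fun b c' e =>
        φ.op M b (transferMap φ M c c' (transferOp φ M c e x)),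
      add_comm, ← add_assoc, add_self_eq_zero_of_charTwo k, zero_add]

theorem d_transferMap [CharP k 2] (a : Fin r →₀ ℕ) (x : M.toDGMod.homology) :
    M.toDGMod.d (transferMap φ M c a x) = transferObs φ M c a x +
      ∑ p ∈ Finset.HasAntidiagonal.antidiagonal a,
        transferMap φ M c p.1 (transferOp φ M c p.2 x) :=
  d_transferMap_of φ M c a x (d_transferObs φ M c a x)

/-- The projection proj kills boundaries; apply it to d(φ ⋆ f) = (φ ⋆ f) ⋆ μ. -/
theorem transferOp_sum [CharP k 2] (a : Fin r →₀ ℕ) :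
    ∑ p ∈ Finset.HasAntidiagonal.antidiagonal a,
      transferOp φ M c p.1 * transferOp φ M c p.2 = 0 := by
  apply LinearMap.ext
  intro x
  have h := congrArg c.proj (d_transferObs φ M c a x)
  rw [c.proj_d, map_sum] at h
  rw [LinearMap.sum_apply, LinearMap.zero_apply, h]
  rfl

/-- Both families are treated in one induction on |a|: φ_b has degree |b| - 1 and hom has degree 1.
-/
theorem transferMap_deg (a : Fin r →₀ ℕ) :
    (∀ n, ∀ x ∈ M.toDGMod.homology.deg n, transferMap φ M c a x ∈ M.toDGMod.deg (a.degree + n)) ∧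
    ∀ n, ∀ x ∈ M.toDGMod.homology.deg n,
      transferObs φ M c a x ∈ M.toDGMod.deg ((a.degree : ℤ) - 1 + n) := by
  induction hn : a.degree using Nat.strong_induction_on generalizing a with
  | _ d ih =>
    have h : ∀ n, ∀ x ∈ M.toDGMod.homology.deg n,
        transferObs φ M c a x ∈ M.toDGMod.deg ((d : ℤ) - 1 + n) := by
      intro n x hx
      rw [transferObs_apply]
      refine Submodule.sum_mem _ fun p hp => ?_
      by_cases h : p.1 = 0
      · rw [h, φ.op_zero]; exact Submodule.zero_mem _
      · rw [Finset.HasAntidiagonal.mem_antidiagonal] at hp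
        have h1 : p.1.degree ≠ 0 := fun h' => h ((Finsupp.degree_eq_zero_iff _).1 h')
        have h2 : p.1.degree + p.2.degree = a.degree := by rw [← hp, map_add]
        have h3 := M.action.act_deg _ _ _ (φ.map_deg _ _ (PolyCoalg.mono_mem k p.1)) _
          ((ih p.2.degree (by omega) p.2 rfl).1 n x hx)
        have h4 : (p.1.degree : ℤ) - 1 + (p.2.degree + n) = (d : ℤ) - 1 + n := by
          rw [← hn, ← h2]; push_cast; ring
        rw [h4] at h3
        exact h3
    refine ⟨fun n x hx => ?_, h⟩
    rw [transferMap_eq, LinearMap.add_apply]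
    refine Submodule.add_mem _ ?_ ?_
    · split_ifs with h0
      · subst h0
        have h5 : d = 0 := by rw [← hn, map_zero]
        subst h5
        simpa using c.incl_deg hx
      · exact Submodule.zero_mem _
    · have h6 := c.hom_deg _ _ (h n x hx)
      rwa [show (d : ℤ) - 1 + n + 1 = d + n by ring] at h6

/-- The transferred structure on the homology. -/
noncomputable def transferAction [CharP k 2] : DGAction (cobar k r) M.toDGMod.homology :=
  familyAction rfl (transferOp φ M c) (transferOp_zero φ M c)
    (fun a n x hx => c.proj_deg ((transferMap_deg φ M c a).2 n x hx)) (transferOp_sum φ M c)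

theorem transferAction_gen [CharP k 2] (a : Fin r →₀ ℕ) :
    (transferAction φ M c).act ((iotaTw k r).toLin (PolyCoalg.mono k a)) = transferOp φ M c a := by
  rw [iotaTw_mono]
  exact familyAct_gen (transferOp_zero φ M c) a

/-- The transferred `∞`-morphism. -/
noncomputable def transferInf [CharP k 2] :
    InfMorphism ⟨M.toDGMod.homology, transferAction φ M c⟩ (M.restrict φ.lift) :=
  InfMorphism.ofFamily (V := ⟨M.toDGMod.homology, transferAction φ M c⟩)
    (W := M.restrict φ.lift) (transferMap φ M c) (fun a => (transferMap_deg φ M c a).1) (by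
    intro a v
    have h1 := d_transferMap φ M c a v
    have h2 : transferMap φ M c a (M.toDGMod.homology.d v) = 0 := map_zero (transferMap φ M c a)
    have h3 : ∀ a, (M.restrict φ.lift).act ((iotaTw k r).toLin (PolyCoalg.mono k a)) =
        φ.op M a := fun a => congrArg M.act (φ.lift_gen a)
    have h4 : ∀ a, DGAlgMod.act ⟨M.toDGMod.homology, transferAction φ M c⟩
        ((iotaTw k r).toLin (PolyCoalg.mono k a)) = transferOp φ M c a := transferAction_gen φ M c
    simp only [h3, h4]
    refine (congrArg₂ (· + ·) h1 h2).trans ((add_zero _).trans ((add_comm _ _).trans ?_))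
    exact congrArg _ (transferObs_apply φ M c a v))

theorem transferInf_linear [CharP k 2] (x : M.toDGMod.homology) :
    (transferInf φ M c).linear.toLin x = c.incl x :=
  LinearMap.congr_fun ((InfMorphism.ofFamily_linear
    (V := ⟨M.toDGMod.homology, transferAction φ M c⟩) (W := M.restrict φ.lift)
    (transferMap φ M c) _ _).trans (transferMap_zero φ M c)) x

/-- The linear part is incl, and proj inverts it in homology. -/
theorem transferInf_isQuasiIso [CharP k 2] : (transferInf φ M c).linear.IsQuasiIso := by
  have key : ∀ (f : DGMod.Hom M.toDGMod.homology M.toDGMod), (∀ x, f.toLin x = c.incl x) →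
      f.IsQuasiIso := by
    intro f hf
    rw [f.isQuasiIso_iff]
    refine ⟨fun x _ w hw => ⟨0, ?_⟩, fun w hw => ⟨M.toDGMod.hcls (M.toDGMod.cyc w hw), rfl, ?_⟩⟩
    · rw [map_zero, ← c.proj_incl x, ← hf, hw, c.proj_d]
    · have h1 := c.sub_incl_proj w
      have h2 : c.proj w = M.toDGMod.hcls (M.toDGMod.cyc w hw) := c.proj_cycle (M.toDGMod.cyc w hw)
      rw [hw, map_zero, add_zero, h2, ← hf, sub_eq_iff_eq_add'] at h1
      exact ⟨_, h1⟩
  exact key (transferInf φ M c).linear (transferInf_linear φ M c)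

end Transfer

/-! ### The bar-cobar resolution and Fox calculus -/

section Rectification

variable {k : Type u} [Field k] {r : ℕ}

section Algebra

variable (M : Type u) [AddCommGroup M] [Module k M]
  (ρ : FreeAlgebra k (Gen r) →ₐ[k] Module.End k M)

/-- The underlying space `Ω S_c ⊗ S_c ⊗ M` of the bar-cobar resolution. -/
abbrev Rect (k : Type u) [Field k] (r : ℕ) (M : Type u) [AddCommGroup M] [Module k M] : Type u :=
  FreeAlgebra k (Gen r) ⊗[k] (PolyCoalg k r ⊗[k] M)

variable {M}

theorem rect_hom_ext {N : Type*} [AddCommGroup N] [Module k N] {f g : Rect k r M →ₗ[k] N}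
    (h : ∀ w a m, f (w ⊗ₜ (PolyCoalg.mono k a ⊗ₜ m)) = g (w ⊗ₜ (PolyCoalg.mono k a ⊗ₜ m))) :
    f = g := by
  refine TensorProduct.ext' fun w b => ?_
  induction b using bar_induction with
  | mono a m => exact h w a m
  | add x y hx hy => rw [TensorProduct.tmul_add, map_add, map_add, hx, hy]

/-- The left-hand twisting map `c ⊗ m ↦ ∑ ι(c') ⊗ c'' ⊗ m`. -/
noncomputable def rectTwist : PolyCoalg k r ⊗[k] M →ₗ[k] Rect k r M :=
  (TensorProduct.assoc k (FreeAlgebra k (Gen r)) (PolyCoalg k r) M).toLinearMap ∘ₗ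
    LinearMap.rTensor M (LinearMap.rTensor (PolyCoalg k r) (PolyCoalg.lin k (gen k)) ∘ₗ
      Coalgebra.comul (R := k))

theorem rectTwist_mono (a : Fin r →₀ ℕ) (m : M) :
    rectTwist (PolyCoalg.mono k a ⊗ₜ m) = ∑ p ∈ Finset.HasAntidiagonal.antidiagonal a,
      gen k p.1 ⊗ₜ[k] (PolyCoalg.mono k p.2 ⊗ₜ[k] m) := by
  simp only [rectTwist, LinearMap.comp_apply, LinearMap.rTensor_tmul, PolyCoalg.comul_mono,
    TensorProduct.sum_tmul, map_sum, LinearEquiv.coe_coe, TensorProduct.assoc_tmul,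
    PolyCoalg.lin_mono]

/-- The differential of the bar-cobar resolution, given the differential of the bar
construction. -/
noncomputable def rectD (δ : PolyCoalg k r ⊗[k] M →ₗ[k] PolyCoalg k r ⊗[k] M) :
    Rect k r M →ₗ[k] Rect k r M :=
  LinearMap.rTensor _ (cobarD k r) + LinearMap.lTensor _ δ +
    TensorProduct.lift ((Algebra.lsmul k k (Rect k r M)).toLinearMap.compl₂ rectTwist)

theorem rectD_tmul (δ : PolyCoalg k r ⊗[k] M →ₗ[k] PolyCoalg k r ⊗[k] M)
    (w : FreeAlgebra k (Gen r)) (b : PolyCoalg k r ⊗[k] M) :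
    rectD δ (w ⊗ₜ b) = cobarD k r w ⊗ₜ b + w ⊗ₜ δ b + w • rectTwist b := rfl

theorem rectD_smul (δ : PolyCoalg k r ⊗[k] M →ₗ[k] PolyCoalg k r ⊗[k] M)
    (w : FreeAlgebra k (Gen r)) (x : Rect k r M) :
    rectD δ (w • x) = cobarD k r w • x + w • rectD δ x := by
  induction x using TensorProduct.induction_on with
  | zero => simp
  | add x y hx hy => rw [smul_add, map_add, hx, hy, map_add, smul_add, smul_add]; abel
  | tmul v b =>
    rw [TensorProduct.smul_tmul', smul_eq_mul, rectD_tmul, rectD_tmul, cobarD_mul, smul_add,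
      smul_add, TensorProduct.smul_tmul', TensorProduct.smul_tmul', TensorProduct.smul_tmul',
      TensorProduct.add_tmul, smul_eq_mul, smul_eq_mul, smul_eq_mul, mul_smul]
    abel

/-- The differential of the bar construction of `M`, for the universal twisting morphism. -/
def IsBarD (d : M →ₗ[k] M) (δ : PolyCoalg k r ⊗[k] M →ₗ[k] PolyCoalg k r ⊗[k] M) : Prop :=
  ∀ a m, δ (PolyCoalg.mono k a ⊗ₜ m) = PolyCoalg.mono k a ⊗ₜ d m +
    ∑ p ∈ Finset.HasAntidiagonal.antidiagonal a, PolyCoalg.mono k p.1 ⊗ₜ ρ (gen k p.2) m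

variable {ρ} {d : M →ₗ[k] M} {δ : PolyCoalg k r ⊗[k] M →ₗ[k] PolyCoalg k r ⊗[k] M}

/-- The differential D is a derivation over the cobar differential, so D² is Ω S_c-linear in
characteristic two. It suffices to evaluate it on 1 ⊗ x^(a) ⊗ m, where coassociativity makes all
terms cancel in pairs. -/
theorem rectD_sq [CharP k 2] (hδ : IsBarD ρ d δ) (hδ2 : ∀ b, δ (δ b) = 0) (x : Rect k r M) :
    rectD δ (rectD δ x) = 0 := by
  have h1 : ∀ b, rectD δ ((1 : FreeAlgebra k (Gen r)) ⊗ₜ b) = 1 ⊗ₜ δ b + rectTwist b := by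
    intro b
    rw [rectD_tmul, cobarD_one, TensorProduct.zero_tmul, zero_add, one_smul]
  have h2 : ∀ b, rectD δ (rectD δ ((1 : FreeAlgebra k (Gen r)) ⊗ₜ b)) = 0 := by
    intro b
    induction b using bar_induction with
    | add x y hx hy => rw [TensorProduct.tmul_add, map_add, map_add, hx, hy, add_zero]
    | mono a m =>
      rw [h1, map_add, h1, hδ2, TensorProduct.tmul_zero, zero_add, hδ, map_add, rectTwist_mono,
        rectTwist_mono, map_sum, map_sum]
      simp only [rectTwist_mono, rectD_tmul, cobarD_gen, Finset.sum_add_distrib,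
        TensorProduct.sum_tmul, Finset.smul_sum, TensorProduct.smul_tmul', smul_eq_mul,
        TensorProduct.tmul_add, TensorProduct.tmul_sum, hδ _ m]
      rw [PolyCoalg.sum_antidiagonal_assoc r a fun x y z =>
          (gen k x * gen k y) ⊗ₜ[k] (PolyCoalg.mono k z ⊗ₜ[k] m),
        PolyCoalg.sum_antidiagonal_assoc r a fun x y z =>
          gen k x ⊗ₜ[k] (PolyCoalg.mono k y ⊗ₜ[k] ρ (gen k z) m)]
      have h2 : ∀ x y z : Rect k r M, x + y + (z + (x + y) + z) = 0 := by
        intro x y z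
        have : x + y + (z + (x + y) + z) = ((x + y) + (x + y)) + (z + z) := by abel
        rw [this, add_self_eq_zero_of_charTwo k, add_self_eq_zero_of_charTwo k, add_zero]
      exact h2 _ _ _
  induction x using TensorProduct.induction_on with
  | zero => simp
  | add x y hx hy => rw [map_add, map_add, hx, hy, add_zero]
  | tmul w b =>
    have h3 : w ⊗ₜ[k] b = w • ((1 : FreeAlgebra k (Gen r)) ⊗ₜ[k] b) := by
      rw [TensorProduct.smul_tmul', smul_eq_mul, mul_one]
    rw [h3, rectD_smul, map_add, rectD_smul, rectD_smul, h2, cobarD_sq, zero_smul, smul_zero,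
      zero_add, add_zero]
    exact add_self_eq_zero_of_charTwo k _

/-- The projection of `S_c ⊗ M` to the coefficient of `mono 0`. -/
noncomputable def barCounit (k : Type u) [Field k] (r : ℕ) (M : Type u) [AddCommGroup M]
    [Module k M] : PolyCoalg k r ⊗[k] M →ₗ[k] M :=
  TensorProduct.lift (PolyCoalg.lin k fun a => if a = 0 then LinearMap.id else 0)

theorem barCounit_mono (a : Fin r →₀ ℕ) (m : M) :
    barCounit k r M (PolyCoalg.mono k a ⊗ₜ m) = if a = 0 then m else 0 := by
  rw [barCounit, TensorProduct.lift.tmul, PolyCoalg.lin_mono]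
  split_ifs <;> rfl

variable (ρ)

/-- The map `w ⊗ mono a ⊗ m ↦ w * gen a ⊗ m + w ⊗ gen a • m`. -/
noncomputable def rectPhi : Rect k r M →ₗ[k] FreeAlgebra k (Gen r) ⊗[k] M :=
  TensorProduct.lift ((Algebra.lsmul k k (FreeAlgebra k (Gen r) ⊗[k] M)).toLinearMap.compl₂
    (TensorProduct.lift (PolyCoalg.lin k fun a =>
      TensorProduct.mk k _ M (gen k a) + TensorProduct.mk k _ M 1 ∘ₗ ρ (gen k a))))

theorem rectPhi_tmul (w : FreeAlgebra k (Gen r)) (a : Fin r →₀ ℕ) (m : M) :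
    rectPhi ρ (w ⊗ₜ (PolyCoalg.mono k a ⊗ₜ m)) =
      (w * gen k a) ⊗ₜ m + w ⊗ₜ ρ (gen k a) m := by
  have h : rectPhi ρ (w ⊗ₜ (PolyCoalg.mono k a ⊗ₜ m)) = w • (PolyCoalg.lin k (fun a =>
      (TensorProduct.mk k (FreeAlgebra k (Gen r)) M (gen k a) +
        TensorProduct.mk k (FreeAlgebra k (Gen r)) M 1 ∘ₗ ρ (gen k a) :
          M →ₗ[k] FreeAlgebra k (Gen r) ⊗[k] M)) (PolyCoalg.mono k a) m) := rfl
  rw [h, PolyCoalg.lin_mono, LinearMap.add_apply, smul_add]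
  simp [TensorProduct.smul_tmul']

theorem rectPhi_smul (w : FreeAlgebra k (Gen r)) (x : Rect k r M) :
    rectPhi ρ (w • x) = w • rectPhi ρ x := by
  induction x using TensorProduct.induction_on with
  | zero => simp
  | add x y hx hy => rw [smul_add, map_add, hx, hy, map_add, smul_add]
  | tmul v b =>
    rw [TensorProduct.smul_tmul', smul_eq_mul]
    exact mul_smul w v _

/-- The algebra map whose off-diagonal entry is the universal derivation. -/
noncomputable def rectTheta : FreeAlgebra k (Gen r) →ₐ[k] Module.End k (Rect k r M × M) :=
  FreeAlgebra.lift k fun g => LinearMap.prod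
    (Algebra.lsmul k k (Rect k r M) (FreeAlgebra.ι k g) ∘ₗ LinearMap.fst k _ _ +
      TensorProduct.mk k _ _ 1 ∘ₗ TensorProduct.mk k _ _ (PolyCoalg.mono k g.1) ∘ₗ
        LinearMap.snd k _ _)
    (ρ (FreeAlgebra.ι k g) ∘ₗ LinearMap.snd k _ _)

theorem rectTheta_ι (g : Gen r) (x : Rect k r M × M) : rectTheta ρ (FreeAlgebra.ι k g) x =
    (FreeAlgebra.ι k g • x.1 + 1 ⊗ₜ (PolyCoalg.mono k g.1 ⊗ₜ x.2),
      ρ (FreeAlgebra.ι k g) x.2) := by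
  rw [rectTheta, FreeAlgebra.lift_ι_apply]; rfl

theorem rectTheta_apply (w : FreeAlgebra k (Gen r)) (x : Rect k r M) (m : M) :
    rectTheta ρ w (x, m) = (w • x + (rectTheta ρ w (0, m)).1, ρ w m) := by
  induction w using FreeAlgebra.induction generalizing x m with
  | grade0 c => simp [Algebra.algebraMap_eq_smul_one]
  | grade1 g => simp [rectTheta_ι]
  | mul a b ha hb =>
    rw [map_mul, Module.End.mul_apply, Module.End.mul_apply, hb x, hb 0, ha,
      ha (b • 0 + _), map_mul, mul_smul, smul_add, smul_zero, zero_add, add_assoc]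
    rfl
  | add a b ha hb =>
    rw [map_add, LinearMap.add_apply, LinearMap.add_apply, ha x, hb x, map_add, add_smul,
      Prod.fst_add]
    refine Prod.ext ?_ rfl
    exact add_add_add_comm _ _ _ _

/-- The Fox derivative `x₁ ⋯ xₙ ⊗ m ↦ ∑ x₁ ⋯ x_{j-1} ⊗ x_j ⊗ x_{j+1} ⋯ xₙ m`. -/
noncomputable def rectSigma : FreeAlgebra k (Gen r) ⊗[k] M →ₗ[k] Rect k r M :=
  TensorProduct.lift
    { toFun := fun w => LinearMap.fst k _ _ ∘ₗ rectTheta ρ w ∘ₗ LinearMap.inr k _ _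
      map_add' := fun v w => by rw [map_add]; rfl
      map_smul' := fun c w => by rw [map_smul]; rfl }

theorem rectSigma_tmul (w : FreeAlgebra k (Gen r)) (m : M) :
    rectSigma ρ (w ⊗ₜ m) = (rectTheta ρ w (0, m)).1 := rfl

theorem rectSigma_mul (v w : FreeAlgebra k (Gen r)) (m : M) :
    rectSigma ρ ((v * w) ⊗ₜ m) = v • rectSigma ρ (w ⊗ₜ m) + rectSigma ρ (v ⊗ₜ ρ w m) := by
  rw [rectSigma_tmul, map_mul, Module.End.mul_apply, rectTheta_apply ρ w, smul_zero, zero_add,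
    rectTheta_apply ρ v]
  rfl

theorem rectSigma_gen (a : Fin r →₀ ℕ) (m : M) : rectSigma ρ (gen k a ⊗ₜ m) =
    if a = 0 then 0 else 1 ⊗ₜ (PolyCoalg.mono k a ⊗ₜ m) := by
  split_ifs with h
  · rw [gen, dif_neg (by simpa using h), TensorProduct.zero_tmul, map_zero]
  · rw [gen, dif_pos h, rectSigma_tmul, rectTheta_ι, smul_zero, zero_add]

/-- With `rectPhi_rectSigma`, this splits the standard resolution Ω ⊗ S̄_c ⊗ M → Ω ⊗ M → M over the
free algebra Ω = Ω S_c, where S̄_c is spanned by the x^(a) with a ≠ 0. The correction term appears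
because x^(0) is not a generator. -/
theorem rectSigma_rectPhi [CharP k 2] (x : Rect k r M) : rectSigma ρ (rectPhi ρ x) =
    x + LinearMap.lTensor _ (TensorProduct.mk k _ M (PolyCoalg.mono k 0))
      (LinearMap.lTensor _ (barCounit k r M) x) := by
  refine LinearMap.congr_fun (f := rectSigma ρ ∘ₗ rectPhi ρ) (g := LinearMap.id +
    LinearMap.lTensor _ (TensorProduct.mk k _ M (PolyCoalg.mono k 0)) ∘ₗ
      LinearMap.lTensor _ (barCounit k r M)) (rect_hom_ext fun w a m => ?_) x
  rw [LinearMap.comp_apply, rectPhi_tmul, map_add, rectSigma_mul, rectSigma_gen, add_assoc,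
    add_self_eq_zero_of_charTwo k, add_zero, LinearMap.add_apply, LinearMap.comp_apply,
    LinearMap.lTensor_tmul, barCounit_mono, LinearMap.lTensor_tmul, LinearMap.id_apply]
  split_ifs with h
  · subst h
    rw [smul_zero]
    exact (add_self_eq_zero_of_charTwo k _).symm
  · rw [map_zero, TensorProduct.tmul_zero, add_zero, TensorProduct.smul_tmul', smul_eq_mul,
      mul_one]

/-- A telescoping sum: for a word x₁ ⋯ xₙ, the terms x₁ ⋯ x_j ⊗ x_{j+1} ⋯ xₙ m occur twice, except
for the two ends. -/
theorem rectPhi_rectSigma [CharP k 2] (w : FreeAlgebra k (Gen r)) (m : M) :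
    rectPhi ρ (rectSigma ρ (w ⊗ₜ m)) = w ⊗ₜ m + 1 ⊗ₜ ρ w m := by
  induction w using FreeAlgebra.induction generalizing m with
  | grade0 c =>
    have h : rectSigma ρ (algebraMap k _ c ⊗ₜ m) = 0 := by
      rw [rectSigma_tmul, AlgHom.commutes, Module.algebraMap_end_apply]
      exact smul_zero _
    rw [h, map_zero, AlgHom.commutes, Module.algebraMap_end_apply,
      Algebra.algebraMap_eq_smul_one, TensorProduct.smul_tmul, add_self_eq_zero_of_charTwo k]
  | grade1 g =>
    have h : FreeAlgebra.ι k g = gen k g.1 := by rw [gen, dif_pos g.2]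
    rw [h, rectSigma_gen, if_neg g.2, rectPhi_tmul, one_mul]
  | mul a b ha hb =>
    rw [rectSigma_mul, map_add, rectPhi_smul, hb, ha, smul_add, TensorProduct.smul_tmul',
      TensorProduct.smul_tmul', smul_eq_mul, smul_eq_mul, mul_one, map_mul, Module.End.mul_apply,
      add_assoc, ← add_assoc (a ⊗ₜ[k] _), add_self_eq_zero_of_charTwo k, zero_add]
  | add a b ha hb =>
    rw [TensorProduct.add_tmul, map_add, map_add, ha, hb, map_add, LinearMap.add_apply,
      TensorProduct.tmul_add]
    abel

/-- The middle factor of a Fox derivative is a generator x^(a) with a ≠ 0, so it has no component at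
x^(0). -/
theorem barCounit_rectSigma (x : FreeAlgebra k (Gen r) ⊗[k] M) :
    LinearMap.lTensor _ (barCounit k r M) (rectSigma ρ x) = 0 := by
  have hs : ∀ (w : FreeAlgebra k (Gen r)) (y : Rect k r M),
      LinearMap.lTensor (FreeAlgebra k (Gen r)) (barCounit k r M) (w • y) =
      w • LinearMap.lTensor (FreeAlgebra k (Gen r)) (barCounit k r M) y := by
    intro w y
    induction y using TensorProduct.induction_on with
    | zero => simp
    | add x y hx hy => rw [smul_add, map_add, hx, hy, map_add, smul_add]
    | tmul v b => rw [TensorProduct.smul_tmul', LinearMap.lTensor_tmul, LinearMap.lTensor_tmul,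
        TensorProduct.smul_tmul']
  induction x using TensorProduct.induction_on with
  | zero => simp
  | add x y hx hy => rw [map_add, map_add, hx, hy, add_zero]
  | tmul w m =>
    induction w using FreeAlgebra.induction generalizing m with
    | grade0 c =>
      rw [rectSigma_tmul, AlgHom.commutes, Module.algebraMap_end_apply]
      simp
    | grade1 g =>
      have h : FreeAlgebra.ι k g = gen k g.1 := by rw [gen, dif_pos g.2]
      rw [h, rectSigma_gen, if_neg g.2, LinearMap.lTensor_tmul, barCounit_mono, if_neg g.2,
        TensorProduct.tmul_zero]
    | mul a b ha hb => rw [rectSigma_mul, map_add, hs, hb, ha, smul_zero, add_zero]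
    | add a b ha hb => rw [TensorProduct.add_tmul, map_add, map_add, ha, hb, add_zero]

/-- The twisting terms reach the component of x^(0) only by moving all of a to the left or all of a
to the right. These are the two terms of `rectPhi`. -/
theorem barCounit_rectD (hδ : IsBarD ρ d δ) (x : Rect k r M) :
    LinearMap.lTensor _ (barCounit k r M) (rectD δ x) = rectPhi ρ x +
      (LinearMap.rTensor M (cobarD k r) + LinearMap.lTensor (FreeAlgebra k (Gen r)) d)
        (LinearMap.lTensor _ (barCounit k r M) x) := by
  refine LinearMap.congr_fun (f := LinearMap.lTensor _ (barCounit k r M) ∘ₗ rectD δ)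
    (g := rectPhi ρ + (LinearMap.rTensor M (cobarD k r) +
      LinearMap.lTensor (FreeAlgebra k (Gen r)) d) ∘ₗ LinearMap.lTensor _ (barCounit k r M)) (rect_hom_ext fun w a m => ?_) x
  have h1 : ∑ p ∈ Finset.HasAntidiagonal.antidiagonal a,
      (if p.1 = 0 then ρ (gen k p.2) m else 0) = ρ (gen k a) m := by
    rw [Finset.sum_eq_single_of_mem (0, a) (by simp)]
    · rw [if_pos rfl]
    · rintro ⟨b, c⟩ hp hne
      rw [Finset.HasAntidiagonal.mem_antidiagonal] at hp
      rw [if_neg]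
      rintro rfl
      exact hne (by simpa using hp)
  have h2 : ∑ p ∈ Finset.HasAntidiagonal.antidiagonal a,
      (w * gen k p.1) ⊗ₜ[k] (if p.2 = 0 then m else 0) = (w * gen k a) ⊗ₜ[k] m := by
    rw [Finset.sum_eq_single_of_mem (a, 0) (by simp)]
    · rw [if_pos rfl]
    · rintro ⟨b, c⟩ hp hne
      rw [Finset.HasAntidiagonal.mem_antidiagonal] at hp
      rw [if_neg, TensorProduct.tmul_zero]
      rintro rfl
      exact hne (by simpa using hp)
  simp only [LinearMap.comp_apply, rectD_tmul, map_add, LinearMap.lTensor_tmul, hδ a m, map_sum,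
    barCounit_mono, h1, rectTwist_mono, Finset.smul_sum, TensorProduct.smul_tmul', smul_eq_mul, h2,
    LinearMap.add_apply, rectPhi_tmul, LinearMap.rTensor_tmul, TensorProduct.tmul_add]
  split_ifs
  · abel
  · simp only [map_zero, TensorProduct.tmul_zero]
    abel

/-- Let q be the component at x^(0), let Φ and σ be `rectPhi` and `rectSigma`, and use q D = Φ + d
q. For y = σ(q x) one has q y = 0 and q D y = Φ σ q x = q x, since the action kills q x. Hence z = x
- D y satisfies q z = 0 and D z = 0, so Φ z = q D z = 0 and z = σ Φ z = 0. The augmentation onto M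
thus has an acyclic kernel. -/
theorem exists_rectD_eq [CharP k 2] (hδ : IsBarD ρ d δ) (hδ2 : ∀ b, δ (δ b) = 0)
    (x : Rect k r M)
    (hx : TensorProduct.lift ρ.toLinearMap (LinearMap.lTensor _ (barCounit k r M) x) = 0)
    (hDx : rectD δ x = 0) :
    ∃ y, LinearMap.lTensor _ (barCounit k r M) y = 0 ∧ x = rectD δ y := by
  have hφσ : ∀ y, rectPhi ρ (rectSigma ρ y) = y + 1 ⊗ₜ TensorProduct.lift ρ.toLinearMap y := by
    intro y
    induction y using TensorProduct.induction_on with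
    | zero => simp
    | add x y hx hy => rw [map_add, map_add, hx, hy, map_add, TensorProduct.tmul_add]; abel
    | tmul w m => rw [rectPhi_rectSigma]; rfl
  let q := LinearMap.lTensor (FreeAlgebra k (Gen r)) (barCounit k r M)
  let y := rectSigma ρ (q x)
  have hy : q y = 0 := barCounit_rectSigma ρ _
  refine ⟨y, hy, ?_⟩
  have h1 : q (rectD δ y) = q x := by
    refine (barCounit_rectD ρ hδ y).trans ?_
    rw [show LinearMap.lTensor _ (barCounit k r M) y = 0 from hy, map_zero, add_zero, hφσ, hx,
      TensorProduct.tmul_zero, add_zero]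
  have h2 : q (x - rectD δ y) = 0 := by rw [map_sub, h1, sub_self]
  have h3 := barCounit_rectD ρ hδ (x - rectD δ y)
  rw [show LinearMap.lTensor _ (barCounit k r M) (x - rectD δ y) = 0 from h2, map_zero, add_zero,
    map_sub, hDx, rectD_sq hδ hδ2, sub_zero, map_zero] at h3
  have h4 := rectSigma_rectPhi ρ (x - rectD δ y)
  rw [← h3, show LinearMap.lTensor _ (barCounit k r M) (x - rectD δ y) = 0 from h2, map_zero,
    map_zero, add_zero] at h4
  exact sub_eq_zero.1 h4.symm

end Algebra

end Rectification

/-! ### From ∞-quasi-isomorphisms to zigzags of modules -/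

section RectModule

variable {k : Type u} [Field k] {r : ℕ}

theorem rect_smul_mem {M : Type u} [AddCommGroup M] [Module k M] {𝒱 : ℤ → Submodule k M} {i j : ℤ}
    {w : FreeAlgebra k (Gen r)} (hw : w ∈ cobarDeg k r i) {x : FreeAlgebra k (Gen r) ⊗[k] M}
    (hx : x ∈ tensorDeg (cobarDeg k r) 𝒱 j) : w • x ∈ tensorDeg (cobarDeg k r) 𝒱 (i + j) := by
  induction hx using Submodule.span_induction with
  | mem x h =>
    obtain ⟨m, n, rfl, v, hv, y, hy, rfl⟩ := h
    rw [TensorProduct.smul_tmul', smul_eq_mul]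
    exact tmul_mem_tensorDeg (SetLike.GradedMul.mul_mem hw hv) hy (by ring)
  | zero => rw [smul_zero]; exact Submodule.zero_mem _
  | add x y _ _ hx hy => rw [smul_add]; exact Submodule.add_mem _ hx hy
  | smul c x _ hx => rw [smul_comm]; exact Submodule.smul_mem _ _ hx

theorem rectTwist_mem {M : DGMod k} {n : ℤ} {x : PolyCoalg k r ⊗[k] M}
    (hx : x ∈ tensorDeg (PolyCoalg.cdeg k r) M.deg n) :
    rectTwist x ∈ tensorDeg (cobarDeg k r) (tensorDeg (PolyCoalg.cdeg k r) M.deg) (n - 1) := by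
  refine tensorDeg_induction hx (P := fun x => rectTwist x ∈
    tensorDeg (cobarDeg k r) (tensorDeg (PolyCoalg.cdeg k r) M.deg) (n - 1)) ?_ ?_ ?_ ?_
  · intro a m hm
    rw [rectTwist_mono]
    refine Submodule.sum_mem _ fun p hp => ?_
    rw [Finset.HasAntidiagonal.mem_antidiagonal] at hp
    refine tmul_mem_tensorDeg (gen_mem k r p.1)
      (tmul_mem_tensorDeg (PolyCoalg.mono_mem k p.2) hm rfl) ?_
    rw [← hp, map_add]
    push_cast
    ring
  · rw [map_zero]; exact Submodule.zero_mem _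
  · intro y z hy hz; rw [map_add]; exact Submodule.add_mem _ hy hz
  · intro c y hy; rw [map_smul]; exact Submodule.smul_mem _ _ hy

variable [CharP k 2] (V : DGAlgMod (cobar k r))

/-- The action of a dg `Ω S_c`-module, as a representation of the free algebra. -/
noncomputable def cobarAct : FreeAlgebra k (Gen r) →ₐ[k] Module.End k V.toDGMod := V.act

theorem isBarD_barD : IsBarD (cobarAct V) V.toDGMod.d ((iotaTw k r).barD V) := by
  intro a m
  rw [Twisting.barD_mono]
  simp only [iotaTw_mono]
  rfl

theorem rectD_mem {n : ℤ} {x : Rect k r V.toDGMod}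
    (hx : x ∈ tensorDeg (cobarDeg k r) (tensorDeg (PolyCoalg.cdeg k r) V.toDGMod.deg) n) :
    rectD ((iotaTw k r).barD V) x ∈
      tensorDeg (cobarDeg k r) (tensorDeg (PolyCoalg.cdeg k r) V.toDGMod.deg) (n - 1) := by
  induction hx using Submodule.span_induction with
  | mem x h =>
    obtain ⟨i, j, rfl, w, hw, b, hb, rfl⟩ := h
    rw [rectD_tmul]
    refine Submodule.add_mem _ (Submodule.add_mem _ ?_ ?_) ?_
    · exact tmul_mem_tensorDeg (cobarD_mem k r _ _ hw) hb (by ring)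
    · exact tmul_mem_tensorDeg hw (barD_mem _ _ hb) (by ring)
    · rw [add_sub_assoc]
      exact rect_smul_mem hw (rectTwist_mem hb)
  | zero => rw [map_zero]; exact Submodule.zero_mem _
  | add x y _ _ hx hy => rw [map_add]; exact Submodule.add_mem _ hx hy
  | smul c x _ hx => rw [map_smul]; exact Submodule.smul_mem _ _ hx

/-- The action of the free algebra on the bar-cobar resolution. -/
noncomputable def rectAct (k : Type u) [Field k] (r : ℕ) (M : Type u) [AddCommGroup M]
    [Module k M] : FreeAlgebra k (Gen r) →ₐ[k] Module.End k (Rect k r M) :=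
  Algebra.lsmul k k (Rect k r M)

/-- The bar-cobar resolution of a dg `Ω S_c`-module. -/
noncomputable def rectMod : DGAlgMod (cobar k r) where
  toDGMod :=
    { carrier := Rect k r V.toDGMod
      deg := tensorDeg (cobarDeg k r) (tensorDeg (PolyCoalg.cdeg k r) V.toDGMod.deg)
      internal := tensorDeg_isInternal (cobarDeg_isInternal k r)
        (tensorDeg_isInternal (PolyCoalg.cdeg_isInternal k r) V.toDGMod.internal)
      d := rectD ((iotaTw k r).barD V)
      d_deg := fun _ _ hx => rectD_mem V hx
      d_sq := rectD_sq (isBarD_barD V) ((iotaTw k r).barD_sq V) }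
  action :=
    { act := rectAct k r V.toDGMod
      act_deg := fun _ _ _ hw _ hx => rect_smul_mem hw hx
      act_d := fun w x => rectD_smul ((iotaTw k r).barD V) w x }

variable {V} {W : DGAlgMod (cobar k r)}

/-- The linear map underlying the map of resolutions. -/
noncomputable def InfMorphism.rectLin (f : InfMorphism V W) :
    Rect k r V.toDGMod →ₗ[k] W.toDGMod :=
  TensorProduct.lift ((cobarAct W).toLinearMap.compl₂ (TensorProduct.lift f.toLin))

theorem InfMorphism.rectLin_tmul (f : InfMorphism V W) (w : FreeAlgebra k (Gen r))
    (b : PolyCoalg k r ⊗[k] V.toDGMod) :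
    f.rectLin (w ⊗ₜ b) = cobarAct W w (TensorProduct.lift f.toLin b) := rfl

theorem InfMorphism.rectLin_smul (f : InfMorphism V W) (w : FreeAlgebra k (Gen r))
    (x : Rect k r V.toDGMod) : f.rectLin (w • x) = cobarAct W w (f.rectLin x) := by
  induction x using TensorProduct.induction_on with
  | zero => simp
  | tmul v b =>
    rw [TensorProduct.smul_tmul', smul_eq_mul, rectLin_tmul, rectLin_tmul, map_mul]
    rfl
  | add x y hx hy => rw [smul_add, map_add, hx, hy, map_add, map_add]

/-- The equation of an ∞-morphism, rearranged: the strict map w ⊗ c ⊗ v ↦ w f_c(v) commutes with the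
differentials on 1 ⊗ S_c ⊗ V. -/
theorem InfMorphism.lift_barD (f : InfMorphism V W) (b : PolyCoalg k r ⊗[k] V.toDGMod) :
    TensorProduct.lift f.toLin ((iotaTw k r).barD V b) + f.rectLin (rectTwist b) =
      W.toDGMod.d (TensorProduct.lift f.toLin b) := by
  refine LinearMap.congr_fun (f := TensorProduct.lift f.toLin ∘ₗ (iotaTw k r).barD V +
    f.rectLin ∘ₗ rectTwist) (g := W.toDGMod.d ∘ₗ TensorProduct.lift f.toLin)
    (tensor_hom_ext fun a m => ?_) b
  have h := f.eqn a m
  rw [LinearMap.add_apply, LinearMap.comp_apply, LinearMap.comp_apply, LinearMap.comp_apply,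
    Twisting.barD_mono, rectTwist_mono, map_add, map_sum, map_sum, TensorProduct.lift.tmul]
  simp only [TensorProduct.lift.tmul, rectLin_tmul]
  have h3 : ∀ c, cobarAct W (gen k c) = W.act ((iotaTw k r).toLin (PolyCoalg.mono k c)) := by
    intro c
    rw [iotaTw_mono]; rfl
  simp only [h3]
  rw [add_assoc, ← h, add_comm (W.toDGMod.d _), ← add_assoc, add_self_eq_zero_of_charTwo k,
    zero_add]

theorem InfMorphism.rectLin_mem (f : InfMorphism V W) {n : ℤ} {x : Rect k r V.toDGMod}
    (hx : x ∈ tensorDeg (cobarDeg k r) (tensorDeg (PolyCoalg.cdeg k r) V.toDGMod.deg) n) :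
    f.rectLin x ∈ W.toDGMod.deg n := by
  induction hx using Submodule.span_induction with
  | mem x h =>
    obtain ⟨i, j, rfl, w, hw, b, hb, rfl⟩ := h
    refine W.action.act_deg i j w hw _ ?_
    exact map_tensorDeg (TensorProduct.lift f.toLin)
      (fun a n m hm => f.map_deg _ n _ (PolyCoalg.mono_mem k a) m hm) j b hb
  | zero => rw [map_zero]; exact Submodule.zero_mem _
  | add x y _ _ hx hy => rw [map_add]; exact Submodule.add_mem _ hx hy
  | smul c x _ hx => rw [map_smul]; exact Submodule.smul_mem _ _ hx

/-- The map of resolutions induced by an `∞`-morphism. -/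
noncomputable def InfMorphism.rectMap (f : InfMorphism V W) : DGAlgMod.Hom (rectMod V) W where
  toLin := f.rectLin
  map_deg := fun _ _ hx => f.rectLin_mem hx
  comm := by
    refine fun x => LinearMap.congr_fun (f := f.rectLin ∘ₗ rectD ((iotaTw k r).barD V))
      (g := W.toDGMod.d ∘ₗ f.rectLin) (TensorProduct.ext' fun w b => ?_) x
    rw [LinearMap.comp_apply, rectD_tmul, map_add, map_add, InfMorphism.rectLin_smul,
      LinearMap.comp_apply]
    rw [InfMorphism.rectLin_tmul, InfMorphism.rectLin_tmul, InfMorphism.rectLin_tmul, add_assoc,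
      ← map_add, InfMorphism.lift_barD]
    exact (W.action.act_d w _).symm
  map_act := f.rectLin_smul

/-- The identity `∞`-morphism. -/
noncomputable def InfMorphism.id (V : DGAlgMod (cobar k r)) : InfMorphism V V :=
  InfMorphism.ofFamily (fun a => if a = 0 then LinearMap.id else 0)
    (by
      intro a n v hv
      split_ifs with h
      · subst h
        simpa using hv
      · exact Submodule.zero_mem _)
    (by
      intro a v
      -- Only the splittings (0, a) and (a, 0) contribute. Both give ι(x^(a)) v, and they cancel.
      rw [Finset.sum_eq_single_of_mem (0, a) (by simp), Finset.sum_eq_single_of_mem (a, 0) (by simp),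
        if_pos rfl, LinearMap.id_apply, LinearMap.id_apply, add_self_eq_zero_of_charTwo k]
      · split_ifs
        · exact add_self_eq_zero_of_charTwo k _
        · rw [LinearMap.zero_apply, LinearMap.zero_apply, map_zero, add_zero]
      · rintro ⟨b, c⟩ hp hne
        rw [Finset.HasAntidiagonal.mem_antidiagonal] at hp
        rw [if_neg, LinearMap.zero_apply, map_zero]
        rintro rfl
        exact hne (by simpa using hp)
      · rintro ⟨b, c⟩ hp hne
        rw [Finset.HasAntidiagonal.mem_antidiagonal] at hp
        rw [if_neg, LinearMap.zero_apply]
        rintro rfl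
        exact hne (by simpa using hp))

theorem InfMorphism.lift_id (b : PolyCoalg k r ⊗[k] V.toDGMod) :
    TensorProduct.lift (InfMorphism.id V).toLin b = barCounit k r V.toDGMod b := rfl

/-- The augmentation w ⊗ c ⊗ v ↦ ε(c) w v is onto, and its kernel is acyclic by `exists_rectD_eq`.
-/
theorem InfMorphism.rectMap_id_isQuasiIso (V : DGAlgMod (cobar k r)) :
    (InfMorphism.id V).rectMap.IsQuasiIso := by
  have h : ∀ x, (InfMorphism.id V).rectLin x = TensorProduct.lift (cobarAct V).toLinearMap
      (LinearMap.lTensor _ (barCounit k r V.toDGMod) x) := by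
    intro x
    induction x using TensorProduct.induction_on with
    | zero => simp
    | tmul w b => rfl
    | add x y hx hy => rw [map_add, hx, hy, map_add, map_add]
  refine (InfMorphism.id V).rectMap.toHom.isQuasiIso_of_ker (fun v => ?_) fun x hx hDx => ?_
  · refine ⟨(1 : FreeAlgebra k (Gen r)) ⊗ₜ (PolyCoalg.mono k 0 ⊗ₜ v), ?_⟩
    refine ((InfMorphism.id V).rectLin_tmul _ _).trans ?_
    rw [map_one, Module.End.one_apply, InfMorphism.lift_id, barCounit_mono, if_pos rfl]
  · obtain ⟨y, hy, hxy⟩ := exists_rectD_eq (cobarAct V) (isBarD_barD V) ((iotaTw k r).barD_sq V) x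
      ((h x).symm.trans hx) hDx
    exact ⟨y, (h y).trans (by rw [hy, map_zero]), hxy⟩

/-- The inclusion of a module in its resolution, a morphism of dg `k`-modules. -/
noncomputable def rectSection (V : DGAlgMod (cobar k r)) :
    DGMod.Hom V.toDGMod (rectMod V).toDGMod where
  toLin := TensorProduct.mk k (FreeAlgebra k (Gen r)) (PolyCoalg k r ⊗[k] V.toDGMod) 1 ∘ₗ
    TensorProduct.mk k (PolyCoalg k r) V.toDGMod (PolyCoalg.mono k 0)
  map_deg n x hx := tmul_mem_tensorDeg (SetLike.GradedOne.one_mem (A := cobarDeg k r))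
    (tmul_mem_tensorDeg (PolyCoalg.mono_mem k 0) hx (by simp)) (zero_add n)
  comm x := by
    have h0 : gen k (0 : Fin r →₀ ℕ) = 0 := dif_neg (by simp)
    change 1 ⊗ₜ (PolyCoalg.mono k 0 ⊗ₜ V.toDGMod.d x) =
      rectD ((iotaTw k r).barD V) ((1 : FreeAlgebra k (Gen r)) ⊗ₜ (PolyCoalg.mono k 0 ⊗ₜ x))
    rw [rectD_tmul, cobarD_one, TensorProduct.zero_tmul, rectTwist_mono, isBarD_barD,
      Finset.HasAntidiagonal.antidiagonal_zero, Finset.sum_singleton, Finset.sum_singleton]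
    simp [h0]

theorem InfMorphism.rectMap_comp_section (f : InfMorphism V W) (x : V.toDGMod) :
    f.rectMap.toLin ((rectSection V).toLin x) = f.linear.toLin x := by
  refine (f.rectLin_tmul _ _).trans ?_
  rw [map_one, Module.End.one_apply]
  rfl

/-- Two out of three, used twice. The section v ↦ 1 ⊗ x^(0) ⊗ v is only a map of complexes over k,
and composing it with the strict map of f gives the linear part of f. For the identity ∞-morphism
this shows that the section is a quasi-isomorphism. For f it then transfers the hypothesis to the
strict map. -/
theorem InfMorphism.rectMap_isQuasiIso (f : InfMorphism V W) (hf : f.linear.IsQuasiIso) :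
    f.rectMap.IsQuasiIso := by
  have key : ∀ {W : DGAlgMod (cobar k r)} (f : InfMorphism V W),
      f.rectMap.toHom.comp (rectSection V) = f.linear := by
    intro W f
    have h : (f.rectMap.toHom.comp (rectSection V)).toLin = f.linear.toLin :=
      LinearMap.ext f.rectMap_comp_section
    generalize f.rectMap.toHom.comp (rectSection V) = g at h
    generalize f.linear = g' at h
    cases g; cases g'
    congr
  have hid : (InfMorphism.id V).linear.IsQuasiIso := by
    refine DGMod.Hom.isQuasiIso_of_bijective _ ?_
    have h : ∀ x, (InfMorphism.id V).linear.toLin x = x := fun x => by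
      have := barCounit_mono (k := k) (0 : Fin r →₀ ℕ) x
      rw [if_pos rfl] at this
      exact this
    exact ⟨fun x y hxy => by rwa [h, h] at hxy, fun x => ⟨x, h x⟩⟩
  have hs : (rectSection V).IsQuasiIso :=
    DGMod.Hom.IsQuasiIso.of_comp_left (InfMorphism.rectMap_id_isQuasiIso V)
      ((key (InfMorphism.id V)).symm ▸ hid)
  exact DGMod.Hom.IsQuasiIso.of_comp_right hs ((key f).symm ▸ hf)

/-- Algebras over `Ω S_c` related by an `∞`-quasi-isomorphism are related by a zigzag of
quasi-isomorphisms. -/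
theorem InfMorphism.zigzag (f : InfMorphism V W) (hf : f.linear.IsQuasiIso) :
    DGAlgMod.Zigzag V W :=
  (Relation.EqvGen.rel _ _ ⟨_, InfMorphism.rectMap_id_isQuasiIso V⟩).symm.trans _ _ _
    (Relation.EqvGen.rel _ _ ⟨_, f.rectMap_isQuasiIso hf⟩)

end RectModule

/-! ### The pairing of `S ⊗ K` with `S_c ⊗ H` -/

section PairMap

variable {k : Type u} [Field k] {r : ℕ}

/-- The pairing between `S` and `S_c`, as a linear map. -/
noncomputable def pairingLin (k : Type u) [Field k] (r : ℕ) :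
    MvPolynomial (Fin r) k →ₗ[k] Module.Dual k (PolyCoalg k r) where
  toFun := PolyCoalg.pairing k r
  map_add' p q := PolyCoalg.hom_ext fun a => by
    simp [PolyCoalg.pairing]
  map_smul' c p := PolyCoalg.hom_ext fun a => by
    simp [PolyCoalg.pairing]

theorem pairing_mono (p : MvPolynomial (Fin r) k) (a : Fin r →₀ ℕ) :
    PolyCoalg.pairing k r p (PolyCoalg.mono k a) = MvPolynomial.coeff a p :=
  PolyCoalg.lin_mono k _ a

variable {H K : Type u} [AddCommGroup H] [Module k H] [AddCommGroup K] [Module k K]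
  (ev : K →ₗ[k] Module.Dual k H)

/-- The map `S ⊗ K → (S_c ⊗ H)^*` induced by a pairing of `K` and `H`. -/
noncomputable def pairMap :
    MvPolynomial (Fin r) k ⊗[k] K →ₗ[k] Module.Dual k (PolyCoalg k r ⊗[k] H) :=
  TensorProduct.dualDistrib k (PolyCoalg k r) H ∘ₗ TensorProduct.map (pairingLin k r) ev

theorem pairMap_tmul (p : MvPolynomial (Fin r) k) (α : K) (c : PolyCoalg k r) (z : H) :
    pairMap ev (p ⊗ₜ α) (c ⊗ₜ z) = PolyCoalg.pairing k r p c * ev α z := rfl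

/-- The coordinates of an element of `S ⊗ K` in the monomial basis. -/
noncomputable def polyCoords (k : Type u) [Field k] (r : ℕ) (K : Type u) [AddCommGroup K]
    [Module k K] : MvPolynomial (Fin r) k ⊗[k] K ≃ₗ[k] (Fin r →₀ ℕ) →₀ K :=
  TensorProduct.equivFinsuppOfBasisLeft (MvPolynomial.basisMonomials (Fin r) k)

theorem polyCoords_tmul (p : MvPolynomial (Fin r) k) (α : K) (a : Fin r →₀ ℕ) :
    polyCoords k r K (p ⊗ₜ α) a = MvPolynomial.coeff a p • α :=
  TensorProduct.equivFinsuppOfBasisLeft_apply_tmul_apply _ _ _ _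

theorem eq_sum_polyCoords (x : MvPolynomial (Fin r) k ⊗[k] K) :
    x = (polyCoords k r K x).sum fun a α => MvPolynomial.monomial a 1 ⊗ₜ α := by
  conv_lhs => rw [← (polyCoords k r K).symm_apply_apply x, polyCoords,
    TensorProduct.equivFinsuppOfBasisLeft_symm_apply]
  rw [MvPolynomial.coe_basisMonomials]
  rfl

theorem pairMap_mono (x : MvPolynomial (Fin r) k ⊗[k] K) (a : Fin r →₀ ℕ) (z : H) :
    pairMap ev x (PolyCoalg.mono k a ⊗ₜ z) = ev (polyCoords k r K x a) z := by
  induction x with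
  | zero => simp
  | tmul p α => rw [pairMap_tmul, pairing_mono, polyCoords_tmul, map_smul]; rfl
  | add x y hx hy => rw [map_add, LinearMap.add_apply, hx, hy, map_add, Finsupp.add_apply, map_add,
      LinearMap.add_apply]

theorem pairMap_injective (hev : Function.Injective ev) :
    Function.Injective (pairMap (r := r) ev) := by
  intro x y h
  refine (polyCoords k r K).injective (Finsupp.ext fun a => hev (LinearMap.ext fun z => ?_))
  rw [← pairMap_mono, ← pairMap_mono, h]

/-- A functional on S_c ⊗ H is a family of functionals on H indexed by the monomials. The bound N
leaves only finitely many nonzero members, and these assemble to an element of S ⊗ K. -/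
theorem exists_pairMap (hev : Function.Surjective ev) (φ : Module.Dual k (PolyCoalg k r ⊗[k] H))
    (N : ℕ) (hφ : ∀ (a : Fin r →₀ ℕ) z, N ≤ a.degree → φ (PolyCoalg.mono k a ⊗ₜ z) = 0) :
    ∃ x, pairMap ev x = φ := by
  classical
  choose θ hθ using fun a => hev (φ ∘ₗ TensorProduct.mk k (PolyCoalg k r) H (PolyCoalg.mono k a))
  have hfin : Set.Finite {a | Finsupp.degree (a : Fin r →₀ ℕ) < N} := by
    refine (Set.finite_Iic (Finsupp.equivFunOnFinite.symm fun _ : Fin r => N)).subset fun a ha i => ?_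
    exact (Finsupp.le_degree i a).trans (le_of_lt ha)
  refine ⟨(polyCoords k r K).symm (∑ a ∈ hfin.toFinset, Finsupp.single a (θ a)),
    tensor_hom_ext fun a z => ?_⟩
  rw [pairMap_mono, LinearEquiv.apply_symm_apply, Finsupp.finsetSum_apply]
  simp only [Finsupp.single_apply]
  rw [Finset.sum_ite_eq']
  split_ifs with h
  · rw [hθ]; rfl
  · rw [map_zero, LinearMap.zero_apply, hφ]
    simpa using h

theorem polyCoords_smul (e : Fin r →₀ ℕ) (x : MvPolynomial (Fin r) k ⊗[k] K) (a : Fin r →₀ ℕ) :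
    polyCoords k r K (MvPolynomial.monomial e (1 : k) • x) a =
      if e ≤ a then polyCoords k r K x (a - e) else 0 := by
  induction x with
  | zero => simp
  | tmul p α =>
    rw [TensorProduct.smul_tmul', smul_eq_mul, polyCoords_tmul, MvPolynomial.coeff_monomial_mul',
      polyCoords_tmul]
    split_ifs
    · rw [one_mul]
    · rw [zero_smul]
  | add x y hx hy =>
    rw [smul_add, map_add, Finsupp.add_apply, hx, hy, map_add, Finsupp.add_apply]
    split_ifs
    · rfl
    · rw [add_zero]

/-- Multiplication on S is the transpose of contraction on S_c: both shift exponents by e. -/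
theorem pairMap_smul {H : DGMod k} (ev : K →ₗ[k] Module.Dual k H) (p : MvPolynomial (Fin r) k)
    (x : MvPolynomial (Fin r) k ⊗[k] K) (y : PolyCoalg k r ⊗[k] H) :
    pairMap ev (p • x) y = pairMap ev x (barAct r H p y) := by
  induction p using MvPolynomial.induction_on' with
  | monomial e c =>
    refine LinearMap.congr_fun (f := pairMap ev (MvPolynomial.monomial e c • x))
      (g := pairMap ev x ∘ₗ barAct r H (MvPolynomial.monomial e c))
      (tensor_hom_ext fun a z => ?_) y
    have h1 : (MvPolynomial.monomial e c : MvPolynomial (Fin r) k) • x =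
        c • (MvPolynomial.monomial e (1 : k) : MvPolynomial (Fin r) k) • x := by
      rw [← smul_assoc, MvPolynomial.smul_monomial, smul_eq_mul, mul_one]
    rw [h1, map_smul, LinearMap.smul_apply, pairMap_mono, polyCoords_smul, LinearMap.comp_apply,
      barAct_tmul, PolyCoalg.contract_monomial, ← TensorProduct.smul_tmul', map_smul]
    refine congrArg (c • ·) ?_
    split_ifs
    · rw [pairMap_mono]
    · rw [map_zero, TensorProduct.zero_tmul, map_zero, LinearMap.zero_apply]
  | add p q hp hq =>
    rw [add_smul, map_add, LinearMap.add_apply, hp, hq, map_add, LinearMap.add_apply, map_add]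

/-- A monomial x^a with a ≠ 0 is divisible by some variable, so only the constant coefficient
obstructs membership. -/
theorem mem_ideal_of_polyCoords (x : MvPolynomial (Fin r) k ⊗[k] K)
    (h : polyCoords k r K x 0 = 0) :
    x ∈ (Ideal.span (Set.range (MvPolynomial.X : Fin r → MvPolynomial (Fin r) k))) •
      (⊤ : Submodule (MvPolynomial (Fin r) k) (MvPolynomial (Fin r) k ⊗[k] K)) := by
  rw [eq_sum_polyCoords x]
  refine Submodule.sum_mem _ fun a ha => ?_
  have ha0 : a ≠ 0 := by
    rintro rfl
    exact (Finsupp.mem_support_iff.1 ha) h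
  obtain ⟨i, hi⟩ : ∃ i, a i ≠ 0 := by
    by_contra! hh
    exact ha0 (Finsupp.ext hh)
  have h1 : (MvPolynomial.monomial a (1 : k) : MvPolynomial (Fin r) k) =
      MvPolynomial.X i * MvPolynomial.monomial (a - Finsupp.single i 1) 1 := by
    rw [MvPolynomial.X, MvPolynomial.monomial_mul, one_mul, add_tsub_cancel_of_le]
    rw [Finsupp.single_le_iff]
    omega
  change MvPolynomial.monomial a 1 ⊗ₜ _ ∈ _
  rw [h1, ← smul_eq_mul, ← TensorProduct.smul_tmul']
  exact Submodule.smul_mem_smul (Ideal.subset_span ⟨i, rfl⟩) trivial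

end PairMap

/-! ### Cohomology as the dual of homology -/

section Evaluation

variable {k : Type u} [Field k]

namespace DGMod

variable (C : DGMod k)

/-- The evaluation of cohomology classes on homology classes. -/
noncomputable def evalHom : C.dual.homology →ₗ[k] Module.Dual k C.homology :=
  C.dual.boundaries.liftQ
    { toFun := fun α => C.boundaries.liftQ (α.1.1 ∘ₗ C.cycles.subtype) (by
        rintro ⟨x, hx⟩ ⟨y, rfl⟩
        exact (dual_d_eq_zero_iff α.1).1 (d_cycle α) y)
      map_add' := fun α β => LinearMap.ext fun x => by
        obtain ⟨z, rfl⟩ := C.boundaries.mkQ_surjective x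
        rfl
      map_smul' := fun c α => LinearMap.ext fun x => by
        obtain ⟨z, rfl⟩ := C.boundaries.mkQ_surjective x
        rfl }
    (by
      rintro ⟨α, hα⟩ ⟨β, rfl⟩
      refine LinearMap.ext fun x => ?_
      obtain ⟨z, rfl⟩ := C.boundaries.mkQ_surjective x
      exact (congrArg β.1 (d_cycle z)).trans (map_zero _))

/-- Over a field, a cocycle that kills every cycle is a coboundary. -/
theorem evalHom_injective : Function.Injective C.evalHom := by
  rw [injective_iff_map_eq_zero]
  intro x hx
  obtain ⟨α, rfl⟩ := exists_hcls x
  rw [hcls_eq_zero_iff]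
  refine exists_dual_d_eq α.1 fun z hz => ?_
  exact LinearMap.congr_fun hx (C.hcls (C.cyc z hz))

theorem evalHom_deg {m n : ℤ} (hmn : m ≠ -n) {α : C.dual.homology} (hα : α ∈ C.dual.homology.deg n)
    {z : C.homology} (hz : z ∈ C.homology.deg m) : C.evalHom α z = 0 := by
  obtain ⟨α, hα, rfl⟩ := hα
  obtain ⟨z, hz, rfl⟩ := hz
  exact hα m hmn z.1 hz

/-- Independent nonzero subspaces of a finite-dimensional space are finite in number. -/
theorem mem_gradedDual_of_finite (V : DGMod k) [Module.Finite k V] (φ : Module.Dual k V) :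
    φ ∈ V.gradedDual := by
  have hfin : {n | V.deg n ≠ ⊥}.Finite :=
    WellFoundedGT.finite_ne_bot_of_iSupIndep V.internal.submodule_iSupIndep
  refine ⟨hfin.toFinset, fun n hn x hx => ?_⟩
  have : V.deg n = ⊥ := by simpa using hn
  rw [this, Submodule.mem_bot] at hx
  rw [hx, map_zero]

/-- The composite φ ∘ proj is a cocycle that represents φ; finiteness puts it in the graded dual. -/
theorem evalHom_surjective [Module.Finite k C] : Function.Surjective C.evalHom := by
  intro φ
  obtain ⟨c⟩ := C.exists_contraction
  let α : C.dual := ⟨φ ∘ₗ c.proj, C.mem_gradedDual_of_finite _⟩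
  have hα : C.dual.d α = 0 := (dual_d_eq_zero_iff α).2 fun x =>
    (congrArg φ (c.proj_d x)).trans (map_zero φ)
  refine ⟨C.dual.hcls (C.dual.cyc α hα), LinearMap.ext fun z => ?_⟩
  obtain ⟨z, rfl⟩ := exists_hcls z
  exact congrArg φ (c.proj_cycle z)

instance finite_homology [Module.Finite k C] : Module.Finite k C.homology :=
  inferInstanceAs (Module.Finite k (C.cycles ⧸ C.boundaries))

end DGMod

end Evaluation

/-! ### The twisted differential on `S ⊗ H^•` and its minimality -/

section HirschBrownModel

variable {k : Type u} [Field k] [CharP k 2] {r : ℕ}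

/-- The transpose of a morphism of dg `S`-modules. -/
noncomputable def dualModMap {M N : DGAlgMod (polyAlg k r)} (f : DGAlgMod.Hom M N) :
    DGAlgMod.Hom (dualMod N) (dualMod M) where
  toHom := f.toHom.dual
  map_act p φ := DGMod.dual_ext (V := M.toDGMod) fun x =>
    congrArg φ.1 (f.map_act p x).symm

variable {C : DGMod k} (μ : DGAction (cobar k r) C.homology)

/-- The isomorphism of `S ⊗ H^•` with the dual of the bar construction, as a map to all
functionals. -/
noncomputable abbrev modelMap (r : ℕ) (C : DGMod k) :
    MvPolynomial (Fin r) k ⊗[k] C.dual.homology →ₗ[k]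
      Module.Dual k (PolyCoalg k r ⊗[k] C.homology) := pairMap C.evalHom

omit [CharP k 2] in
theorem modelMap_deg {m n : ℤ} (hmn : m ≠ -n) {x : MvPolynomial (Fin r) k ⊗[k] C.dual.homology}
    (hx : x ∈ tensorDeg (polyDeg k r) C.dual.homology.deg n) {y : PolyCoalg k r ⊗[k] C.homology}
    (hy : y ∈ tensorDeg (PolyCoalg.cdeg k r) C.homology.deg m) : modelMap r C x y = 0 := by
  induction hx using Submodule.span_induction with
  | mem x h =>
    obtain ⟨i, j, rfl, p, hp, α, hα, rfl⟩ := h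
    refine tensorDeg_induction hy (P := fun y => modelMap r C (p ⊗ₜ α) y = 0) ?_ ?_ ?_ ?_
    · intro a z hz
      rw [pairMap_tmul, pairing_mono]
      by_cases hc : MvPolynomial.coeff a p = 0
      · rw [hc, zero_mul]
      · have := hp a hc
        rw [C.evalHom_deg (m := m - a.degree) (by omega) hα hz, mul_zero]
    · rw [map_zero]
    · intro y z hy hz; rw [map_add, hy, hz, add_zero]
    · intro c y hy; rw [map_smul, hy, smul_zero]
  | zero => rw [map_zero, LinearMap.zero_apply]
  | add x y _ _ hx hy => rw [map_add, LinearMap.add_apply, hx, hy, add_zero]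
  | smul c x _ hx => rw [map_smul, LinearMap.smul_apply, hx, smul_zero]

/-- The dual of the bar construction on the homology. -/
noncomputable abbrev barHomologyDual : DGMod k :=
  (dualMod (bar (iotaTw k r) ⟨C.homology, μ⟩)).toDGMod

theorem modelMap_mem (x : MvPolynomial (Fin r) k ⊗[k] C.dual.homology) :
    modelMap r C x ∈ (bar (iotaTw k r) ⟨C.homology, μ⟩).toDGMod.gradedDual := by
  refine homog_induction (tensorDeg_isInternal (polyDeg_isInternal k r) C.dual.homology.internal)
    (P := fun x => modelMap r C x ∈ (bar (iotaTw k r) ⟨C.homology, μ⟩).toDGMod.gradedDual) x ?_ ?_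
  · intro n y hy
    refine ⟨{-n}, fun m hm z hz => ?_⟩
    exact modelMap_deg (by simpa using hm) hy hz
  · intro y z hy hz
    rw [map_add]
    exact Submodule.add_mem _ hy hz

/-- The isomorphism of `S ⊗ H^•` with the dual of the bar construction. -/
noncomputable def modelLin :
    MvPolynomial (Fin r) k ⊗[k] C.dual.homology →ₗ[k] barHomologyDual μ :=
  LinearMap.codRestrict _ (modelMap r C) (modelMap_mem μ)

theorem modelLin_deg (n : ℤ) (x : MvPolynomial (Fin r) k ⊗[k] C.dual.homology)
    (hx : x ∈ tensorDeg (polyDeg k r) C.dual.homology.deg n) :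
    modelLin μ x ∈ (barHomologyDual μ).deg n :=
  fun _ hm _ hy => modelMap_deg hm hx hy

theorem modelLin_smul (p : MvPolynomial (Fin r) k)
    (x : MvPolynomial (Fin r) k ⊗[k] C.dual.homology) : modelLin μ (p • x) =
      (dualMod (bar (iotaTw k r) ⟨C.homology, μ⟩)).act p (modelLin μ x) :=
  DGMod.dual_ext (V := (bar (iotaTw k r) ⟨C.homology, μ⟩).toDGMod) fun y => pairMap_smul C.evalHom p x y

/-- Surjectivity depends on finiteness. An element of the graded dual lives in finitely many total
degrees, and H(C) lives in finitely many degrees. The functional therefore vanishes on x^(a) ⊗ z for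
large |a|, as `exists_pairMap` requires. -/
theorem modelLin_bijective [Module.Finite k C] : Function.Bijective (modelLin μ) := by
  refine ⟨fun x y h => pairMap_injective C.evalHom C.evalHom_injective
    (congrArg Subtype.val h), fun φ => ?_⟩
  obtain ⟨s, hs⟩ := φ.2
  have hfin : {n | C.homology.deg n ≠ ⊥}.Finite :=
    WellFoundedGT.finite_ne_bot_of_iSupIndep C.homology.internal.submodule_iSupIndep
  obtain ⟨N, hN⟩ : ∃ N : ℕ, ∀ i ∈ s, ∀ j ∈ hfin.toFinset, i - j < N := by
    obtain ⟨N, hN⟩ := ((s ×ˢ hfin.toFinset).image fun q => q.1 - q.2).bddAbove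
    refine ⟨N.toNat + 1, fun i hi j hj => ?_⟩
    have := hN (Finset.mem_coe.2 (Finset.mem_image.2
      ⟨(i, j), Finset.mem_product.2 ⟨hi, hj⟩, rfl⟩))
    simp only at this
    omega
  let φ' : Module.Dual k (PolyCoalg k r ⊗[k] C.homology) := φ.1
  obtain ⟨x, hx⟩ := exists_pairMap C.evalHom C.evalHom_surjective φ' N (by
    intro a z ha
    refine homog_induction C.homology.internal
      (P := fun z => φ' (PolyCoalg.mono k a ⊗ₜ z) = 0) z ?_ ?_
    · intro j z hz
      by_cases hj : j ∈ hfin.toFinset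
      · refine hs (a.degree + j) (fun h => ?_) _
          (tmul_mem_tensorDeg (PolyCoalg.mono_mem k a) hz rfl)
        have := hN _ h j hj
        omega
      · have : C.homology.deg j = ⊥ := by simpa using hj
        rw [this, Submodule.mem_bot] at hz
        rw [hz, TensorProduct.tmul_zero, map_zero]
    · intro y z hy hz
      rw [TensorProduct.tmul_add, map_add, hy, hz, add_zero])
  exact ⟨x, Subtype.ext hx⟩

variable [Module.Finite k C]

/-- The isomorphism of `S ⊗ H^•` with the dual of the bar construction. -/
noncomputable def modelEquiv :
    (MvPolynomial (Fin r) k ⊗[k] C.dual.homology) ≃ₗ[k] barHomologyDual μ :=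
  LinearEquiv.ofBijective (modelLin μ) (modelLin_bijective μ)

theorem modelLin_symm (φ : barHomologyDual μ) : modelLin μ ((modelEquiv μ).symm φ) = φ :=
  (modelEquiv μ).apply_symm_apply φ

/-- The twisted differential of the minimal Hirsch–Brown model. -/
noncomputable def modelDiff : TwistedDiff r C.dual.homology where
  δ :=
    { toFun := fun x => (modelEquiv μ).symm ((barHomologyDual μ).d (modelLin μ x))
      map_add' := fun x y => by rw [map_add, map_add, map_add]
      -- S-linearity is checked after applying the isomorphism, where the action of p commutes with
      -- the differential because S has none.
      map_smul' := fun p x => by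
        refine (modelLin_bijective μ).1 ?_
        refine (modelLin_symm μ _).trans ?_
        rw [RingHom.id_apply, modelLin_smul, modelLin_smul, modelLin_symm]
        have h0 : (dualMod (bar (iotaTw k r) ⟨C.homology, μ⟩)).act 0 (modelLin μ x) = 0 := by
          rw [map_zero]; rfl
        refine ((dualMod (bar (iotaTw k r) ⟨C.homology, μ⟩)).action.act_d p _).trans ?_
        exact (congrArg (· + _) h0).trans (zero_add _) }
  δ_deg n x hx := by
    refine mem_of_map_mem (tensorDeg_isInternal (polyDeg_isInternal k r)
      C.dual.homology.internal) (barHomologyDual μ).internal (f := modelLin μ) (modelLin_deg μ)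
      (modelLin_bijective μ).1 ?_
    refine (modelLin_symm μ _).symm ▸ ?_
    exact (barHomologyDual μ).d_deg n _ (modelLin_deg μ n x hx)
  δ_sq x := by
    change (modelEquiv μ).symm ((barHomologyDual μ).d (modelLin μ
      ((modelEquiv μ).symm ((barHomologyDual μ).d (modelLin μ x))))) = 0
    rw [modelLin_symm, (barHomologyDual μ).d_sq, map_zero]

theorem modelLin_modelDiff (x : MvPolynomial (Fin r) k ⊗[k] C.dual.homology) :
    modelLin μ ((modelDiff μ).δ x) = (barHomologyDual μ).d (modelLin μ x) :=
  modelLin_symm μ _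

/-- The isomorphism of dg `S`-modules of the minimal Hirsch–Brown model with the dual of the bar
construction. -/
noncomputable def modelHom :
    DGAlgMod.Hom (modelDiff μ).toMod (dualMod (bar (iotaTw k r) ⟨C.homology, μ⟩)) where
  toLin := modelLin μ
  map_deg := modelLin_deg μ
  comm := modelLin_modelDiff μ
  map_act := modelLin_smul μ

/-- The constant coefficient of δ x pairs with z as x pairs with the bar differential of x^(0) ⊗ z.
The latter is zero, since H(C) has zero differential and ι(x^(0)) = 0. -/
theorem modelDiff_isMinimal : (modelDiff μ).IsMinimal := by
  intro x
  refine mem_ideal_of_polyCoords _ (C.evalHom_injective (LinearMap.ext fun z => ?_))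
  rw [← pairMap_mono, map_zero, LinearMap.zero_apply]
  have h := congrArg (fun φ : barHomologyDual μ => φ.1 (PolyCoalg.mono k 0 ⊗ₜ z))
    (modelLin_modelDiff μ x)
  refine h.trans ?_
  have h2 : (iotaTw k r).barD ⟨C.homology, μ⟩ (PolyCoalg.mono k 0 ⊗ₜ z) = 0 := by
    rw [Twisting.barD_mono, Finset.HasAntidiagonal.antidiagonal_zero, Finset.sum_singleton,
      (iotaTw k r).map_unit, map_zero]
    change PolyCoalg.mono k 0 ⊗ₜ (0 : C.homology) + PolyCoalg.mono k 0 ⊗ₜ (0 : C.homology) = 0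
    rw [TensorProduct.tmul_zero, add_zero]
  exact (congrArg (modelMap r C x) h2).trans (map_zero _)

end HirschBrownModel

/-! ### The bar construction of a free module over the exterior algebra -/

section Koszul

variable {k : Type u} [Field k] {r : ℕ} (M : DGAlgMod (extAlg k r))

/-- The action of the generator `t_i` of the exterior algebra. -/
noncomputable def extGen (i : Fin r) : Module.End k M.toDGMod := M.act (tgen k r i)

theorem kappaTw_mono (a : Fin r →₀ ℕ) :
    (kappaTw k r).toLin (PolyCoalg.mono k a) = kappaFun k r a := PolyCoalg.lin_mono k _ a

theorem act_kappaFun (a : Fin r →₀ ℕ) (m : M.toDGMod) : M.act (kappaFun k r a) m =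
    ∑ i, if a = Finsupp.single i 1 then extGen M i m else 0 := by
  have h : M.act (kappaFun k r a) = ∑ i, if a = Finsupp.single i 1 then extGen M i else 0 := by
    refine (map_sum M.act _ _).trans (Finset.sum_congr rfl fun i _ => ?_)
    split_ifs
    · rfl
    · exact map_zero M.act
  rw [h, LinearMap.sum_apply]
  refine Finset.sum_congr rfl fun i _ => ?_
  split_ifs <;> rfl

/-- As κ lives on the exponents e_i, the twisting part is a Koszul differential: x_i contracts S_c
while t_i acts on M. -/
theorem kappa_barD (a : Fin r →₀ ℕ) (m : M.toDGMod) :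
    (kappaTw k r).barD M (PolyCoalg.mono k a ⊗ₜ m) = PolyCoalg.mono k a ⊗ₜ M.toDGMod.d m +
      ∑ i, PolyCoalg.lower k r (Finsupp.single i 1) (PolyCoalg.mono k a) ⊗ₜ extGen M i m := by
  rw [Twisting.barD_mono]
  refine congrArg (_ + ·) ?_
  simp only [kappaTw_mono]
  have h1 : ∀ p : (Fin r →₀ ℕ) × (Fin r →₀ ℕ),
      PolyCoalg.mono k p.1 ⊗ₜ[k] M.act (kappaFun k r p.2) m = ∑ i : Fin r,
        if p.2 = Finsupp.single i 1 then PolyCoalg.mono k p.1 ⊗ₜ[k] extGen M i m else 0 := by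
    intro p
    rw [act_kappaFun, TensorProduct.tmul_sum]
    refine Finset.sum_congr rfl fun i _ => ?_
    split_ifs
    · rfl
    · rw [TensorProduct.tmul_zero]
  refine (Finset.sum_congr rfl fun p _ => h1 p).trans ?_
  rw [Finset.sum_comm]
  refine Finset.sum_congr rfl fun i _ => ?_
  rw [PolyCoalg.lower, PolyCoalg.lin_mono]
  split_ifs with h
  · rw [Finset.sum_eq_single_of_mem (a - Finsupp.single i 1, Finsupp.single i 1)]
    · rw [if_pos rfl]
    · rw [Finset.HasAntidiagonal.mem_antidiagonal, tsub_add_cancel_of_le h]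
    · rintro ⟨b, c⟩ hp hne
      rw [Finset.HasAntidiagonal.mem_antidiagonal] at hp
      refine if_neg fun hc => hne ?_
      simp only at hc hp
      rw [← hp, hc, add_tsub_cancel_right]
  · rw [TensorProduct.zero_tmul]
    refine Finset.sum_eq_zero fun p hp => if_neg fun hc => h ?_
    rw [Finset.HasAntidiagonal.mem_antidiagonal] at hp
    rw [← hp, ← hc]
    exact le_add_self

/-- The operator `mono a ↦ mono (a + e_i)` on `S_c`. -/
noncomputable def PolyCoalg.raise (k : Type u) [Field k] (i : Fin r) :
    PolyCoalg k r →ₗ[k] PolyCoalg k r :=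
  PolyCoalg.lin k fun a => PolyCoalg.mono k (a + Finsupp.single i 1)

/-- The projection of `S_c` to the span of the monomials not involving the index `i`. -/
noncomputable def PolyCoalg.omit (k : Type u) [Field k] (i : Fin r) :
    PolyCoalg k r →ₗ[k] PolyCoalg k r :=
  PolyCoalg.lin k fun a => if a i = 0 then PolyCoalg.mono k a else 0

theorem lower_raise_self (i : Fin r) (a : Fin r →₀ ℕ) :
    PolyCoalg.lower k r (Finsupp.single i 1) (PolyCoalg.raise k i (PolyCoalg.mono k a)) =
      PolyCoalg.mono k a := by
  rw [PolyCoalg.raise, PolyCoalg.lin_mono, PolyCoalg.lower, PolyCoalg.lin_mono,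
    if_pos le_add_self, add_tsub_cancel_right]

theorem raise_lower_self (i : Fin r) (a : Fin r →₀ ℕ) :
    PolyCoalg.raise k i (PolyCoalg.lower k r (Finsupp.single i 1) (PolyCoalg.mono k a)) +
      PolyCoalg.omit k i (PolyCoalg.mono k a) = PolyCoalg.mono k a := by
  rw [PolyCoalg.lower, PolyCoalg.lin_mono, PolyCoalg.omit, PolyCoalg.lin_mono]
  by_cases h : a i = 0
  · rw [if_pos h, if_neg, map_zero, zero_add]
    rw [Finsupp.single_le_iff]
    omega
  · have h' : Finsupp.single i 1 ≤ a := by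
      rw [Finsupp.single_le_iff]
      omega
    rw [if_neg h, if_pos h', PolyCoalg.raise, PolyCoalg.lin_mono, tsub_add_cancel_of_le h', add_zero]

theorem raise_lower_comm {i j : Fin r} (hij : i ≠ j) (a : Fin r →₀ ℕ) :
    PolyCoalg.raise k i (PolyCoalg.lower k r (Finsupp.single j 1) (PolyCoalg.mono k a)) =
      PolyCoalg.lower k r (Finsupp.single j 1) (PolyCoalg.raise k i (PolyCoalg.mono k a)) := by
  have h1 : Finsupp.single j 1 ≤ a + Finsupp.single i 1 ↔ Finsupp.single j 1 ≤ a := by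
    rw [Finsupp.single_le_iff, Finsupp.single_le_iff]
    simp [hij]
  simp only [PolyCoalg.raise, PolyCoalg.lower, PolyCoalg.lin_mono, h1]
  split_ifs with h
  · rw [PolyCoalg.lin_mono, tsub_add_eq_add_tsub h]
  · rw [map_zero]

/-- The filtration of `S_c ⊗ M` by the degree of the second factor. -/
noncomputable def degFil (r : ℕ) (V : DGMod k) (n : ℕ) : Submodule k (PolyCoalg k r ⊗[k] V) :=
  Submodule.span k {x | ∃ (c : PolyCoalg k r) (j : ℤ), j < n ∧ ∃ m ∈ V.deg j, x = c ⊗ₜ m}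

theorem map_mem_degFil {V : DGMod k} (p : PolyCoalg k r →ₗ[k] PolyCoalg k r) (q : V →ₗ[k] V)
    {n n' : ℕ} (hq : ∀ j : ℤ, j < n → ∀ m ∈ V.deg j, ∃ j' : ℤ, j' < n' ∧ q m ∈ V.deg j')
    {x : PolyCoalg k r ⊗[k] V} (hx : x ∈ degFil r V n) :
    TensorProduct.map p q x ∈ degFil r V n' := by
  have : degFil r V n ≤ (degFil r V n').comap (TensorProduct.map p q) := by
    refine Submodule.span_le.2 ?_
    rintro _ ⟨c, j, hj, m, hm, rfl⟩
    obtain ⟨j', hj', hm'⟩ := hq j hj m hm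
    exact Submodule.subset_span ⟨p c, j', hj', q m, hm', rfl⟩
  exact this hx

theorem degFil_mono {V : DGMod k} {m n : ℕ} (h : m ≤ n) : degFil r V m ≤ degFil r V n := by
  refine Submodule.span_mono ?_
  rintro _ ⟨c, j, hj, m, hm, rfl⟩
  exact ⟨c, j, by omega, m, hm, rfl⟩

theorem exists_mem_degFil {V : DGMod k} (x : PolyCoalg k r ⊗[k] V) : ∃ n, x ∈ degFil r V n := by
  induction x using TensorProduct.induction_on with
  | zero => exact ⟨0, Submodule.zero_mem _⟩
  | tmul c m =>
    refine homog_induction V.internal (P := fun m => ∃ n, c ⊗ₜ[k] m ∈ degFil r V n) m ?_ ?_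
    · intro j m hm
      exact ⟨j.toNat + 1, Submodule.subset_span ⟨c, j, by omega, m, hm, rfl⟩⟩
    · rintro x y ⟨m, hm⟩ ⟨n, hn⟩
      rw [TensorProduct.tmul_add]
      exact ⟨max m n, Submodule.add_mem _ (degFil_mono (le_max_left _ _) hm)
        (degFil_mono (le_max_right _ _) hn)⟩
  | add x y hx hy =>
    obtain ⟨m, hm⟩ := hx
    obtain ⟨n, hn⟩ := hy
    exact ⟨max m n, Submodule.add_mem _ (degFil_mono (le_max_left _ _) hm)
      (degFil_mono (le_max_right _ _) hn)⟩

theorem degFil_zero {V : DGMod k} (hV : ∀ n < 0, ∀ x ∈ V.deg n, x = 0) : degFil r V 0 = ⊥ := by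
  rw [degFil, Submodule.span_eq_bot]
  rintro _ ⟨c, j, hj, m, hm, rfl⟩
  rw [hV j (by exact_mod_cast hj) m hm, TensorProduct.tmul_zero]

variable {M}

/-- The map `c ⊗ m ↦ ε(c) π(m)` from the bar construction to a quotient on which the exterior
algebra acts through its augmentation. -/
noncomputable def barAug [CharP k 2] {N : DGMod k} (π : DGMod.Hom M.toDGMod N)
    (hπ : ∀ i x, π.toLin (extGen M i x) = 0) :
    DGMod.Hom (bar (kappaTw k r) M).toDGMod N where
  toLin := π.toLin ∘ₗ barCounit k r M.toDGMod
  map_deg := map_tensorDeg (M := M.toDGMod) (N := N) (π.toLin ∘ₗ barCounit k r M.toDGMod) (by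
    intro a n m hm
    rw [LinearMap.comp_apply, barCounit_mono]
    split_ifs with h
    · subst h
      simpa using π.map_deg n m hm
    · rw [map_zero]
      exact Submodule.zero_mem _)
  comm := by
    refine fun x => LinearMap.congr_fun (f := (π.toLin ∘ₗ barCounit k r M.toDGMod) ∘ₗ
      (kappaTw k r).barD M) (g := N.d ∘ₗ π.toLin ∘ₗ barCounit k r M.toDGMod)
      (tensor_hom_ext fun a m => ?_) x
    have h1 : ∀ (c : PolyCoalg k r) i, π.toLin (barCounit k r M.toDGMod (c ⊗ₜ extGen M i m)) = 0 := by
      intro c i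
      refine LinearMap.congr_fun (f := π.toLin ∘ₗ barCounit k r M.toDGMod ∘ₗ
        (TensorProduct.mk k (PolyCoalg k r) M.toDGMod).flip (extGen M i m)) (g := 0)
        (PolyCoalg.hom_ext fun b => ?_) c
      change π.toLin (barCounit k r M.toDGMod (PolyCoalg.mono k b ⊗ₜ extGen M i m)) = 0
      rw [barCounit_mono]
      split_ifs
      · exact hπ i m
      · exact map_zero _
    rw [LinearMap.comp_apply, LinearMap.comp_apply, LinearMap.comp_apply, LinearMap.comp_apply,
      kappa_barD, map_add, map_sum, map_add, map_sum, Finset.sum_eq_zero fun i _ => h1 _ i,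
      add_zero, barCounit_mono, barCounit_mono]
    split_ifs
    · exact π.comm m
    · rw [map_zero, map_zero]

/-- Contracting operators for the generators of the exterior algebra: a witness that `M` is free
over the exterior algebra. -/
structure KoszulOps (M : DGAlgMod (extAlg k r)) where
  s : Fin r → Module.End k M.toDGMod
  s_deg : ∀ i n, ∀ x ∈ M.toDGMod.deg n, s i x ∈ M.toDGMod.deg n
  self : ∀ i x, extGen M i (s i x) + s i (extGen M i x) = x
  comm : ∀ i j, i ≠ j → ∀ x, extGen M j (s i x) = s i (extGen M j x)

namespace KoszulOps

variable (o : KoszulOps M)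

/-- The homotopy `raise_i ⊗ s_i`. -/
noncomputable def hty (i : Fin r) : Module.End k (PolyCoalg k r ⊗[k] M.toDGMod) :=
  TensorProduct.map (PolyCoalg.raise k i) (o.s i)

/-- The commutator of the internal differential and the homotopy. -/
noncomputable def err (i : Fin r) : Module.End k (PolyCoalg k r ⊗[k] M.toDGMod) :=
  TensorProduct.map (PolyCoalg.raise k i) (M.toDGMod.d ∘ₗ o.s i + o.s i ∘ₗ M.toDGMod.d)

/-- The projection `omit_i ⊗ s_i t_i`. -/
noncomputable def prj (i : Fin r) : Module.End k (PolyCoalg k r ⊗[k] M.toDGMod) :=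
  TensorProduct.map (PolyCoalg.omit k i) (o.s i ∘ₗ extGen M i)

theorem extGen_mem (i : Fin r) {n : ℤ} {x : M.toDGMod} (hx : x ∈ M.toDGMod.deg n) :
    extGen M i x ∈ M.toDGMod.deg n := by
  have h0 : tgen k r i ∈ (extAlg k r).deg 0 := by
    change _ ∈ concentratedDeg k (ExteriorAlgebra k (Fin r → k)) 0
    simp [concentratedDeg]
  have h := M.action.act_deg 0 n _ h0 x hx
  rw [zero_add] at h
  exact h

/-- For j ≠ i the operators raise_i ⊗ s_i and lower_j ⊗ t_j commute, so their terms cancel. For j =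
i, lowering after raising is the identity, while raising after lowering misses the monomials without
x_i. With t_i s_i + s_i t_i = 1 this leaves the identity and `prj`. The remaining term measures the
failure of s_i to commute with d. -/
theorem hty_comm [CharP k 2] (i : Fin r) (x : PolyCoalg k r ⊗[k] M.toDGMod) :
    (kappaTw k r).barD M (o.hty i x) + o.hty i ((kappaTw k r).barD M x) =
      x + o.prj i x + o.err i x := by
  refine LinearMap.congr_fun (f := (kappaTw k r).barD M ∘ₗ o.hty i +
    o.hty i ∘ₗ (kappaTw k r).barD M) (g := LinearMap.id + o.prj i + o.err i)
    (tensor_hom_ext fun a m => ?_) x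
  have h1 : PolyCoalg.raise k i (PolyCoalg.mono k a) = PolyCoalg.mono k (a + Finsupp.single i 1) :=
    PolyCoalg.lin_mono k _ a
  simp only [LinearMap.add_apply, LinearMap.comp_apply, hty, prj, err, TensorProduct.map_tmul,
    LinearMap.id_apply]
  rw [kappa_barD, h1, kappa_barD, map_add, map_sum]
  simp only [TensorProduct.map_tmul, h1]
  have h2 : ∀ j, j ≠ i → PolyCoalg.lower k r (Finsupp.single j 1)
      (PolyCoalg.mono k (a + Finsupp.single i 1)) ⊗ₜ[k] extGen M j (o.s i m) +
      PolyCoalg.raise k i (PolyCoalg.lower k r (Finsupp.single j 1) (PolyCoalg.mono k a)) ⊗ₜ[k]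
        o.s i (extGen M j m) = 0 := by
    intro j hj
    rw [raise_lower_comm hj.symm, h1, o.comm i j hj.symm]
    exact add_self_eq_zero_of_charTwo k _
  have h3 : PolyCoalg.lower k r (Finsupp.single i 1)
      (PolyCoalg.mono k (a + Finsupp.single i 1)) ⊗ₜ[k] extGen M i (o.s i m) +
      PolyCoalg.raise k i (PolyCoalg.lower k r (Finsupp.single i 1) (PolyCoalg.mono k a)) ⊗ₜ[k]
        o.s i (extGen M i m) = PolyCoalg.mono k a ⊗ₜ m +
        PolyCoalg.omit k i (PolyCoalg.mono k a) ⊗ₜ o.s i (extGen M i m) := by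
    have h4 := lower_raise_self (k := k) i a
    rw [h1] at h4
    have h5 : PolyCoalg.raise k i (PolyCoalg.lower k r (Finsupp.single i 1) (PolyCoalg.mono k a)) =
        PolyCoalg.mono k a + PolyCoalg.omit k i (PolyCoalg.mono k a) := by
      have h6 : ∀ x y z : PolyCoalg k r, x + y = z → x = z + y := by
        rintro x y _ rfl
        rw [add_assoc, add_self_eq_zero_of_charTwo k, add_zero]
      exact h6 _ _ _ (raise_lower_self i a)
    rw [h4, h5, TensorProduct.add_tmul, ← add_assoc, ← TensorProduct.tmul_add, o.self]
  have h6 : (∑ j, PolyCoalg.lower k r (Finsupp.single j 1)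
      (PolyCoalg.mono k (a + Finsupp.single i 1)) ⊗ₜ[k] extGen M j (o.s i m)) +
      (∑ j, PolyCoalg.raise k i (PolyCoalg.lower k r (Finsupp.single j 1) (PolyCoalg.mono k a)) ⊗ₜ[k]
        o.s i (extGen M j m)) = PolyCoalg.mono k a ⊗ₜ m +
        PolyCoalg.omit k i (PolyCoalg.mono k a) ⊗ₜ o.s i (extGen M i m) := by
    rw [← Finset.sum_add_distrib, ← h3]
    exact Finset.sum_eq_single_of_mem i (Finset.mem_univ i) fun j _ hj => h2 j hj
  rw [add_add_add_comm, h6, TensorProduct.tmul_add, add_comm]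

/-- The commutator of d and s_i has degree -1, so the error term drops one step in the filtration by
the degree in M. -/
theorem err_mem [CharP k 2] (i : Fin r) {n : ℕ} {x : PolyCoalg k r ⊗[k] M.toDGMod}
    (hx : x ∈ degFil r M.toDGMod (n + 1)) : o.err i x ∈ degFil r M.toDGMod n := by
  refine map_mem_degFil _ _ (fun j hj m hm => ⟨j - 1, by push_cast at hj; omega, ?_⟩) hx
  exact Submodule.add_mem _ (M.toDGMod.d_deg _ _ (o.s_deg i j m hm))
    (o.s_deg i _ _ (M.toDGMod.d_deg _ _ hm))

theorem prj_mem (i : Fin r) {n : ℕ} {x : PolyCoalg k r ⊗[k] M.toDGMod}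
    (hx : x ∈ degFil r M.toDGMod n) : o.prj i x ∈ degFil r M.toDGMod n :=
  map_mem_degFil _ _ (fun j hj m hm => ⟨j, hj, o.s_deg i j (extGen M i m) (extGen_mem i hm)⟩) hx

/-- The composition of the projections `s_i t_i`. -/
noncomputable def normal (l : List (Fin r)) : Module.End k M.toDGMod :=
  (l.map fun i => o.s i ∘ₗ extGen M i).prod

/-- The composition of the projections `omit_i ⊗ s_i t_i`. -/
noncomputable def prjs (l : List (Fin r)) : Module.End k (PolyCoalg k r ⊗[k] M.toDGMod) :=
  (l.map o.prj).prod

theorem prjs_mono (l : List (Fin r)) (a : Fin r →₀ ℕ) (m : M.toDGMod) :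
    o.prjs l (PolyCoalg.mono k a ⊗ₜ m) =
      if ∀ i ∈ l, a i = 0 then PolyCoalg.mono k a ⊗ₜ o.normal l m else 0 := by
  induction l with
  | nil => simp [prjs, normal]
  | cons i l ih =>
    have h1 : o.prjs (i :: l) (PolyCoalg.mono k a ⊗ₜ m) =
        o.prj i (o.prjs l (PolyCoalg.mono k a ⊗ₜ m)) := by simp [prjs]
    have h2 : o.normal (i :: l) m = o.s i (extGen M i (o.normal l m)) := by simp [normal]
    rw [h1, ih, h2]
    by_cases h : ∀ i ∈ l, a i = 0
    · rw [if_pos h, prj, TensorProduct.map_tmul, PolyCoalg.omit, PolyCoalg.lin_mono]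
      by_cases hi : a i = 0
      · rw [if_pos hi, if_pos (by simpa using ⟨hi, h⟩)]
        rfl
      · rw [if_neg hi, if_neg (by simp [hi]), TensorProduct.zero_tmul]
    · rw [if_neg h, map_zero, if_neg (by simpa using fun _ => by simpa using h)]

/-- One homotopy per variable: each multiplies the current projection of x by a further `prj`,
modulo lower filtration. The corrections have no component at x^(0), because raising an exponent
never yields x^(0); this keeps them in the kernel of the augmentation. -/
theorem exists_sub_prjs_mem [CharP k 2] (l : List (Fin r)) {n : ℕ}
    {x : PolyCoalg k r ⊗[k] M.toDGMod} (hx : x ∈ degFil r M.toDGMod (n + 1))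
    (hDx : (kappaTw k r).barD M x = 0) : ∃ y, barCounit k r M.toDGMod y = 0 ∧
      x - (kappaTw k r).barD M y - o.prjs l x ∈ degFil r M.toDGMod n := by
  have hmem : ∀ (l : List (Fin r)) (n : ℕ) (x), x ∈ degFil r M.toDGMod n →
      o.prjs l x ∈ degFil r M.toDGMod n := by
    intro l n x hx
    induction l with
    | nil => simpa [prjs] using hx
    | cons i l ih =>
      have h1 : o.prjs (i :: l) x = o.prj i (o.prjs l x) := by simp [prjs]
      rw [h1]
      exact o.prj_mem i ih
  induction l with
  | nil => exact ⟨0, map_zero _, by simp [prjs]⟩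
  | cons i l ih =>
    obtain ⟨y, hy, hxy⟩ := ih
    have h1 : o.prjs (i :: l) x = o.prj i (o.prjs l x) := by simp [prjs]
    obtain ⟨x', hx'⟩ : ∃ x', x - (kappaTw k r).barD M y = x' := ⟨_, rfl⟩
    rw [hx'] at hxy
    have hx'' : x' ∈ degFil r M.toDGMod (n + 1) := by
      have := Submodule.add_mem _ (degFil_mono (Nat.le_succ n) hxy) (hmem l _ x hx)
      rwa [sub_add_cancel] at this
    have hDx' : (kappaTw k r).barD M x' = 0 := by
      rw [← hx', map_sub, hDx, (kappaTw k r).barD_sq M, sub_zero]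
    have hh : barCounit k r M.toDGMod (o.hty i x') = 0 := by
      refine LinearMap.congr_fun (f := barCounit k r M.toDGMod ∘ₗ o.hty i) (g := 0)
        (tensor_hom_ext fun a m => ?_) x'
      rw [LinearMap.comp_apply, hty, TensorProduct.map_tmul, PolyCoalg.raise, PolyCoalg.lin_mono,
        barCounit_mono, if_neg, LinearMap.zero_apply]
      intro h
      have := DFunLike.congr_fun h i
      simp at this
    refine ⟨y + o.hty i x', by rw [map_add, hy, hh, add_zero], ?_⟩
    have h2 := o.hty_comm i x'
    rw [hDx', map_zero, add_zero] at h2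
    have h3 : x - (kappaTw k r).barD M (y + o.hty i x') - o.prjs (i :: l) x =
        o.prj i (x' - o.prjs l x) + o.err i x' := by
      rw [map_add, ← sub_sub, hx', h2, h1, map_sub, sub_eq_add_of_charTwo k, sub_eq_add_of_charTwo k,
        sub_eq_add_of_charTwo k (o.prj i x')]
      have h4 : ∀ a b c d : PolyCoalg k r ⊗[k] M.toDGMod,
          a + (a + b + c) + d = (a + a) + (b + d + c) := by intros; abel
      rw [h4, add_self_eq_zero_of_charTwo k, zero_add]
    rw [h3]
    exact Submodule.add_mem _ (o.prj_mem i hxy) (o.err_mem i hx'')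

/-- For j ≠ i, t_i commutes with s_j t_j. It therefore moves through the product until it meets s_i
t_i, where t_i² = 0. -/
theorem normal_extGen [CharP k 2] (hT : ∀ i x, extGen M i (extGen M i x) = 0)
    (hTT : ∀ i j x, extGen M i (extGen M j x) = extGen M j (extGen M i x))
    (l : List (Fin r)) (i : Fin r) (hi : i ∈ l) (x : M.toDGMod) :
    o.normal l (extGen M i x) = 0 := by
  have key : ∀ l : List (Fin r), o.normal l (extGen M i x) = 0 ∨
      ∃ y, o.normal l (extGen M i x) = extGen M i y ∧ i ∉ l := by
    intro l
    induction l with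
    | nil => exact Or.inr ⟨x, by simp [normal], by simp⟩
    | cons j l ih =>
      have h2 : o.normal (j :: l) (extGen M i x) =
        o.s j (extGen M j (o.normal l (extGen M i x))) := by simp [normal]
      rw [h2]
      rcases ih with h | ⟨y, hy, hl⟩
      · left; rw [h, map_zero, map_zero]
      · rw [hy]
        by_cases hij : j = i
        · left; rw [hij, hT, map_zero]
        · right
          refine ⟨o.s j (extGen M j y), ?_, ?_⟩
          · rw [hTT j i, ← o.comm j i hij]
          · simp [hl, Ne.symm hij]
  rcases key l with h | ⟨y, _, hl⟩
  · exact h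
  · exact absurd hi hl

include o in
-- The kernel is acyclic by the filtration by the degree in M, which starts at zero thanks to `hM`.
-- On a cycle x in the kernel, the homotopies leave x^(0) ⊗ (∏ s_i t_i) m, where m is the component
-- of x at x^(0). As m lies in the sum of the images of the t_i, the product kills it.
theorem barAug_isQuasiIso [CharP k 2] (hM : ∀ n < 0, ∀ x ∈ M.toDGMod.deg n, x = 0)
    {N : DGMod k} (π : DGMod.Hom M.toDGMod N)
    (hπ : ∀ i x, π.toLin (extGen M i x) = 0) (hs : Function.Surjective π.toLin)
    (hker : ∀ x, π.toLin x = 0 → x ∈ ⨆ i, LinearMap.range (extGen M i)) :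
    (barAug π hπ).IsQuasiIso := by
  have hTT : ∀ i j x, extGen M i (extGen M j x) = extGen M j (extGen M i x) := by
    intro i j x
    have h : tgen k r i * tgen k r j = tgen k r j * tgen k r i :=
      eq_of_add_eq_zero_of_charTwo k (ExteriorAlgebra.ι_add_mul_swap _ _)
    have h2 := congrArg (fun f : Module.End k M.toDGMod => f x) ((map_mul M.act (tgen k r i)
      (tgen k r j)).symm.trans ((congrArg M.act h).trans (map_mul M.act _ _)))
    exact h2
  have hT : ∀ i x, extGen M i (extGen M i x) = 0 := by
    intro i x
    have h : tgen k r i * tgen k r i = 0 := ExteriorAlgebra.ι_sq_zero _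
    have h2 := congrArg (fun f : Module.End k M.toDGMod => f x) ((map_mul M.act (tgen k r i)
      (tgen k r i)).symm.trans ((congrArg M.act h).trans (map_zero M.act)))
    exact h2
  have hnormal : ∀ x, π.toLin x = 0 → o.normal (List.finRange r) x = 0 := by
    intro x hx
    have hle : (⨆ i, LinearMap.range (extGen M i)) ≤ LinearMap.ker (o.normal (List.finRange r)) := by
      refine iSup_le fun i => ?_
      rintro _ ⟨y, rfl⟩
      exact o.normal_extGen hT hTT _ i (List.mem_finRange i) y
    exact hle (hker x hx)
  refine (barAug π hπ).isQuasiIso_of_ker (fun y => ?_) fun x hx hDx => ?_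
  · obtain ⟨m, rfl⟩ := hs y
    refine ⟨PolyCoalg.mono k 0 ⊗ₜ m, congrArg π.toLin ?_⟩
    exact (barCounit_mono 0 m).trans (if_pos rfl)
  · have hprj : ∀ x, o.prjs (List.finRange r) x = PolyCoalg.mono k 0 ⊗ₜ
        o.normal (List.finRange r) (barCounit k r M.toDGMod x) := by
      intro x
      refine LinearMap.congr_fun (f := o.prjs (List.finRange r))
        (g := TensorProduct.mk k _ _ (PolyCoalg.mono k 0) ∘ₗ o.normal (List.finRange r) ∘ₗ
          barCounit k r M.toDGMod) (tensor_hom_ext fun a m => ?_) x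
      rw [LinearMap.comp_apply, LinearMap.comp_apply, barCounit_mono, prjs_mono]
      by_cases ha : a = 0
      · subst ha
        simp
      · rw [if_neg ha, map_zero, map_zero, if_neg]
        intro h
        exact ha (Finsupp.ext fun i => h i (List.mem_finRange i))
    exact exact_of_filtration ((kappaTw k r).barD M) ((kappaTw k r).barD_sq M)
      (degFil r M.toDGMod) (degFil_zero hM) exists_mem_degFil
      (LinearMap.ker (π.toLin ∘ₗ barCounit k r M.toDGMod))
      (fun x hx => ((barAug π hπ).comm x).trans ((congrArg N.d hx).trans (map_zero _)))
      (fun n x hx hxK hDx => by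
        obtain ⟨y, hy, hxy⟩ := o.exists_sub_prjs_mem (List.finRange r) hx hDx
        refine ⟨y, (congrArg π.toLin hy).trans (map_zero _), ?_⟩
        rwa [hprj, hnormal _ hxK, TensorProduct.tmul_zero, sub_zero] at hxy) x hx hDx

end KoszulOps

end Koszul

/-! ### Normalized chains in terms of simplices -/

section Chains

variable {k : Type u} [Field k]

theorem simplexChain_of_degenerate {X : SSet.{u}} {n : ℕ} {σ : X _⦋n⦌} (h : σ ∈ X.degenerate n) :
    simplexChain k σ = 0 := by
  rw [simplexChain, X.ιNormalizedChainComplex_eq_zero σ h]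
  exact map_zero (DirectSum.lof k ℕ (fun n => (X.normalizedChainComplex (ModuleCat.of k k)).X n) n)

theorem chains_hom_ext {X : SSet.{u}} {M : Type u} [AddCommGroup M] [Module k M]
    {f g : chains k X →ₗ[k] M}
    (h : ∀ n (σ : X _⦋n⦌), f (simplexChain k σ) = g (simplexChain k σ)) : f = g := by
  let K := X.normalizedChainComplex (ModuleCat.of k k)
  let f' : (⨁ n, K.X n) →ₗ[k] M := f
  let g' : (⨁ n, K.X n) →ₗ[k] M := g
  change f' = g'
  refine DirectSum.linearMap_ext k fun n => ?_
  have : ModuleCat.ofHom (f' ∘ₗ DirectSum.lof k ℕ (fun n => K.X n) n) =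
      ModuleCat.ofHom (g' ∘ₗ DirectSum.lof k ℕ (fun n => K.X n) n) := by
    refine X.normalizedChainComplex_hom_ext fun σ _ => ?_
    refine ModuleCat.hom_ext (LinearMap.ext_ring ?_)
    exact h n σ
  exact congrArg ModuleCat.Hom.hom this

theorem span_simplexChain (X : SSet.{u}) :
    Submodule.span k (Set.range fun s : Σ n, X _⦋n⦌ => simplexChain k s.2) = ⊤ := by
  rw [← Submodule.ker_mkQ (Submodule.span k _), LinearMap.ker_eq_top]
  refine chains_hom_ext fun n σ => ?_
  rw [LinearMap.zero_apply, Submodule.mkQ_apply, Submodule.Quotient.mk_eq_zero]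
  exact Submodule.subset_span ⟨⟨n, σ⟩, rfl⟩

/-- The linear map on normalized chains with prescribed values on the simplices. -/
noncomputable def chainsLift {X : SSet.{u}} {M : Type u} [AddCommGroup M] [Module k M]
    (f : ∀ n, X _⦋n⦌ → M) : chains k X →ₗ[k] M :=
  DirectSum.toModule k ℕ M fun n =>
    ((X.isColimitCofanNormalizedChainComplex (ModuleCat.of k k) n).desc
      (Limits.Cofan.mk (ModuleCat.of k M) fun σ =>
        ModuleCat.ofHom (LinearMap.toSpanSingleton k M (f n σ.1)))).hom

/-- The lift is defined on the basis of nondegenerate simplices. The hypothesis makes the formula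
valid for every σ, so that later computations need no case distinction. -/
theorem chainsLift_simplexChain {X : SSet.{u}} {M : Type u} [AddCommGroup M] [Module k M]
    (f : ∀ n, X _⦋n⦌ → M) {n : ℕ} (σ : X _⦋n⦌) (h : σ ∈ X.degenerate n → f n σ = 0) :
    chainsLift f (simplexChain k σ) = f n σ := by
  by_cases hσ : σ ∈ X.degenerate n
  · rw [simplexChain_of_degenerate hσ, map_zero, h hσ]
  · have hfac := (X.isColimitCofanNormalizedChainComplex (ModuleCat.of k k) n).fac
      (Limits.Cofan.mk (ModuleCat.of k M) fun σ =>
        ModuleCat.ofHom (LinearMap.toSpanSingleton k M (f n σ.1))) ⟨⟨σ, hσ⟩⟩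
    have h1 := congrArg (fun φ => φ.hom (1 : k)) hfac
    refine Eq.trans ?_ (h1.trans (one_smul k _))
    exact DirectSum.toModule_lof k n _

theorem simplexChain_mem {X : SSet.{u}} {n : ℕ} (σ : X _⦋n⦌) :
    simplexChain k σ ∈ (chains k X).deg n := fun m hm =>
  DirectSum.of_eq_of_ne _ _ _ (by exact_mod_cast hm)

theorem chains_deg_neg (X : SSet.{u}) : ∀ n < 0, ∀ x ∈ (chains k X).deg n, x = 0 :=
  fun _ hn _ hx => DFinsupp.ext fun m => hx m (by omega)

/-- A linear map on chains preserves degrees if it does so on simplices. -/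
theorem chains_map_deg {X : SSet.{u}} {V : Type u} [AddCommGroup V] [Module k V]
    {𝒱 : ℤ → Submodule k V} (f : chains k X →ₗ[k] V) (e : ℤ)
    (h : ∀ n (σ : X _⦋n⦌), f (simplexChain k σ) ∈ 𝒱 (n + e)) :
    ∀ m, ∀ x ∈ (chains k X).deg m, f x ∈ 𝒱 (m + e) := by
  have key : ∀ n : ℕ, ∀ y : (X.normalizedChainComplex (ModuleCat.of k k)).X n,
      f (DirectSum.lof k ℕ (fun n => (X.normalizedChainComplex (ModuleCat.of k k)).X n) n y) ∈
        𝒱 (n + e) := by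
    intro n
    -- Membership is tested in the quotient by `𝒱 (n + e)`, where it becomes the vanishing of a map
    -- on C_n and can be checked on simplices.
    let g : (X.normalizedChainComplex (ModuleCat.of k k)).X n →ₗ[k] V ⧸ 𝒱 (n + e) :=
      (𝒱 (n + e)).mkQ ∘ₗ f ∘ₗ
        DirectSum.lof k ℕ (fun n => (X.normalizedChainComplex (ModuleCat.of k k)).X n) n
    have hg : ModuleCat.ofHom g = ModuleCat.ofHom 0 := by
      refine X.normalizedChainComplex_hom_ext fun σ _ => ?_
      refine ModuleCat.hom_ext (LinearMap.ext_ring ?_)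
      exact (Submodule.Quotient.mk_eq_zero _).2 (h n σ)
    intro y
    exact (Submodule.Quotient.mk_eq_zero _).1
      (LinearMap.congr_fun (congrArg ModuleCat.Hom.hom hg) y)
  intro m x hx
  by_cases hm : 0 ≤ m
  · obtain ⟨n, rfl⟩ := Int.eq_ofNat_of_zero_le hm
    let x' : ⨁ n, (X.normalizedChainComplex (ModuleCat.of k k)).X n := x
    have : x' = DirectSum.lof k ℕ
        (fun n => (X.normalizedChainComplex (ModuleCat.of k k)).X n) n (x' n) := by
      refine DFinsupp.ext fun i => ?_
      by_cases hi : i = n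
      · subst hi
        rw [DirectSum.lof_apply]
      · rw [DirectSum.lof_eq_of, DirectSum.of_eq_of_ne _ _ _ hi]
        exact hx i (by exact_mod_cast hi)
    exact (congrArg f this) ▸ key n _
  · rw [chains_deg_neg X m (by omega) x hx, map_zero]
    exact Submodule.zero_mem _

theorem complexMap_lof {K L : ChainComplex (ModuleCat.{u} k) ℕ} (f : K ⟶ L) (n : ℕ) (y : K.X n) :
    complexMap f (DirectSum.lof k ℕ (fun n => K.X n) n y) =
      DirectSum.lof k ℕ (fun n => L.X n) n ((f.f n).hom y) :=
  DirectSum.lmap_lof _ _ _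

theorem complexD_lof_zero (K : ChainComplex (ModuleCat.{u} k) ℕ) (y : K.X 0) :
    complexD K (DirectSum.lof k ℕ (fun n => K.X n) 0 y) = 0 := by
  rw [complexD, DirectSum.toModule_lof]
  rfl

theorem complexD_lof_succ (K : ChainComplex (ModuleCat.{u} k) ℕ) (n : ℕ) (y : K.X (n + 1)) :
    complexD K (DirectSum.lof k ℕ (fun n => K.X n) (n + 1) y) =
      DirectSum.lof k ℕ (fun n => K.X n) n ((K.d (n + 1) n).hom y) := by
  rw [complexD, DirectSum.toModule_lof]
  rfl

theorem chainsMap_simplexChain {X Y : SSet.{u}} (f : X ⟶ Y) {n : ℕ} (σ : X _⦋n⦌) :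
    chainsMap k f (simplexChain k σ) = simplexChain k (f.app _ σ) :=
  (complexMap_lof _ n _).trans (congrArg (DirectSum.lof k ℕ
    (fun n => (Y.normalizedChainComplex (ModuleCat.of k k)).X n) n)
    (congrArg (fun φ => φ.hom (1 : k))
      (SSet.ι_normalizedChainComplexMap_f (R := ModuleCat.of k k) f σ)))

theorem d_simplexChain_zero {X : SSet.{u}} (σ : X _⦋0⦌) :
    (chains k X).d (simplexChain k σ) = 0 :=
  complexD_lof_zero _ _

theorem d_simplexChain_succ [CharP k 2] {X : SSet.{u}} {n : ℕ} (σ : X _⦋n + 1⦌) :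
    (chains k X).d (simplexChain k σ) = ∑ i, simplexChain k (X.δ i σ) := by
  refine (complexD_lof_succ _ n _).trans ?_
  have h := congrArg (fun φ => φ.hom (1 : k))
    (X.ιNormalizedChainComplex_d (R := ModuleCat.of k k) σ)
  -- The signs of the alternating sum disappear in characteristic two.
  have h2 : (∑ i : Fin (n + 2), (-1 : ℤ) ^ i.1 • X.ιNormalizedChainComplex (R := ModuleCat.of k k)
      (X.δ i σ)).hom (1 : k) = ∑ i : Fin (n + 2),
        (X.ιNormalizedChainComplex (R := ModuleCat.of k k) (X.δ i σ)).hom (1 : k) := by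
    rw [ModuleCat.hom_sum, LinearMap.sum_apply]
    refine Finset.sum_congr rfl fun i _ => ?_
    rcases neg_one_pow_eq_or ℤ i.1 with h | h
    · rw [h, one_smul]
    · rw [h, neg_one_smul, ModuleCat.hom_neg, LinearMap.neg_apply]
      exact neg_eq_of_charTwo k _
  refine (congrArg (DirectSum.lof k ℕ
    (fun n => (X.normalizedChainComplex (ModuleCat.of k k)).X n) n) (h.trans h2)).trans ?_
  exact map_sum (DirectSum.lof k ℕ
    (fun n => (X.normalizedChainComplex (ModuleCat.of k k)).X n) n) _ _

theorem finite_chains (X : SSet.{u}) (hX : X.Finite) : Module.Finite k (chains k X) := by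
  have := hX.finite
  have : Submodule.span k (Set.range fun s : X.N => simplexChain k s.simplex) = ⊤ := by
    rw [eq_top_iff, ← span_simplexChain, Submodule.span_le]
    rintro _ ⟨⟨n, σ⟩, rfl⟩
    by_cases hσ : σ ∈ X.degenerate n
    · simp only [simplexChain_of_degenerate hσ]
      exact Submodule.zero_mem _
    · exact Submodule.subset_span ⟨SSet.N.mk σ hσ, rfl⟩
  exact Module.finite_def.2 (this ▸ Submodule.fg_span (Set.finite_range _))

/-- The total map of a chain homotopy. -/
noncomputable def homotopyTotal {K L : ChainComplex (ModuleCat.{u} k) ℕ} {φ ψ : K ⟶ L}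
    (H : Homotopy φ ψ) : (⨁ n, K.X n) →ₗ[k] ⨁ n, L.X n :=
  DirectSum.toModule k ℕ _ fun n =>
    DirectSum.lof k ℕ (fun n => L.X n) (n + 1) ∘ₗ (H.hom n (n + 1)).hom

theorem homotopyTotal_succ {K L : ChainComplex (ModuleCat.{u} k) ℕ} {φ ψ : K ⟶ L}
    (H : Homotopy φ ψ) (x : ⨁ n, K.X n) (n : ℕ) :
    homotopyTotal H x (n + 1) = (H.hom n (n + 1)).hom (x n) := by
  induction x using DirectSum.induction_on with
  | zero => rw [map_zero]; exact (map_zero _).symm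
  | of m y =>
    rw [← DirectSum.lof_eq_of k, homotopyTotal, DirectSum.toModule_lof]
    by_cases h : n = m
    · subst h
      rw [LinearMap.comp_apply, DirectSum.lof_apply, DirectSum.lof_apply]
    · have h1 : DirectSum.lof k ℕ (fun n => K.X n) m y n = 0 := DirectSum.of_eq_of_ne _ _ _ h
      rw [h1, map_zero]
      exact DirectSum.of_eq_of_ne _ _ _ (by simpa using h)
  | add x y hx hy => rw [map_add, DirectSum.add_apply, hx, hy, DirectSum.add_apply, map_add]

/-- On a cycle the summand h d of the homotopy formula drops out. -/
theorem complexMap_sub_of_cycle {K L : ChainComplex (ModuleCat.{u} k) ℕ} {φ ψ : K ⟶ L}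
    (H : Homotopy φ ψ) (x : ⨁ n, K.X n) (hx : complexD K x = 0) :
    complexMap φ x - complexMap ψ x = complexD L (homotopyTotal H x) := by
  refine DFinsupp.ext fun n => ?_
  rw [DirectSum.sub_apply, complexMap_apply, complexMap_apply, complexD_apply, homotopyTotal_succ]
  have h0 : (dNext n H.hom).hom (x n) = 0 := by
    cases n with
    | zero => rw [dNext_eq_zero _ _ (by simp)]; rfl
    | succ n =>
      rw [dNext_eq H.hom (show (ComplexShape.down ℕ).Rel (n + 1) n from rfl)]
      have : (K.d (n + 1) n).hom (x (n + 1)) = 0 := by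
        rw [← complexD_apply, hx]; rfl
      exact (congrArg (H.hom n (n + 1)).hom this).trans (map_zero _)
  rw [H.comm n, prevD_eq H.hom (show (ComplexShape.down ℕ).Rel (n + 1) n from rfl)]
  change (dNext n H.hom).hom (x n) + (L.d (n + 1) n).hom ((H.hom n (n + 1)).hom (x n)) +
    (ψ.f n).hom (x n) - (ψ.f n).hom (x n) = _
  rw [h0, zero_add, add_sub_cancel_right]

/-- Homotopic maps agree on cycles up to boundaries. -/
theorem exists_chainsMap_sub {X Y : SSet.{u}} {f g : X ⟶ Y} (H : SSet.Homotopy f g)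
    (x : chains k X) (hx : (chains k X).d x = 0) :
    ∃ y, chainsMap k f x - chainsMap k g x = (chains k Y).d y := by
  -- The available homotopy lives on unnormalized chains, so the normalized map is written as the
  -- unnormalized one between inclusion and projection.
  have key : ∀ φ : X ⟶ Y, SSet.normalizedChainComplexMap φ (ModuleCat.of k k) =
      X.fromNormalizedChainComplex _ ≫ SSet.chainComplexMap φ _ ≫
        Y.toNormalizedChainComplex _ := by
    intro φ
    rfl
  have H' := ((H.chainComplexMap (ModuleCat.of k k)).compRight
    (Y.toNormalizedChainComplex _)).compLeft (X.fromNormalizedChainComplex _)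
  rw [← key, ← key] at H'
  exact ⟨_, complexMap_sub_of_cycle H' x hx⟩

end Chains

/-- An elementary abelian `2`-group has coordinates dual to a minimal generating family. -/
theorem exists_coordinates (k : Type*) [Field k] [CharP k 2] {r : ℕ} {G : Type*} [Group G]
    (hG : ∀ x : G, x * x = 1) (hcard : Nat.card G = 2 ^ r) (g : Fin r → G)
    (hgen : Subgroup.closure (Set.range g) = ⊤) :
    ∃ ε : Fin r → G → k, (∀ i x y, ε i (x * y) = ε i x + ε i y) ∧
      ∀ i j, ε i (g j) = if i = j then 1 else 0 := by
  have hcomm : ∀ x y : G, x * y = y * x := by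
    intro x y
    have hinv : ∀ z : G, z⁻¹ = z := fun z => inv_eq_of_mul_eq_one_left (hG z)
    rw [← hinv (x * y), mul_inv_rev, hinv, hinv]
  let _ : CommGroup G := { (inferInstance : Group G) with mul_comm := hcomm }
  let _ : Module (ZMod 2) (Additive G) := AddCommGroup.zmodModule fun x => by
    rw [two_nsmul]
    exact hG x
  have hfin : Finite G := Nat.finite_of_card_ne_zero (by rw [hcard]; positivity)
  have : Module.Finite (ZMod 2) (Additive G) := Module.Finite.of_finite
  have hrank : Module.finrank (ZMod 2) (Additive G) = r := by
    have h := Module.natCard_eq_pow_finrank (K := ZMod 2) (V := Additive G)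
    have h' : Nat.card (Additive G) = 2 ^ r := hcard
    rw [h', Nat.card_zmod] at h
    exact (Nat.pow_right_injective le_rfl h).symm
  -- The r elements g_i span an F₂-vector space of dimension r, hence form a basis. The function ε_i
  -- is the i-th coordinate, read in k.
  let v : Fin r → Additive G := fun i => Additive.ofMul (g i)
  have hspan : ⊤ ≤ Submodule.span (ZMod 2) (Set.range v) := by
    intro x _
    have key : ∀ y ∈ Subgroup.closure (Set.range g),
        Additive.ofMul y ∈ Submodule.span (ZMod 2) (Set.range v) := by
      intro y hy
      induction hy using Subgroup.closure_induction with
      | mem y hy =>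
        obtain ⟨i, rfl⟩ := hy
        exact Submodule.subset_span ⟨i, rfl⟩
      | one => exact Submodule.zero_mem _
      | mul y z _ _ hy hz => exact Submodule.add_mem _ hy hz
      | inv y _ hy => exact Submodule.neg_mem _ hy
    exact key x.toMul (hgen ▸ Subgroup.mem_top _)
  have hli : LinearIndependent (ZMod 2) v :=
    linearIndependent_of_top_le_span_of_card_eq_finrank hspan (by simp [hrank])
  let b := Module.Basis.mk hli hspan
  refine ⟨fun i x => ZMod.castHom (dvd_refl 2) k (b.repr (Additive.ofMul x) i), ?_, ?_⟩
  · intro i x y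
    change ZMod.castHom (dvd_refl 2) k (b.repr (Additive.ofMul x + Additive.ofMul y) i) = _
    rw [map_add, Finsupp.add_apply, map_add]
  · intro i j
    have : b.repr (Additive.ofMul (g j)) = Finsupp.single j 1 := by
      rw [show Additive.ofMul (g j) = b j from (Module.Basis.mk_apply hli hspan j).symm]
      exact b.repr_self j
    change ZMod.castHom (dvd_refl 2) k (b.repr (Additive.ofMul (g j)) i) = _
    rw [this, Finsupp.single_apply]
    by_cases h : i = j
    · rw [if_pos h, if_pos h.symm, map_one]
    · rw [if_neg h, if_neg (Ne.symm h), map_zero]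

/-! ### Chains of a simplicial `G`-set and of its quotient -/

section Group

variable {k : Type u} [Field k] {G : Type u} [Group G]

theorem chainsRep_simplexChain (Y : Action SSet.{u} G) (x : G) {n : ℕ} (σ : Y.V _⦋n⦌) :
    chainsRep k Y x (simplexChain k σ) = simplexChain k ((Y.ρ x : Y.V ⟶ Y.V).app _ σ) :=
  chainsMap_simplexChain (Y.ρ x : Y.V ⟶ Y.V) σ

theorem action_app_mul (Y : Action SSet.{u} G) (x y : G) {n : SimplexCategoryᵒᵖ} (σ : Y.V.obj n) :
    (Y.ρ (x * y)).app n σ = (Y.ρ x).app n ((Y.ρ y).app n σ) := by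
  rw [map_mul]
  rfl

theorem action_app_one (Y : Action SSet.{u} G) {n : SimplexCategoryᵒᵖ} (σ : Y.V.obj n) :
    (Y.ρ 1).app n σ = σ := by
  rw [map_one]
  rfl

/-- The projection of a simplicial `G`-set onto its quotient. -/
def orbitMap (Y : Action SSet.{u} G) : Y.V ⟶ orbits Y where
  app _ := TypeCat.ofHom (Quot.mk _)
  naturality _ _ _ := rfl

theorem orbitMap_action (Y : Action SSet.{u} G) (x : G) {n : SimplexCategoryᵒᵖ} (σ : Y.V.obj n) :
    (orbitMap Y).app n ((Y.ρ x).app n σ) = (orbitMap Y).app n σ :=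
  (Quot.sound ⟨x, rfl⟩).symm

theorem orbitMap_surjective (Y : Action SSet.{u} G) (n : SimplexCategoryᵒᵖ)
    (σ : (orbits Y).obj n) : ∃ τ, (orbitMap Y).app n τ = σ :=
  Quot.exists_rep σ

theorem chainsMap_orbitMap_surjective (Y : Action SSet.{u} G) :
    Function.Surjective (chainsMap k (orbitMap Y)) := by
  rw [← LinearMap.range_eq_top, eq_top_iff, ← span_simplexChain, Submodule.span_le]
  rintro _ ⟨⟨n, σ⟩, rfl⟩
  obtain ⟨τ, rfl⟩ := orbitMap_surjective Y _ σ
  exact ⟨simplexChain k τ, chainsMap_simplexChain _ _⟩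

theorem chainsMap_orbitMap_rep (Y : Action SSet.{u} G) (x : G) (c : chains k Y.V) :
    chainsMap k (orbitMap Y) (chainsRep k Y x c) = chainsMap k (orbitMap Y) c := by
  refine LinearMap.congr_fun (f := chainsMap k (orbitMap Y) ∘ₗ chainsRep k Y x)
    (chains_hom_ext fun n σ => ?_) c
  rw [LinearMap.comp_apply, chainsRep_simplexChain, chainsMap_simplexChain,
    chainsMap_simplexChain, orbitMap_action]

variable [CharP k 2] (hG : ∀ x : G, x * x = 1) (Y : Action SSet.{u} G) {r : ℕ} (g : Fin r → G)

theorem extGen_chainsMod (i : Fin r) (x : chains k Y.V) :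
    extGen (chainsMod k hG Y g) i x = x + chainsRep k Y (g i) x :=
  chainsMod_tgen k hG Y g i x

/-- The span of the images of the operators `1 + g_i`. -/
noncomputable def genRange : Submodule k (chains k Y.V) :=
  ⨆ i, LinearMap.range (tOp k Y (g i))

/-- The elements of G that act trivially modulo the images of the 1 + g_i are closed under products,
and they contain the generators. -/
theorem sub_rep_mem_genRange (hG : ∀ x : G, x * x = 1)
    (hgen : Subgroup.closure (Set.range g) = ⊤) (x : G) (c : chains k Y.V) :
    c - chainsRep k Y x c ∈ genRange (k := k) Y g := by
  have hx : x ∈ Subgroup.closure (Set.range g) := hgen ▸ Subgroup.mem_top _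
  induction hx using Subgroup.closure_induction generalizing c with
  | mem y hy =>
    obtain ⟨i, rfl⟩ := hy
    rw [sub_eq_add_of_charTwo k]
    exact Submodule.mem_iSup_of_mem i ⟨c, rfl⟩
  | one =>
    rw [map_one]
    exact (sub_self c).symm ▸ Submodule.zero_mem _
  | mul y z _ _ hy hz =>
    have h := Submodule.add_mem _ (hz c) (hy (chainsRep k Y z c))
    rw [map_mul]
    rwa [sub_add_sub_cancel] at h
  | inv y _ hy =>
    rw [inv_eq_of_mul_eq_one_left (hG y)]
    exact hy c

/-- Modulo the sum W of the images of the 1 + g_i, a simplex depends only on its orbit. The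
projection C(Y) → C(Y)/W thus factors through C(Y/G), and the kernel of the orbit map lies in W. -/
theorem mem_genRange_of_orbitMap_eq_zero (hG : ∀ x : G, x * x = 1)
    (hgen : Subgroup.closure (Set.range g) = ⊤)
    (c : chains k Y.V) (hc : chainsMap k (orbitMap Y) c = 0) :
    c ∈ genRange (k := k) Y g := by
  let W := genRange (k := k) Y g
  let q : chains k (orbits Y) →ₗ[k] chains k Y.V ⧸ W := chainsLift fun n =>
    Quot.lift (fun y => W.mkQ (simplexChain k y)) (by
      rintro y _ ⟨x, rfl⟩
      refine (Submodule.Quotient.eq W).2 ?_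
      rw [← chainsRep_simplexChain]
      exact sub_rep_mem_genRange Y g hG hgen x _)
  have hq : q ∘ₗ chainsMap k (orbitMap Y) = W.mkQ := by
    refine chains_hom_ext fun n σ => ?_
    rw [LinearMap.comp_apply, chainsMap_simplexChain]
    refine chainsLift_simplexChain _ _ fun h => ?_
    -- A degenerate simplex of the quotient is a degeneracy of an orbit, so it also has a degenerate
    -- representative, and that one is zero in normalized chains.
    cases n with
    | zero => rw [SSet.degenerate_zero] at h; exact h.elim
    | succ n =>
      rw [SSet.degenerate_eq_iUnion_range_σ, Set.mem_iUnion] at h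
      obtain ⟨i, τ, hτ⟩ := h
      obtain ⟨τ, rfl⟩ := orbitMap_surjective Y _ τ
      rw [← hτ]
      refine (congrArg W.mkQ ?_).trans (map_zero W.mkQ)
      exact simplexChain_of_degenerate (Y.V.σ_mem_degenerate i τ)
  have h := LinearMap.congr_fun hq c
  rw [LinearMap.comp_apply, hc, map_zero] at h
  exact (Submodule.Quotient.mk_eq_zero W).1 h.symm

/-- The Koszul homotopies on the chains of a simplicial `G`-set which maps equivariantly to `G`,
given by coordinates on `G`. -/
noncomputable def chainsKoszul (v : ∀ n, Y.V _⦋n⦌ → G)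
    (hv : ∀ n (x : G) (σ : Y.V _⦋n⦌), v n ((Y.ρ x).app _ σ) = x * v n σ)
    (ε : Fin r → G → k) (hadd : ∀ i x y, ε i (x * y) = ε i x + ε i y)
    (hε : ∀ i j, ε i (g j) = if i = j then 1 else 0) : KoszulOps (chainsMod k hG Y g) := by
  -- The map σ ↦ g_i σ is weighted by the i-th coordinate of the label of σ. Acting by g_j changes
  -- this coordinate by 1 if i = j and by 0 otherwise, which produces the commutation relations with
  -- 1 + g_j. The labels need not be simplicial, so s_i need not commute with d.
  let s : Fin r → Module.End k (chains k Y.V) := fun i => chainsLift fun n σ =>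
    ε i (v n σ) • simplexChain k ((Y.ρ (g i) : Y.V ⟶ Y.V).app _ σ)
  have hs : ∀ i n (σ : Y.V _⦋n⦌), s i (simplexChain k σ) =
      ε i (v n σ) • simplexChain k ((Y.ρ (g i) : Y.V ⟶ Y.V).app _ σ) := by
    intro i n σ
    refine chainsLift_simplexChain _ σ fun h => ?_
    rw [simplexChain_of_degenerate (SSet.degenerate_app_apply h _), smul_zero]
  have key : ∀ i j (x : chains k Y.V), (s i x + chainsRep k Y (g j) (s i x)) +
      s i (x + chainsRep k Y (g j) x) = if i = j then x else 0 := by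
    intro i j x
    refine LinearMap.congr_fun (f := (s i + chainsRep k Y (g j) ∘ₗ s i) +
      s i ∘ₗ (LinearMap.id + chainsRep k Y (g j)))
      (g := if i = j then LinearMap.id else 0) (chains_hom_ext fun n σ => ?_) x |>.trans ?_
    · simp only [LinearMap.add_apply, LinearMap.comp_apply, LinearMap.id_apply, map_add, hs,
        chainsRep_simplexChain, map_smul, hv, hadd, hε, ← action_app_mul]
      have hc : g i * g j = g j * g i := by
        have hinv : ∀ z : G, z⁻¹ = z := fun z => inv_eq_of_mul_eq_one_left (hG z)
        rw [← hinv (g i * g j), mul_inv_rev, hinv, hinv]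
      rw [hc, add_add_add_comm, add_self_eq_zero_of_charTwo k, zero_add, add_smul, add_left_comm,
        add_self_eq_zero_of_charTwo k, add_zero]
      split_ifs with h
      · subst h
        rw [hG, action_app_one, one_smul]
        rfl
      · rw [zero_smul]
        rfl
    · split_ifs <;> rfl
  exact
  { s := s
    s_deg := fun i n x hx => by
      have := chains_map_deg (𝒱 := (chains k Y.V).deg) (s i) 0 (fun n σ => by
        rw [hs, add_zero]
        exact Submodule.smul_mem _ _ (simplexChain_mem _)) n x hx
      rwa [add_zero] at this
    self := fun i x => (congrArg₂ (fun a b : chains k Y.V => a + b) (extGen_chainsMod hG Y g i (s i x))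
      (congrArg (s i) (extGen_chainsMod hG Y g i x))).trans ((key i i x).trans (if_pos rfl))
    comm := fun i j hij x => eq_of_add_eq_zero_of_charTwo k
      ((congrArg₂ (fun a b : chains k Y.V => a + b) (extGen_chainsMod hG Y g j (s i x))
        (congrArg (s i) (extGen_chainsMod hG Y g j x))).trans ((key i j x).trans (if_neg hij))) }

/-- The augmentation `π` of `C(Y)` onto `C(Y / G)`. -/
noncomputable def orbitHom : DGMod.Hom (chains k Y.V) (chains k (orbits Y)) where
  toLin := chainsMap k (orbitMap Y)
  map_deg _ _ hx := chainsMap_mem _ hx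
  comm x := (chainsMap_d _ x).symm

theorem orbitHom_extGen (i : Fin r) (x : chains k Y.V) :
    (orbitHom (k := k) Y).toLin (extGen (chainsMod k hG Y g) i x) = 0 := by
  rw [extGen_chainsMod, map_add]
  refine (congrArg ((orbitHom (k := k) Y).toLin x + ·) (chainsMap_orbitMap_rep Y (g i) x)).trans ?_
  exact add_self_eq_zero_of_charTwo k _

/-- The map `B_κ C(Y) → C(Y / G)`. -/
noncomputable def barOrbit :
    DGMod.Hom (bar (kappaTw k r) (chainsMod k hG Y g)).toDGMod (chains k (orbits Y)) :=
  barAug (orbitHom Y) (orbitHom_extGen hG Y g)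

/-- The labelling v exhibits the set of n-simplices as a free G-set for each n, without
compatibility between dimensions. This suffices for the Koszul homotopies. The kernel of C(Y) →
C(Y/G) is generated by the images of the 1 + g_i. -/
theorem barOrbit_isQuasiIso (hcard : Nat.card G = 2 ^ r)
    (hgen : Subgroup.closure (Set.range g) = ⊤) (v : ∀ n, Y.V _⦋n⦌ → G)
    (hv : ∀ n (x : G) (σ : Y.V _⦋n⦌), v n ((Y.ρ x).app _ σ) = x * v n σ) :
    (barOrbit (k := k) hG Y g).IsQuasiIso := by
  obtain ⟨ε, hadd, hε⟩ := exists_coordinates k hG hcard g hgen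
  refine KoszulOps.barAug_isQuasiIso (chainsKoszul hG Y g v hv ε hadd hε) (chains_deg_neg _)
    (orbitHom Y) (orbitHom_extGen hG Y g) (chainsMap_orbitMap_surjective Y) fun x hx => ?_
  have h := mem_genRange_of_orbitMap_eq_zero Y g hG hgen x hx
  have h2 : genRange (k := k) Y g = ⨆ i, LinearMap.range (extGen (chainsMod k hG Y g) i) :=
    iSup_congr fun i => congrArg LinearMap.range
      (LinearMap.ext fun x => (extGen_chainsMod hG Y g i x).symm)
  exact h2 ▸ h

end Group

/-! ### Contracting `EG` and comparing `EG × X` with `X` -/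

section

variable {G : Type u} [Group G]

variable (G) in
/-- The contraction of the simplicial set `EG` to the vertex `1`. -/
noncomputable def universalContraction : (universalSpace G).V ⊗ Δ[1] ⟶ (universalSpace G).V where
  app n := TypeCat.ofHom fun p => fun j : Fin (n.unop.len + 1) =>
    if (SSet.stdSimplex.objEquiv p.2).toOrderHom j = 0 then (p.1 : Fin (n.unop.len + 1) → G) j
      else 1
  naturality m n f := by
    ext p
    rfl

variable (G) in
/-- The constant map at the vertex `1` of `EG`. -/
noncomputable def universalConst (Z : SSet.{u}) : Z ⟶ (universalSpace G).V where
  app n := TypeCat.ofHom fun _ => fun _ : Fin (n.unop.len + 1) => (1 : G)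
  naturality _ _ _ := rfl

theorem ι₀_universalContraction : SSet.ι₀ ≫ universalContraction G = 𝟙 (universalSpace G).V := by
  ext n γ
  rfl

theorem ι₁_universalContraction :
    SSet.ι₁ ≫ universalContraction G = universalConst G (universalSpace G).V := by
  ext n γ
  rfl

/-- A homotopy given by a map out of the cylinder. -/
noncomputable def homotopyOfCylinder {X Y : SSet.{u}} {f g : X ⟶ Y} (h : X ⊗ Δ[1] ⟶ Y)
    (h₀ : SSet.ι₀ ≫ h = f) (h₁ : SSet.ι₁ ≫ h = g) : SSet.Homotopy f g where
  h := h
  h₀ := h₀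
  h₁ := h₁
  rel := by
    -- The homotopy is relative to the empty subcomplex, so the condition is vacuous.
    ext n ⟨⟨x, hx⟩, _⟩
    exact hx.elim

variable (X : Action SSet.{u} G)

/-- The projection of `EG × X` onto `X`. -/
noncomputable def borelSnd : (universalSpace G ⊗ X).V ⟶ X.V where
  app n := TypeCat.ofHom fun p : (Fin (n.unop.len + 1) → G) × X.V.obj n => p.2
  naturality _ _ _ := rfl

/-- The section `x ↦ (1, x)` of the projection of `EG × X` onto `X`. -/
noncomputable def borelSection : X.V ⟶ (universalSpace G ⊗ X).V where
  app n := TypeCat.ofHom fun x => ((fun _ => 1, x) : (Fin (n.unop.len + 1) → G) × X.V.obj n)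
  naturality _ _ _ := rfl

theorem borelSection_snd : borelSection X ≫ borelSnd X = 𝟙 X.V := rfl

/-- The deformation of `EG × X` onto `1 × X`. -/
noncomputable def borelDeformation :
    (universalSpace G ⊗ X).V ⊗ Δ[1] ⟶ (universalSpace G ⊗ X).V where
  app n := TypeCat.ofHom fun p =>
    (((universalContraction G).app n
      ((p.1 : (Fin (n.unop.len + 1) → G) × X.V.obj n).1, p.2),
      (p.1 : (Fin (n.unop.len + 1) → G) × X.V.obj n).2) : (Fin (n.unop.len + 1) → G) × X.V.obj n)
  naturality _ _ _ := rfl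

/-- This homotopy need not be equivariant. It serves only to compare the underlying complexes. -/
noncomputable def borelHomotopy :
    SSet.Homotopy (𝟙 (universalSpace G ⊗ X).V) (borelSnd X ≫ borelSection X) :=
  homotopyOfCylinder (borelDeformation X) (by ext n p; rfl) (by ext n p; rfl)

variable {k : Type u} [Field k]

theorem chainsMap_comm_of_comm {Y X : Action SSet.{u} G} (φ : Y.V ⟶ X.V)
    (hφ : ∀ x : G, (Y.ρ x : Y.V ⟶ Y.V) ≫ φ = φ ≫ (X.ρ x : X.V ⟶ X.V)) (x : G)
    (c : chains k Y.V) :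
    chainsMap k φ (chainsRep k Y x c) = chainsRep k X x (chainsMap k φ c) :=
  LinearMap.congr_fun ((chainsMap_comp k (Y.ρ x : Y.V ⟶ Y.V) φ).symm.trans
    ((congrArg (chainsMap k) (hφ x)).trans (chainsMap_comp k φ (X.ρ x : X.V ⟶ X.V)))) c

variable [CharP k 2] (hG : ∀ x : G, x * x = 1) {r : ℕ} (g : Fin r → G)

theorem chainsMap_chainsAct {Y X : Action SSet.{u} G} (φ : Y.V ⟶ X.V)
    (hφ : ∀ x : G, (Y.ρ x : Y.V ⟶ Y.V) ≫ φ = φ ≫ (X.ρ x : X.V ⟶ X.V))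
    (a : ExteriorAlgebra k (Fin r → k)) (x : chains k Y.V) :
    chainsMap k φ (chainsAct k hG Y g a x) = chainsAct k hG X g a (chainsMap k φ x) := by
  induction a using ExteriorAlgebra.induction generalizing x with
  | algebraMap c =>
    rw [AlgHom.commutes, AlgHom.commutes, Module.algebraMap_end_apply,
      Module.algebraMap_end_apply, map_smul]
  | ι v =>
    rw [chainsAct, chainsAct, ExteriorAlgebra.lift_ι_apply, ExteriorAlgebra.lift_ι_apply,
      Fintype.linearCombination_apply, Fintype.linearCombination_apply, LinearMap.sum_apply,
      LinearMap.sum_apply, map_sum]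
    refine Finset.sum_congr rfl fun i _ => ?_
    rw [LinearMap.smul_apply, LinearMap.smul_apply, map_smul]
    refine congrArg (v i • ·) ?_
    refine (map_add (chainsMap k φ) _ _).trans ?_
    exact congrArg (chainsMap k φ x + ·) (chainsMap_comm_of_comm φ hφ (g i) x)
  | mul a b ha hb =>
    rw [map_mul, map_mul, Module.End.mul_apply, Module.End.mul_apply, ha, hb]
  | add a b ha hb =>
    rw [map_add, map_add, LinearMap.add_apply, LinearMap.add_apply, map_add, ha, hb]

/-- An equivariant map induces a morphism of dg `Λ`-modules on chains. -/
noncomputable def chainsModMap {Y X : Action SSet.{u} G} (φ : Y.V ⟶ X.V)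
    (hφ : ∀ x : G, (Y.ρ x : Y.V ⟶ Y.V) ≫ φ = φ ≫ (X.ρ x : X.V ⟶ X.V)) :
    DGAlgMod.Hom (chainsMod k hG Y g) (chainsMod k hG X g) where
  toLin := chainsMap k φ
  map_deg _ _ hx := chainsMap_mem _ hx
  comm x := (chainsMap_d _ x).symm
  map_act := chainsMap_chainsAct hG g φ hφ

theorem borelSnd_comm (x : G) : ((universalSpace G ⊗ X).ρ x : (universalSpace G ⊗ X).V ⟶ _) ≫
    borelSnd X = borelSnd X ≫ (X.ρ x : X.V ⟶ X.V) := rfl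

/-- The morphism `C(EG × X) → C(X)` of dg `Λ`-modules. -/
noncomputable def borelProj :
    DGAlgMod.Hom (chainsMod k hG (universalSpace G ⊗ X) g) (chainsMod k hG X g) :=
  chainsModMap hG g (borelSnd X) (borelSnd_comm X)

omit [CharP k 2] in
theorem chainsMap_borelSection_snd (w : chains k X.V) :
    chainsMap k (borelSnd X) (chainsMap k (borelSection X) w) = w :=
  LinearMap.congr_fun ((chainsMap_comp k (borelSection X) (borelSnd X)).symm.trans
    ((congrArg (chainsMap k) (borelSection_snd X)).trans (chainsMap_id k X.V))) w

omit [CharP k 2] in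
theorem exists_borelSection_add (x : chains k (universalSpace G ⊗ X).V)
    (hx : (chains k (universalSpace G ⊗ X).V).d x = 0) :
    ∃ y, x = (chains k (universalSpace G ⊗ X).V).d y +
      chainsMap k (borelSection X) (chainsMap k (borelSnd X) x) := by
  obtain ⟨y, hy⟩ := exists_chainsMap_sub (borelHomotopy X) (k := k) x hx
  rw [chainsMap_id, chainsMap_comp, LinearMap.id_apply, LinearMap.comp_apply] at hy
  exact ⟨y, sub_eq_iff_eq_add.1 hy⟩

/-- The section x ↦ (1, x) inverts the projection in homology. It need not be Λ-linear, but
quasi-isomorphisms are tested on the underlying complexes. -/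
theorem borelProj_isQuasiIso : (borelProj (k := k) X hG g).IsQuasiIso := by
  refine (DGMod.Hom.isQuasiIso_iff _).2 ⟨?_, ?_⟩
  · intro x hx w hw
    obtain ⟨y, hy⟩ := exists_borelSection_add X (k := k) x hx
    refine ⟨y + chainsMap k (borelSection X) w, ?_⟩
    refine hy.trans (Eq.trans ?_ (map_add (chains k (universalSpace G ⊗ X).V).d _ _).symm)
    refine congrArg ((chains k (universalSpace G ⊗ X).V).d y + ·) ?_
    exact (congrArg (chainsMap k (borelSection X)) hw).trans (chainsMap_d _ w).symm
  · intro w hw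
    refine ⟨chainsMap k (borelSection X) w, ?_, 0, ?_⟩
    · refine (chainsMap_d _ w).trans ?_
      exact (congrArg _ hw).trans (map_zero _)
    · refine (chainsMap_borelSection_snd X w).symm.trans ?_
      exact ((congrArg (chainsMap k (borelSnd X) (chainsMap k (borelSection X) w) + ·)
        (map_zero (chains k X.V).d)).trans (add_zero _)).symm

/-- The initial vertex of the component in EG serves as the label in G. It is equivariant, though
the zeroth face changes it. -/
theorem barOrbit_borel_isQuasiIso (hcard : Nat.card G = 2 ^ r)
    (hgen : Subgroup.closure (Set.range g) = ⊤) :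
    (barOrbit (k := k) hG (universalSpace G ⊗ X) g).IsQuasiIso :=
  barOrbit_isQuasiIso hG _ g hcard hgen
    (fun n σ => (σ : (Fin (n + 1) → G) × X.V _⦋n⦌).1 0) fun _ _ _ => rfl

theorem barOrbit_universal_isQuasiIso (hcard : Nat.card G = 2 ^ r)
    (hgen : Subgroup.closure (Set.range g) = ⊤) :
    (barOrbit (k := k) hG (universalSpace G) g).IsQuasiIso :=
  barOrbit_isQuasiIso hG _ g hcard hgen
    (fun n σ => (σ : Fin (n + 1) → G) 0) fun _ _ _ => rfl

/-- The span `B_κ C(X) ← B_κ C(EG × X) → C(EG ×_G X)` yields a homotopy equivalence. -/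
theorem bar_homotopyEquivalent_borel (hcard : Nat.card G = 2 ^ r)
    (hgen : Subgroup.closure (Set.range g) = ⊤) :
    DGMod.HomotopyEquivalent (bar (kappaTw k r) (chainsMod k hG X g)).toDGMod
      (chains k (borelConstruction X)) :=
  DGMod.homotopyEquivalent_of_span (barMap_isQuasiIso (kappaTw k r) (borelProj_isQuasiIso X hG g))
    (barOrbit_borel_isQuasiIso X hG g hcard hgen)

end

/-! ### The model and the dual of the bar construction -/

section Model

variable {k : Type u} [Field k] [CharP k 2] {r : ℕ} {A : DGAlg k} (φ : Twisting k r A)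
  (M : DGAlgMod A) (c : M.toDGMod.Contraction)

theorem transferInf_linear_represents (h : M.toDGMod.homology) :
    ∃ hz : (transferInf φ M c).linear.toLin h ∈ M.toDGMod.cycles,
      M.toDGMod.cls ⟨(transferInf φ M c).linear.toLin h, hz⟩ = h := by
  have key : ∀ y : M.toDGMod, y = c.incl h →
      ∃ hz : y ∈ M.toDGMod.cycles, M.toDGMod.cls ⟨y, hz⟩ = h := by
    rintro y rfl
    exact ⟨LinearMap.mem_ker.2 (c.d_incl h), c.hcls_incl h⟩
  exact key _ (transferInf_linear φ M c h)

theorem transferInf_zigzag :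
    DGAlgMod.Zigzag ⟨M.toDGMod.homology, transferAction φ M c⟩ (M.restrict φ.lift) :=
  (transferInf φ M c).zigzag (transferInf_isQuasiIso φ M c)

variable [Module.Finite k M.toDGMod]

theorem modelHom_isQuasiIso {C : DGMod k} [Module.Finite k C] (μ : DGAction (cobar k r) C.homology) :
    (modelHom μ).IsQuasiIso :=
  DGMod.Hom.isQuasiIso_of_bijective _ (modelLin_bijective μ)

/-- The transferred ∞-morphism gives a quasi-isomorphism from B_ι H(M) to the bar construction of
the restricted module, which is B_φ M. Its transpose is composed with the isomorphism from S ⊗ H^•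
onto the dual of B_ι H(M). -/
theorem modelDiff_zigzag : DGAlgMod.Zigzag (modelDiff (transferAction φ M c)).toMod
    (dualMod (bar φ M)) := by
  have h1 : DGAlgMod.Zigzag (modelDiff (transferAction φ M c)).toMod
      (dualMod (bar (iotaTw k r) ⟨M.toDGMod.homology, transferAction φ M c⟩)) :=
    Relation.EqvGen.rel _ _ ⟨_, modelHom_isQuasiIso _⟩
  have h2 : DGAlgMod.Zigzag (dualMod (bar (iotaTw k r) (M.restrict φ.lift)))
      (dualMod (bar (iotaTw k r) ⟨M.toDGMod.homology, transferAction φ M c⟩)) :=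
    Relation.EqvGen.rel _ _ ⟨dualModMap (transferInf φ M c).barMap,
      DGMod.Hom.IsQuasiIso.dual
        ((transferInf φ M c).barMap_isQuasiIso (transferInf_isQuasiIso φ M c))⟩
  rw [bar_iota_restrict] at h2
  exact h1.trans _ _ _ h2.symm

omit [CharP k 2] in
theorem DGAlgMod.Zigzag.toDGMod {A : DGAlg k} {M N : DGAlgMod A} (h : DGAlgMod.Zigzag M N) :
    DGMod.Zigzag M.toDGMod N.toDGMod := by
  induction h with
  | rel M N h =>
    obtain ⟨f, hf⟩ := h
    exact Relation.EqvGen.rel _ _ ⟨f.toHom, hf⟩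
  | refl M => exact Relation.EqvGen.refl _
  | symm M N _ ih => exact ih.symm
  | trans M N P _ _ ih1 ih2 => exact ih1.trans _ _ _ ih2

end Model

/-! ### The dual span for the Borel construction -/

section Borel

variable {k : Type u} [Field k] [CharP k 2] {G : Type u} [Group G] (X : Action SSet.{u} G)
  (hG : ∀ x : G, x * x = 1) {r : ℕ} (g : Fin r → G)

theorem bar_dual_zigzag_borel (hcard : Nat.card G = 2 ^ r)
    (hgen : Subgroup.closure (Set.range g) = ⊤) :
    DGMod.Zigzag (bar (kappaTw k r) (chainsMod k hG X g)).toDGMod.dual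
      (chains k (borelConstruction X)).dual :=
  (Relation.EqvGen.rel _ _ ⟨_, DGMod.Hom.IsQuasiIso.dual
    (barMap_isQuasiIso (kappaTw k r) (borelProj_isQuasiIso X hG g))⟩).trans _ _ _
    (Relation.EqvGen.rel _ _ ⟨_, (barOrbit_borel_isQuasiIso X hG g hcard hgen).dual⟩).symm

end Borel

/-! ### The cup product on normalized cochains -/

section Cup

variable {k : Type u} [Field k] {X Y : SSet.{u}}

theorem map_mem_degenerate {m n : ℕ} (f : ⦋m⦌ ⟶ ⦋n⦌) (hf : ¬ Function.Injective f.toOrderHom)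
    (σ : X _⦋n⦌) : X.map f.op σ ∈ X.degenerate m := by
  cases m with
  | zero =>
    refine (hf fun a b _ => ?_).elim
    exact Subsingleton.elim (α := Fin 1) a b
  | succ m =>
    obtain ⟨i, θ, rfl⟩ := SimplexCategory.eq_σ_comp_of_not_injective f hf
    rw [op_comp, X.map_comp_apply]
    exact X.σ_mem_degenerate i _

/-- The linear extension to `C_n` detects vanishing in one degree. -/
theorem chains_functional_eq_zero {V : Type u} [AddCommGroup V] [Module k V]
    (f : chains k X →ₗ[k] V) {m : ℤ}
    (h : ∀ n (σ : X _⦋n⦌), (n : ℤ) = m → f (simplexChain k σ) = 0) {x : chains k X}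
    (hx : x ∈ (chains k X).deg m) : f x = 0 := by
  have := chains_map_deg (𝒱 := fun n => if n = m then ⊥ else ⊤) f 0 (fun n σ => by
    split_ifs with hn
    · exact (Submodule.mem_bot k).2 (h n σ (by omega))
    · trivial) m x hx
  rwa [add_zero, if_pos rfl, Submodule.mem_bot] at this

/-- The simplex of `σ` with vertices `v 0, …, v m`, as a chain. -/
noncomputable def faceChain {N : ℕ} (σ : X _⦋N⦌) (m : ℕ) (v : ℕ → ℕ) : chains k X :=
  open Classical in
  if h : (∀ i j, i ≤ j → j ≤ m → v i ≤ v j) ∧ ∀ j ≤ m, v j ≤ N then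
    simplexChain k (X.map (SimplexCategory.mkHom
      { toFun := fun j : Fin (m + 1) => (⟨v j, Nat.lt_succ_of_le (h.2 j (by omega))⟩ : Fin (N + 1))
        monotone' := fun i j hij => h.1 i j hij (by omega) }).op σ) else 0

/-- Encoding faces by vertex maps ℕ → ℕ turns the simplicial identities into arithmetic on indices.
-/
theorem simplexChain_map {N m : ℕ} (σ : X _⦋N⦌) (f : ⦋m⦌ ⟶ ⦋N⦌) (v : ℕ → ℕ)
    (hv : ∀ j : Fin (m + 1), (f.toOrderHom j).1 = v j) :
    simplexChain k (X.map f.op σ) = faceChain σ m v := by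
  have h : (∀ i j, i ≤ j → j ≤ m → v i ≤ v j) ∧ ∀ j ≤ m, v j ≤ N := by
    let F : Fin (m + 1) →o Fin (N + 1) := f.toOrderHom
    have hF : ∀ j : Fin (m + 1), (F j).1 = v j := hv
    refine ⟨fun i j hij hj => ?_, fun j hj => ?_⟩
    · have h2 : (F ⟨i, by omega⟩).1 ≤ (F ⟨j, by omega⟩).1 :=
        F.monotone (show (⟨i, by omega⟩ : Fin (m + 1)) ≤ ⟨j, by omega⟩ from hij)
      rwa [hF, hF] at h2
    · have h2 := (F ⟨j, by omega⟩).2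
      rw [hF] at h2
      exact Nat.le_of_lt_succ h2
  rw [faceChain, dif_pos h]
  exact congrArg (fun f : ⦋m⦌ ⟶ ⦋N⦌ => simplexChain k (X.map f.op σ))
    (SimplexCategory.Hom.ext _ _ (OrderHom.ext _ _ (funext fun j => Fin.ext (hv j))))

theorem faceChain_congr {N : ℕ} (σ : X _⦋N⦌) {m : ℕ} {v w : ℕ → ℕ} (h : ∀ j ≤ m, v j = w j) :
    faceChain (k := k) σ m v = faceChain σ m w := by
  by_cases hv : (∀ i j, i ≤ j → j ≤ m → v i ≤ v j) ∧ ∀ j ≤ m, v j ≤ N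
  · rw [faceChain, dif_pos hv]
    exact simplexChain_map σ _ _ fun j => h j (by omega)
  · have hw : ¬ ((∀ i j, i ≤ j → j ≤ m → w i ≤ w j) ∧ ∀ j ≤ m, w j ≤ N) := by
      rintro ⟨h1, h2⟩
      refine hv ⟨fun i j hij hj => ?_, fun j hj => ?_⟩
      · rw [h i (by omega), h j hj]; exact h1 i j hij hj
      · rw [h j hj]; exact h2 j hj
    rw [faceChain, faceChain, dif_neg hv, dif_neg hw]

theorem faceChain_eq {N : ℕ} (σ : X _⦋N⦌) {m : ℕ} {v : ℕ → ℕ}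
    (h : (∀ i j, i ≤ j → j ≤ m → v i ≤ v j) ∧ ∀ j ≤ m, v j ≤ N) :
    ∃ f : ⦋m⦌ ⟶ ⦋N⦌, (∀ j : Fin (m + 1), (f.toOrderHom j).1 = v j) ∧
      faceChain σ m v = simplexChain k (X.map f.op σ) :=
  ⟨_, fun _ => rfl, by rw [faceChain, dif_pos h]⟩

/-- The order-preserving map of the natural numbers which omits `l`. -/
def skip (l j : ℕ) : ℕ := if j < l then j else j + 1

theorem val_δ {n : ℕ} (i : Fin (n + 2)) (j : Fin (n + 1)) :
    ((SimplexCategory.δ i).toOrderHom j).1 = skip i j := by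
  change (i.succAbove j).1 = _
  rw [skip, Fin.succAbove]
  by_cases h : j.1 < i.1
  · rw [if_pos h, if_pos (show j.castSucc < i from h)]
    rfl
  · rw [if_neg h, if_neg (show ¬ j.castSucc < i from h)]
    rfl

theorem d_faceChain [CharP k 2] {N : ℕ} (σ : X _⦋N⦌) {m : ℕ} {v : ℕ → ℕ}
    (h : (∀ i j, i ≤ j → j ≤ m + 1 → v i ≤ v j) ∧ ∀ j ≤ m + 1, v j ≤ N) :
    (chains k X).d (faceChain σ (m + 1) v) =
      ∑ l ∈ Finset.range (m + 2), faceChain σ m fun j => v (skip l j) := by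
  obtain ⟨f, hf, hc⟩ := faceChain_eq (k := k) σ h
  rw [hc, d_simplexChain_succ, Finset.sum_range]
  refine Finset.sum_congr rfl fun l _ => ?_
  have : X.δ l (X.map f.op σ) = X.map (SimplexCategory.δ l ≫ f).op σ := by
    rw [op_comp, X.map_comp_apply]
    rfl
  rw [this]
  refine simplexChain_map σ _ _ fun j => ?_
  rw [← val_δ, ← hf]
  rfl

theorem faceChain_δ {N : ℕ} (σ : X _⦋N + 1⦌) (l : Fin (N + 2)) {m : ℕ} {v : ℕ → ℕ}
    (h : (∀ i j, i ≤ j → j ≤ m → v i ≤ v j) ∧ ∀ j ≤ m, v j ≤ N) :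
    faceChain (k := k) (X.δ l σ) m v = faceChain σ m fun j => skip l (v j) := by
  obtain ⟨f, hf, hc⟩ := faceChain_eq (k := k) (X.δ l σ) h
  have : X.map f.op (X.δ l σ) = X.map (f ≫ SimplexCategory.δ l).op σ := by
    rw [op_comp, X.map_comp_apply]
    rfl
  rw [hc, this]
  refine simplexChain_map σ _ _ fun j => ?_
  rw [← hf, ← val_δ]
  rfl

/-- The value of the cup product on a simplex. -/
noncomputable def cupFun (α β : Module.Dual k (chains k X)) (n : ℕ) (σ : X _⦋n⦌) : k :=
  ∑ i : Fin (n + 1),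
    α (simplexChain k (X.map (SimplexCategory.subinterval 0 i.1 (by omega)).op σ)) *
    β (simplexChain k (X.map (SimplexCategory.subinterval i.1 (n - i.1) (by omega)).op σ))

theorem cupFun_eq (α β : Module.Dual k (chains k X)) (n : ℕ) (σ : X _⦋n⦌) :
    cupFun α β n σ = ∑ i ∈ Finset.range (n + 1),
      α (faceChain σ i fun j => j) * β (faceChain σ (n - i) fun j => j + i) := by
  rw [cupFun, Finset.sum_range]
  refine Finset.sum_congr rfl fun i _ => ?_
  rw [simplexChain_map σ _ (fun j => j) fun j => rfl,
    simplexChain_map σ _ (fun j => j + i) fun j => rfl]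

/-- If σ is degenerate along the vertices l and l + 1, then for each i the front face or the back
face contains both, hence is degenerate. The cup product therefore descends to normalized cochains.
-/
theorem cupFun_degenerate (α β : Module.Dual k (chains k X)) (n : ℕ) (σ : X _⦋n⦌)
    (h : σ ∈ X.degenerate n) : cupFun α β n σ = 0 := by
  cases n with
  | zero => rw [SSet.degenerate_zero] at h; exact h.elim
  | succ n =>
    rw [SSet.degenerate_eq_iUnion_range_σ, Set.mem_iUnion] at h
    obtain ⟨l, τ, rfl⟩ := h
    -- Here b is the position of the vertex l in the interval of length m that starts at a.
    have key : ∀ (m a b : ℕ) (hm : a + m ≤ n + 1), b + a = l.1 → b + 1 ≤ m →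
        simplexChain k (X.map (SimplexCategory.subinterval a m hm).op (X.σ l τ)) = 0 := by
      intro m a b hm hb hb'
      have h : X.map (SimplexCategory.subinterval a m hm).op (X.σ l τ) =
          X.map (SimplexCategory.subinterval a m hm ≫ SimplexCategory.σ l).op τ := by
        rw [op_comp, X.map_comp_apply]
        rfl
      rw [h]
      refine simplexChain_of_degenerate (map_mem_degenerate _ (fun hinj => ?_) τ)
      have h2 : (⟨b, by omega⟩ : Fin (m + 1)) = ⟨b + 1, by omega⟩ := by
        refine hinj ?_
        change l.predAbove ⟨b + a, _⟩ = l.predAbove ⟨b + 1 + a, _⟩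
        have e1 : (⟨b + a, by omega⟩ : Fin (n + 2)) = l.castSucc := Fin.ext hb
        have e2 : (⟨b + 1 + a, by omega⟩ : Fin (n + 2)) = l.succ := Fin.ext (by
          rw [Fin.val_succ]; simp only; omega)
        rw [e1, e2, Fin.predAbove_castSucc_self, Fin.predAbove_succ_self]
      simp at h2
    refine Finset.sum_eq_zero fun i _ => ?_
    by_cases hi : l.1 + 1 ≤ i.1
    · rw [key i.1 0 l.1 _ (add_zero _) hi, map_zero, zero_mul]
    · rw [key (n + 1 - i.1) i.1 (l.1 - i.1) _ (by omega) (by omega), map_zero, mul_zero]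

/-- The cup product with `β`. -/
noncomputable def cup (β : Module.Dual k (chains k X)) :
    Module.Dual k (chains k X) →ₗ[k] Module.Dual k (chains k X) where
  toFun α := chainsLift (cupFun α β)
  map_add' α α' := chains_hom_ext fun n σ => by
    rw [LinearMap.add_apply, chainsLift_simplexChain _ _ (cupFun_degenerate _ _ _ _),
      chainsLift_simplexChain _ _ (cupFun_degenerate _ _ _ _),
      chainsLift_simplexChain _ _ (cupFun_degenerate _ _ _ _), cupFun, cupFun, cupFun,
      ← Finset.sum_add_distrib]
    exact Finset.sum_congr rfl fun i _ => add_mul _ _ _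
  map_smul' c α := chains_hom_ext fun n σ => by
    rw [RingHom.id_apply, LinearMap.smul_apply,
      chainsLift_simplexChain _ _ (cupFun_degenerate _ _ _ _),
      chainsLift_simplexChain _ _ (cupFun_degenerate _ _ _ _), cupFun, cupFun, Finset.smul_sum]
    exact Finset.sum_congr rfl fun i _ => mul_assoc _ _ _

theorem cup_simplexChain (α β : Module.Dual k (chains k X)) {n : ℕ} (σ : X _⦋n⦌) :
    cup β α (simplexChain k σ) = cupFun α β n σ :=
  chainsLift_simplexChain _ _ (cupFun_degenerate _ _ _ _)

theorem cup_comp_chainsMap (f : X ⟶ Y) (α β : Module.Dual k (chains k Y)) :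
    cup (β ∘ₗ chainsMap k f) (α ∘ₗ chainsMap k f) = cup β α ∘ₗ chainsMap k f := by
  refine chains_hom_ext fun n σ => ?_
  rw [LinearMap.comp_apply, chainsMap_simplexChain, cup_simplexChain, cup_simplexChain]
  refine Finset.sum_congr rfl fun i _ => ?_
  rw [LinearMap.comp_apply, LinearMap.comp_apply, chainsMap_simplexChain, chainsMap_simplexChain,
    NatTrans.naturality_apply, NatTrans.naturality_apply]

/-- The Leibniz rule for the cup product with a cocycle. -/
theorem cup_d_of_cocycle [CharP k 2] (α β : Module.Dual k (chains k X))
    (hβ : β ∘ₗ (chains k X).d = 0) :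
    cup β α ∘ₗ (chains k X).d = cup β (α ∘ₗ (chains k X).d) := by
  refine chains_hom_ext fun n σ => ?_
  rw [LinearMap.comp_apply]
  cases n with
  | zero =>
    rw [d_simplexChain_zero, map_zero, cup_simplexChain, cupFun_eq, Finset.sum_range_one]
    have h : (α ∘ₗ (chains k X).d) (faceChain σ 0 fun j => j) = 0 := by
      obtain ⟨f, _, hc⟩ := faceChain_eq (k := k) σ (m := 0) (v := fun j => j)
        ⟨fun i j hij _ => hij, fun j hj => hj⟩
      rw [hc, LinearMap.comp_apply, d_simplexChain_zero, map_zero]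
    rw [h, zero_mul]
  | succ n =>
    -- The last face of the front (i + 1)-face is the front i-face; it is kept apart from the
    -- others.
    have hF : ∀ i : ℕ, i ≤ n → (chains k X).d (faceChain σ (i + 1) fun j => j) =
        ∑ l ∈ Finset.range (i + 1), faceChain σ i (skip l) + faceChain σ i fun j => j := by
      intro i hi
      rw [d_faceChain σ ⟨fun i j hij _ => hij, fun j hj => by omega⟩, Finset.sum_range_succ]
      refine congrArg (_ + ·) (faceChain_congr σ fun j hj => ?_)
      rw [skip, if_pos (by omega)]
    -- The cocycle condition for β on the back face starting at i: the zeroth face, which starts at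
    -- i + 1, carries the same value as the sum of all the others.
    have hB : ∀ i : ℕ, i ≤ n → ∑ x ∈ Finset.range (n - i + 1),
        β (faceChain σ (n - i) fun j => skip (x + 1) j + i) =
          β (faceChain σ (n - i) fun j => j + (i + 1)) := by
      intro i hi
      have h := LinearMap.congr_fun hβ (faceChain σ (n - i + 1) fun j => j + i)
      rw [LinearMap.comp_apply, LinearMap.zero_apply,
        d_faceChain σ ⟨fun a b hab _ => by omega, fun j hj => by omega⟩, map_sum,
        Finset.sum_range_succ'] at h
      rw [eq_of_add_eq_zero_of_charTwo k h]
      refine congrArg β (faceChain_congr σ fun j _ => ?_)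
      rw [skip, if_neg (by omega)]
      omega
    rw [d_simplexChain_succ, map_sum, cup_simplexChain, cupFun_eq]
    have h1 : ∀ l : Fin (n + 2), cup β α (simplexChain k (X.δ l σ)) =
        ∑ i ∈ Finset.range (n + 1), α (faceChain σ i (skip l)) *
          β (faceChain σ (n - i) fun j => skip l (j + i)) := by
      intro l
      rw [cup_simplexChain, cupFun_eq]
      refine Finset.sum_congr rfl fun i hi => ?_
      have hi := Finset.mem_range.1 hi
      rw [faceChain_δ σ l ⟨fun i j hij _ => hij, fun j hj => by omega⟩,
        faceChain_δ σ l ⟨fun a b hab _ => by omega, fun j hj => by omega⟩]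
    rw [Finset.sum_congr rfl fun l _ => h1 l,
      ← Finset.sum_range (n := n + 2) fun l => ∑ i ∈ Finset.range (n + 1),
        α (faceChain σ i (skip l)) * β (faceChain σ (n - i) fun j => skip l (j + i)),
      Finset.sum_comm]
    -- The term i = 0 on the right is split off: it vanishes because α ∘ d is zero on vertices.
    refine Eq.trans ?_ (Finset.sum_range_succ' _ (n + 1)).symm
    have h0 : (α ∘ₗ (chains k X).d) (faceChain σ 0 fun j => j) = 0 := by
      obtain ⟨f, _, hc⟩ := faceChain_eq (k := k) σ (m := 0) (v := fun j => j)
        ⟨fun i j hij _ => hij, fun j hj => by omega⟩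
      rw [hc, LinearMap.comp_apply, d_simplexChain_zero, map_zero]
    rw [h0, zero_mul, add_zero]
    refine Finset.sum_congr rfl fun i hi => ?_
    have hi := Nat.le_of_lt_succ (Finset.mem_range.1 hi)
    -- The faces with l ≤ i alter the front part and those with l > i the back part. By `hB` the
    -- latter sum up to the front i-face times the back face from i + 1.
    rw [LinearMap.comp_apply, hF i hi, map_add, map_sum, add_mul, Finset.sum_mul,
      show n + 2 = (i + 1) + (n - i + 1) by omega, Finset.sum_range_add,
      show n + 1 - (i + 1) = n - i by omega]
    refine congrArg₂ (· + ·) (Finset.sum_congr rfl fun l hl => ?_) ?_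
    · have hl := Finset.mem_range.1 hl
      refine congrArg (fun c => α _ * β c) (faceChain_congr σ fun j _ => ?_)
      rw [skip, if_neg (by omega)]
      omega
    · rw [← hB i hi, Finset.mul_sum]
      refine Finset.sum_congr rfl fun x _ => ?_
      refine congrArg₂ (fun c c' => α c * β c') (faceChain_congr σ fun j hj => ?_)
        (faceChain_congr σ fun j _ => ?_)
      · rw [skip, if_pos (by omega)]
      · rw [skip, skip]
        split_ifs <;> omega

end Cup

/-! ### The augmentation as unit cochain -/

section Augmentation

variable {k : Type u} [Field k]

/-- The augmentation of the chains of a simplicial set. -/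
noncomputable def chainsAug (k : Type u) [Field k] (X : SSet.{u}) : Module.Dual k (chains k X) :=
  chainsLift fun n _ => if n = 0 then 1 else 0

variable {X Y : SSet.{u}}

theorem chainsAug_simplexChain {n : ℕ} (σ : X _⦋n⦌) :
    chainsAug k X (simplexChain k σ) = if n = 0 then 1 else 0 := by
  refine chainsLift_simplexChain _ σ fun h => if_neg ?_
  rintro rfl
  rw [SSet.degenerate_zero] at h
  exact h.elim

theorem chainsAug_d [CharP k 2] (x : chains k X) : chainsAug k X ((chains k X).d x) = 0 := by
  refine LinearMap.congr_fun (f := chainsAug k X ∘ₗ (chains k X).d) (g := 0)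
    (chains_hom_ext fun n σ => ?_) x
  rw [LinearMap.comp_apply, LinearMap.zero_apply]
  cases n with
  | zero => rw [d_simplexChain_zero, map_zero]
  | succ n =>
    rw [d_simplexChain_succ, map_sum]
    simp only [chainsAug_simplexChain]
    cases n with
    | zero => rw [Fin.sum_univ_two, if_pos rfl, add_self_eq_zero_of_charTwo k]
    | succ n => exact Finset.sum_eq_zero fun i _ => if_neg (Nat.succ_ne_zero n)

theorem chainsAug_chainsMap (f : X ⟶ Y) (x : chains k X) :
    chainsAug k Y (chainsMap k f x) = chainsAug k X x := by
  refine LinearMap.congr_fun (f := chainsAug k Y ∘ₗ chainsMap k f)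
    (chains_hom_ext fun n σ => ?_) x
  rw [LinearMap.comp_apply, chainsMap_simplexChain, chainsAug_simplexChain,
    chainsAug_simplexChain]

theorem chainsAug_mem (m : ℤ) (x : chains k X) (hx : x ∈ (chains k X).deg m) :
    chainsAug k X x ∈ concentratedDeg k k m := by
  have := chains_map_deg (𝒱 := concentratedDeg k k) (chainsAug k X) 0 (fun n σ => by
    rw [chainsAug_simplexChain, concentratedDeg]
    by_cases hn : n = 0
    · subst hn
      rw [if_pos (by simp)]
      trivial
    · rw [if_neg hn]
      exact Submodule.zero_mem _) m x hx
  rwa [add_zero] at this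

/-- The augmentation is the unit of the cup product. -/
theorem cup_chainsAug (β : Module.Dual k (chains k X)) : cup β (chainsAug k X) = β := by
  refine chains_hom_ext fun n σ => ?_
  rw [cup_simplexChain, cupFun, Fin.sum_univ_succ, Finset.sum_eq_zero, add_zero,
    chainsAug_simplexChain]
  · refine (congrArg₂ (· * ·) (if_pos rfl) (congrArg β ?_)).trans (one_mul _)
    refine (simplexChain_map σ _ (fun j => j) fun j => rfl).trans ?_
    refine (simplexChain_map σ (𝟙 ⦋n⦌) (fun j => j) fun j => rfl).symm.trans ?_
    rw [op_id, X.map_id_apply]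
  · intro i _
    rw [chainsAug_simplexChain, if_neg (by simp), zero_mul]

end Augmentation

/-! ### The ground field: `S` as the dual of `B_κ k` -/

section Trivial

variable (k : Type u) [Field k] (r : ℕ)

/-- The ground field as a dg module. -/
noncomputable def groundDG : DGMod k where
  carrier := k
  deg := concentratedDeg k k
  internal := concentratedDeg_isInternal
  d := 0
  d_deg _ _ _ := Submodule.zero_mem _
  d_sq _ := rfl

/-- The ground field as a trivial dg `Λ`-module. -/
noncomputable def groundMod : DGAlgMod (extAlg k r) where
  toDGMod := groundDG k
  action :=
    { act := (Algebra.ofId k (Module.End k k)).comp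
        (ExteriorAlgebra.algebraMapInv (R := k) (M := Fin r → k))
      act_deg := by
        intro m n a ha x hx
        by_cases hm : m = 0
        · subst hm
          rw [zero_add]
          exact Submodule.smul_mem _ _ hx
        · have h : a ∈ concentratedDeg k (ExteriorAlgebra k (Fin r → k)) m := ha
          have h := eq_zero_of_mem_concentratedDeg
            (V := ExteriorAlgebra k (Fin r → k)) hm h
          subst h
          have h0 : ((Algebra.ofId k (Module.End k k)).comp
            (ExteriorAlgebra.algebraMapInv (R := k) (M := Fin r → k))) 0 x = 0 := by
            rw [map_zero]; rfl
          exact h0.symm ▸ Submodule.zero_mem _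
      act_d := by
        intro a x
        have h0 : ((Algebra.ofId k (Module.End k k)).comp
            (ExteriorAlgebra.algebraMapInv (R := k) (M := Fin r → k))) 0 x = 0 := by
          rw [map_zero]; rfl
        have h1 : ((Algebra.ofId k (Module.End k k)).comp
            (ExteriorAlgebra.algebraMapInv (R := k) (M := Fin r → k))) a 0 = 0 := map_zero _
        exact ((add_zero _).symm.trans (congrArg₂ (fun a b : k => a + b) h0 h1).symm :) }

variable {k r}

theorem extGen_groundMod (i : Fin r) (x : k) : extGen (groundMod k r) i x = 0 := by
  have h : ExteriorAlgebra.algebraMapInv (tgen k r i) = (0 : k) := by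
    rw [ExteriorAlgebra.algebraMapInv, tgen, ExteriorAlgebra.lift_ι_apply, LinearMap.zero_apply]
  exact (congrArg (· * x) h).trans (zero_mul x)

theorem bar_groundMod_d [CharP k 2] : (bar (kappaTw k r) (groundMod k r)).toDGMod.d = 0 := by
  refine tensor_hom_ext (M := k) fun a x => ?_
  refine (kappa_barD (groundMod k r) a x).trans ?_
  refine (congrArg₂ (· + ·) (TensorProduct.tmul_zero _ _)
    (Finset.sum_eq_zero fun i _ => ?_)).trans (add_zero _)
  exact (congrArg _ (extGen_groundMod i x)).trans (TensorProduct.tmul_zero _ _)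

variable (k r)

/-- The polynomial algebra as a dg module with zero differential. -/
noncomputable def polyDG : DGMod k where
  carrier := MvPolynomial (Fin r) k
  deg := polyDeg k r
  internal := polyDeg_isInternal k r
  d := 0
  d_deg _ _ _ := Submodule.zero_mem _
  d_sq _ := rfl

/-- The functional on `S_c ⊗ k` given by a polynomial. -/
noncomputable def polyFunctional :
    MvPolynomial (Fin r) k →ₗ[k] Module.Dual k (PolyCoalg k r ⊗[k] groundDG k) :=
  pairMap (H := k) (LinearMap.mul k k) ∘ₗ (TensorProduct.mk k (MvPolynomial (Fin r) k) k).flip 1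

variable {k r}

theorem polyFunctional_tmul (p : MvPolynomial (Fin r) k) (c : PolyCoalg k r) (t : k) :
    polyFunctional k r p (c ⊗ₜ[k] t) = PolyCoalg.pairing k r p c * (1 * t) := rfl

theorem polyFunctional_deg {m n : ℤ} (hmn : m ≠ -n) {p : MvPolynomial (Fin r) k}
    (hp : p ∈ polyDeg k r n) {y : PolyCoalg k r ⊗[k] groundDG k}
    (hy : y ∈ tensorDeg (PolyCoalg.cdeg k r) (groundDG k).deg m) : polyFunctional k r p y = 0 := by
  refine tensorDeg_induction hy (P := fun y => polyFunctional k r p y = 0) ?_ ?_ ?_ ?_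
  · intro a z hz
    refine (polyFunctional_tmul p _ z).trans ?_
    rw [pairing_mono]
    by_cases hc : MvPolynomial.coeff a p = 0
    · rw [hc, zero_mul]
    · have := hp a hc
      have hz0 : z = 0 := eq_zero_of_mem_concentratedDeg (V := k) (by omega) hz
      rw [hz0]
      exact (congrArg (MvPolynomial.coeff a p * ·) (mul_zero (1 : k))).trans (mul_zero _)
  · rw [map_zero]
  · intro y z hy hz; rw [map_add, hy, hz, add_zero]
  · intro c y hy; rw [map_smul, hy, smul_zero]

theorem polyFunctional_mem [CharP k 2] (p : MvPolynomial (Fin r) k) :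
    polyFunctional k r p ∈ (bar (kappaTw k r) (groundMod k r)).toDGMod.gradedDual := by
  refine homog_induction (polyDeg_isInternal k r)
    (P := fun x => polyFunctional k r x ∈
      (bar (kappaTw k r) (groundMod k r)).toDGMod.gradedDual) p ?_ ?_
  · intro n y hy
    refine ⟨{-n}, fun m hm z hz => ?_⟩
    exact polyFunctional_deg (by simpa using hm) hy hz
  · intro y z hy hz
    rw [map_add]
    exact Submodule.add_mem _ hy hz

/-- The functionals given by polynomials, as elements of the graded dual. -/
noncomputable def polyLin [CharP k 2] : MvPolynomial (Fin r) k →ₗ[k]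
    (bar (kappaTw k r) (groundMod k r)).toDGMod.gradedDual :=
  LinearMap.codRestrict _ (polyFunctional k r) polyFunctional_mem

/-- The identification of `S` with the dual of the bar construction on the ground field. -/
noncomputable def polyHom [CharP k 2] :
    DGMod.Hom (polyDG k r) (dualMod (bar (kappaTw k r) (groundMod k r))).toDGMod where
  toLin := polyLin
  map_deg _ _ hx _ hm _ hy := polyFunctional_deg hm hx hy
  comm x := by
    refine (map_zero _).trans (DGMod.dual_ext
      (V := (bar (kappaTw k r) (groundMod k r)).toDGMod) fun y => ?_)
    refine Eq.symm ((DGMod.dual_d_apply _ y).trans ?_)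
    rw [bar_groundMod_d]
    exact map_zero _

/-- The pairing argument with coefficients in k. The total degree of x^(a) ⊗ z is |a|, so finite
support in degree bounds |a|. -/
theorem polyLin_bijective [CharP k 2] : Function.Bijective (polyLin (k := k) (r := r)) := by
  have hinj : Function.Injective (LinearMap.mul k k) := fun x y h => by
    have := LinearMap.congr_fun h 1
    simpa using this
  have hsurj : Function.Surjective (LinearMap.mul k k) := fun φ =>
    ⟨φ 1, LinearMap.ext_ring (by simp)⟩
  constructor
  · intro p q h
    have h2 := pairMap_injective (H := k) (LinearMap.mul k k) hinj (congrArg Subtype.val h)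
    exact (TensorProduct.rid k _).symm.injective h2
  · intro φ
    obtain ⟨s, hs⟩ := φ.2
    obtain ⟨N, hN⟩ := s.bddAbove
    let φ' : Module.Dual k (PolyCoalg k r ⊗[k] k) := φ.1
    obtain ⟨x, hx⟩ := exists_pairMap (LinearMap.mul k k) hsurj φ' (N.toNat + 1) (by
      intro a z ha
      refine hs a.degree (fun h => ?_) _
        (tmul_mem_tensorDeg (PolyCoalg.mono_mem k a)
          (show z ∈ concentratedDeg k k 0 by rw [concentratedDeg, if_pos rfl]; trivial)
          (add_zero _))
      have := hN h
      omega)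
    obtain ⟨p, rfl⟩ := (TensorProduct.rid k _).symm.surjective x
    exact ⟨p, Subtype.ext hx⟩

theorem polyHom_isQuasiIso [CharP k 2] : (polyHom (k := k) (r := r)).IsQuasiIso :=
  DGMod.Hom.isQuasiIso_of_bijective _ polyLin_bijective

theorem polyHom_mul [CharP k 2] (p q : MvPolynomial (Fin r) k) :
    (polyHom (k := k) (r := r)).toLin (p * q) =
      (dualMod (bar (kappaTw k r) (groundMod k r))).act p (polyHom.toLin q) := by
  refine DGMod.dual_ext (V := (bar (kappaTw k r) (groundMod k r)).toDGMod) fun y => ?_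
  exact pairMap_smul (H := groundDG k) (LinearMap.mul k k) p (q ⊗ₜ 1) y

end Trivial

/-- A quasi-isomorphism from a module with zero differential, compared with another
quasi-isomorphism with the same target, gives an isomorphism with the homology. -/
theorem DGMod.exists_homology_equiv {k : Type u} [Field k] {V W B : DGMod k} (hV : V.d = 0)
    {Θ : Hom V W} {A : Hom B W} (hΘ : Θ.IsQuasiIso) (hA : A.IsQuasiIso) :
    ∃ e : V ≃ₗ[k] B.homology, (∀ n x, x ∈ V.deg n ↔ e x ∈ B.homology.deg n) ∧
      ∀ x (α : B.cycles), e x = B.hcls α ↔ ∃ w, A.toLin α.1 - Θ.toLin x = W.d w := by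
  have h0 : ∀ x, V.d x = 0 := fun x => by rw [hV]; rfl
  let c : V →ₗ[k] V.homology :=
    V.hcls ∘ₗ LinearMap.codRestrict V.cycles LinearMap.id fun x => LinearMap.mem_ker.2 (h0 x)
  have hc : Function.Bijective c := by
    constructor
    · rw [injective_iff_map_eq_zero]
      intro x hx
      obtain ⟨w, hw⟩ := (hcls_eq_zero_iff _).1 hx
      exact hw.trans (h0 w)
    · intro y
      obtain ⟨z, rfl⟩ := exists_hcls y
      exact ⟨z.1, rfl⟩
  let e : V ≃ₗ[k] B.homology := (LinearEquiv.ofBijective c hc).trans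
    ((LinearEquiv.ofBijective _ hΘ).trans (LinearEquiv.ofBijective _ hA).symm)
  have he : ∀ x, A.mapHomology (e x) = Θ.mapHomology (c x) := fun x =>
    (LinearEquiv.ofBijective _ hA).apply_symm_apply _
  have hdeg : ∀ n, ∀ x ∈ V.deg n, e x ∈ B.homology.deg n := by
    intro n x hx
    refine mem_of_map_mem B.homology.internal W.homology.internal (f := A.mapHomology)
      (fun n y hy => A.mapHomology_deg hy) hA.1 ?_
    rw [he]
    exact Θ.mapHomology_deg ⟨⟨x, _⟩, hx, rfl⟩
  refine ⟨e, fun n x => ⟨hdeg n x, fun h =>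
    mem_of_map_mem V.internal B.homology.internal (f := e.toLinearMap) hdeg e.injective h⟩,
    fun x α => ?_⟩
  rw [← hA.1.eq_iff, he, eq_comm]
  exact hcls_eq_iff _ _

/-! ### The quasi-isomorphism `S → (B_κ C(EG))^*` -/

section Augmentation

variable {k : Type u} [Field k] {G : Type u} [Group G] (Y : Action SSet.{u} G)

theorem chainsAug_rep (x : G) (c : chains k Y.V) :
    chainsAug k Y.V (chainsRep k Y x c) = chainsAug k Y.V c :=
  chainsAug_chainsMap (Y.ρ x : Y.V ⟶ Y.V) c

variable [CharP k 2] (hG : ∀ x : G, x * x = 1) {r : ℕ} (g : Fin r → G)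

theorem chainsAug_act (a : ExteriorAlgebra k (Fin r → k)) (x : chains k Y.V) :
    chainsAug k Y.V (chainsAct k hG Y g a x) =
      ExteriorAlgebra.algebraMapInv a * chainsAug k Y.V x := by
  induction a using ExteriorAlgebra.induction generalizing x with
  | algebraMap c =>
    rw [AlgHom.commutes, Module.algebraMap_end_apply, map_smul,
      ExteriorAlgebra.algebraMap_leftInverse (R := k) (Fin r → k) c]
    rfl
  | ι v =>
    rw [chainsAct, ExteriorAlgebra.lift_ι_apply, Fintype.linearCombination_apply,
      LinearMap.sum_apply, map_sum, ExteriorAlgebra.algebraMapInv, ExteriorAlgebra.lift_ι_apply,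
      LinearMap.zero_apply, zero_mul]
    refine Finset.sum_eq_zero fun i _ => ?_
    rw [LinearMap.smul_apply, map_smul]
    refine (congrArg (v i • ·) ?_).trans (smul_zero _)
    refine (map_add (chainsAug k Y.V) _ _).trans ?_
    refine (congrArg (chainsAug k Y.V x + ·) (chainsAug_rep Y (g i) x)).trans ?_
    exact add_self_eq_zero_of_charTwo k _
  | mul a b ha hb =>
    rw [map_mul, map_mul, Module.End.mul_apply, ha, hb, mul_assoc]
  | add a b ha hb =>
    rw [map_add, map_add, LinearMap.add_apply, map_add, ha, hb, add_mul]

/-- The augmentation as a morphism of dg `Λ`-modules. -/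
noncomputable def augHom : DGAlgMod.Hom (chainsMod k hG Y g) (groundMod k r) where
  toLin := chainsAug k Y.V
  map_deg := chainsAug_mem
  comm := chainsAug_d
  map_act := chainsAug_act Y hG g

omit [CharP k 2] in
-- The contraction of EG ends in the constant map. On normalized chains this is the augmentation
-- times a vertex, since the constant simplices of positive dimension are degenerate.
theorem exists_universal_sub (x : chains k (universalSpace G).V)
    (hx : (chains k (universalSpace G).V).d x = 0) :
    ∃ y, x = (chains k (universalSpace G).V).d y + chainsAug k (universalSpace G).V x •
      simplexChain k (n := 0) (X := (universalSpace G).V) (fun _ : Fin 1 => (1 : G)) := by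
  obtain ⟨y, hy⟩ := exists_chainsMap_sub (k := k) (homotopyOfCylinder (universalContraction G)
    ι₀_universalContraction ι₁_universalContraction) x hx
  rw [chainsMap_id, LinearMap.id_apply] at hy
  refine ⟨y, (sub_eq_iff_eq_add.1 hy).trans (congrArg ((chains k (universalSpace G).V).d y + ·) ?_)⟩
  refine LinearMap.congr_fun (f := chainsMap k (universalConst G (universalSpace G).V))
    (g := (chainsAug k (universalSpace G).V).smulRight _) (chains_hom_ext fun n σ => ?_) x
  rw [chainsMap_simplexChain, LinearMap.smulRight_apply, chainsAug_simplexChain]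
  cases n with
  | zero => rw [if_pos rfl, one_smul]; rfl
  | succ n =>
    rw [if_neg (Nat.succ_ne_zero n), zero_smul]
    refine simplexChain_of_degenerate ?_
    exact (universalSpace G).V.σ_mem_degenerate 0 (fun _ : Fin (n + 1) => (1 : G))

theorem augHom_isQuasiIso : (augHom (k := k) (universalSpace G) hG g).IsQuasiIso := by
  refine (DGMod.Hom.isQuasiIso_iff _).2 ⟨fun x hx w hw => ?_, fun w _ => ?_⟩
  · obtain ⟨y, hy⟩ := exists_universal_sub (k := k) x hx
    refine ⟨y, hy.trans ?_⟩
    have h0 : chainsAug k (universalSpace G).V x = 0 := hw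
    rw [h0, zero_smul, add_zero]
    rfl
  · let p : chains k (universalSpace G).V :=
      simplexChain k (n := 0) (X := (universalSpace G).V) (fun _ : Fin 1 => (1 : G))
    have hp : chainsAug k (universalSpace G).V p = 1 :=
      (chainsAug_simplexChain _).trans (if_pos rfl)
    let w' : k := w
    refine ⟨w' • p, ?_, 0, ?_⟩
    · refine (map_smul (chains k (universalSpace G).V).d w' p).trans ?_
      exact (congrArg (w' • ·) (d_simplexChain_zero _)).trans (smul_zero _)
    · have h : chainsAug k (universalSpace G).V (w' • p) = w' := by
        rw [map_smul, hp, smul_eq_mul, mul_one]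
      exact (h.symm.trans (add_zero _).symm :)

/-- The map `S → (B_κ C(EG))^*`. -/
noncomputable def polyBarHom :
    DGMod.Hom (polyDG k r) (bar (kappaTw k r) (chainsMod k hG Y g)).toDGMod.dual :=
  (barMap (kappaTw k r) (augHom Y hG g)).toHom.dual.comp polyHom

theorem polyBarHom_tmul (p : MvPolynomial (Fin r) k) (c : PolyCoalg k r) (z : chains k Y.V) :
    ((polyBarHom Y hG g).toLin p).1 (c ⊗ₜ[k] z) =
      PolyCoalg.pairing k r p c * (1 * chainsAug k Y.V z) := rfl

theorem polyBarHom_mul (p q : MvPolynomial (Fin r) k) :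
    (polyBarHom Y hG g).toLin (p * q) =
      (dualMod (bar (kappaTw k r) (chainsMod k hG Y g))).act p ((polyBarHom Y hG g).toLin q) :=
  (congrArg (dualModMap (barMap (kappaTw k r) (augHom Y hG g))).toLin (polyHom_mul p q)).trans
    ((dualModMap (barMap (kappaTw k r) (augHom Y hG g))).map_act p _)

theorem polyBarHom_isQuasiIso :
    (polyBarHom (k := k) (universalSpace G) hG g).IsQuasiIso :=
  DGMod.Hom.IsQuasiIso.comp (DGMod.Hom.IsQuasiIso.dual
    (barMap_isQuasiIso (kappaTw k r) (augHom_isQuasiIso hG g))) polyHom_isQuasiIso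

end Augmentation

/-! ### Right multiplication of `(B_κ C(Y))^*` by cochains of the quotient -/

section BarCup

variable {k : Type u} [Field k] {G : Type u} [Group G] {Y : Action SSet.{u} G} {r : ℕ}

/-- The product of a functional on `S_c ⊗ C(Y)` with a cochain on `Y`. -/
noncomputable def barCup (β : Module.Dual k (chains k Y.V))
    (φ : Module.Dual k (PolyCoalg k r ⊗[k] chains k Y.V)) :
    Module.Dual k (PolyCoalg k r ⊗[k] chains k Y.V) :=
  TensorProduct.lift (cup β ∘ₗ TensorProduct.curry φ)

theorem barCup_tmul (β : Module.Dual k (chains k Y.V))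
    (φ : Module.Dual k (PolyCoalg k r ⊗[k] chains k Y.V)) (c : PolyCoalg k r) (z : chains k Y.V) :
    barCup β φ (c ⊗ₜ z) = cup β (TensorProduct.curry φ c) z := rfl

theorem barCup_add (β : Module.Dual k (chains k Y.V))
    (φ ψ : Module.Dual k (PolyCoalg k r ⊗[k] chains k Y.V)) :
    barCup β (φ + ψ) = barCup β φ + barCup β ψ := by
  refine tensor_hom_ext fun a z => ?_
  have h : TensorProduct.curry (φ + ψ) (PolyCoalg.mono k a) =
    TensorProduct.curry φ (PolyCoalg.mono k a) + TensorProduct.curry ψ (PolyCoalg.mono k a) := rfl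
  rw [LinearMap.add_apply, barCup_tmul, barCup_tmul, barCup_tmul, h, map_add, LinearMap.add_apply]

/-- The degrees in the support of a cup product are sums of degrees in the supports of the factors.
The shift e makes room for the degree of x^(a) when α is a slice φ(x^(a) ⊗ -). -/
theorem cup_eq_zero_of_deg {X : SSet.{u}} {α β : Module.Dual k (chains k X)} {s t : Finset ℤ}
    {e m : ℤ} (hα : ∀ n, n + e ∉ s → ∀ x ∈ (chains k X).deg n, α x = 0)
    (hβ : ∀ n, n ∉ t → ∀ x ∈ (chains k X).deg n, β x = 0)
    (hm : m + e ∉ (s ×ˢ t).image fun q => q.1 + q.2) {x : chains k X}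
    (hx : x ∈ (chains k X).deg m) : cup β α x = 0 := by
  refine chains_functional_eq_zero (cup β α) (fun n σ hn => ?_) hx
  rw [cup_simplexChain, cupFun]
  refine Finset.sum_eq_zero fun i _ => ?_
  by_cases hi : (i.1 : ℤ) + e ∈ s
  · rw [hβ ((n - i.1 : ℕ) : ℤ) (fun hj => hm (Finset.mem_image.2
      ⟨(_, _), Finset.mem_product.2 ⟨hi, hj⟩, ?_⟩)) _ (simplexChain_mem _), mul_zero]
    change (i.1 : ℤ) + e + ((n - i.1 : ℕ) : ℤ) = m + e
    rw [Nat.cast_sub (Nat.le_of_lt_succ i.2)]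
    omega
  · rw [hα _ hi _ (simplexChain_mem _), zero_mul]

theorem cup_mem_gradedDual {X : SSet.{u}} {α β : Module.Dual k (chains k X)}
    (hα : α ∈ (chains k X).gradedDual) (hβ : β ∈ (chains k X).gradedDual) :
    cup β α ∈ (chains k X).gradedDual := by
  obtain ⟨s, hs⟩ := hα
  obtain ⟨t, ht⟩ := hβ
  exact ⟨_, fun n hn x hx => cup_eq_zero_of_deg (e := 0) (fun n hn => hs n (by simpa using hn)) ht
    (by rwa [add_zero]) hx⟩

variable [CharP k 2] (hG : ∀ x : G, x * x = 1) (g : Fin r → G)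

theorem barCup_mem_gradedDual {φ : Module.Dual k (PolyCoalg k r ⊗[k] chains k Y.V)}
    {β : Module.Dual k (chains k Y.V)}
    (hφ : φ ∈ (bar (kappaTw k r) (chainsMod k hG Y g)).toDGMod.gradedDual)
    (hβ : β ∈ (chains k Y.V).gradedDual) :
    barCup β φ ∈ (bar (kappaTw k r) (chainsMod k hG Y g)).toDGMod.gradedDual := by
  obtain ⟨s, hs⟩ := hφ
  obtain ⟨t, ht⟩ := hβ
  refine ⟨(s ×ˢ t).image fun q => q.1 + q.2, fun n hn x hx => ?_⟩
  refine tensorDeg_induction (M := chains k Y.V) hx (P := fun x => barCup β φ x = 0) ?_ ?_ ?_ ?_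
  · intro a z hz
    rw [barCup_tmul]
    refine cup_eq_zero_of_deg (e := a.degree) (s := s) (fun m hm y hy => ?_) ht (by simpa using hn)
      hz
    exact hs _ hm _ (tmul_mem_tensorDeg (PolyCoalg.mono_mem k a) hy (add_comm _ _))
  · rw [map_zero]
  · intro y z hy hz; rw [map_add, hy, hz, add_zero]
  · intro c y hy; rw [map_smul, hy, smul_zero]

omit [CharP k 2] in
-- Naturality of the cup product under the action of x, with β fixed by x: only the left factor is
-- moved.
theorem cup_comp_tOp {β : Module.Dual k (chains k Y.V)} (hinv : ∀ x : G, β ∘ₗ chainsRep k Y x = β)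
    (ψ : Module.Dual k (chains k Y.V)) (x : G) :
    cup β (ψ ∘ₗ tOp k Y x) = cup β ψ ∘ₗ tOp k Y x := by
  have h1 : ∀ χ : Module.Dual k (chains k Y.V), χ ∘ₗ tOp k Y x = χ + χ ∘ₗ chainsRep k Y x :=
    fun χ => LinearMap.ext fun c => map_add χ c (chainsRep k Y x c)
  have h2 : cup β (ψ ∘ₗ chainsRep k Y x) = cup β ψ ∘ₗ chainsRep k Y x := by
    conv_lhs => rw [← hinv x]
    exact cup_comp_chainsMap (Y.ρ x : Y.V ⟶ Y.V) ψ β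
  rw [h1, map_add, h2, h1]

/-- The Leibniz rule for the product with an invariant cocycle. -/
theorem barCup_comp {β : Module.Dual k (chains k Y.V)} (hβ : β ∘ₗ (chains k Y.V).d = 0)
    (hinv : ∀ x : G, β ∘ₗ chainsRep k Y x = β)
    (φ : Module.Dual k (PolyCoalg k r ⊗[k] chains k Y.V)) (c : (Fin r →₀ ℕ) → Fin r → PolyCoalg k r)
    (D : Module.End k (PolyCoalg k r ⊗[k] chains k Y.V))
    (hD : ∀ a z, D (PolyCoalg.mono k a ⊗ₜ z) = PolyCoalg.mono k a ⊗ₜ (chains k Y.V).d z +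
      ∑ i, c a i ⊗ₜ tOp k Y (g i) z) :
    barCup β φ ∘ₗ D = barCup β (φ ∘ₗ D) := by
  refine tensor_hom_ext fun a z => ?_
  -- The slice of φ ∘ D at x^(a) separates the internal differential, covered by the Leibniz rule,
  -- from the operators 1 + g_i, covered by the invariance of β.
  have hcurry : TensorProduct.curry (φ ∘ₗ D) (PolyCoalg.mono k a) =
      TensorProduct.curry φ (PolyCoalg.mono k a) ∘ₗ (chains k Y.V).d +
        ∑ i, TensorProduct.curry φ (c a i) ∘ₗ tOp k Y (g i) := by
    refine LinearMap.ext fun z => ?_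
    refine (congrArg φ (hD a z)).trans ?_
    rw [map_add, map_sum, LinearMap.add_apply, LinearMap.sum_apply]
    rfl
  rw [LinearMap.comp_apply, barCup_tmul, hcurry, hD, map_add, map_sum, map_add, map_sum,
    ← cup_d_of_cocycle _ _ hβ, LinearMap.add_apply, LinearMap.sum_apply]
  refine congrArg₂ (· + ·) rfl (Finset.sum_congr rfl fun i _ => ?_)
  rw [cup_comp_tOp hinv, barCup_tmul]
  rfl

theorem barCup_d {β : Module.Dual k (chains k Y.V)} (hβ : β ∘ₗ (chains k Y.V).d = 0)
    (hinv : ∀ x : G, β ∘ₗ chainsRep k Y x = β)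
    (φ : Module.Dual k (PolyCoalg k r ⊗[k] chains k Y.V)) :
    barCup β φ ∘ₗ (kappaTw k r).barD (chainsMod k hG Y g) =
      barCup β (φ ∘ₗ (kappaTw k r).barD (chainsMod k hG Y g)) :=
  barCup_comp g hβ hinv φ
    (fun a i => PolyCoalg.lower k r (Finsupp.single i 1) (PolyCoalg.mono k a)) _ fun a z =>
    (kappa_barD (chainsMod k hG Y g) a z).trans (congrArg
      (fun t : PolyCoalg k r ⊗[k] chains k Y.V =>
        PolyCoalg.mono k a ⊗ₜ[k] (chains k Y.V).d z + t)
      (Finset.sum_congr rfl fun i _ => congrArg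
        (PolyCoalg.lower k r (Finsupp.single i 1) (PolyCoalg.mono k a) ⊗ₜ[k] ·)
        (extGen_chainsMod hG Y g i z)))

theorem barOrbit_tmul (a : Fin r →₀ ℕ) (z : chains k Y.V) :
    (barOrbit hG Y g).toLin (PolyCoalg.mono k a ⊗ₜ z) =
      if a = 0 then chainsMap k (orbitMap Y) z else 0 := by
  refine (congrArg (chainsMap k (orbitMap Y)) (barCounit_mono a z)).trans ?_
  split_ifs
  · rfl
  · exact map_zero _

/-- The pullback to the bar construction is compatible with products. -/
theorem barCup_orbit (α β : Module.Dual k (chains k (orbits Y))) :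
    barCup (β ∘ₗ chainsMap k (orbitMap Y)) (α ∘ₗ (barOrbit hG Y g).toLin) =
      cup β α ∘ₗ (barOrbit hG Y g).toLin := by
  refine tensor_hom_ext fun a z => ?_
  rw [barCup_tmul]
  refine Eq.trans ?_ (congrArg (cup β α) (barOrbit_tmul hG g a z)).symm
  by_cases h : a = 0
  · have h1 : TensorProduct.curry (α ∘ₗ (barOrbit hG Y g).toLin) (PolyCoalg.mono k a) =
        α ∘ₗ chainsMap k (orbitMap Y) := LinearMap.ext fun z =>
      congrArg α ((barOrbit_tmul hG g a z).trans (if_pos h))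
    rw [if_pos h]
    exact (congrArg (fun ψ => cup (β ∘ₗ chainsMap k (orbitMap Y)) ψ z) h1).trans
      (LinearMap.congr_fun (cup_comp_chainsMap (orbitMap Y) α β) z)
  · have h1 : TensorProduct.curry (α ∘ₗ (barOrbit hG Y g).toLin) (PolyCoalg.mono k a) = 0 :=
      LinearMap.ext fun z => (congrArg α ((barOrbit_tmul hG g a z).trans (if_neg h))).trans
        (map_zero α)
    rw [if_neg h, map_zero]
    exact (congrArg (fun ψ => cup (β ∘ₗ chainsMap k (orbitMap Y)) ψ z) h1).trans
      (LinearMap.congr_fun (map_zero (cup (β ∘ₗ chainsMap k (orbitMap Y)))) z)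

omit [CharP k 2] in
theorem barCounit_barAct (M : DGMod k) (p : MvPolynomial (Fin r) k) (a : Fin r →₀ ℕ) (z : M) :
    barCounit k r M (barAct r M p (PolyCoalg.mono k a ⊗ₜ z)) = MvPolynomial.coeff a p • z := by
  induction p using MvPolynomial.induction_on' with
  | monomial e c =>
    rw [barAct_tmul, PolyCoalg.contract_monomial, ← TensorProduct.smul_tmul', map_smul,
      MvPolynomial.coeff_monomial]
    by_cases h : e = a
    · subst h
      rw [if_pos le_rfl, if_pos rfl, tsub_self, barCounit_mono, if_pos rfl]
    · rw [if_neg h, zero_smul]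
      split_ifs with hle
      · rw [barCounit_mono, if_neg (fun h0 => h (le_antisymm hle (tsub_eq_zero_iff_le.1 h0))),
          smul_zero]
      · rw [TensorProduct.zero_tmul, map_zero, smul_zero]
  | add p q hp hq =>
    rw [map_add, LinearMap.add_apply, map_add, hp, hq, MvPolynomial.coeff_add, add_smul]

/-- The product of a polynomial with a cochain of the orbit space is given by the action of `S`. -/
theorem barCup_poly (p : MvPolynomial (Fin r) k) (β : Module.Dual k (chains k (orbits Y))) :
    barCup (β ∘ₗ chainsMap k (orbitMap Y)) ((polyBarHom Y hG g).toLin p).1 =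
      (β ∘ₗ (barOrbit hG Y g).toLin) ∘ₗ barAct r (chains k Y.V) p := by
  refine tensor_hom_ext fun a z => ?_
  -- The slice at x^(a) is the coefficient of p times the augmentation, which is the unit for the
  -- cup product.
  have h1 : TensorProduct.curry ((polyBarHom Y hG g).toLin p).1 (PolyCoalg.mono k a) =
      MvPolynomial.coeff a p • chainsAug k Y.V := LinearMap.ext fun z => by
    refine (polyBarHom_tmul Y hG g p (PolyCoalg.mono k a) z).trans ?_
    rw [pairing_mono, one_mul]
    rfl
  refine (congrArg (fun ψ => cup (β ∘ₗ chainsMap k (orbitMap Y)) ψ z) h1).trans ?_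
  rw [map_smul, cup_chainsAug]
  have h2 := congrArg (fun x => β (chainsMap k (orbitMap Y) x))
    (barCounit_barAct (chains k Y.V) p a z)
  refine Eq.trans ?_ h2.symm
  rw [map_smul, map_smul]
  rfl

end BarCup

/-! ### The cohomology ring of `BG` -/

section Classifying

variable {k : Type u} [Field k] [CharP k 2] {G : Type u} [Group G] {Y : Action SSet.{u} G} {r : ℕ}
  (hG : ∀ x : G, x * x = 1) (g : Fin r → G)

/-- If cocycles on the orbit space represent polynomials, so does their cup product. -/
theorem exists_cup_represents {p q : MvPolynomial (Fin r) k}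
    {α β : (chains k (orbits Y)).dual} (hβ : (chains k (orbits Y)).dual.d β = 0)
    {φ ψ : (bar (kappaTw k r) (chainsMod k hG Y g)).toDGMod.dual}
    (hφ : (barOrbit hG Y g).dual.toLin α - (polyBarHom Y hG g).toLin p =
      (bar (kappaTw k r) (chainsMod k hG Y g)).toDGMod.dual.d φ)
    (hψ : (barOrbit hG Y g).dual.toLin β - (polyBarHom Y hG g).toLin q =
      (bar (kappaTw k r) (chainsMod k hG Y g)).toDGMod.dual.d ψ)
    (γ : (chains k (orbits Y)).dual) (hγ : γ.1 = cup β.1 α.1) :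
    ∃ w, (barOrbit hG Y g).dual.toLin γ - (polyBarHom Y hG g).toLin (p * q) =
      (bar (kappaTw k r) (chainsMod k hG Y g)).toDGMod.dual.d w := by
  let U := bar (kappaTw k r) (chainsMod k hG Y g)
  let π : DGMod.Hom (chains k Y.V) (chains k (orbits Y)) := orbitHom Y
  let β' : Module.Dual k (chains k Y.V) := β.1 ∘ₗ chainsMap k (orbitMap Y)
  have hβ0 : β.1 ∘ₗ (chains k (orbits Y)).d = 0 := congrArg Subtype.val hβ
  have hβ' : β' ∘ₗ (chains k Y.V).d = 0 := LinearMap.ext fun x =>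
    (congrArg β.1 (chainsMap_d (orbitMap Y) x).symm).trans (LinearMap.congr_fun hβ0 _)
  have hinv : ∀ x : G, β' ∘ₗ chainsRep k Y x = β' := fun x => LinearMap.ext fun c =>
    congrArg β.1 (chainsMap_orbitMap_rep Y x c)
  have hβm : β' ∈ (chains k Y.V).gradedDual := (π.dual.toLin β).2
  let ω : U.toDGMod.dual := ⟨barCup β' φ.1, barCup_mem_gradedDual hG g φ.2 hβm⟩
  let P : Module.End k U.toDGMod.dual := (dualMod U).act p
  -- Pulled back to the bar construction, α ∪ β is the pullback of α times β. Replacing the former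
  -- by the functional of p costs d ω and gives p times the pullback of β; replacing this pullback
  -- by the functional of q costs d (p ψ) and gives the functional of pq.
  refine ⟨P ψ + ω, ?_⟩
  have e1 : (barOrbit hG Y g).dual.toLin γ =
      P ((barOrbit hG Y g).dual.toLin β) + U.toDGMod.dual.d ω := by
    refine DGMod.dual_ext (V := U.toDGMod) fun x => ?_
    have h1 : (barOrbit hG Y g).dual.toLin α = (polyBarHom Y hG g).toLin p + U.toDGMod.dual.d φ :=
      eq_add_of_sub_eq' hφ
    have h2 : γ.1 ∘ₗ (barOrbit hG Y g).toLin = barCup β' ((barOrbit hG Y g).dual.toLin α).1 := by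
      rw [hγ]
      exact (barCup_orbit hG g α.1 β.1).symm
    have h3 : barCup β' ((barOrbit hG Y g).dual.toLin α).1 =
        barCup β' ((polyBarHom Y hG g).toLin p).1 + barCup β' (U.toDGMod.dual.d φ).1 :=
      (congrArg (fun t : U.toDGMod.dual => barCup β' t.1) h1).trans (barCup_add β' _ _)
    have h4 : barCup β' (U.toDGMod.dual.d φ).1 = (U.toDGMod.dual.d ω).1 :=
      (barCup_d hG g hβ' hinv φ.1).symm
    have h5 := h2.trans (h3.trans (congrArg₂ (fun s t => s + t) (barCup_poly hG g p β.1) h4))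
    exact LinearMap.congr_fun h5 x
  have e2 : (barOrbit hG Y g).dual.toLin β = (polyBarHom Y hG g).toLin q + U.toDGMod.dual.d ψ :=
    eq_add_of_sub_eq' hψ
  have e3 : P (U.toDGMod.dual.d ψ) = U.toDGMod.dual.d (P ψ) := by
    have h := (dualMod U).action.act_d p ψ
    have h0 : (dualMod U).action.act ((polyAlg k r).d p) ψ = 0 :=
      LinearMap.congr_fun (map_zero (dualMod U).action.act) ψ
    exact (h.trans ((congrArg (fun t : U.toDGMod.dual => t + P (U.toDGMod.dual.d ψ)) h0).trans
      (zero_add _))).symm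
  have e4 : (polyBarHom Y hG g).toLin (p * q) = P ((polyBarHom Y hG g).toLin q) :=
    polyBarHom_mul Y hG g p q
  rw [e1, e2, e4, map_add, e3, map_add]
  abel

include hG g in
-- Both S → (B_κ C(EG))^* and C(BG)^* → (B_κ C(EG))^* are quasi-isomorphisms, and S has zero
-- differential. This identifies S with H^•(BG) additively; `exists_cup_represents` supplies the
-- products.
theorem exists_classifyingSpace_equiv (hcard : Nat.card G = 2 ^ r)
    (hgen : Subgroup.closure (Set.range g) = ⊤) :
    ∃ e : MvPolynomial (Fin r) k ≃ₗ[k] (chains k (classifyingSpace G)).dual.homology,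
      (∀ n p, p ∈ polyDeg k r n ↔ e p ∈ (chains k (classifyingSpace G)).dual.homology.deg n) ∧
      ∀ (p q : MvPolynomial (Fin r) k) (α β : (chains k (classifyingSpace G)).dual.cycles),
        e p = (chains k (classifyingSpace G)).dual.cls α →
        e q = (chains k (classifyingSpace G)).dual.cls β →
        ∃ γ : (chains k (classifyingSpace G)).dual.cycles, IsCup α.1 β.1 γ.1 ∧
          e (p * q) = (chains k (classifyingSpace G)).dual.cls γ := by
  obtain ⟨e, hdeg, he⟩ := DGMod.exists_homology_equiv (V := polyDG k r) rfl
    (polyBarHom_isQuasiIso (k := k) hG g)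
    (barOrbit_universal_isQuasiIso (k := k) hG g hcard hgen).dual
  refine ⟨e, hdeg, fun p q α β hα hβ => ?_⟩
  obtain ⟨φ, hφ⟩ := (he p α).1 hα
  obtain ⟨ψ, hψ⟩ := (he q β).1 hβ
  let B := chains k (classifyingSpace G)
  have hβ0 : β.1.1 ∘ₗ B.d = 0 := congrArg Subtype.val (DGMod.d_cycle β)
  have hα0 : α.1.1 ∘ₗ B.d = 0 := congrArg Subtype.val (DGMod.d_cycle α)
  let γ : B.dual := ⟨cup β.1.1 α.1.1, cup_mem_gradedDual α.1.2 β.1.2⟩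
  have hγ : B.dual.d γ = 0 := DGMod.dual_ext (V := B) fun x => by
    have h := cup_d_of_cocycle α.1.1 β.1.1 hβ0
    rw [hα0, map_zero] at h
    exact LinearMap.congr_fun h x
  refine ⟨B.dual.cyc γ hγ, fun n σ => cup_simplexChain _ _ σ, ?_⟩
  exact (he (p * q) _).2 (exists_cup_represents hG g (DGMod.d_cycle β) hφ hψ γ rfl)

end Classifying

end HirschBrown

/-! ### Assembly of the theorem -/

theorem mainTheorem3 {k : Type u} [Field k] [IsAlgClosed k] [CharP k 2] {r : ℕ} (hr : 0 < r)
    {G : Type u} [Group G] (hG : ∀ x : G, x * x = 1) (hcard : Nat.card G = 2 ^ r)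
    (g : Fin r → G) (hgen : Subgroup.closure (Set.range g) = ⊤)
    (X : Action SSet.{u} G) (hfin : X.V.Finite) (hfree : IsFreeAction X) :
    -- `H^•(BG; k)` is isomorphic to `S` as a graded algebra
    (∃ e : MvPolynomial (Fin r) k ≃ₗ[k] (chains k (classifyingSpace G)).dual.homology,
      (∀ n p, p ∈ polyDeg k r n ↔ e p ∈ (chains k (classifyingSpace G)).dual.homology.deg n) ∧
      ∀ (p q : MvPolynomial (Fin r) k) (α β : (chains k (classifyingSpace G)).dual.cycles),
        e p = (chains k (classifyingSpace G)).dual.cls α →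
        e q = (chains k (classifyingSpace G)).dual.cls β →
        ∃ γ : (chains k (classifyingSpace G)).dual.cycles, IsCup α.1 β.1 γ.1 ∧
          e (p * q) = (chains k (classifyingSpace G)).dual.cls γ) ∧
    -- the transferred structure on `H(C)`
    ∃ μ : DGAction (cobar k r) (chains k X.V).homology,
      (∃ f : InfMorphism ⟨(chains k X.V).homology, μ⟩
          ((chainsMod k hG X g).restrict (kappaTw k r).lift),
        f.linear.IsQuasiIso ∧
        ∀ h : (chains k X.V).homology, ∃ hz : f.linear.toLin h ∈ (chains k X.V).cycles,
          (chains k X.V).cls ⟨f.linear.toLin h, hz⟩ = h) ∧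
      DGAlgMod.Zigzag ⟨(chains k X.V).homology, μ⟩
        ((chainsMod k hG X g).restrict (kappaTw k r).lift) ∧
      -- the bar constructions
      CoalgZigzag (bar (iotaTw k r) ⟨(chains k X.V).homology, μ⟩)
        (bar (iotaTw k r) ((chainsMod k hG X g).restrict (kappaTw k r).lift)) ∧
      bar (iotaTw k r) ((chainsMod k hG X g).restrict (kappaTw k r).lift) =
        bar (kappaTw k r) (chainsMod k hG X g) ∧
      DGMod.HomotopyEquivalent (bar (kappaTw k r) (chainsMod k hG X g)).toDGMod
        (chains k (borelConstruction X)) ∧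
      -- the twisted differential on `S ⊗ H^•(X; k)`
      ∃ D : TwistedDiff r (chains k X.V).dual.homology,
        (∃ Φ : DGAlgMod.Hom D.toMod (dualMod (bar (iotaTw k r) ⟨(chains k X.V).homology, μ⟩)),
          Function.Bijective Φ.toLin ∧
          ∀ (p : MvPolynomial (Fin r) k) (α : (chains k X.V).dual.cycles) (c : PolyCoalg k r)
            (z : (chains k X.V).cycles),
            (Φ.toLin (p ⊗ₜ[k] (chains k X.V).dual.cls α)).1 (c ⊗ₜ[k] (chains k X.V).cls z) =
              PolyCoalg.pairing k r p c * α.1.1 z.1) ∧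
        D.IsMinimal ∧
        DGAlgMod.Zigzag D.toMod (dualMod (bar (kappaTw k r) (chainsMod k hG X g))) ∧
        DGMod.Zigzag D.toMod.toDGMod (chains k (borelConstruction X)).dual := by
  -- Finiteness of X makes H^•(X) the full dual of H(C), which the isomorphism with (B_ι H(C))^*
  -- requires.
  have : Module.Finite k (chains k X.V) := finite_chains X.V hfin
  have : Module.Finite k (chainsMod k hG X g).toDGMod := this
  -- A single contraction determines the structure on H(C), the ∞-morphism and δ, so the later
  -- statements all refer to the same data.
  obtain ⟨c⟩ := (chainsMod k hG X g).toDGMod.exists_contraction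
  refine ⟨exists_classifyingSpace_equiv hG g hcard hgen,
    transferAction (kappaTw k r) (chainsMod k hG X g) c,
    ⟨transferInf _ _ c, transferInf_isQuasiIso _ _ c, transferInf_linear_represents _ _ c⟩,
    transferInf_zigzag _ _ c,
    (transferInf _ _ c).coalgZigzag (transferInf_isQuasiIso _ _ c),
    bar_iota_restrict _ _, bar_homotopyEquivalent_borel X hG g hcard hgen,
    modelDiff _, ⟨modelHom _, modelLin_bijective _, fun p α c z => rfl⟩, modelDiff_isMinimal _,
    modelDiff_zigzag _ _ c, ?_⟩
  exact (modelDiff_zigzag _ _ c).toDGMod.trans _ _ _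
    (bar_dual_zigzag_borel X hG g hcard hgen)
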